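/- Let $M$ be an $m$-dimensional compact $C^\infty$ Riemannian manifold without boundary, with norm $\|\cdot\|$ on $TM$, Riemannian distance $d$ and exponential maps $\exp_x:T_xM\to M$. Let $f:M\to M$ be a $C^r$ diffeomorphism, $1\le r\le\infty$, that is partially hyperbolic: there are numbers $0<\lambda<1<\mu$, $\lambda<\lambda'\le\mu'<\mu$, $C>0$ and a $df$-invariant splitting $T_xM=E^s_x\oplus E^c_x\oplus E^u_x$ $(x\in M)$ such that for all $x\in M$ and $n\ge 0$, $$\|d_xf^nv\|\le C\lambda^n\|v\|\ (v\in E^s_x),\qquad C^{-1}(\lambda')^n\|v\|\le\|d_xf^nv\|\le C(\mu')^n\|v\|\ (v\in E^c_x),\qquad C^{-1}\mu^n\|v\|\le\|d_xf^nv\|\ (v\in E^u_x).$$ Suppose that $E^c$ is tangent to a $C^1$ foliation (one with a $C^1$ foliated atlas) with one-dimensional leaves. Let $u$ be a continuous vector field on $M$ with $u(x)\in E^c_x$ and $\|u(x)\|=1$ for all $x$, and let $\varphi^t$ be the flow generated by $u$ (each $t\mapsto\varphi^t(x)$ is an integral curve of $u$ with $\varphi^0(x)=x$). Then there is $\rho_0>0$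 such that every $\exp_x$ is injective on $\{v\in T_xM:\|v\|<\rho_0\}$, with inverse denoted $\exp_x^{-1}$ there, and there is $\varepsilon_0\in(0,\rho_0)$ such that for every $\varepsilon\in(0,\varepsilon_0)$ there is $\delta>0$ with the following property. For every homeomorphism $g$ of $M$ with $d(f(x),g(x))<\delta$ for all $x\in M$ there exist a continuous function $\tilde\tau:M\to\mathbb R$ and a surjective continuous map $\pi:M\to M$ such that $$\pi(g(x))=\varphi^{\tilde\tau(f(x))}\bigl(f(\pi(x))\bigr)\qquad\text{for all }x\in M,$$ and such that, for all $x\in M$, $$|\tilde\tau(x)|<\varepsilon,\qquad d(\pi(x),x)<\varepsilon,\qquad \exp_x^{-1}(\pi(x))\in E^s_x\oplus E^u_x .$$ Moreover $(\tilde\tau,\pi)$ is unique: it is the only pair of a continuous function $M\to\mathbb R$ and a continuous map $M\to M$ that satisfies this equation and these three conditions. -/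

import Mathlib

open Bundle
open scoped Manifold ContDiff Topology

noncomputable section

namespace PartialHyperbolicity

section Riemannian

variable {m : ℕ} {M : Type*} [TopologicalSpace M] [ChartedSpace (EuclideanSpace ℝ (Fin m)) M]
  [RiemannianBundle (fun x : M ↦ TangentSpace (𝓡 m) x)]

/-- The Riemannian metric read in the preferred chart at `p`: the coordinate vectors `a`, `b` at the
point `y` of the chart are pushed to the manifold and their inner product is taken there. -/
def chartMetric (p : M) (y a b : EuclideanSpace ℝ (Fin m)) : ℝ :=
  inner ℝ
    (mfderiv 𝓘(ℝ, EuclideanSpace ℝ (Fin m)) (𝓡 m) (extChartAt (𝓡 m) p).symm y a :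
      TangentSpace (𝓡 m) ((extChartAt (𝓡 m) p).symm y))
    (mfderiv 𝓘(ℝ, EuclideanSpace ℝ (Fin m)) (𝓡 m) (extChartAt (𝓡 m) p).symm y b :
      TangentSpace (𝓡 m) ((extChartAt (𝓡 m) p).symm y))

/-- The Christoffel symbol of the first kind of the Levi-Civita connection in the preferred chart
at `p`: `Γ(a, b; w) = (∂_a g(b, w) + ∂_b g(a, w) - ∂_w g(a, b)) / 2`. -/
def christoffel (p : M) (y a b w : EuclideanSpace ℝ (Fin m)) : ℝ :=
  (fderiv ℝ (fun z ↦ chartMetric p z b w) y a + fderiv ℝ (fun z ↦ chartMetric p z a w) y b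
    - fderiv ℝ (fun z ↦ chartMetric p z a b) y w) / 2

/-- A complete geodesic `γ : ℝ → M`: a `C^2` curve whose coordinate expression `c` in every
preferred chart satisfies the geodesic equation `g(c'', w) + Γ(c', c'; w) = 0` for all `w`. -/
def IsGeodesic (γ : ℝ → M) : Prop :=
  ContMDiff 𝓘(ℝ, ℝ) (𝓡 m) 2 γ ∧
  ∀ (p : M) (t : ℝ), γ t ∈ (extChartAt (𝓡 m) p).source →
    ∀ w : EuclideanSpace ℝ (Fin m),
      chartMetric p (extChartAt (𝓡 m) p (γ t))
          (deriv (deriv fun s ↦ extChartAt (𝓡 m) p (γ s)) t) w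
        + christoffel p (extChartAt (𝓡 m) p (γ t))
          (deriv (fun s ↦ extChartAt (𝓡 m) p (γ s)) t)
          (deriv (fun s ↦ extChartAt (𝓡 m) p (γ s)) t) w = 0

/-- `γ` is the geodesic with initial point `x` and initial velocity `v`. -/
def IsGeodesicFrom (x : M) (v : TangentSpace (𝓡 m) x) (γ : ℝ → M) : Prop :=
  IsGeodesic (m := m) γ ∧
  (⟨γ 0, mfderiv 𝓘(ℝ, ℝ) (𝓡 m) γ 0 (1 : ℝ)⟩ : TangentBundle (𝓡 m) M) = ⟨x, v⟩

open Classical in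
/-- The Riemannian exponential map: `exp_x v = γ 1` for the geodesic `γ` with initial point `x` and
initial velocity `v` (the value `x` is used where there is no complete such geodesic, which does not
happen on a compact manifold). -/
def riemExp (x : M) (v : TangentSpace (𝓡 m) x) : M :=
  if h : ∃ γ : ℝ → M, IsGeodesicFrom x v γ then h.choose 1 else x

/-- The diffeomorphism `f` is (uniformly) partially hyperbolic with invariant splitting
`TM = Es ⊕ Ec ⊕ Eu`. -/
structure IsPartiallyHyperbolic (f : M → M)
    (Es Ec Eu : (x : M) → Submodule ℝ (TangentSpace (𝓡 m) x)) : Prop where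
  /-- The splitting is a direct sum decomposition of every tangent space. -/
  isInternal : ∀ x, DirectSum.IsInternal ![Es x, Ec x, Eu x]
  map_stable : ∀ x, (Es x).map (mfderiv (𝓡 m) (𝓡 m) f x).toLinearMap = Es (f x)
  map_center : ∀ x, (Ec x).map (mfderiv (𝓡 m) (𝓡 m) f x).toLinearMap = Ec (f x)
  map_unstable : ∀ x, (Eu x).map (mfderiv (𝓡 m) (𝓡 m) f x).toLinearMap = Eu (f x)
  /-- The growth estimates; here `l`, `l'`, `μ'`, `μ` are the four rates. -/
  rates : ∃ l l' μ' μ C : ℝ, 0 < l ∧ l < 1 ∧ 1 < μ ∧ l < l' ∧ l' ≤ μ' ∧ μ' < μ ∧ 0 < C ∧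
    ∀ (x : M) (n : ℕ),
      (∀ v ∈ Es x, ‖mfderiv (𝓡 m) (𝓡 m) f^[n] x v‖ ≤ C * l ^ n * ‖v‖) ∧
      (∀ v ∈ Ec x, C⁻¹ * l' ^ n * ‖v‖ ≤ ‖mfderiv (𝓡 m) (𝓡 m) f^[n] x v‖ ∧
        ‖mfderiv (𝓡 m) (𝓡 m) f^[n] x v‖ ≤ C * μ' ^ n * ‖v‖) ∧
      (∀ v ∈ Eu x, C⁻¹ * μ ^ n * ‖v‖ ≤ ‖mfderiv (𝓡 m) (𝓡 m) f^[n] x v‖)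

end Riemannian

section Foliation

/-- A foliation of class `C^r` of the `m`-dimensional manifold `M`, with leaves of dimension `p` and
codimension `q`, given by an atlas of `C^r` foliated charts. The plaques of a chart `e` are the sets
on which `(e ·).2` is constant; the leaves are obtained by chaining plaques. -/
structure Foliation (m : ℕ) (M : Type*) [TopologicalSpace M]
    [ChartedSpace (EuclideanSpace ℝ (Fin m)) M] (r : ℕ∞) (p q : ℕ) where
  charts : Set (OpenPartialHomeomorph M (EuclideanSpace ℝ (Fin p) × EuclideanSpace ℝ (Fin q)))
  covers : ∀ x : M, ∃ e ∈ charts, x ∈ e.source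
  contMDiffOn : ∀ e ∈ charts,
    ContMDiffOn (𝓡 m) 𝓘(ℝ, EuclideanSpace ℝ (Fin p) × EuclideanSpace ℝ (Fin q)) r e e.source
  contMDiffOn_symm : ∀ e ∈ charts,
    ContMDiffOn 𝓘(ℝ, EuclideanSpace ℝ (Fin p) × EuclideanSpace ℝ (Fin q)) (𝓡 m) r e.symm e.target
  /-- Transition maps are locally of the form `(a, b) ↦ (h₁ (a, b), h₂ b)`. -/
  compatible : ∀ e ∈ charts, ∀ e' ∈ charts, ∀ x ∈ e.source ∩ e'.source,
    ∃ U ∈ 𝓝 x, ∀ y ∈ U, ∀ z ∈ U, (e y).2 = (e z).2 → (e' y).2 = (e' z).2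

/-- The foliation `W` is tangent to the distribution `D`: at every point, `D` is the tangent space
of the plaque, that is, the kernel of the derivative of the transverse coordinate. -/
def Foliation.IsTangentTo {m : ℕ} {M : Type*} [TopologicalSpace M]
    [ChartedSpace (EuclideanSpace ℝ (Fin m)) M] {r : ℕ∞} {p q : ℕ}
    (W : Foliation m M r p q) (D : (x : M) → Submodule ℝ (TangentSpace (𝓡 m) x)) : Prop :=
  ∀ e ∈ W.charts, ∀ x ∈ e.source, ∀ v : TangentSpace (𝓡 m) x,
    v ∈ D x ↔ mfderiv (𝓡 m) (𝓡 q) (fun y ↦ (e y).2) x v = 0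

end Foliation

/-- `φ` is the flow generated by the vector field `u`: every `t ↦ φ t x` is the integral curve of
`u` that starts at `x`. -/
def IsFlowOf {m : ℕ} {M : Type*} [TopologicalSpace M] [ChartedSpace (EuclideanSpace ℝ (Fin m)) M]
    (φ : ℝ → M → M) (u : (x : M) → TangentSpace (𝓡 m) x) : Prop :=
  ∀ x, φ 0 x = x ∧ IsMIntegralCurve (I := 𝓡 m) (fun t ↦ φ t x) u

/-- The smallness and transversality conditions for a pair `(τ, P)`: `|τ| < ε`, `d(P, id) < ε`, and
`exp_x⁻¹ (P x) ∈ Es x ⊕ Eu x` for all `x`, where `exp_x⁻¹` is the inverse of the restriction of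
`exp_x` to the ball of radius `ρ`. -/
structure IsAdmissible {m : ℕ} {M : Type*} [EMetricSpace M]
    [ChartedSpace (EuclideanSpace ℝ (Fin m)) M]
    [RiemannianBundle (fun x : M ↦ TangentSpace (𝓡 m) x)]
    (Es Eu : (x : M) → Submodule ℝ (TangentSpace (𝓡 m) x)) (ρ ε : ℝ)
    (τ : M → ℝ) (P : M → M) : Prop where
  abs_lt : ∀ x, |τ x| < ε
  edist_lt : ∀ x, edist (P x) x < ENNReal.ofReal ε
  exp_inv_mem : ∀ x, ∃ v ∈ Es x ⊔ Eu x, ‖v‖ < ρ ∧ riemExp x v = P x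

end PartialHyperbolicity

end

/-! Write $\pi(x)=\exp_x V(x)$ with $V(x)\in E^s_x\oplus E^u_x$ small. Given such a $V$, the orbit
of $f(\exp_x V(x))$ under $\varphi$ meets the section $\exp_{g(x)}(E^s\oplus E^u)$ near $g(x)$ in
exactly one point $\exp_{g(x)}W(x)$, at exactly one small time. The required equation says that
$V(g(x))=W(x)$, and the time is then $\tilde\tau(f(x))$. So the theorem is a fixed point problem for
the section $V$.

A foliated chart supplies a $C^1$ transverse coordinate $b$ that is constant along orbits and whose
derivative has kernel $E^c$. Comparing values of $b$ shows that $W$ is, up to an arbitrarily small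
Lipschitz error, the hyperbolic part of $df$ applied to $V$
(`CenterSystem.box_transition_isLittleO`, made uniform in `CenterSystem.exists_transition_le`). The
equation becomes $V=LV+N(V)$, where $L$ is a weighted shift over $g$, $N$ has small Lipschitz
constant, and $N(0)$ is small if $g$ is $C^0$-close to $f$.

The operator $1-L$ is invertible on continuous sections, with a bound that does not depend on $g$
near $f$. A power of the stable part is a contraction, and the unstable part is nearly inverse to an
operator with the same property. The weights live on $M\times M$, so the finitely many inequalities
involved depend continuously on $g$ in the $C^0$ topology (`eventually_hasBoundedInverse`).
Existence is then the contraction principle (`CenterSystem.eventually_exists`). Uniqueness follows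
because the difference $\Delta$ of two solutions satisfies $\|\Delta\|\le
K\|\Delta-L\Delta\|\le\|\Delta\|/2$ (`CenterSystem.eventually_unique`).

The argument is carried out in a `CenterSystem`, where $M$ is embedded in a Euclidean space and all
tangent vectors lie in that one space. Four facts bring the manifold into this form. The splitting
is continuous, because each subbundle is characterized by closed growth conditions. The exponential
map comes from the geodesic spray and is the identity to first order, uniformly in the base point.
Flow boxes come from foliated charts; as $u$ is only continuous, they also provide the continuity of
the flow. Finally, a continuous self-map of $M$ close to the identity is surjective, by a local form
of Brouwer's theorem. -/

noncomputable section

namespace PartialHyperbolicity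

/-! ### Picard–Lindelöf with confinement of the trajectories -/

section LocalFlow

open Metric Set ODE
open scoped NNReal

variable {E : Type*} [NormedAddCommGroup E] [NormedSpace ℝ E] [CompleteSpace E]

/-- The Picard-Lindelöf flow, together with the information that trajectories stay in the ball
on which the vector field is controlled. -/
theorem exists_flow_mem_closedBall {f : ℝ → E → E} {tmin tmax : ℝ} {t₀ : Icc tmin tmax} {x₀ : E}
    {a r L K : ℝ≥0} (hf : IsPicardLindelof f t₀ x₀ a r L K) :
    ∃ α : E → ℝ → E, ∀ x ∈ closedBall x₀ r, α x t₀ = x ∧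
      ∀ t ∈ Icc tmin tmax,
        HasDerivWithinAt (α x) (f t (α x t)) (Icc tmin tmax) t ∧ α x t ∈ closedBall x₀ a := by
  classical
  have (x) (hx : x ∈ closedBall x₀ r) := FunSpace.exists_isFixedPt_next hf hx
  choose α hα using this
  refine ⟨fun (x : E) ↦ if hx : x ∈ closedBall x₀ r then α x hx |>.compProj else 0,
    fun x hx ↦ ⟨?_, fun t ht ↦ ⟨?_, ?_⟩⟩⟩
  · beta_reduce
    rw [dif_pos hx, FunSpace.compProj_val, ← hα, FunSpace.next_apply₀]
  · beta_reduce
    rw [dif_pos hx, FunSpace.compProj_apply]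
    apply hasDerivWithinAt_picard_Icc t₀.2 hf.continuousOn_uncurry
      (α x hx |>.continuous_compProj.continuousOn)
      (fun _ ht' ↦ α x hx |>.compProj_mem_closedBall hf.mul_max_le)
      x ht |>.congr_of_mem _ ht
    intro t' ht'
    nth_rw 1 [← hα]
    rw [FunSpace.compProj_of_mem ht', FunSpace.next_apply]
  · beta_reduce
    rw [dif_pos hx]
    exact (α x hx).compProj_mem_closedBall hf.mul_max_le

end LocalFlow

/-! ### Second order equations quadratic in the velocity, and their time-one map -/

section Spray

open Metric Set
open scoped NNReal

variable {V : Type*} [NormedAddCommGroup V] [NormedSpace ℝ V]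

/-- The first order system of the second order equation `c'' = Q(c)(c', c')`. -/
def sprayField (Q : V → V →L[ℝ] V →L[ℝ] V) (z : V × V) : V × V := (z.2, Q z.1 z.2 z.2)

theorem contDiffAt_sprayField {Q : V → V →L[ℝ] V →L[ℝ] V} {z : V × V} (hQ : ContDiffAt ℝ 1 Q z.1) :
    ContDiffAt ℝ 1 (sprayField Q) z := by
  have h1 : ContDiffAt ℝ 1 (fun z : V × V ↦ Q z.1) z := hQ.comp z contDiffAt_fst
  exact contDiffAt_snd.prodMk ((h1.clm_apply contDiffAt_snd).clm_apply contDiffAt_snd)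

/-- The acceleration is quadratic in the velocity, so it vanishes to first order at zero velocity.
Hence it is Lipschitz with arbitrarily small constant near $(y,0)$, which is why the time-one map is
close to a translation by the velocity. -/
theorem hasStrictFDerivAt_quadratic {Q : V → V →L[ℝ] V →L[ℝ] V} {y : V} (hQ : ContDiffAt ℝ 1 Q y) :
    HasStrictFDerivAt (fun z : V × V ↦ Q z.1 z.2 z.2) (0 : V × V →L[ℝ] V) (y, 0) := by
  have h1 : ContDiffAt ℝ 1 (fun z : V × V ↦ Q z.1) (y, (0 : V)) :=
    ContDiffAt.comp (y, (0 : V)) (f := Prod.fst) (g := Q) hQ contDiffAt_fst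
  have h2 := h1.hasStrictFDerivAt one_ne_zero
  have h3 := (h2.clm_apply hasStrictFDerivAt_snd).clm_apply hasStrictFDerivAt_snd
  refine h3.congr_fderiv (ContinuousLinearMap.ext fun w ↦ ?_)
  change Q y 0 w.2 + (Q y w.2 0 + (fderiv ℝ (fun z : V × V ↦ Q z.1) (y, 0) w) 0 0) = 0
  generalize fderiv ℝ (fun z : V × V ↦ Q z.1) (y, 0) w = B
  simp

theorem HasDerivAt.prod_fst {W : Type*} [NormedAddCommGroup W] [NormedSpace ℝ W] {f : ℝ → V × W}
    {f' : V × W} {t : ℝ} (h : HasDerivAt f f' t) : HasDerivAt (fun t ↦ (f t).1) f'.1 t :=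
  (hasFDerivAt_fst (𝕜 := ℝ) (E := V) (F := W) (p := f t)).comp_hasDerivAt t h

theorem HasDerivAt.prod_snd {W : Type*} [NormedAddCommGroup W] [NormedSpace ℝ W] {f : ℝ → V × W}
    {f' : V × W} {t : ℝ} (h : HasDerivAt f f' t) : HasDerivAt (fun t ↦ (f t).2) f'.2 t :=
  (hasFDerivAt_snd (𝕜 := ℝ) (E := V) (F := W) (p := f t)).comp_hasDerivAt t h

variable [CompleteSpace V]

/-- The analytic content of the exponential map in a chart. Time two is reached by slowing the field
down by a factor $\sigma$ and undoing this by homogeneity in the velocity. The final estimate says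
that the velocities of two solutions with the same initial point differ by a nearly constant vector.
-/
theorem exists_sprayFlow {O : Set V} (hO : IsOpen O) {Q : V → V →L[ℝ] V →L[ℝ] V}
    (hQ : ContDiffOn ℝ 1 Q O) {y₀ : V} (hy₀ : y₀ ∈ O) :
    ∃ ρ > 0, ∃ Ψ : V → V → ℝ → V × V,
      (∀ y ∈ ball y₀ ρ, ∀ v ∈ ball (0 : V) ρ, Ψ y v 0 = (y, v) ∧ ∀ t ∈ Ioo (-2 : ℝ) 2,
        (Ψ y v t).1 ∈ O ∧ HasDerivAt (Ψ y v) (sprayField Q (Ψ y v t)) t) ∧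
      ContinuousOn (fun p : V × V ↦ (Ψ p.1 p.2 1).1) (ball y₀ ρ ×ˢ ball 0 ρ) ∧
      ∀ η > 0, ∃ ρ' > 0, ∀ y ∈ ball y₀ ρ', ∀ v₁ ∈ ball (0 : V) ρ', ∀ v₂ ∈ ball (0 : V) ρ',
        ‖(Ψ y v₁ 1).1 - (Ψ y v₂ 1).1 - (v₁ - v₂)‖ ≤ η * ‖v₁ - v₂‖ := by
  set X := sprayField Q with hX
  set x₀ : V × V := (y₀, 0) with hx₀
  have hQ0 : ContDiffAt ℝ 1 Q y₀ := hQ.contDiffAt (hO.mem_nhds hy₀)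
  have hXc : ContDiffAt ℝ 1 X x₀ := contDiffAt_sprayField hQ0
  obtain ⟨K, s, hs, hl⟩ := hXc.exists_lipschitzOnWith
  have hOx : {z : V × V | z.1 ∈ O} ∈ 𝓝 x₀ :=
    continuous_fst.continuousAt.preimage_mem_nhds (hO.mem_nhds hy₀)
  obtain ⟨R, hR, hRs⟩ := nhds_basis_closedBall.mem_iff.mp (Filter.inter_mem hs hOx)
  obtain ⟨R, rfl⟩ : ∃ R' : ℝ≥0, (R' : ℝ) = R := ⟨R.toNNReal, Real.coe_toNNReal _ hR.le⟩
  have hX0 : X x₀ = 0 := by simp [hX, hx₀, sprayField]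
  have hb (x) (hx : x ∈ closedBall x₀ R) : ‖X x‖ ≤ K * R := by
    have h := hl.norm_sub_le (hRs hx).1 (mem_of_mem_nhds hs)
    rw [hX0, sub_zero] at h
    refine h.trans ?_
    gcongr
    exact mem_closedBall_iff_norm.mp hx
  -- With this $\sigma$ one has $\sigma K\le 1/4$, so the slowed field has norm at most $R/4$ on the
  -- ball of radius $R$. In time two a trajectory moves at most $R/2$ and cannot leave the ball if
  -- it starts in the half ball.
  obtain ⟨σ', hσ'⟩ : ∃ σ' : ℝ≥0, σ' = 1 / (4 * (K + 1)) := ⟨_, rfl⟩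
  obtain ⟨σ, hσσ⟩ : ∃ σ : ℝ, σ = σ' := ⟨_, rfl⟩
  have hσ : σ = 1 / (4 * (K + 1)) := by rw [hσσ, hσ']; push_cast; rfl
  have hσ0 : 0 < σ := by rw [hσ]; positivity
  have hσ1 : σ * K ≤ 1 / 4 := by
    rw [hσ, div_mul_eq_mul_div, div_le_div_iff₀ (by positivity) (by norm_num)]
    nlinarith [K.2]
  have hσle : σ ≤ 1 := by
    rw [hσ, div_le_one (by positivity)]
    nlinarith [K.2]
  have hPL : IsPicardLindelof (fun _ : ℝ ↦ fun z ↦ σ • X z) (tmin := -2) (tmax := 2)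
      ⟨0, by norm_num⟩ x₀ R (R / 2) (R / 4)
      (σ' * K) := by
    refine .of_time_independent (fun x hx ↦ ?_) ?_ ?_
    · rw [norm_smul, Real.norm_of_nonneg hσ0.le]
      calc σ * ‖X x‖ ≤ σ * (K * R) := by gcongr; exact hb x hx
        _ = (σ * K) * R := by ring
        _ ≤ 1 / 4 * R := by gcongr
        _ = (R / 4 : ℝ≥0) := by push_cast; ring
    · refine LipschitzOnWith.of_dist_le_mul fun x hx y hy ↦ ?_
      rw [dist_eq_norm, ← smul_sub, norm_smul, Real.norm_of_nonneg hσ0.le]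
      have h := hl.norm_sub_le (hRs hx).1 (hRs hy).1
      rw [dist_eq_norm]
      calc σ * ‖X x - X y‖ ≤ σ * (K * ‖x - y‖) := by gcongr
        _ = _ := by push_cast; rw [hσσ]; ring
    · push_cast
      norm_num
      linarith
  obtain ⟨α, hα⟩ := exists_flow_mem_closedBall hPL
  have hα0 (x) (hx : x ∈ closedBall x₀ (R / 2)) : α x 0 = x := (hα x hx).1
  have hαm (x) (hx : x ∈ closedBall x₀ (R / 2)) (t) (ht : t ∈ Icc (-2 : ℝ) 2) :
      α x t ∈ closedBall x₀ R := ((hα x hx).2 t ht).2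
  have hαd (x) (hx : x ∈ closedBall x₀ (R / 2)) (t) (ht : t ∈ Icc (-2 : ℝ) 2) :
      HasDerivWithinAt (α x) (σ • X (α x t)) (Icc (-2 : ℝ) 2) t := ((hα x hx).2 t ht).1
  have hαd' (x) (hx : x ∈ closedBall x₀ (R / 2)) (t) (ht : t ∈ Ioo (-2 : ℝ) 2) :
      HasDerivAt (α x) (σ • X (α x t)) t :=
    (hαd x hx t (Ioo_subset_Icc_self ht)).hasDerivAt (Icc_mem_nhds ht.1 ht.2)
  have hLip (t : ℝ) : LipschitzOnWith (σ' * K) (fun z ↦ σ • X z) (closedBall x₀ R) :=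
    hPL.lipschitzOnWith 0 (by norm_num)
  have hsub1 : Icc (0 : ℝ) 1 ⊆ Ioo (-2 : ℝ) 2 := fun t ht ↦ ⟨by linarith [ht.1], by linarith [ht.2]⟩
  -- The Gronwall factor on $[0,1]$ is at most $e^{1/4}\le 4/3$, which is rounded up to $2$.
  have hgron (x) (hx : x ∈ closedBall x₀ (R / 2)) (y) (hy : y ∈ closedBall x₀ (R / 2)) (t)
      (ht : t ∈ Icc (0 : ℝ) 1) : ‖α x t - α y t‖ ≤ 2 * ‖x - y‖ := by
    have h := dist_le_of_trajectories_ODE_of_mem (v := fun _ z ↦ σ • X z)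
      (s := fun _ ↦ closedBall x₀ R) (a := 0) (b := 1) (f := α x) (g := α y) (δ := dist x y)
      (fun t _ ↦ hLip t)
      (fun t ht ↦ (hαd' x hx t (hsub1 ht)).continuousAt.continuousWithinAt)
      (fun t ht ↦ (hαd' x hx t (hsub1 (Ico_subset_Icc_self ht))).hasDerivWithinAt)
      (fun t ht ↦ hαm x hx t (Ioo_subset_Icc_self (hsub1 (Ico_subset_Icc_self ht))))
      (fun t ht ↦ (hαd' y hy t (hsub1 ht)).continuousAt.continuousWithinAt)
      (fun t ht ↦ (hαd' y hy t (hsub1 (Ico_subset_Icc_self ht))).hasDerivWithinAt)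
      (fun t ht ↦ hαm y hy t (Ioo_subset_Icc_self (hsub1 (Ico_subset_Icc_self ht))))
      (by rw [hα0 x hx, hα0 y hy]) t ht
    rw [dist_eq_norm, dist_eq_norm] at h
    refine h.trans ?_
    rw [mul_comm]
    gcongr
    have h1 : ((σ' * K : ℝ≥0) : ℝ) * (t - 0) ≤ 1 / 4 := by
      push_cast
      rw [← hσσ]
      have : (t - 0) ≤ 1 := by linarith [ht.2]
      have h0 : 0 ≤ t - 0 := by linarith [ht.1]
      have h2 : 0 ≤ σ * (K : ℝ) := by positivity
      calc _ ≤ σ * (K : ℝ) * 1 := by simpa using mul_le_mul_of_nonneg_left this h2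
        _ ≤ _ := by simpa using hσ1
    have h2 := Real.exp_bound_div_one_sub_of_interval (x := 1 / 4) (by norm_num) (by norm_num)
    calc Real.exp _ ≤ Real.exp (1 / 4) := Real.exp_le_exp.mpr h1
      _ ≤ _ := h2
      _ ≤ 2 := by norm_num
  have hmemR (ρ : ℝ) (hρ : ρ ≤ σ * R / 2) (y) (hy : y ∈ ball y₀ ρ) (v) (hv : v ∈ ball (0 : V) ρ) :
      (y, σ⁻¹ • v) ∈ closedBall x₀ (R / 2) := by
    rw [mem_ball_iff_norm] at hy hv
    rw [sub_zero] at hv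
    rw [mem_closedBall_iff_norm, hx₀, Prod.mk_sub_mk, Prod.norm_mk, max_le_iff, sub_zero, norm_smul,
      norm_inv, Real.norm_of_nonneg hσ0.le, inv_mul_le_iff₀ hσ0]
    refine ⟨?_, by linarith⟩
    have : σ * R ≤ 1 * R := by gcongr
    linarith
  -- Starting the slowed flow at $(y,\sigma^{-1}v)$ and multiplying the velocity by $\sigma$ gives a
  -- solution of the original system, because $\sigma\cdot\sigma Q(v,v)=Q(\sigma v,\sigma v)$.
  refine ⟨σ * R / 2, by positivity,
    fun y v t ↦ ((α (y, σ⁻¹ • v) t).1, σ • (α (y, σ⁻¹ • v) t).2), ?_, ?_, ?_⟩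
  · intro y hy v hv
    have hm := hmemR _ le_rfl y hy v hv
    refine ⟨by simp [hα0 _ hm, hσ0.ne'], fun t ht ↦ ⟨?_, ?_⟩⟩
    · exact (hRs (hαm _ hm t (Ioo_subset_Icc_self ht))).2
    · have h := hαd' _ hm t ht
      have h1 := HasDerivAt.prod_fst h
      have h2 := (HasDerivAt.prod_snd h).const_smul σ
      have h3 := h1.prodMk h2
      refine HasDerivAt.congr_deriv h3 (Prod.ext rfl ?_)
      change σ • σ • Q _ _ _ = Q _ (σ • _) (σ • _)
      simp
  · have : ContinuousOn (fun z ↦ α z 1) (closedBall x₀ (R / 2)) := by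
      refine (LipschitzOnWith.of_dist_le_mul (K := 2) fun x hx y hy ↦ ?_).continuousOn
      rw [dist_eq_norm, dist_eq_norm]
      exact hgron x hx y hy 1 (by norm_num)
    have h2 : Continuous (fun p : V × V ↦ (p.1, σ⁻¹ • p.2)) := by fun_prop
    refine (ContinuousOn.comp (f := fun p : V × V ↦ (p.1, σ⁻¹ • p.2)) (g := fun z ↦ α z 1)
      this h2.continuousOn ?_).fst
    rintro ⟨y, v⟩ ⟨hy, hv⟩
    exact hmemR _ le_rfl y hy v hv
  · intro η hη
    -- The Lipschitz constant of the quadratic term may be prescribed because its derivative is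
    -- zero. The value $\eta/2$ compensates the factor $2$ of `hgron`.
    obtain ⟨s', hs', hq⟩ := (hasStrictFDerivAt_quadratic hQ0).exists_lipschitzOnWith_of_nnnorm_lt
      (⟨η / 2, by positivity⟩) (by rw [nnnorm_zero]; exact (by positivity : (0 : ℝ) < η / 2))
    obtain ⟨R', hR', hRs'⟩ := nhds_basis_closedBall.mem_iff.mp hs'
    set ρ' := min (σ * R / 2) (σ * R' / 4) with hρ'
    have hρ'0 : 0 < ρ' := by positivity
    refine ⟨ρ', hρ'0, fun y hy v₁ hv₁ v₂ hv₂ ↦ ?_⟩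
    have hm₁ := hmemR ρ' (min_le_left _ _) y hy v₁ hv₁
    have hm₂ := hmemR ρ' (min_le_left _ _) y hy v₂ hv₂
    have hconst : x₀ ∈ closedBall x₀ (R / 2) := mem_closedBall_self (by positivity)
    -- The rest point is a constant solution, and comparison with it keeps slow trajectories inside
    -- the ball where `hq` applies.
    have hx0const (t) (ht : t ∈ Icc (0 : ℝ) 1) : α x₀ t = x₀ := by
      have h := dist_le_of_trajectories_ODE_of_mem (v := fun _ z ↦ σ • X z)
        (s := fun _ ↦ closedBall x₀ R) (a := 0) (b := 1) (f := α x₀) (g := fun _ ↦ x₀) (δ := 0)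
        (fun t _ ↦ hLip t)
        (fun t ht ↦ (hαd' x₀ hconst t (hsub1 ht)).continuousAt.continuousWithinAt)
        (fun t ht ↦ (hαd' x₀ hconst t (hsub1 (Ico_subset_Icc_self ht))).hasDerivWithinAt)
        (fun t ht ↦ hαm x₀ hconst t (Ioo_subset_Icc_self (hsub1 (Ico_subset_Icc_self ht))))
        continuousOn_const
        (fun t ht ↦ by simpa [hX0] using hasDerivWithinAt_const t (Ici t) x₀)
        (fun t ht ↦ mem_closedBall_self hR.le)
        (by rw [hα0 _ hconst, dist_self]) t ht
      simpa using h
    have hnear (v) (hv : v ∈ ball (0 : V) ρ') (t) (ht : t ∈ Icc (0 : ℝ) 1) :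
        α (y, σ⁻¹ • v) t ∈ closedBall x₀ R' := by
      have h := hgron _ (hmemR ρ' (min_le_left _ _) y hy v hv) x₀ hconst t ht
      rw [hx0const t ht] at h
      rw [mem_closedBall_iff_norm]
      refine h.trans ?_
      rw [mem_ball_iff_norm] at hv hy
      rw [sub_zero] at hv
      have h4 : ρ' ≤ σ * R' / 4 := min_le_right _ _
      have h5 : ‖(y, σ⁻¹ • v) - x₀‖ ≤ R' / 4 := by
        rw [hx₀, Prod.mk_sub_mk, Prod.norm_mk, max_le_iff, sub_zero, norm_smul,
          norm_inv, Real.norm_of_nonneg hσ0.le, inv_mul_le_iff₀ hσ0]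
        refine ⟨?_, by linarith⟩
        have : σ * R' ≤ 1 * R' := by gcongr
        linarith
      linarith
    set z₁ := α (y, σ⁻¹ • v₁)
    set z₂ := α (y, σ⁻¹ • v₂)
    have hz (t) (ht : t ∈ Icc (0 : ℝ) 1) : ‖z₁ t - z₂ t‖ ≤ 2 * (σ⁻¹ * ‖v₁ - v₂‖) := by
      refine (hgron _ hm₁ _ hm₂ t ht).trans_eq ?_
      rw [Prod.mk_sub_mk, sub_self, ← smul_sub, Prod.norm_mk, norm_zero, norm_smul, norm_inv,
        Real.norm_of_nonneg hσ0.le, max_eq_right (by positivity)]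
    have hder (t) (ht : t ∈ Icc (0 : ℝ) 1) :
        HasDerivAt (fun t ↦ z₁ t - z₂ t) (σ • X (z₁ t) - σ • X (z₂ t)) t :=
      (hαd' _ hm₁ t (hsub1 ht)).sub (hαd' _ hm₂ t (hsub1 ht))
    have ha (t) (ht : t ∈ Icc (0 : ℝ) 1) :
        ‖(z₁ t - z₂ t).2 - σ⁻¹ • (v₁ - v₂)‖ ≤ η * ‖v₁ - v₂‖ := by
      have h := norm_image_sub_le_of_norm_deriv_le_segment' (a := 0) (b := 1)
        (f := fun t ↦ (z₁ t - z₂ t).2) (C := η * ‖v₁ - v₂‖)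
        (f' := fun t ↦ (σ • X (z₁ t) - σ • X (z₂ t)).2)
        (fun t ht ↦ (HasDerivAt.prod_snd (hder t ht)).hasDerivWithinAt) ?_ t ht
      · rw [show z₁ 0 - z₂ 0 = (0, σ⁻¹ • (v₁ - v₂)) by
          simp [z₁, z₂, hα0 _ hm₁, hα0 _ hm₂, smul_sub]] at h
        refine h.trans ?_
        have := ht.2
        have h0 : 0 ≤ η * ‖v₁ - v₂‖ := by positivity
        nlinarith
      · intro t ht
        have ht' := Ico_subset_Icc_self ht
        have h := hq.norm_sub_le (hRs' (hnear _ hv₁ t ht')) (hRs' (hnear _ hv₂ t ht'))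
        change ‖σ • Q (z₁ t).1 (z₁ t).2 (z₁ t).2 - σ • Q (z₂ t).1 (z₂ t).2 (z₂ t).2‖ ≤ _
        rw [← smul_sub, norm_smul, Real.norm_of_nonneg hσ0.le]
        calc _ ≤ σ * (η / 2 * (2 * (σ⁻¹ * ‖v₁ - v₂‖))) := by
              gcongr
              refine h.trans ?_
              change η / 2 * _ ≤ _
              gcongr
              exact hz t ht'
          _ = η * ‖v₁ - v₂‖ := by field_simp
    have h := norm_image_sub_le_of_norm_deriv_le_segment_01'
      (f := fun t ↦ (z₁ t - z₂ t).1 - t • (v₁ - v₂)) (C := η * ‖v₁ - v₂‖)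
      (f' := fun t ↦ (σ • X (z₁ t) - σ • X (z₂ t)).1 - (1 : ℝ) • (v₁ - v₂))
      (fun t ht ↦ (HasDerivAt.sub (HasDerivAt.prod_fst (hder t ht)) ((hasDerivAt_id t).smul_const _)).hasDerivWithinAt) ?_
    · simpa [z₁, z₂, hα0 _ hm₁, hα0 _ hm₂] using h
    · intro t ht
      have h := ha t (Ico_subset_Icc_self ht)
      change ‖σ • (z₁ t).2 - σ • (z₂ t).2 - (1 : ℝ) • (v₁ - v₂)‖ ≤ _
      have h2 : σ • (z₁ t).2 - σ • (z₂ t).2 - (1 : ℝ) • (v₁ - v₂)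
          = σ • ((z₁ t - z₂ t).2 - σ⁻¹ • (v₁ - v₂)) := by
        rw [smul_sub σ, smul_smul, mul_inv_cancel₀ hσ0.ne', Prod.snd_sub, smul_sub σ, one_smul]
      rw [h2, norm_smul, Real.norm_of_nonneg hσ0.le]
      calc σ * _ ≤ 1 * (η * ‖v₁ - v₂‖) := by gcongr
        _ = _ := one_mul _

end Spray

/-! ### Maps close to the identity cover a point: no-retraction by a volume argument -/

section NearIdentity

open Metric Set MeasureTheory
open scoped NNReal

variable {m : ℕ}

local notation "𝔼" => EuclideanSpace ℝ (Fin m)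

/-- The function $t\mapsto\det(1+tA)$ is a polynomial of degree at most $m$. Lagrange interpolation
at $m+1$ small nodes recovers its value at $1$, with weights that do not depend on $A$. -/
theorem exists_weights_det_one_add (m : ℕ) (t₀ : ℝ) (ht₀ : 0 < t₀) :
    ∃ (t c : ℕ → ℝ), (∀ i, 0 < t i ∧ t i < t₀) ∧
      (∑ i ∈ Finset.range (m + 1), c i = 1) ∧
      ∀ A : EuclideanSpace ℝ (Fin m) →L[ℝ] EuclideanSpace ℝ (Fin m),
        ∑ i ∈ Finset.range (m + 1), c i * (1 + t i • A).det = (1 + A).det := by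
  set t : ℕ → ℝ := fun i ↦ t₀ / (i + 2) with ht
  have hinj : Set.InjOn t (Finset.range (m + 1)) := by
    intro i _ j _ h
    have h' : t₀ / ((i : ℝ) + 2) = t₀ / ((j : ℝ) + 2) := h
    rw [div_eq_div_iff (by positivity) (by positivity)] at h'
    have := mul_left_cancel₀ ht₀.ne' h'
    exact_mod_cast (add_right_cancel this).symm
  have key (p : Polynomial ℝ) (hp : p.natDegree ≤ m) :
      ∑ i ∈ Finset.range (m + 1),
        (Lagrange.basis (Finset.range (m + 1)) t i).eval 1 * p.eval (t i) = p.eval 1 := by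
    have h := Lagrange.eq_interpolate hinj (f := p) (by
      rw [Finset.card_range]
      exact lt_of_le_of_lt Polynomial.degree_le_natDegree (by exact_mod_cast Nat.lt_succ_of_le hp))
    conv_rhs => rw [h]
    rw [Lagrange.interpolate_apply, Polynomial.eval_finsetSum]
    refine Finset.sum_congr rfl fun i _ ↦ ?_
    simp [mul_comm]
  refine ⟨t, fun i ↦ (Lagrange.basis (Finset.range (m + 1)) t i).eval 1, fun i ↦ ⟨by positivity, ?_⟩,
    ?_, fun A ↦ ?_⟩
  · rw [div_lt_iff₀ (by positivity)]
    nlinarith [(Nat.cast_nonneg i : (0 : ℝ) ≤ i)]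
  · simpa using key 1 (by simp)
  · set b := (EuclideanSpace.basisFun (Fin m) ℝ).toBasis
    set N := LinearMap.toMatrix b b (A : EuclideanSpace ℝ (Fin m) →ₗ[ℝ] EuclideanSpace ℝ (Fin m))
    set p : Polynomial ℝ :=
      Matrix.det ((Polynomial.X : Polynomial ℝ) • N.map Polynomial.C
        + (1 : Matrix (Fin m) (Fin m) ℝ).map Polynomial.C) with hp
    have hpe (s : ℝ) : p.eval s = (1 + s • A).det := by
      rw [hp, ← Polynomial.coe_evalRingHom, RingHom.map_det, ContinuousLinearMap.det,
        ← LinearMap.det_toMatrix b]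
      congr 1
      have : LinearMap.toMatrix b b ((1 + s • A : EuclideanSpace ℝ (Fin m) →L[ℝ] _) :
          EuclideanSpace ℝ (Fin m) →ₗ[ℝ] EuclideanSpace ℝ (Fin m)) = 1 + s • N := by
        rw [ContinuousLinearMap.toLinearMap_add, ContinuousLinearMap.toLinearMap_smul, map_add, map_smul]
        congr 1
        exact LinearMap.toMatrix_one b
      rw [this]
      ext i j
      simp [Matrix.map_apply, Matrix.one_apply, add_comm]
      split_ifs <;> simp [mul_comm]
    have hdeg : p.natDegree ≤ m := by
      simpa [hp] using Polynomial.natDegree_det_X_add_C_le N 1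
    have := key p hdeg
    simpa only [hpe, one_smul] using this

/-- Milnor's and Rogers' proof of the no-retraction theorem. The normalized map $r=H/\|H\|$ fixes
the unit sphere. For small $t$ the map $x\mapsto x+t(r(x)-x)$ is a bijection of the unit ball, so
its Jacobian integrates to the volume of the ball. Being polynomial in $t$, this identity persists
at $t=1$, where the Jacobian of $r$ vanishes because $r$ takes values in a sphere. -/
theorem not_exists_nonvanishing_contDiff {H : 𝔼 → 𝔼} (hH : ContDiff ℝ 1 H) (h0 : ∀ x, H x ≠ 0)
    {s : ℝ} (hs : s < 1) (hid : ∀ x, s ≤ ‖x‖ → H x = x) : False := by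
  set r : 𝔼 → 𝔼 := fun x ↦ ‖H x‖⁻¹ • H x with hr
  have hrC : ContDiff ℝ 1 r :=
    ((hH.norm ℝ h0).inv fun x ↦ norm_ne_zero_iff.mpr (h0 x)).smul hH
  have hr1 (x) : ‖r x‖ = 1 := by
    rw [hr, norm_smul, norm_inv, norm_norm, inv_mul_cancel₀ (norm_ne_zero_iff.mpr (h0 x))]
  have hrid (x) (hx : ‖x‖ = 1) : r x = x := by simp [hr, hid x (by linarith), hx]
  set w : 𝔼 → 𝔼 := fun x ↦ r x - x with hw
  have hwC : ContDiff ℝ 1 w := hrC.sub contDiff_id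
  have hwd (x) : HasFDerivAt w (fderiv ℝ w x) x := (hwC.differentiable one_ne_zero x).hasFDerivAt
  obtain ⟨C, hC⟩ : ∃ C : ℝ, ∀ x ∈ closedBall (0 : 𝔼) 1, ‖fderiv ℝ w x‖ ≤ C :=
    (isCompact_closedBall (0 : 𝔼) 1).exists_bound_of_continuousOn
      (hwC.continuous_fderiv one_ne_zero).continuousOn
  have hC0 : 0 ≤ C := (norm_nonneg _).trans (hC 0 (by simp))
  have hlip (x) (hx : x ∈ closedBall (0 : 𝔼) 1) (y) (hy : y ∈ closedBall (0 : 𝔼) 1) :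
      ‖w x - w y‖ ≤ C * ‖x - y‖ :=
    (convex_closedBall (0 : 𝔼) 1).norm_image_sub_le_of_norm_fderiv_le
      (fun x _ ↦ hwC.differentiable one_ne_zero x) hC hy hx
  have hdet : ∀ᶠ T : 𝔼 →L[ℝ] 𝔼 in 𝓝 0, 0 < (1 + T).det := by
    have : ContinuousAt (fun T : 𝔼 →L[ℝ] 𝔼 ↦ (1 + T).det) 0 :=
      (ContinuousLinearMap.continuous_det.comp (continuous_const.add continuous_id)).continuousAt
    exact this.eventually (lt_mem_nhds (by simp [ContinuousLinearMap.det]))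
  obtain ⟨δ, hδ, hdet⟩ := Metric.eventually_nhds_iff_ball.mp hdet
  -- Below $t_0$ one has $tC<1$, which gives injectivity and local invertibility, and $tC<\delta$,
  -- which makes the Jacobian positive. The bound $t<1$ makes $x+tw(x)$ a convex combination of $x$
  -- and $r(x)$.
  set t₀ := min 1 (min 1 δ / (C + 1)) with ht₀
  have ht₀0 : 0 < t₀ := by positivity
  have htC (t) (h1 : 0 < t) (h2 : t < t₀) : t * C < 1 ∧ t * C < δ := by
    have h3 : t < min 1 δ / (C + 1) := h2.trans_le (min_le_right _ _)
    rw [lt_div_iff₀ (by positivity)] at h3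
    have := min_le_left 1 δ
    have := min_le_right 1 δ
    constructor <;> nlinarith
  set U := ball (0 : 𝔼) 1 with hU
  have hvol (t) (h1 : 0 < t) (h2 : t < t₀) :
      ∫ x in U, (1 + t • fderiv ℝ w x).det = volume.real U := by
    set g : 𝔼 → 𝔼 := fun x ↦ x + t • w x with hg
    have hg' (x) : HasFDerivAt g (1 + t • fderiv ℝ w x) x :=
      (hasFDerivAt_id x).add ((hwd x).const_smul t)
    have hgC : ContDiff ℝ 1 g := contDiff_id.add (hwC.const_smul t)
    have ht1 : t < 1 := h2.trans_le (min_le_left _ _)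
    have hT (x) (hx : x ∈ closedBall (0 : 𝔼) 1) : ‖t • fderiv ℝ w x‖ ≤ t * C := by
      rw [norm_smul, Real.norm_of_nonneg h1.le]
      exact mul_le_mul_of_nonneg_left (hC x hx) h1.le
    have hginj : InjOn g (closedBall (0 : 𝔼) 1) := by
      intro x hx y hy h
      have h3 : x - y = -(t • (w x - w y)) := by
        have : x + t • w x = y + t • w y := h
        rw [smul_sub, neg_sub, sub_eq_sub_iff_add_eq_add, this, add_comm]
      have h4 : ‖x - y‖ ≤ t * C * ‖x - y‖ := by
        conv_lhs => rw [h3, norm_neg, norm_smul, Real.norm_of_nonneg h1.le]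
        rw [mul_assoc]
        exact mul_le_mul_of_nonneg_left (hlip x hx y hy) h1.le
      have := (htC t h1 h2).1
      have h5 : ‖x - y‖ = 0 := by nlinarith [norm_nonneg (x - y)]
      exact sub_eq_zero.mp (norm_eq_zero.mp h5)
    -- The image of the open ball is open by the inverse function theorem. It is relatively closed
    -- because a limit from the boundary is a boundary point, which `g` fixes. Connectedness of the
    -- ball finishes.
    have hgU : g '' U = U := by
      have hsub : g '' U ⊆ U := by
        rintro _ ⟨x, hx, rfl⟩
        rw [hU, mem_ball_zero_iff] at hx ⊢
        have : g x = (1 - t) • x + t • r x := by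
          simp only [hg, hw, smul_sub, sub_smul, one_smul]; abel
        rw [this]
        refine (norm_add_le _ _).trans_lt ?_
        rw [norm_smul, norm_smul, hr1, Real.norm_of_nonneg h1.le,
          Real.norm_of_nonneg (by linarith : 0 ≤ 1 - t)]
        nlinarith
      refine hsub.antisymm ?_
      have hopen : IsOpen (g '' U) := by
        rw [isOpen_iff_mem_nhds]
        rintro _ ⟨x, hx, rfl⟩
        have hx' := ball_subset_closedBall hx
        have hlt : ‖-(t • fderiv ℝ w x)‖ < 1 := by
          rw [norm_neg]
          exact (hT x hx').trans_lt (htC t h1 h2).1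
        have hst : HasStrictFDerivAt g
            ((ContinuousLinearEquiv.unitsEquiv ℝ 𝔼 (Units.oneSub _ hlt) : 𝔼 ≃L[ℝ] 𝔼) :
              𝔼 →L[ℝ] 𝔼) x := by
          have h5 := hgC.contDiffAt.hasStrictFDerivAt (x := x) one_ne_zero
          rw [(hg' x).fderiv] at h5
          refine h5.congr_fderiv (ContinuousLinearMap.ext fun v ↦ ?_)
          change (1 + t • fderiv ℝ w x) v = (1 - -(t • fderiv ℝ w x)) v
          rw [sub_neg_eq_add]
        rw [← hst.map_nhds_eq_of_equiv]
        exact Filter.image_mem_map (isOpen_ball.mem_nhds hx)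
      have hUc : IsPreconnected U := (convex_ball (0 : 𝔼) 1).isPreconnected
      have hcl : closure (g '' U) ∩ U ⊆ g '' U := by
        rintro y ⟨hy, hyU⟩
        have hcomp : IsClosed (g '' closedBall (0 : 𝔼) 1) :=
          ((isCompact_closedBall (0 : 𝔼) 1).image hgC.continuous).isClosed
        obtain ⟨x, hx, rfl⟩ := closure_minimal (image_mono ball_subset_closedBall) hcomp hy
        rcases (mem_closedBall_zero_iff.mp hx).lt_or_eq with hx1 | hx1
        · exact ⟨x, mem_ball_zero_iff.mpr hx1, rfl⟩
        · exfalso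
          have : g x = x := by simp [hg, hw, hrid x hx1]
          rw [this, hU, mem_ball_zero_iff] at hyU
          linarith
      refine hUc.subset_of_closure_inter_subset hopen ?_ hcl
      exact ⟨g 0, hsub ⟨0, mem_ball_self one_pos, rfl⟩, 0, mem_ball_self one_pos, rfl⟩
    have h6 := integral_image_eq_integral_abs_det_fderiv_smul (μ := volume)
      (measurableSet_ball : MeasurableSet U)
      (fun x _ ↦ (hg' x).hasFDerivWithinAt) (hginj.mono ball_subset_closedBall) (fun _ ↦ (1 : ℝ))
    rw [hgU] at h6
    simp only [integral_const, smul_eq_mul, mul_one] at h6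
    rw [measureReal_restrict_apply_univ] at h6
    rw [h6]
    refine setIntegral_congr_fun measurableSet_ball fun x hx ↦ ?_
    refine (abs_of_pos (hdet _ ?_)).symm
    rw [mem_ball_zero_iff]
    exact (hT x (ball_subset_closedBall hx)).trans_lt (htC t h1 h2).2
  obtain ⟨t, c, ht, hc, hA⟩ := exists_weights_det_one_add m t₀ ht₀0
  have hint (s : ℝ) : IntegrableOn (fun x ↦ (1 + s • fderiv ℝ w x).det) U := by
    have : Continuous fun x ↦ (1 + s • fderiv ℝ w x).det :=
      ContinuousLinearMap.continuous_det.comp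
        (continuous_const.add ((hwC.continuous_fderiv one_ne_zero).const_smul s))
    exact (this.continuousOn.integrableOn_compact (isCompact_closedBall (0 : 𝔼) 1)).mono_set
      ball_subset_closedBall
  -- Integrating the interpolation formula: each node contributes the same volume, and the weights
  -- have sum one.
  have h1 : ∫ x in U, (1 + fderiv ℝ w x).det = volume.real U := by
    rw [show (fun x ↦ (1 + fderiv ℝ w x).det) = fun x ↦ ∑ i ∈ Finset.range (m + 1),
      c i * (1 + t i • fderiv ℝ w x).det from funext fun x ↦ (hA _).symm]
    rw [integral_finsetSum _ fun i _ ↦ (hint (t i)).const_mul _]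
    simp_rw [integral_const_mul, hvol _ (ht _).1 (ht _).2]
    rw [← Finset.sum_mul, hc, one_mul]
  -- Differentiating $\|r\|^2=1$ shows that the range of $Dr$ is orthogonal to $r\ne0$. Thus $Dr$ is
  -- not onto and its determinant is zero.
  have h2 (x) : (1 + fderiv ℝ w x).det = 0 := by
    have hrd : HasFDerivAt r (1 + fderiv ℝ w x) x := by
      have := (hasFDerivAt_id x).add (hwd x)
      refine this.congr_of_eventuallyEq (Filter.Eventually.of_forall fun y ↦ ?_)
      change r y = y + (r y - y)
      abel
    have hperp (v : 𝔼) : inner ℝ (r x) ((1 + fderiv ℝ w x) v) = 0 := by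
      have h3 := hrd.inner ℝ hrd
      have h4 : HasFDerivAt (fun y ↦ inner ℝ (r y) (r y)) (0 : 𝔼 →L[ℝ] ℝ) x := by
        refine (hasFDerivAt_const (1 : ℝ) x).congr_of_eventuallyEq
          (Filter.Eventually.of_forall fun y ↦ ?_)
        simp [hr1]
      have h5 := congrArg (fun T : 𝔼 →L[ℝ] ℝ ↦ T v) (h3.unique h4)
      simp [fderivInnerCLM_apply] at h5
      rw [real_inner_comm (r x)] at h5
      simp
      linarith
    by_contra hne
    have hunit : IsUnit (LinearMap.det ((1 + fderiv ℝ w x : 𝔼 →L[ℝ] 𝔼) : 𝔼 →ₗ[ℝ] 𝔼)) :=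
      isUnit_iff_ne_zero.mpr hne
    obtain ⟨v, hv⟩ := (LinearMap.equivOfDetNeZero _ hne).surjective (r x)
    have h7 := hperp v
    have h8 : (1 + fderiv ℝ w x) v = r x := hv
    rw [h8, real_inner_self_eq_norm_sq, hr1] at h7
    norm_num at h7
  simp only [h2, integral_zero] at h1
  have h3 : 0 < volume.real U := by
    rw [measureReal_def]
    exact ENNReal.toReal_pos (measure_ball_pos _ _ one_pos).ne' measure_ball_lt_top.ne
  linarith

/-- A continuous map `x ↦ x + u x` with `‖u‖ ≤ ε < 1` takes the value zero on the unit ball. -/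
theorem exists_add_eq_zero {u : 𝔼 → 𝔼} (hu : Continuous u) {ε : ℝ} (hε : ε < 1)
    (hb : ∀ x, ‖u x‖ ≤ ε) : ∃ x, x + u x = 0 := by
  by_contra! hne
  have hε0 : 0 ≤ ε := (norm_nonneg _).trans (hb 0)
  -- A cut-off equal to $1$ for $\|x\|\le\varepsilon$ and to $0$ for $\|x\|\ge(1+\varepsilon)/2$.
  -- Outside the ball of radius $\varepsilon$ no zero of $x+\psi u$ can occur, whatever the value of
  -- $\psi$.
  set ψ : 𝔼 → ℝ := fun x ↦ max 0 (min 1 (2 - (‖x‖ - ε) * (4 / (1 - ε)))) with hψ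
  have hψC : Continuous ψ := by fun_prop
  have hψ0 (x) : 0 ≤ ψ x := le_max_left _ _
  have hψ1 (x) : ψ x ≤ 1 := max_le zero_le_one (min_le_left _ _)
  have h1ε : 0 < 1 - ε := by linarith
  set u₁ : 𝔼 → 𝔼 := fun x ↦ ψ x • u x with hu₁
  have hu₁C : Continuous u₁ := hψC.smul hu
  have hne₁ (x) : x + u₁ x ≠ 0 := by
    rcases le_or_gt ‖x‖ ε with hx | hx
    · have : ψ x = 1 := by
        have : 1 ≤ 2 - (‖x‖ - ε) * (4 / (1 - ε)) := by
          have : (‖x‖ - ε) * (4 / (1 - ε)) ≤ 0 :=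
            mul_nonpos_of_nonpos_of_nonneg (by linarith) (by positivity)
          linarith
        simp [hψ, min_eq_left this]
      simpa [hu₁, this] using hne x
    · intro h
      have h1 : ‖x‖ = ‖u₁ x‖ := by
        conv_lhs => rw [eq_neg_of_add_eq_zero_left h, norm_neg]
      have h2 : ‖u₁ x‖ ≤ 1 * ε := by
        rw [hu₁, norm_smul, Real.norm_of_nonneg (hψ0 x)]
        exact mul_le_mul (hψ1 x) (hb x) (norm_nonneg _) zero_le_one
      linarith
  -- The error is kept below $\|x+u_1(x)\|$, so that the smooth approximation has no zero either.
  -- The control of the support leaves it equal to the identity near the sphere and beyond.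
  obtain ⟨g, hgC, hgu, hsupp⟩ := hu₁C.exists_contDiff_approx 1
    (ε := fun x ↦ ‖x + u₁ x‖) (by fun_prop) (fun x ↦ norm_pos_iff.mpr (hne₁ x))
  refine not_exists_nonvanishing_contDiff (H := fun x ↦ x + g x) (contDiff_id.add hgC)
    (fun x h ↦ ?_) (s := (1 + ε) / 2) (by linarith) fun x hx ↦ ?_
  · have h1 := hgu x
    rw [dist_eq_norm, eq_neg_of_add_eq_zero_right h, ← norm_neg] at h1
    refine h1.ne (congrArg _ ?_)
    abel
  · have : x ∉ Function.support u₁ := by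
      rw [Function.notMem_support, hu₁]
      have : 2 - (‖x‖ - ε) * (4 / (1 - ε)) ≤ 0 := by
        rw [sub_nonpos, ← mul_div_assoc, le_div_iff₀ h1ε]
        linarith
      simp [hψ, this]
    have : g x = 0 := Function.notMem_support.mp fun h ↦ this (hsupp h)
    simp [this]

/-- A map of a closed ball that moves points by less than the radius covers the center. -/
theorem mem_image_closedBall_of_near_id {h : 𝔼 → 𝔼} {c : 𝔼} {R ε : ℝ} (hR : 0 < R) (hεR : ε < R)
    (hc : ContinuousOn h (closedBall c R)) (hb : ∀ x ∈ closedBall c R, ‖h x - x‖ ≤ ε) :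
    c ∈ h '' closedBall c R := by
  -- The radial retraction onto the closed ball, in coordinates in which that ball is the unit ball.
  -- It extends the displacement to the whole space without enlarging it.
  set p : 𝔼 → 𝔼 := fun x ↦ c + R • (max 1 ‖x‖)⁻¹ • x with hp
  have hmax (x : 𝔼) : 0 < max 1 ‖x‖ := lt_max_of_lt_left one_pos
  have hpC : Continuous p := continuous_const.add
    (((continuous_const.max continuous_norm).inv₀ fun x ↦ (hmax x).ne').smul
      continuous_id |>.const_smul R)
  have hpm (x) : p x ∈ closedBall c R := by
    rw [mem_closedBall_iff_norm, hp, add_sub_cancel_left, norm_smul, norm_smul, norm_inv,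
      Real.norm_of_nonneg hR.le, Real.norm_of_nonneg (hmax x).le]
    have : (max 1 ‖x‖)⁻¹ * ‖x‖ ≤ 1 := by
      rw [inv_mul_le_iff₀ (hmax x), mul_one]
      exact le_max_right _ _
    nlinarith
  have huC : Continuous fun x ↦ R⁻¹ • (h (p x) - p x) :=
    ((hc.comp_continuous hpC hpm).sub hpC).const_smul R⁻¹
  obtain ⟨x, hx⟩ := exists_add_eq_zero (u := fun x ↦ R⁻¹ • (h (p x) - p x)) (ε := R⁻¹ * ε)
    huC
    (by rwa [inv_mul_lt_iff₀ hR, mul_one]) fun x ↦ by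
      rw [norm_smul, norm_inv, Real.norm_of_nonneg hR.le]
      gcongr
      exact hb _ (hpm x)
  refine ⟨p x, hpm x, ?_⟩
  have hx1 : ‖x‖ ≤ 1 := by
    rw [eq_neg_of_add_eq_zero_left hx, norm_neg]
    generalize x = x
    rw [norm_smul, norm_inv, Real.norm_of_nonneg hR.le,
      inv_mul_le_iff₀ hR, mul_one]
    exact (hb _ (hpm x)).trans hεR.le
  have hpx : p x = c + R • x := by simp [hp, max_eq_left hx1]
  have h2 : R • x + (h (p x) - p x) = 0 := by
    have := congrArg (R • ·) hx
    simpa [smul_add, smul_smul, hR.ne'] using this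
  calc h (p x) = (R • x + (h (p x) - p x)) + (p x - R • x) := by abel
    _ = c := by rw [h2, hpx]; abel

end NearIdentity

/-! ### Inverses with norm bounds in a normed ring -/

section BoundedInverse

variable {𝒜 : Type*} [NormedRing 𝒜]

/-- `z` has a two-sided inverse of norm at most `K`. -/
def HasBoundedInverse (z : 𝒜) (K : ℝ) : Prop := ∃ y, y * z = 1 ∧ z * y = 1 ∧ ‖y‖ ≤ K

theorem HasBoundedInverse.mono {z : 𝒜} {K K' : ℝ} (h : HasBoundedInverse z K) (hK : K ≤ K') :
    HasBoundedInverse z K' :=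
  let ⟨y, h1, h2, h3⟩ := h
  ⟨y, h1, h2, h3.trans hK⟩

theorem HasBoundedInverse.mul {z w : 𝒜} {K K' : ℝ} (hz : HasBoundedInverse z K)
    (hw : HasBoundedInverse w K') : HasBoundedInverse (z * w) (K' * K) := by
  obtain ⟨y, h1, h2, h3⟩ := hz
  obtain ⟨x, g1, g2, g3⟩ := hw
  refine ⟨x * y, ?_, ?_, (norm_mul_le _ _).trans ?_⟩
  · rw [mul_assoc, ← mul_assoc y, h1, one_mul, g1]
  · rw [mul_assoc, ← mul_assoc w, g2, one_mul, h2]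
  · exact mul_le_mul g3 h3 (norm_nonneg _) ((norm_nonneg _).trans g3)

/-- The first product supplies a left inverse of `z` and the second a right inverse. The two
coincide, so the bound for the left one suffices. -/
theorem HasBoundedInverse.of_mul_left_right {z y z₁ z₂ : 𝒜} {K : ℝ} (h1 : y * z = z₁)
    (h2 : z * y = z₂) (hz1 : HasBoundedInverse z₁ K) (hz2 : HasBoundedInverse z₂ K) :
    HasBoundedInverse z (K * ‖y‖) := by
  obtain ⟨y1, a1, -, a3⟩ := hz1
  obtain ⟨y2, -, b2, -⟩ := hz2
  have hl : (y1 * y) * z = 1 := by rw [mul_assoc, h1, a1]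
  have hr : z * (y * y2) = 1 := by rw [← mul_assoc, h2, b2]
  have heq : y1 * y = y * y2 := left_inv_eq_right_inv hl hr
  refine ⟨y1 * y, hl, by rw [heq, hr], (norm_mul_le _ _).trans ?_⟩
  exact mul_le_mul_of_nonneg_right a3 (norm_nonneg _)

variable [CompleteSpace 𝒜]

/-- The inverse $y$ satisfies $y=1-ye$, hence $\|y\|\le1+\|y\|/2$. Asking only for $\|1\|\le1$
admits the zero ring, which is the ring of operators on a trivial space. -/
theorem HasBoundedInverse.one_add (h1 : ‖(1 : 𝒜)‖ ≤ 1) {e : 𝒜} (he : ‖e‖ ≤ 1 / 2) :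
    HasBoundedInverse (1 + e) 2 := by
  have hlt : ‖-e‖ < 1 := by rw [norm_neg]; linarith
  set u := Units.oneSub (-e) hlt
  have hu : (u : 𝒜) = 1 + e := by simp [u]
  refine ⟨((u⁻¹ : 𝒜ˣ) : 𝒜), by rw [← hu, Units.inv_mul], by rw [← hu, Units.mul_inv], ?_⟩
  set y : 𝒜 := ((u⁻¹ : 𝒜ˣ) : 𝒜)
  have h : y = 1 - y * e := by
    have : y * (1 + e) = 1 := by rw [← hu, Units.inv_mul]
    rw [mul_add, mul_one] at this
    rw [← this, add_sub_cancel_right]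
  have h2 : ‖y‖ ≤ 1 + ‖y‖ * (1 / 2) := by
    calc ‖y‖ = ‖1 - y * e‖ := by rw [← h]
      _ ≤ ‖(1 : 𝒜)‖ + ‖y * e‖ := norm_sub_le _ _
      _ ≤ 1 + ‖y‖ * ‖e‖ := add_le_add h1 (norm_mul_le _ _)
      _ ≤ _ := by gcongr
  linarith

theorem HasBoundedInverse.add (h1 : ‖(1 : 𝒜)‖ ≤ 1) {z e : 𝒜} {K : ℝ}
    (hz : HasBoundedInverse z K) (he : K * ‖e‖ ≤ 1 / 2) : HasBoundedInverse (z + e) (2 * K) := by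
  obtain ⟨y, a1, a2, a3⟩ := hz
  have h : z + e = z * (1 + y * e) := by rw [mul_add, mul_one, ← mul_assoc, a2, one_mul]
  rw [h]
  refine HasBoundedInverse.mul ⟨y, a1, a2, a3⟩ (HasBoundedInverse.one_add h1 ?_)
  exact (norm_mul_le _ _).trans ((mul_le_mul_of_nonneg_right a3 (norm_nonneg _)).trans he)

/-- The factorization of $1-x^n$ by the geometric sum reduces the claim to the case of norm at most
$1/2$. No adapted norm is needed for an operator that is only eventually contracting. -/
theorem HasBoundedInverse.one_sub_of_pow (h1 : ‖(1 : 𝒜)‖ ≤ 1) {x : 𝒜} {A : ℝ} (hA : 1 ≤ A)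
    (hx : ‖x‖ ≤ A) {n : ℕ} (hn : ‖x ^ n‖ ≤ 1 / 2) :
    HasBoundedInverse (1 - x) (2 * (n * A ^ n)) := by
  have h2 : HasBoundedInverse (1 - x ^ n) 2 := by
    rw [sub_eq_add_neg]
    exact HasBoundedInverse.one_add h1 (by rwa [norm_neg])
  have hb : ‖∑ i ∈ Finset.range n, x ^ i‖ ≤ n * A ^ n := by
    refine (norm_sum_le _ _).trans ?_
    calc ∑ i ∈ Finset.range n, ‖x ^ i‖ ≤ ∑ i ∈ Finset.range n, A ^ n := by
          refine Finset.sum_le_sum fun i hi ↦ ?_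
          have : ‖x ^ i‖ ≤ A ^ i := by
            rcases Nat.eq_zero_or_pos i with rfl | hi0
            · simpa using h1
            · exact (norm_pow_le' x hi0).trans (pow_le_pow_left₀ (norm_nonneg _) hx i)
          exact this.trans (pow_le_pow_right₀ hA (Finset.mem_range.mp hi).le)
      _ = _ := by simp
  refine (HasBoundedInverse.of_mul_left_right (geom_sum_mul_neg x n) (mul_neg_geom_sum x n)
    h2 h2).mono ?_
  gcongr

/-- The operator `1 - Ls - Lu` is invertible if `Ls` is eventually contracting and `Lu` is, up to
small errors, the inverse of the eventually contracting `B` on the range of the projection `Q`. -/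
theorem HasBoundedInverse.one_sub_hyperbolic (h1 : ‖(1 : 𝒜)‖ ≤ 1) {Ls Lu B Q : 𝒜} {A : ℝ}
    (hA : 1 ≤ A) {n k : ℕ} (hLs : ‖Ls‖ ≤ A) (hB : ‖B‖ ≤ A) (hLsn : ‖Ls ^ n‖ ≤ 1 / 2)
    (hBn : ‖B ^ k‖ ≤ 1 / 2) (hsu : Ls * Lu = 0) (hQL : Q * Lu = Lu) (hLQ : Lu * Q = Lu)
    (hQ : ‖1 - Q - B‖ ≤ A)
    (h3 : 2 * (k * A ^ k) * ‖B * Lu - Q‖ ≤ 1 / 2) (h4 : 2 * (k * A ^ k) * ‖Lu * B - Q‖ ≤ 1 / 2) :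
    HasBoundedInverse (1 - (Ls + Lu)) ((2 * (2 * (k * A ^ k)) * A) * (2 * (n * A ^ n))) := by
  have e1 := HasBoundedInverse.one_sub_of_pow h1 hA hLs hLsn
  have e2 := HasBoundedInverse.one_sub_of_pow h1 hA hB hBn
  have e3 := e2.add h1 h3
  have e4 := e2.add h1 h4
  -- On the range of `Q` the factor $1-Lu$ is approximately $-Lu(1-B)$, and on the complement it is
  -- the identity. Multiplication by $1-Q-B$ therefore turns it, from either side, into $1-B$ up to
  -- a small error.
  have h5 : (1 - Q - B) * (1 - Lu) = 1 - B + (B * Lu - Q) := by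
    simp only [sub_mul, mul_sub, one_mul, mul_one, hQL]; abel
  have h6 : (1 - Lu) * (1 - Q - B) = 1 - B + (Lu * B - Q) := by
    simp only [sub_mul, mul_sub, one_mul, mul_one, hLQ]; abel
  have e5 : HasBoundedInverse (1 - Lu) (2 * (2 * (k * A ^ k)) * A) := by
    refine (HasBoundedInverse.of_mul_left_right h5 h6 e3 e4).mono ?_
    have : 0 ≤ A := by linarith
    gcongr
  have h7 : 1 - (Ls + Lu) = (1 - Ls) * (1 - Lu) := by
    simp only [sub_mul, mul_sub, one_mul, mul_one, hsu]; abel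
  rw [h7]
  exact e1.mul e5

end BoundedInverse

/-! ### Weighted shift operators on continuous functions -/

section WeightedShift

theorem _root_.ContinuousMap.zero_le_norm {M F : Type*} [TopologicalSpace M] [CompactSpace M]
    [SeminormedAddCommGroup F] (a : C(M, F)) : 0 ≤ ‖a‖ := norm_nonneg a

variable {M : Type*} [TopologicalSpace M] [CompactSpace M]
variable {E : Type*} [NormedAddCommGroup E] [NormedSpace ℝ E]

/-- Pointwise application of a continuous family of operators to a continuous function. -/
def mulOp (a : C(M, E →L[ℝ] E)) : C(M, E) →L[ℝ] C(M, E) :=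
  LinearMap.mkContinuous
    { toFun := fun V ↦ ⟨fun x ↦ a x (V x), a.continuous.clm_apply V.continuous⟩
      map_add' := fun V W ↦ by ext x; simp
      map_smul' := fun c V ↦ by ext x; simp } ‖a‖ fun V ↦ by
    refine (ContinuousMap.norm_le _
      (mul_nonneg (ContinuousMap.zero_le_norm _) (norm_nonneg _))).mpr fun x ↦ ?_
    exact (a x).le_of_opNorm_le_of_le (a.norm_coe_le_norm x) (V.norm_coe_le_norm x)

@[simp] theorem mulOp_apply (a : C(M, E →L[ℝ] E)) (V : C(M, E)) (x : M) :
    mulOp a V x = a x (V x) := rfl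

theorem norm_mulOp_le (a : C(M, E →L[ℝ] E)) : ‖mulOp a‖ ≤ ‖a‖ :=
  LinearMap.mkContinuous_norm_le _ (ContinuousMap.zero_le_norm _) _

/-- Composition with a continuous map. -/
def compOp (g : C(M, M)) : C(M, E) →L[ℝ] C(M, E) :=
  LinearMap.mkContinuous
    { toFun := fun V ↦ V.comp g
      map_add' := fun V W ↦ by ext x; simp
      map_smul' := fun c V ↦ by ext x; simp } 1 fun V ↦ by
    refine (ContinuousMap.norm_le _ (by positivity)).mpr fun x ↦ ?_
    rw [one_mul]
    exact V.norm_coe_le_norm (g x)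

@[simp] theorem compOp_apply (g : C(M, M)) (V : C(M, E)) (x : M) :
    compOp g V x = V (g x) := rfl

theorem norm_compOp_le (g : C(M, M)) : ‖(compOp g : C(M, E) →L[ℝ] C(M, E))‖ ≤ 1 :=
  LinearMap.mkContinuous_norm_le _ zero_le_one _

/-- The operator with `forwardOp g a V (g x) = a x (V x)`. -/
def forwardOp (g : M ≃ₜ M) (a : C(M, E →L[ℝ] E)) : C(M, E) →L[ℝ] C(M, E) :=
  compOp (g.symm : C(M, M)) ∘L mulOp a

@[simp] theorem forwardOp_apply (g : M ≃ₜ M) (a : C(M, E →L[ℝ] E)) (V : C(M, E)) (x : M) :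
    forwardOp g a V (g x) = a x (V x) := by
  simp [forwardOp]

/-- The operator with `backwardOp g b V x = b x (V (g x))`. -/
def backwardOp (g : M ≃ₜ M) (b : C(M, E →L[ℝ] E)) : C(M, E) →L[ℝ] C(M, E) :=
  mulOp b ∘L compOp (g : C(M, M))

@[simp] theorem backwardOp_apply (g : M ≃ₜ M) (b : C(M, E →L[ℝ] E)) (V : C(M, E)) (x : M) :
    backwardOp g b V x = b x (V (g x)) := rfl

theorem norm_forwardOp_le (g : M ≃ₜ M) (a : C(M, E →L[ℝ] E)) : ‖forwardOp g a‖ ≤ ‖a‖ := by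
  refine (ContinuousLinearMap.opNorm_comp_le _ _).trans ?_
  calc _ ≤ 1 * ‖a‖ := mul_le_mul (norm_compOp_le _) (norm_mulOp_le _) (norm_nonneg _) zero_le_one
    _ = _ := one_mul _

theorem norm_backwardOp_le (g : M ≃ₜ M) (b : C(M, E →L[ℝ] E)) : ‖backwardOp g b‖ ≤ ‖b‖ := by
  refine (ContinuousLinearMap.opNorm_comp_le _ _).trans ?_
  calc _ ≤ ‖b‖ * 1 := mul_le_mul (norm_mulOp_le _) (norm_compOp_le _) (norm_nonneg _) (ContinuousMap.zero_le_norm _)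
    _ = _ := mul_one _

/-- The products `a (g^[n-1] x) ∘ ⋯ ∘ a x`. -/
def forwardCocycle (g : C(M, M)) (a : C(M, E →L[ℝ] E)) : ℕ → C(M, E →L[ℝ] E)
  | 0 => 1
  | n + 1 => (forwardCocycle g a n).comp g * a

/-- The products `b x ∘ ⋯ ∘ b (g^[n-1] x)`. -/
def backwardCocycle (g : C(M, M)) (b : C(M, E →L[ℝ] E)) : ℕ → C(M, E →L[ℝ] E)
  | 0 => 1
  | n + 1 => b * (backwardCocycle g b n).comp g

theorem forwardOp_pow_apply (g : M ≃ₜ M) (a : C(M, E →L[ℝ] E)) (n : ℕ) (V : C(M, E)) (x : M) :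
    (forwardOp g a ^ n) V (g^[n] x) = forwardCocycle (g : C(M, M)) a n x (V x) := by
  induction n generalizing V x with
  | zero => simp [forwardCocycle]
  | succ n ih =>
    rw [pow_succ, Function.iterate_succ_apply]
    change (forwardOp g a ^ n) (forwardOp g a V) (g^[n] (g x)) = _
    rw [ih]
    simp [forwardCocycle]

theorem backwardOp_pow_apply (g : M ≃ₜ M) (b : C(M, E →L[ℝ] E)) (n : ℕ) (V : C(M, E)) (x : M) :
    (backwardOp g b ^ n) V x = backwardCocycle (g : C(M, M)) b n x (V (g^[n] x)) := by
  induction n generalizing V x with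
  | zero => simp [backwardCocycle]
  | succ n ih =>
    rw [pow_succ', Function.iterate_succ_apply]
    change backwardOp g b ((backwardOp g b ^ n) V) x = _
    rw [backwardOp_apply, ih]
    simp [backwardCocycle]

/-- A power of a weighted shift is the shift over the iterate, weighted by the product of the
weights along an orbit. The decay of the cocycle is thus inherited by the operator. -/
theorem norm_forwardOp_pow_le (g : M ≃ₜ M) (a : C(M, E →L[ℝ] E)) (n : ℕ) :
    ‖forwardOp g a ^ n‖ ≤ ‖forwardCocycle (g : C(M, M)) a n‖ := by
  refine ContinuousLinearMap.opNorm_le_bound _ (ContinuousMap.zero_le_norm _) fun V ↦ ?_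
  refine (ContinuousMap.norm_le _
    (mul_nonneg (ContinuousMap.zero_le_norm _) (norm_nonneg _))).mpr fun y ↦ ?_
  obtain ⟨x, rfl⟩ := (g.surjective.iterate n) y
  rw [forwardOp_pow_apply]
  exact ContinuousLinearMap.le_of_opNorm_le_of_le _ (ContinuousMap.norm_coe_le_norm _ x)
    (V.norm_coe_le_norm x)

theorem norm_backwardOp_pow_le (g : M ≃ₜ M) (b : C(M, E →L[ℝ] E)) (n : ℕ) :
    ‖backwardOp g b ^ n‖ ≤ ‖backwardCocycle (g : C(M, M)) b n‖ := by
  refine ContinuousLinearMap.opNorm_le_bound _ (ContinuousMap.zero_le_norm _) fun V ↦ ?_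
  refine (ContinuousMap.norm_le _
    (mul_nonneg (ContinuousMap.zero_le_norm _) (norm_nonneg _))).mpr fun x ↦ ?_
  rw [backwardOp_pow_apply]
  exact ContinuousLinearMap.le_of_opNorm_le_of_le _ (ContinuousMap.norm_coe_le_norm _ x)
    (V.norm_coe_le_norm _)

/-- The restriction of a family of operators over `M × M` to the graph of a map. -/
def graphRestrict (a : C(M × M, E →L[ℝ] E)) (g : C(M, M)) : C(M, E →L[ℝ] E) :=
  a.comp ((ContinuousMap.id M).prodMk g)

@[simp] theorem graphRestrict_apply (a : C(M × M, E →L[ℝ] E)) (g : C(M, M)) (x : M) :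
    graphRestrict a g x = a (x, g x) := rfl

variable [T2Space M]

theorem continuous_graphRestrict (a : C(M × M, E →L[ℝ] E)) : Continuous (graphRestrict a) :=
  ContinuousMap.continuous_of_continuous_uncurry _ <| by
    have : Continuous fun p : C(M, M) × M ↦ a (p.2, p.1 p.2) :=
      a.continuous.comp (continuous_snd.prodMk continuous_eval)
    exact this

/-- Because the weight is defined on $M\times M$ and is only restricted to the graph of `g`, it
varies continuously with `g` in the $C^0$ topology. A contraction estimate for a fixed power at `f`
therefore persists for nearby `g`, of which no derivative is available. -/
theorem continuous_forwardCocycle (a : C(M × M, E →L[ℝ] E)) (n : ℕ) :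
    Continuous fun g : C(M, M) ↦ forwardCocycle g (graphRestrict a g) n := by
  induction n with
  | zero => exact continuous_const
  | succ n ih => exact (ih.compCM continuous_id).mul (continuous_graphRestrict a)

theorem continuous_backwardCocycle (b : C(M × M, E →L[ℝ] E)) (n : ℕ) :
    Continuous fun g : C(M, M) ↦ backwardCocycle g (graphRestrict b g) n := by
  induction n with
  | zero => exact continuous_const
  | succ n ih => exact (continuous_graphRestrict b).mul (ih.compCM continuous_id)

end WeightedShift

/-! ### Uniform invertibility of the hyperbolic transport operator -/

section Hyperbolic

theorem _root_.ContinuousMap.norm_comp_le_norm {M R : Type*}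
    [TopologicalSpace M] [CompactSpace M] [SeminormedAddCommGroup R] (F : C(M, R)) (g : C(M, M)) :
    ‖F.comp g‖ ≤ ‖F‖ :=
  (ContinuousMap.norm_le _ (norm_nonneg F)).mpr fun x ↦ F.norm_coe_le_norm (g x)

theorem _root_.ContinuousMap.eventually_norm_lt {X M R : Type*} [TopologicalSpace X]
    [TopologicalSpace M] [CompactSpace M] [SeminormedAddCommGroup R] {F : X → C(M, R)} {x : X}
    (hF : Continuous F) {c : ℝ} (hc : ‖F x‖ < c) : ∀ᶠ y in 𝓝 x, ‖F y‖ < c :=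
  hF.norm.continuousAt.eventually (gt_mem_nhds hc)

theorem _root_.ContinuousMap.eventually_norm_mul_sub_lt {X M R : Type*} [TopologicalSpace X]
    [TopologicalSpace M] [CompactSpace M] [NormedRing R] {F G H : X → C(M, R)} {x : X}
    (hF : Continuous F) (hG : Continuous G) (hH : Continuous H) {c : ℝ} (hc : 0 < c)
    (h : F x * G x - H x = 0) : ∀ᶠ y in 𝓝 x, ‖F y * G y - H y‖ < c :=
  ContinuousMap.eventually_norm_lt ((hF.mul hG).sub hH) (by
    change ‖F x * G x - H x‖ < c
    rwa [h, norm_zero])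

variable {M : Type*} [TopologicalSpace M] [CompactSpace M] [T2Space M]
variable {E : Type*} [NormedAddCommGroup E] [NormedSpace ℝ E]

/-- The map from the fibre over `x` to the fibre over `y` induced by `D x` and a projection. -/
def pushTransport (P D : C(M, E →L[ℝ] E)) : C(M × M, E →L[ℝ] E) :=
  ⟨fun z ↦ P z.2 * D z.1 * P z.1, by fun_prop⟩

/-- The map from the fibre over `y` to the fibre over `x` induced by `D x` and a projection. -/
def pullTransport (P D : C(M, E →L[ℝ] E)) : C(M × M, E →L[ℝ] E) :=
  ⟨fun z ↦ P z.1 * D z.1 * P z.2, by fun_prop⟩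

@[simp] theorem pushTransport_apply (P D : C(M, E →L[ℝ] E)) (z : M × M) :
    pushTransport P D z = P z.2 * D z.1 * P z.1 := rfl

@[simp] theorem pullTransport_apply (P D : C(M, E →L[ℝ] E)) (z : M × M) :
    pullTransport P D z = P z.1 * D z.1 * P z.2 := rfl

/-- The transport operator of the hyperbolic part, over a homeomorphism `g`. -/
def hyperbolicOp (Ps Pu D : C(M, E →L[ℝ] E)) (g : M ≃ₜ M) : C(M, E) →L[ℝ] C(M, E) :=
  forwardOp g (graphRestrict (pushTransport Ps D) g)
    + forwardOp g (graphRestrict (pushTransport Pu D) g)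

theorem hyperbolicOp_apply (Ps Pu D : C(M, E →L[ℝ] E)) (g : M ≃ₜ M) (V : C(M, E)) (x : M) :
    hyperbolicOp Ps Pu D g V (g x)
      = (pushTransport Ps D (x, g x) + pushTransport Pu D (x, g x)) (V x) := by
  simp [hyperbolicOp]

/-- Each hypothesis of `HasBoundedInverse.one_sub_hyperbolic` either holds for every `g` or is a
strict inequality that holds at `f` and depends continuously on `g`. At `f` the unstable push and
pull are exactly inverse to each other; for nearby `g` the error of their products is below any
prescribed constant. -/
theorem eventually_hasBoundedInverse [CompleteSpace E] (f : M ≃ₜ M) (Ps Pu D D' : C(M, E →L[ℝ] E))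
    (hsu : ∀ x, Ps x * Pu x = 0) (huu : ∀ x, Pu x * Pu x = Pu x)
    (hD : ∀ x, Pu (f x) * D x * Pu x = D x * Pu x)
    (hD' : ∀ x, Pu x * D' x * Pu (f x) = D' x * Pu (f x))
    (hDD : ∀ x, D' x * D x * Pu x = Pu x) (hDD' : ∀ x, D x * D' x * Pu (f x) = Pu (f x))
    (hs : ∃ n, ‖forwardCocycle (f : C(M, M)) (graphRestrict (pushTransport Ps D) f) n‖ < 1 / 2)
    (hu : ∃ n, ‖backwardCocycle (f : C(M, M)) (graphRestrict (pullTransport Pu D') f) n‖ < 1 / 2) :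
    ∃ K > 0, ∀ᶠ g in Filter.comap (fun g : M ≃ₜ M ↦ (g : C(M, M))) (𝓝 (f : C(M, M))),
      HasBoundedInverse (1 - hyperbolicOp Ps Pu D g) K := by
  obtain ⟨n, hn⟩ := hs
  obtain ⟨k, hk⟩ := hu
  set as := pushTransport Ps D
  set au := pushTransport Pu D
  set b := pullTransport Pu D'
  set Q : C(M, E) →L[ℝ] C(M, E) := mulOp Pu
  -- One constant for all norms that occur. The stable shift and `B` are allowed to exceed their
  -- value at `f` by $1$, and $\|1-Q-B\|\le1+\|Q\|+\|B\|$.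
  set A : ℝ := 1 + ‖graphRestrict as f‖ + ‖graphRestrict b f‖ + ‖Q‖ + 2 with hA
  have p1 : 0 ≤ ‖graphRestrict as f‖ := ContinuousMap.zero_le_norm _
  have p2 : 0 ≤ ‖graphRestrict b f‖ := ContinuousMap.zero_le_norm _
  have p3 : 0 ≤ ‖Q‖ := norm_nonneg _
  have hA1 : 1 ≤ A := by linarith
  have c1 := ContinuousMap.eventually_norm_lt (continuous_forwardCocycle as n) hn
  have c2 := ContinuousMap.eventually_norm_lt (continuous_backwardCocycle b k) hk
  have c3 := ContinuousMap.eventually_norm_lt (continuous_graphRestrict as) (lt_add_one ‖graphRestrict as f‖)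
  have c4 := ContinuousMap.eventually_norm_lt (continuous_graphRestrict b) (lt_add_one ‖graphRestrict b f‖)
  have hc0 : 0 < 1 / (4 * (k * A ^ k) + 1) := by positivity
  have e1 : graphRestrict b (f : C(M, M)) * graphRestrict au (f : C(M, M)) - Pu = 0 := by
    ext1 x
    change (Pu x * D' x * Pu (f x)) * (Pu (f x) * D x * Pu x) - Pu x = 0
    rw [hD, hD', mul_assoc (D' x), ← hD x, mul_assoc (Pu (f x)), ← mul_assoc (Pu (f x)), huu,
      ← mul_assoc (Pu (f x)), hD x, ← mul_assoc, hDD, sub_self]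
  have e2 : graphRestrict au (f : C(M, M)) * graphRestrict b (f : C(M, M)) - Pu.comp f = 0 := by
    ext1 x
    change (Pu (f x) * D x * Pu x) * (Pu x * D' x * Pu (f x)) - Pu (f x) = 0
    rw [hD, hD', mul_assoc (D x), ← hD' x, mul_assoc (Pu x), ← mul_assoc (Pu x), huu,
      ← mul_assoc (Pu x), hD' x, ← mul_assoc, hDD', sub_self]
  have c5 := ContinuousMap.eventually_norm_mul_sub_lt (continuous_graphRestrict b)
    (continuous_graphRestrict au) continuous_const hc0 e1
  have c6 := ContinuousMap.eventually_norm_mul_sub_lt (continuous_graphRestrict au)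
    (continuous_graphRestrict b) ((continuous_const (y := Pu)).compCM continuous_id) hc0 e2
  have hsmall {e : ℝ} (he : e ≤ 1 / (4 * (k * A ^ k) + 1)) : 2 * (k * A ^ k) * e ≤ 1 / 2 := by
    calc 2 * (k * A ^ k) * e ≤ 2 * (k * A ^ k) * (1 / (4 * (k * A ^ k) + 1)) := by gcongr
      _ ≤ 1 / 2 := by
        rw [mul_one_div, div_le_div_iff₀ (by positivity) (by norm_num)]
        linarith
  -- The summand $1$ keeps the bound positive when `n` or `k` is zero.
  refine ⟨(2 * (2 * (k * A ^ k)) * A) * (2 * (n * A ^ n)) + 1, by positivity, ?_⟩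
  filter_upwards [Filter.preimage_mem_comap c1, Filter.preimage_mem_comap c2,
    Filter.preimage_mem_comap c3, Filter.preimage_mem_comap c4, Filter.preimage_mem_comap c5,
    Filter.preimage_mem_comap c6] with g g1 g2 g3 g4 g5 g6
  simp only [Set.mem_preimage, Set.mem_ofPred_eq] at g1 g2 g3 g4 g5 g6
  refine (HasBoundedInverse.one_sub_hyperbolic (n := n) (k := k) (A := A)
    (B := backwardOp g (graphRestrict b g)) (Q := Q)
    ContinuousLinearMap.norm_id_le hA1 ((norm_forwardOp_le _ _).trans ?_)
    ((norm_backwardOp_le _ _).trans ?_) ((norm_forwardOp_pow_le _ _ _).trans g1.le)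
    ((norm_backwardOp_pow_le _ _ _).trans g2.le) ?_ ?_ ?_ ?_
    (hsmall (le_trans ?_ g5.le)) (hsmall (le_trans ?_ g6.le))).mono (by linarith)
  · linarith
  · linarith
  · ext V y
    obtain ⟨x, rfl⟩ := g.surjective y
    obtain ⟨x, rfl⟩ := g.surjective x
    change forwardOp g _ (forwardOp g _ V) (g (g x)) = 0
    rw [forwardOp_apply, forwardOp_apply]
    have := congrArg (fun T : E →L[ℝ] E ↦ T (D x (Pu x (V x)))) (hsu (g x))
    change Ps (g (g x)) (D (g x) (Ps (g x) (Pu (g x) (D x (Pu x (V x)))))) = 0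
    rw [show Ps (g x) (Pu (g x) (D x (Pu x (V x)))) = 0 from this, map_zero, map_zero]
  · ext V y
    obtain ⟨x, rfl⟩ := g.surjective y
    change Pu (g x) (forwardOp g _ V (g x)) = forwardOp g _ V (g x)
    rw [forwardOp_apply]
    exact congrArg (fun T : E →L[ℝ] E ↦ T (D x (Pu x (V x)))) (huu (g x))
  · ext V y
    obtain ⟨x, rfl⟩ := g.surjective y
    change forwardOp g _ (mulOp Pu V) (g x) = forwardOp g _ V (g x)
    rw [forwardOp_apply, forwardOp_apply]
    exact congrArg (fun T : E →L[ℝ] E ↦ Pu (g x) (D x (T (V x)))) (huu x)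
  · refine (norm_sub_le _ _).trans ?_
    have h1 : ‖(1 : C(M, E) →L[ℝ] C(M, E)) - Q‖ ≤ 1 + ‖Q‖ :=
      (norm_sub_le _ _).trans (add_le_add_left ContinuousLinearMap.norm_id_le _)
    have h2 := norm_backwardOp_le g (graphRestrict b g)
    linarith
  · have : backwardOp g (graphRestrict b g) * forwardOp g (graphRestrict au g) - Q
        = mulOp (graphRestrict b g * graphRestrict au g - Pu) := by
      ext V x
      change graphRestrict b g x (forwardOp g _ V (g x)) - Pu x (V x) = _
      rw [forwardOp_apply]
      rfl
    rw [this]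
    exact norm_mulOp_le _
  · have : forwardOp g (graphRestrict au g) * backwardOp g (graphRestrict b g) - Q
        = mulOp ((graphRestrict au g * graphRestrict b g - Pu.comp g).comp (g.symm : C(M, M))) := by
      ext V y
      obtain ⟨x, rfl⟩ := g.surjective y
      change forwardOp g _ (backwardOp g _ V) (g x) - Pu (g x) (V (g x)) = _
      rw [forwardOp_apply]
      change _ = (graphRestrict au g (g.symm (g x)) * graphRestrict b g (g.symm (g x))
        - Pu (g (g.symm (g x)))) (V (g x))
      rw [g.symm_apply_apply]
      rfl
    rw [this]
    exact (norm_mulOp_le _).trans (ContinuousMap.norm_comp_le_norm _ _)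

end Hyperbolic

/-! ### Solving a small Lipschitz perturbation of an invertible linear equation -/

section FixedPoint

variable {Z : Type*} [NormedAddCommGroup Z] [NormedSpace ℝ Z]

/-- A small Lipschitz perturbation of an invertible equation has a solution near `0`. -/
theorem exists_eq_add_of_hasBoundedInverse [CompleteSpace Z] {L : Z →L[ℝ] Z} {K η ρ : ℝ}
    (hL : HasBoundedInverse (1 - L) K) {N : Z → Z} (hρ : 0 ≤ ρ)
    (hN : ∀ V ∈ Metric.closedBall (0 : Z) ρ, ∀ W ∈ Metric.closedBall (0 : Z) ρ,
      ‖N V - N W‖ ≤ η * ‖V - W‖)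
    (hη : K * η ≤ 1 / 2) (h0 : K * ‖N 0‖ ≤ ρ / 2) :
    ∃ V ∈ Metric.closedBall (0 : Z) ρ, V = L V + N V := by
  obtain ⟨y, -, h2, h3⟩ := hL
  have hlip (V) (hV : V ∈ Metric.closedBall (0 : Z) ρ) (W) (hW : W ∈ Metric.closedBall (0 : Z) ρ) :
      ‖y (N V) - y (N W)‖ ≤ 1 / 2 * ‖V - W‖ := by
    rw [← map_sub]
    calc ‖y (N V - N W)‖ ≤ K * (η * ‖V - W‖) := y.le_of_opNorm_le_of_le h3 (hN V hV W hW)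
      _ = (K * η) * ‖V - W‖ := by ring
      _ ≤ _ := by gcongr
  have hmem0 : (0 : Z) ∈ Metric.closedBall (0 : Z) ρ := Metric.mem_closedBall_self hρ
  have hmaps : Set.MapsTo (fun V ↦ y (N V)) (Metric.closedBall (0 : Z) ρ)
      (Metric.closedBall (0 : Z) ρ) := by
    intro V hV
    have h4 := hlip V hV 0 hmem0
    rw [mem_closedBall_zero_iff] at hV ⊢
    rw [sub_zero] at h4
    have h5 : ‖y (N 0)‖ ≤ ρ / 2 := (y.le_of_opNorm_le h3 _).trans h0
    calc ‖y (N V)‖ = ‖(y (N V) - y (N 0)) + y (N 0)‖ := by rw [sub_add_cancel]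
      _ ≤ 1 / 2 * ‖V‖ + ρ / 2 := (norm_add_le _ _).trans (add_le_add h4 h5)
      _ ≤ ρ := by linarith
  have hc : ContractingWith (1 / 2) (hmaps.restrict _ _ _) := by
    refine ⟨by norm_num, LipschitzWith.of_dist_le_mul fun V W ↦ ?_⟩
    rw [Subtype.dist_eq, Subtype.dist_eq, dist_eq_norm, dist_eq_norm]
    have := hlip V V.2 W W.2
    simpa using this
  obtain ⟨V, hV, hfix, -⟩ := hc.exists_fixedPoint' Metric.isClosed_closedBall.isComplete hmaps hmem0
    (edist_ne_top _ _)
  refine ⟨V, hV, ?_⟩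
  have h6 : (1 - L) V = N V := by
    have h7 : (1 - L) (y (N V)) = N V := congrArg (fun T : Z →L[ℝ] Z ↦ T (N V)) h2
    rwa [show y (N V) = V from hfix] at h7
  have h8 : V - L V = N V := h6
  rw [← h8]
  abel

theorem norm_le_of_hasBoundedInverse {L : Z →L[ℝ] Z} {K : ℝ} (hL : HasBoundedInverse (1 - L) K)
    (V : Z) : ‖V‖ ≤ K * ‖V - L V‖ := by
  obtain ⟨y, h1, -, h3⟩ := hL
  have h4 : y (V - L V) = V := congrArg (fun T : Z →L[ℝ] Z ↦ T V) h1
  calc ‖V‖ = ‖y (V - L V)‖ := by rw [h4]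
    _ ≤ _ := y.le_of_opNorm_le h3 _

end FixedPoint

/-! ### Center systems and the first order estimate in a flow box -/

section CenterSystem

open Asymptotics Filter

variable {M : Type*} [TopologicalSpace M]
variable {E : Type*} [NormedAddCommGroup E] [NormedSpace ℝ E]

/-- A flow box at `q`: `b` is a transverse coordinate, constant along orbits, whose derivative at
`q` is `B`, and `h` is a time coordinate. -/
structure IsFlowBox (ι : M → E) (φ : ℝ → M → M) (T Pc : E →L[ℝ] E) (q : M) {k : ℕ}
    (U : Set M) (b : M → EuclideanSpace ℝ (Fin k)) (h : M → ℝ)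
    (B : E →L[ℝ] EuclideanSpace ℝ (Fin k)) : Prop where
  isOpen : IsOpen U
  mem : q ∈ U
  strict : (fun z : M × M ↦ b z.1 - b z.2 - B (ι z.1 - ι z.2)) =o[𝓝 (q, q)]
    fun z ↦ ι z.1 - ι z.2
  apply_eq_zero_iff : ∀ V, T V = V → (B V = 0 ↔ Pc V = V)
  surjective : ∀ w, ∃ V, T V = V ∧ B V = w
  continuousAt_transverse : ∀ z ∈ U, ContinuousAt b z
  continuousAt_time : ∀ z ∈ U, ContinuousAt h z
  injective : ∀ z ∈ U, ∀ z' ∈ U, b z = b z' → h z = h z' → z = z'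
  flow : ∀ z t, (∀ s ∈ Set.uIcc 0 t, φ s z ∈ U) → b (φ t z) = b z ∧ h (φ t z) = h z + t

/-- A homeomorphism with a hyperbolic splitting transverse to the orbits of a flow, on a space that
is embedded in a vector space. The tangent space at `x` is the fixed space of `Ps x + Pc x + Pu x`,
and `ex x` plays the role of the exponential map at `x`. -/
structure CenterSystem (M E : Type*) [TopologicalSpace M] [NormedAddCommGroup E]
    [NormedSpace ℝ E] where
  ι : M → E
  f : M ≃ₜ M
  φ : ℝ → M → M
  ex : M → E → M
  (Ps Pc Pu D D' : C(M, E →L[ℝ] E))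
  isEmbedding : Topology.IsEmbedding ι
  ss : ∀ x, Ps x * Ps x = Ps x
  cc : ∀ x, Pc x * Pc x = Pc x
  uu : ∀ x, Pu x * Pu x = Pu x
  sc : ∀ x, Ps x * Pc x = 0
  su : ∀ x, Ps x * Pu x = 0
  cs : ∀ x, Pc x * Ps x = 0
  cu : ∀ x, Pc x * Pu x = 0
  us : ∀ x, Pu x * Ps x = 0
  uc : ∀ x, Pu x * Pc x = 0
  Ds : ∀ x, Ps (f x) * D x = D x * Ps x
  Du : ∀ x, Pu (f x) * D x = D x * Pu x
  Du' : ∀ x, Pu x * D' x = D' x * Pu (f x)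
  DT : ∀ x, (Ps (f x) + Pc (f x) + Pu (f x)) * D x = D x
  DD : ∀ x, D' x * D x = Ps x + Pc x + Pu x
  DD' : ∀ x, D x * D' x = Ps (f x) + Pc (f x) + Pu (f x)
  ex_zero : ∀ x, ex x 0 = x
  ex_approx : ∀ η > 0, ∃ ρ > 0, ∀ x V W, (Ps x + Pc x + Pu x) V = V → (Ps x + Pc x + Pu x) W = W →
    ‖V‖ < ρ → ‖W‖ < ρ → ‖ι (ex x V) - ι (ex x W) - (V - W)‖ ≤ η * ‖V - W‖
  continuousOn_ex : ∃ ρ > 0, ContinuousOn (Function.uncurry ex) (Set.univ ×ˢ Metric.ball 0 ρ)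
  strict_f : ∀ p, (fun z : M × M ↦ ι (f z.1) - ι (f z.2) - D p (ι z.1 - ι z.2)) =o[𝓝 (p, p)]
    fun z ↦ ι z.1 - ι z.2
  flow_speed : ∃ K, ∀ t x, ‖ι (φ t x) - ι x‖ ≤ K * |t|
  exists_flowBox : ∀ q, ∃ (k : ℕ) (U : Set M) (b : M → EuclideanSpace ℝ (Fin k)) (h : M → ℝ)
    (B : E →L[ℝ] EuclideanSpace ℝ (Fin k)), IsFlowBox ι φ (Ps q + Pc q + Pu q) (Pc q) q U b h B

/-- To find a uniform radius it suffices to argue along ultrafilters. -/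
theorem exists_pos_of_ultrafilter {α : Type*} {K : ℝ → α → Prop} {C : α → Prop}
    (hK : ∀ r r' a, r ≤ r' → K r a → K r' a)
    (h : ∀ l : Ultrafilter α, (∀ r > 0, ∀ᶠ a in l, K r a) → ∀ᶠ a in l, C a) :
    ∃ r > 0, ∀ a, K r a → C a := by
  by_contra! hne
  obtain ⟨a₀, -, -⟩ := hne 1 one_pos
  have : Nonempty α := ⟨a₀⟩
  -- If no radius works, the sets of counterexamples of radius $r$ are nonempty and decrease with
  -- $r$. An ultrafilter finer than all of them contradicts `h`.
  have hb : (⨅ r : {r : ℝ // 0 < r}, 𝓟 {a | K r a ∧ ¬ C a}).NeBot := by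
    refine iInf_neBot_of_directed ?_ fun r ↦ ?_
    · intro r s
      refine ⟨⟨min r s, lt_min r.2 s.2⟩, ?_, ?_⟩
      · exact principal_mono.mpr fun a ha ↦ ⟨hK _ _ _ (min_le_left _ _) ha.1, ha.2⟩
      · exact principal_mono.mpr fun a ha ↦ ⟨hK _ _ _ (min_le_right _ _) ha.1, ha.2⟩
    · obtain ⟨a, h1, h2⟩ := hne r r.2
      exact principal_neBot_iff.mpr ⟨a, h1, h2⟩
  set l := Ultrafilter.of (⨅ r : {r : ℝ // 0 < r}, 𝓟 {a | K r a ∧ ¬ C a})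
  have hl (r : ℝ) (hr : 0 < r) : ∀ᶠ a in l, K r a ∧ ¬ C a :=
    (Ultrafilter.of_le _).trans (iInf_le _ ⟨r, hr⟩) (mem_principal_self _)
  obtain ⟨a, h1, h2⟩ := ((h l fun r hr ↦ (hl r hr).mono fun a ↦ And.left).and
    (hl 1 one_pos)).exists
  exact h2.2 h1

namespace CenterSystem

variable (S : CenterSystem M E)

/-- The projection onto the sum of the stable and unstable directions. -/
def P : C(M, E →L[ℝ] E) := S.Ps + S.Pu

/-- The projection onto the tangent space. -/
def T : C(M, E →L[ℝ] E) := S.Ps + S.Pc + S.Pu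

/-- The hyperbolic part of the derivative, as a map from the fibre over `x` to the one over `y`. -/
def a : C(M × M, E →L[ℝ] E) := pushTransport S.Ps S.D + pushTransport S.Pu S.D

theorem P_apply (x : M) : S.P x = S.Ps x + S.Pu x := rfl

theorem T_apply (x : M) : S.T x = S.Ps x + S.Pc x + S.Pu x := rfl

theorem P_mul_P (x : M) : S.P x * S.P x = S.P x := by
  simp only [P_apply, add_mul, mul_add, S.ss, S.su, S.us, S.uu, add_zero, zero_add]

theorem Pc_mul_P (x : M) : S.Pc x * S.P x = 0 := by
  simp only [P_apply, mul_add, S.cs, S.cu, add_zero]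

theorem T_mul_P (x : M) : S.T x * S.P x = S.P x := by
  simp only [P_apply, T_apply, add_mul, mul_add, S.ss, S.su, S.us, S.uu, S.cs, S.cu, add_zero,
    zero_add]

theorem T_mul_Pc (x : M) : S.T x * S.Pc x = S.Pc x := by
  simp only [T_apply, add_mul, S.sc, S.cc, S.uc, add_zero, zero_add]

theorem T_eq (x : M) : S.T x = S.P x + S.Pc x := by
  rw [T_apply, P_apply]; abel

theorem a_mul_P (x y : M) : S.a (x, y) * S.P x = S.a (x, y) := by
  change (S.Ps y * S.D x * S.Ps x + S.Pu y * S.D x * S.Pu x) * (S.Ps x + S.Pu x)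
    = S.Ps y * S.D x * S.Ps x + S.Pu y * S.D x * S.Pu x
  simp only [add_mul, mul_add, mul_assoc, S.ss, S.su, S.us, S.uu, mul_zero, add_zero, zero_add]

theorem a_graph (x : M) : S.a (x, S.f x) = S.P (S.f x) * S.D x := by
  change S.Ps (S.f x) * S.D x * S.Ps x + S.Pu (S.f x) * S.D x * S.Pu x
    = (S.Ps (S.f x) + S.Pu (S.f x)) * S.D x
  rw [add_mul, mul_assoc, ← S.Ds, ← mul_assoc, S.ss, mul_assoc, ← S.Du, ← mul_assoc, S.uu]

theorem T_of_P {x : M} {V : E} (h : S.P x V = V) : S.T x V = V := by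
  have := congrArg (fun A : E →L[ℝ] E ↦ A V) (S.T_mul_P x)
  change S.T x (S.P x V) = S.P x V at this
  rwa [h] at this

theorem P_P (x : M) (V : E) : S.P x (S.P x V) = S.P x V :=
  congrArg (fun A : E →L[ℝ] E ↦ A V) (S.P_mul_P x)

theorem a_P (x y : M) (V : E) : S.a (x, y) (S.P x V) = S.a (x, y) V :=
  congrArg (fun A : E →L[ℝ] E ↦ A V) (S.a_mul_P x y)

theorem continuous_ι : Continuous S.ι := S.isEmbedding.continuous

theorem exists_ball_of_eventually {q : M} {p : M → Prop} (h : ∀ᶠ z in 𝓝 q, p z) :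
    ∃ r > 0, ∀ z, ‖S.ι z - S.ι q‖ < r → p z := by
  rw [S.isEmbedding.isInducing.nhds_eq_comap, (Metric.nhds_basis_ball.comap S.ι).eventually_iff] at h
  obtain ⟨r, hr, h⟩ := h
  exact ⟨r, hr, fun z hz ↦ h (by simpa [dist_eq_norm] using hz)⟩

theorem tendsto_of_norm_sub {α : Type*} {l : Filter α} {z z' : α → M} {q : M}
    (hz : Tendsto z l (𝓝 q)) (h : Tendsto (fun a ↦ S.ι (z' a) - S.ι (z a)) l (𝓝 0)) :
    Tendsto z' l (𝓝 q) := by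
  rw [S.isEmbedding.tendsto_nhds_iff]
  have := h.add ((S.continuous_ι.tendsto q).comp hz)
  simpa [Function.comp_def] using this

theorem tendsto_ex {α : Type*} {l : Filter α} {x : α → M} {V : α → E} {q : M}
    (hx : Tendsto x l (𝓝 q)) (hV : Tendsto V l (𝓝 0)) :
    Tendsto (fun a ↦ S.ex (x a) (V a)) l (𝓝 q) := by
  obtain ⟨ρ, hρ, h⟩ := S.continuousOn_ex
  have h1 : ContinuousAt (Function.uncurry S.ex) (q, 0) :=
    h.continuousAt (prod_mem_nhds univ_mem (Metric.ball_mem_nhds 0 hρ))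
  have h2 := h1.tendsto.comp (hx.prodMk_nhds hV)
  rwa [Function.uncurry_apply_pair, S.ex_zero] at h2

theorem ex_sub_isLittleO {α : Type*} {l : Filter α} {x : α → M} {V W : α → E}
    (hV : Tendsto V l (𝓝 0)) (hW : Tendsto W l (𝓝 0))
    (hTV : ∀ᶠ a in l, S.T (x a) (V a) = V a) (hTW : ∀ᶠ a in l, S.T (x a) (W a) = W a) :
    (fun a ↦ S.ι (S.ex (x a) (V a)) - S.ι (S.ex (x a) (W a)) - (V a - W a))
      =o[l] fun a ↦ V a - W a := by
  refine IsLittleO.of_bound fun η hη ↦ ?_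
  obtain ⟨ρ, hρ, h⟩ := S.ex_approx η hη
  filter_upwards [hTV, hTW, hV.eventually (Metric.ball_mem_nhds 0 hρ),
    hW.eventually (Metric.ball_mem_nhds 0 hρ)] with a h1 h2 h3 h4
  exact h _ _ _ h1 h2 (by simpa using h3) (by simpa using h4)

theorem ex_sub_isBigO {α : Type*} {l : Filter α} {x : α → M} {V W : α → E}
    (hV : Tendsto V l (𝓝 0)) (hW : Tendsto W l (𝓝 0))
    (hTV : ∀ᶠ a in l, S.T (x a) (V a) = V a) (hTW : ∀ᶠ a in l, S.T (x a) (W a) = W a) :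
    (fun a ↦ S.ι (S.ex (x a) (V a)) - S.ι (S.ex (x a) (W a))) =O[l] fun a ↦ V a - W a := by
  have := (S.ex_sub_isLittleO hV hW hTV hTW).isBigO.add (isBigO_refl (fun a ↦ V a - W a) l)
  simpa using this

section Box

variable {S} {q : M} {k : ℕ} {U : Set M} {b : M → EuclideanSpace ℝ (Fin k)} {h : M → ℝ}
  {B : E →L[ℝ] EuclideanSpace ℝ (Fin k)}

/-- The derivative `B` of the transverse coordinate kills the center direction, so it sees only the
hyperbolic component of a tangent vector. -/
theorem box_apply_P (hB : IsFlowBox S.ι S.φ (S.T q) (S.Pc q) q U b h B) {V : E}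
    (hV : S.T q V = V) : B (S.P q V) = B V := by
  have h1 : B (S.Pc q V) = 0 := by
    refine (hB.apply_eq_zero_iff _ ?_).mpr ?_
    · exact congrArg (fun A : E →L[ℝ] E ↦ A V) (S.T_mul_Pc q)
    · exact congrArg (fun A : E →L[ℝ] E ↦ A V) (S.cc q)
  have h2 : V = S.P q V + S.Pc q V := by
    conv_lhs => rw [← hV, S.T_eq]
    rfl
  conv_rhs => rw [h2, map_add, h1, add_zero]

/-- The speed bound keeps short orbit segments that start near `q` in a closed ball contained in
`U`. That this set is closed matters for passing to limits of orbit points. -/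
theorem box_flow (hB : IsFlowBox S.ι S.φ (S.T q) (S.Pc q) q U b h B) :
    ∃ F ⊆ U, IsClosed F ∧ ∃ r > 0, ∀ z t, ‖S.ι z - S.ι q‖ < r → |t| < r →
      S.φ t z ∈ F ∧ b (S.φ t z) = b z ∧ h (S.φ t z) = h z + t := by
  obtain ⟨R, hR, hU⟩ := S.exists_ball_of_eventually (hB.isOpen.mem_nhds hB.mem)
  obtain ⟨K, hK⟩ := S.flow_speed
  set r := R / 2 with hr_def
  have hr : 0 < r := by positivity
  have hFU (z) (hz : ‖S.ι z - S.ι q‖ ≤ r) : z ∈ U := hU _ (hz.trans_lt (by linarith))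
  set s := min (r / 2) (r / (2 * (|K| + 1))) with hs
  have hs0 : 0 < s := by positivity
  have hmem (z t) (hz : ‖S.ι z - S.ι q‖ < s) (ht : |t| < s) : ‖S.ι (S.φ t z) - S.ι q‖ ≤ r := by
    have h1 : K * |t| ≤ r / 2 := by
      have h2 : |t| ≤ r / (2 * (|K| + 1)) := ht.le.trans (min_le_right _ _)
      rw [le_div_iff₀ (by positivity)] at h2
      have h3 : K * |t| ≤ |K| * |t| := mul_le_mul_of_nonneg_right (le_abs_self K) (abs_nonneg t)
      nlinarith [abs_nonneg t]
    calc ‖S.ι (S.φ t z) - S.ι q‖ ≤ ‖S.ι (S.φ t z) - S.ι z‖ + ‖S.ι z - S.ι q‖ :=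
          norm_sub_le_norm_sub_add_norm_sub _ _ _
      _ ≤ K * |t| + ‖S.ι z - S.ι q‖ := by gcongr; exact hK t z
      _ ≤ r / 2 + r / 2 := add_le_add h1 (hz.trans_le (min_le_left _ _)).le
      _ = r := by ring
  refine ⟨{z | ‖S.ι z - S.ι q‖ ≤ r}, hFU, ?_, s, hs0, fun z t hz ht ↦ ⟨hmem z t hz ht,
    hB.flow z t fun t' ht' ↦ hFU _ (hmem z t' hz ?_)⟩⟩
  · exact isClosed_le (S.continuous_ι.sub continuous_const).norm continuous_const
  · refine lt_of_le_of_lt ?_ ht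
    have := Set.abs_sub_left_of_mem_uIcc ht'
    simpa using this

theorem box_eventually_flow (hB : IsFlowBox S.ι S.φ (S.T q) (S.Pc q) q U b h B) {α : Type*}
    {l : Filter α} {z : α → M} {t : α → ℝ} (hz : Tendsto z l (𝓝 q)) (ht : Tendsto t l (𝓝 0)) :
    ∀ᶠ a in l, S.φ (t a) (z a) ∈ U ∧ b (S.φ (t a) (z a)) = b (z a) ∧
      h (S.φ (t a) (z a)) = h (z a) + t a := by
  obtain ⟨F, hFU, -, r, hr, H⟩ := box_flow hB
  have h1 : Tendsto (fun a ↦ S.ι (z a)) l (𝓝 (S.ι q)) := (S.continuous_ι.tendsto q).comp hz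
  filter_upwards [h1.eventually (Metric.ball_mem_nhds _ hr),
    ht.eventually (Metric.ball_mem_nhds _ hr)] with a h2 h3
  have h4 := H _ _ (by simpa [dist_eq_norm] using h2) (by simpa using h3 : |t a| < r)
  exact ⟨hFU h4.1, h4.2⟩

theorem box_ex_isLittleO (hB : IsFlowBox S.ι S.φ (S.T q) (S.Pc q) q U b h B) {α : Type*}
    {l : Filter α} {y : α → M} {V W : α → E} (hy : Tendsto y l (𝓝 q))
    (hV : Tendsto V l (𝓝 0)) (hW : Tendsto W l (𝓝 0))
    (hTV : ∀ᶠ a in l, S.T (y a) (V a) = V a) (hTW : ∀ᶠ a in l, S.T (y a) (W a) = W a) :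
    (fun a ↦ b (S.ex (y a) (V a)) - b (S.ex (y a) (W a)) - B (V a - W a))
      =o[l] fun a ↦ V a - W a := by
  have h1 := (hB.strict.comp_tendsto
    ((S.tendsto_ex hy hV).prodMk_nhds (S.tendsto_ex hy hW))).trans_isBigO
      (S.ex_sub_isBigO hV hW hTV hTW)
  have h2 := (B.isBigO_comp _ l).trans_isLittleO (S.ex_sub_isLittleO hV hW hTV hTW)
  refine (h1.add h2).congr_left fun a ↦ ?_
  simp only [Function.comp, map_sub]
  abel

variable [FiniteDimensional ℝ E]

/-- On tangent vectors the kernel of `B` is the center direction, which meets the range of the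
hyperbolic projection only in zero. In finite dimension injectivity gives a lower bound. -/
theorem box_injective (hB : IsFlowBox S.ι S.φ (S.T q) (S.Pc q) q U b h B) :
    ∃ c > 0, ∀ V, S.P q V = V → ‖V‖ ≤ c * ‖B V‖ := by
  set X := LinearMap.range (S.P q : E →ₗ[ℝ] E)
  have hX (V : X) : S.P q V = V := by
    obtain ⟨V, W, rfl⟩ := V
    exact S.P_P q W
  have hker : LinearMap.ker (B.toLinearMap ∘ₗ X.subtype) = ⊥ := by
    refine LinearMap.ker_eq_bot'.mpr fun V hV ↦ ?_
    have h1 := (hB.apply_eq_zero_iff V (S.T_of_P (hX V))).mp hV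
    have h2 : S.Pc q (S.P q V) = 0 := congrArg (fun A : E →L[ℝ] E ↦ A V) (S.Pc_mul_P q)
    rw [hX, h1] at h2
    exact Subtype.ext h2
  obtain ⟨K, hK, hA⟩ := LinearMap.exists_antilipschitzWith _ hker
  refine ⟨K, hK, fun V hV ↦ ?_⟩
  have := hA.le_mul_norm (map_zero _) ⟨V, V, hV⟩
  exact this

/-- The basic estimate: two pairs of points on common orbit segments are related by the hyperbolic
part of the derivative, up to a small error. -/
theorem box_transition_isLittleO {p : M}
    (hB : IsFlowBox S.ι S.φ (S.T (S.f p)) (S.Pc (S.f p)) (S.f p) U b h B) {α : Type*}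
    {l : Filter α} {x y : α → M} {V₁ V₂ W₁ W₂ : α → E} {t₁ t₂ : α → ℝ}
    (hx : Tendsto x l (𝓝 p)) (hy : Tendsto y l (𝓝 (S.f p)))
    (hV₁ : Tendsto V₁ l (𝓝 0)) (hV₂ : Tendsto V₂ l (𝓝 0))
    (hW₁ : Tendsto W₁ l (𝓝 0)) (hW₂ : Tendsto W₂ l (𝓝 0))
    (ht₁ : Tendsto t₁ l (𝓝 0)) (ht₂ : Tendsto t₂ l (𝓝 0))
    (hPV₁ : ∀ᶠ a in l, S.P (x a) (V₁ a) = V₁ a) (hPV₂ : ∀ᶠ a in l, S.P (x a) (V₂ a) = V₂ a)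
    (hPW₁ : ∀ᶠ a in l, S.P (y a) (W₁ a) = W₁ a) (hPW₂ : ∀ᶠ a in l, S.P (y a) (W₂ a) = W₂ a)
    (h₁ : ∀ᶠ a in l, S.ex (y a) (W₁ a) = S.φ (t₁ a) (S.f (S.ex (x a) (V₁ a))))
    (h₂ : ∀ᶠ a in l, S.ex (y a) (W₂ a) = S.φ (t₂ a) (S.f (S.ex (x a) (V₂ a)))) :
    (fun a ↦ W₁ a - W₂ a - S.a (x a, y a) (V₁ a - V₂ a)) =o[l]
      fun a ↦ ‖V₁ a - V₂ a‖ + ‖W₁ a - W₂ a‖ := by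
  set q := S.f p
  have hTV₁ := hPV₁.mono fun a ↦ S.T_of_P
  have hTV₂ := hPV₂.mono fun a ↦ S.T_of_P
  have hTW₁ := hPW₁.mono fun a ↦ S.T_of_P
  have hTW₂ := hPW₂.mono fun a ↦ S.T_of_P
  set s : α → ℝ := fun a ↦ ‖V₁ a - V₂ a‖ + ‖W₁ a - W₂ a‖
  have oV : (fun a ↦ V₁ a - V₂ a) =O[l] s := by
    refine IsBigO.of_bound 1 (Eventually.of_forall fun a ↦ ?_)
    rw [one_mul, Real.norm_of_nonneg (by positivity)]
    exact le_add_of_nonneg_right (norm_nonneg _)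
  have oW : (fun a ↦ W₁ a - W₂ a) =O[l] s := by
    refine IsBigO.of_bound 1 (Eventually.of_forall fun a ↦ ?_)
    rw [one_mul, Real.norm_of_nonneg (by positivity)]
    exact le_add_of_nonneg_left (norm_nonneg _)
  have z₁ := S.tendsto_ex hx hV₁
  have z₂ := S.tendsto_ex hx hV₂
  have w₁ := (S.f.continuous.tendsto p).comp z₁
  have w₂ := (S.f.continuous.tendsto p).comp z₂
  have e1 := (S.ex_sub_isLittleO hV₁ hV₂ hTV₁ hTV₂)
  have e1' := (S.ex_sub_isBigO hV₁ hV₂ hTV₁ hTV₂)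
  have e2 := ((S.strict_f p).comp_tendsto (z₁.prodMk_nhds z₂)).trans_isBigO e1'
  have e2' := e2.add (((S.D p).isBigO_comp _ l).trans_isLittleO e1)
  have e2'' : (fun a ↦ S.ι (S.f (S.ex (x a) (V₁ a))) - S.ι (S.f (S.ex (x a) (V₂ a)))
      - S.D p (V₁ a - V₂ a)) =o[l] fun a ↦ V₁ a - V₂ a := by
    refine e2'.congr_left fun a ↦ ?_
    simp only [Function.comp, map_sub]
    abel
  have e3' : (fun a ↦ S.ι (S.f (S.ex (x a) (V₁ a))) - S.ι (S.f (S.ex (x a) (V₂ a))))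
      =O[l] fun a ↦ V₁ a - V₂ a := by
    have := e2''.isBigO.add ((S.D p).isBigO_comp (fun a ↦ V₁ a - V₂ a) l)
    simpa using this
  have e3 := (hB.strict.comp_tendsto (w₁.prodMk_nhds w₂)).trans_isBigO e3'
  have e4 := (e3.add ((B.isBigO_comp _ l).trans_isLittleO e2'')).trans_isBigO oV
  have e5 := (box_ex_isLittleO hB hy hW₁ hW₂ hTW₁ hTW₂).trans_isBigO oW
  have hb₁ := box_eventually_flow hB w₁ ht₁
  have hb₂ := box_eventually_flow hB w₂ ht₂
  -- The points on the section at `y` and the images under `f` have the same transverse coordinate,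
  -- because they lie on common short orbit segments. Comparing the two expansions of its difference
  -- eliminates the unknown times.
  have e6 : (fun a ↦ B (W₁ a - W₂ a) - B (S.D p (V₁ a - V₂ a))) =o[l] s := by
    refine (e4.sub e5).congr' ?_ EventuallyEq.rfl
    filter_upwards [hb₁, hb₂, h₁, h₂] with a g₁ g₂ g₃ g₄
    simp only [Function.comp] at g₁ g₂
    rw [g₃, g₄, g₁.2.1, g₂.2.1]
    simp only [Function.comp, map_sub]
    abel
  have c1 : Tendsto (fun a ↦ S.P (y a) - S.P q) l (𝓝 0) := by
    have := ((S.P.continuous.tendsto q).comp hy).sub_const (S.P q)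
    simpa using this
  have c2 : Tendsto (fun a ↦ S.a (x a, y a) - S.P q * S.D p) l (𝓝 0) := by
    have := ((S.a.continuous.tendsto (p, q)).comp (hx.prodMk_nhds hy)).sub_const (S.P q * S.D p)
    simpa [q, a_graph] using this
  have mulo {A : α → E →L[ℝ] E} (hA : Tendsto A l (𝓝 0)) {u : α → E} (hu : u =O[l] s) :
      (fun a ↦ A a (u a)) =o[l] s := by
    have h1 : (fun a ↦ A a (u a)) =O[l] fun a ↦ ‖A a‖ * ‖u a‖ :=
      IsBigO.of_bound 1 (Eventually.of_forall fun a ↦ by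
        rw [one_mul, norm_mul, norm_norm, norm_norm]; exact (A a).le_opNorm _)
    have h2 : (fun a ↦ ‖A a‖) =o[l] fun _ ↦ (1 : ℝ) := (isLittleO_one_iff ℝ).mpr (by simpa using hA.norm)
    have h3 := h2.mul_isBigO hu.norm_left
    simp only [one_mul] at h3
    exact h1.trans_isLittleO h3
  have e7 : (fun a ↦ W₁ a - W₂ a - S.P q (W₁ a - W₂ a)) =o[l] s := by
    refine (mulo c1 oW).congr' ?_ EventuallyEq.rfl
    filter_upwards [hPW₁, hPW₂] with a g₁ g₂
    rw [sub_apply, map_sub (S.P (y a)), g₁, g₂]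
  obtain ⟨c, hc, hinj⟩ := box_injective hB
  -- `B` does not distinguish a tangent vector from its hyperbolic part, so `e6` controls the
  -- hyperbolic difference after applying `B`. The lower bound for `B` on the hyperbolic space then
  -- removes it.
  have e8 : (fun a ↦ S.P q (W₁ a - W₂ a) - S.P q (S.D p (V₁ a - V₂ a))) =o[l] s := by
    have h1 : (fun a ↦ B (S.P q (W₁ a - W₂ a) - S.P q (S.D p (V₁ a - V₂ a)))) =o[l] s := by
      refine (e6.sub ((B.isBigO_comp _ l).trans_isLittleO e7)).congr_left fun a ↦ ?_
      have : S.T q (S.D p (V₁ a - V₂ a)) = S.D p (V₁ a - V₂ a) :=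
        congrArg (fun A : E →L[ℝ] E ↦ A (V₁ a - V₂ a)) (S.DT p)
      rw [map_sub B (S.P q _), box_apply_P hB this, map_sub B (W₁ a - W₂ a)]
      abel
    refine IsBigO.trans_isLittleO (IsBigO.of_bound c (Eventually.of_forall fun a ↦ ?_)) h1
    refine hinj _ ?_
    rw [← map_sub, S.P_P]
  refine ((e7.add e8).sub (mulo c2 oV)).congr_left fun a ↦ ?_
  rw [sub_apply]
  change _ - (_ - S.P q (S.D p (V₁ a - V₂ a))) = _
  abel

end Box

end CenterSystem

end CenterSystem

/-! ### Uniform local estimates from compactness -/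

namespace CenterSystem

open Asymptotics Filter

variable {M : Type*} [TopologicalSpace M] [CompactSpace M]
variable {E : Type*} [NormedAddCommGroup E] [NormedSpace ℝ E] (S : CenterSystem M E)

theorem t2Space {M E : Type*} [TopologicalSpace M] [NormedAddCommGroup E] [NormedSpace ℝ E]
    (S : CenterSystem M E) : T2Space M := S.isEmbedding.t2Space

theorem exists_le_nhds {α : Type*} (l : Ultrafilter α) (z : α → M) : ∃ q, Tendsto z l (𝓝 q) := by
  obtain ⟨q, -, hq⟩ := isCompact_univ.ultrafilter_le_nhds (l.map z) (by simp)
  exact ⟨q, hq⟩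

theorem tendsto_zero_of_forall_lt {α F : Type*} [NormedAddCommGroup F] {l : Filter α} {V : α → F}
    (h : ∀ r > 0, ∀ᶠ a in l, ‖V a‖ < r) : Tendsto V l (𝓝 0) := by
  refine Metric.tendsto_nhds.mpr fun r hr ↦ ?_
  simpa using h r hr

theorem _root_.Filter.Tendsto.apply_clm {α E F : Type*} [NormedAddCommGroup E] [NormedSpace ℝ E]
    [NormedAddCommGroup F] [NormedSpace ℝ F] {l : Filter α} {A : α → E →L[ℝ] F} {V : α → E}
    {A₀ : E →L[ℝ] F} {V₀ : E} (hA : Tendsto A l (𝓝 A₀)) (hV : Tendsto V l (𝓝 V₀)) :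
    Tendsto (fun a ↦ A a (V a)) l (𝓝 (A₀ V₀)) :=
  (isBoundedBilinearMap_apply.continuous.tendsto (A₀, V₀)).comp (hA.prodMk_nhds hV)

/-- The generating field is only continuous, so continuity of the flow has to come from the flow
boxes. A limit of orbit points has transverse coordinate $b(z)$ and time coordinate $h(z)+t$, and
these two numbers determine it. -/
theorem exists_continuousOn_flow :
    ∃ r > 0, ∀ z t, |t| < r → ContinuousAt (fun p : M × ℝ ↦ S.φ p.2 p.1) (z, t) := by
  have := S.t2Space
  obtain ⟨r, hr, H⟩ := exists_pos_of_ultrafilter (α := M × ℝ) (K := fun r a ↦ |a.2| < r)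
    (C := fun a ↦ ContinuousAt (fun p : M × ℝ ↦ S.φ p.2 p.1) a)
    (fun r r' a hr h ↦ lt_of_lt_of_le h hr) (fun l hl ↦ by
      obtain ⟨q, hq⟩ := exists_le_nhds l Prod.fst
      obtain ⟨k, U, b, h, B, hB⟩ := S.exists_flowBox q
      obtain ⟨F, hFU, hF, r, hr, H⟩ := box_flow (S := S) hB
      have h1 : Tendsto (fun a : M × ℝ ↦ S.ι a.1) l (𝓝 (S.ι q)) :=
        (S.continuous_ι.tendsto q).comp hq
      have hq' : {z | ‖S.ι z - S.ι q‖ < r} ∈ 𝓝 q := by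
        refine (isOpen_lt (S.continuous_ι.sub continuous_const).norm continuous_const).mem_nhds ?_
        simpa using hr
      have hqU := hB.isOpen.mem_nhds hB.mem
      filter_upwards [hq hq', hl r hr, hq hqU] with ⟨z, t⟩ hz ht hzU
      have hn : ∀ᶠ p : M × ℝ in 𝓝 (z, t), ‖S.ι p.1 - S.ι q‖ < r ∧ |p.2| < r := by
        refine IsOpen.mem_nhds ?_ ⟨hz, ht⟩
        exact (isOpen_lt ((S.continuous_ι.comp continuous_fst).sub continuous_const).norm
          continuous_const).inter (isOpen_lt continuous_snd.abs continuous_const)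
      refine (tendsto_iff_ultrafilter _ _ _).mpr fun g hg ↦ ?_
      obtain ⟨w, hw⟩ := exists_le_nhds g (fun p : M × ℝ ↦ S.φ p.2 p.1)
      have hev := hg hn
      have hwF : w ∈ F := hF.mem_of_tendsto hw (by
        filter_upwards [hev] with p hp using (H _ _ hp.1 hp.2).1)
      have hg1 : Tendsto Prod.fst (g : Filter (M × ℝ)) (𝓝 z) :=
        (continuous_fst.tendsto (z, t)).mono_left hg
      have hg2 : Tendsto Prod.snd (g : Filter (M × ℝ)) (𝓝 t) :=
        (continuous_snd.tendsto (z, t)).mono_left hg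
      have hb : b w = b z := by
        refine tendsto_nhds_unique ((hB.continuousAt_transverse w (hFU hwF)).tendsto.comp hw) ?_
        refine ((hB.continuousAt_transverse z hzU).tendsto.comp hg1).congr' ?_
        filter_upwards [hev] with p hp using (H _ _ hp.1 hp.2).2.1.symm
      have hh : h w = h z + t := by
        refine tendsto_nhds_unique ((hB.continuousAt_time w (hFU hwF)).tendsto.comp hw) ?_
        refine (((hB.continuousAt_time z hzU).tendsto.comp hg1).add hg2).congr' ?_
        filter_upwards [hev] with p hp using (H _ _ hp.1 hp.2).2.2.symm
      obtain ⟨g1, g2, g3⟩ := H z t hz ht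
      have : w = S.φ t z :=
        hB.injective _ (hFU hwF) _ (hFU g1) (hb.trans g2.symm) (hh.trans g3.symm)
      rw [this] at hw
      exact hw)
  exact ⟨r, hr, fun z t ht ↦ H (z, t) ht⟩

/-- In a flow box the time coordinate advances at unit speed, so short orbit segments do not return
to a point. -/
theorem exists_flow_injective :
    ∃ r > 0, ∀ z t s, |t| < r → |s| < r → S.φ t z = S.φ s z → t = s := by
  obtain ⟨r, hr, H⟩ := exists_pos_of_ultrafilter (α := M × ℝ × ℝ)
    (K := fun r a ↦ |a.2.1| < r ∧ |a.2.2| < r)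
    (C := fun a ↦ S.φ a.2.1 a.1 = S.φ a.2.2 a.1 → a.2.1 = a.2.2)
    (fun r r' a hr h ↦ ⟨h.1.trans_le hr, h.2.trans_le hr⟩) (fun l hl ↦ by
      obtain ⟨q, hq⟩ := exists_le_nhds l Prod.fst
      obtain ⟨k, U, b, h, B, hB⟩ := S.exists_flowBox q
      have h1 := box_eventually_flow (S := S) hB hq
        (tendsto_zero_of_forall_lt (V := fun a : M × ℝ × ℝ ↦ a.2.1)
          fun r hr ↦ (hl r hr).mono fun a h ↦ h.1)
      have h2 := box_eventually_flow (S := S) hB hq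
        (tendsto_zero_of_forall_lt (V := fun a : M × ℝ × ℝ ↦ a.2.2)
          fun r hr ↦ (hl r hr).mono fun a h ↦ h.2)
      filter_upwards [h1, h2] with a g1 g2 heq
      have := g1.2.2
      rw [heq, g2.2.2] at this
      linarith)
  exact ⟨r, hr, fun z t s ht hs ↦ H (z, t, s) ⟨ht, hs⟩⟩

/-- Small vectors stay in a compact ball. Any limit $W$ of $V$ at $x$ satisfies $\mathrm{ex}_x
W=\mathrm{ex}_x V(x)$, and the first order approximation with constant $1/2$ makes $\mathrm{ex}_x$
injective on small tangent vectors. -/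
theorem exists_continuous_of_continuous_ex :
    ∃ r > 0, ∀ V : M → E, (∀ x, S.P x (V x) = V x) → (∀ x, ‖V x‖ < r) →
      Continuous (fun x ↦ S.ex x (V x)) → ∀ [FiniteDimensional ℝ E], Continuous V := by
  obtain ⟨ρ, hρ, h⟩ := S.continuousOn_ex
  obtain ⟨ρ', hρ', h'⟩ := S.ex_approx (1 / 2) (by norm_num)
  have := S.t2Space
  set r := min ρ ρ' / 2 with hr_def
  have hr : 0 < r := by positivity
  have hr1 : r < ρ := by have := min_le_left ρ ρ'; have : 0 < min ρ ρ' := by positivity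
                         linarith
  have hr2 : r < ρ' := by have := min_le_right ρ ρ'; have : 0 < min ρ ρ' := by positivity
                          linarith
  refine ⟨r, hr, fun V hP hV hc _ ↦ ?_⟩
  have := FiniteDimensional.proper_real E
  refine continuous_iff_continuousAt.mpr fun x ↦ (tendsto_iff_ultrafilter _ _ _).mpr fun g hg ↦ ?_
  obtain ⟨W, hWr, hW⟩ := (isCompact_closedBall (0 : E) r).ultrafilter_le_nhds (g.map V)
    (by
      rw [le_principal_iff]
      exact Filter.mem_map.mpr (univ_mem' fun y ↦ by simpa using (hV y).le))
  have hW : Tendsto V g (𝓝 W) := hW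
  have hWr : ‖W‖ ≤ r := by simpa using hWr
  have hg' : Tendsto id (g : Filter M) (𝓝 x) := hg
  have hPW : S.P x W = W := by
    refine tendsto_nhds_unique ?_ hW
    refine (((S.P.continuous.tendsto x).comp hg').apply_clm hW).congr fun y ↦ ?_
    exact hP y
  have he : S.ex x W = S.ex x (V x) := by
    have h1 : ContinuousAt (Function.uncurry S.ex) (x, W) := h.continuousAt
      (prod_mem_nhds univ_mem (Metric.isOpen_ball.mem_nhds (by simpa using hWr.trans_lt hr1)))
    exact tendsto_nhds_unique (h1.tendsto.comp (hg'.prodMk_nhds hW)) ((hc.tendsto x).comp hg')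
  have h2 := h' x W (V x) (S.T_of_P hPW) (S.T_of_P (hP x)) (hWr.trans_lt hr2) ((hV x).trans hr2)
  rw [he, sub_self, zero_sub, norm_neg] at h2
  have : W = V x := by
    rw [← sub_eq_zero, ← norm_eq_zero]
    linarith [norm_nonneg (W - V x)]
  rwa [this] at hW

theorem exists_f_ex_near (r : ℝ) (hr : 0 < r) :
    ∃ ρ > 0, ∀ x V, ‖V‖ < ρ → ‖S.ι (S.f (S.ex x V)) - S.ι (S.f x)‖ < r := by
  obtain ⟨ρ, hρ, H⟩ := exists_pos_of_ultrafilter (α := M × E) (K := fun r a ↦ ‖a.2‖ < r)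
    (C := fun a ↦ ‖S.ι (S.f (S.ex a.1 a.2)) - S.ι (S.f a.1)‖ < r)
    (fun r r' a hr h ↦ lt_of_lt_of_le h hr) (fun l hl ↦ by
      obtain ⟨q, hq⟩ := exists_le_nhds l Prod.fst
      have hV : Tendsto (fun a : M × E ↦ a.2) l (𝓝 0) := tendsto_zero_of_forall_lt hl
      have hf := S.continuous_ι.comp S.f.continuous
      have h1 := (((hf.tendsto q).comp (S.tendsto_ex hq hV)).sub ((hf.tendsto q).comp hq)).norm
      rw [sub_self, norm_zero] at h1
      exact h1.eventually (gt_mem_nhds hr))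
  exact ⟨ρ, hρ, fun x V ↦ H (x, V)⟩

/-- `W` and `t` connect the point `z` to the hyperbolic section of the exponential map at `y`. -/
def Solves (r : ℝ) (y z : M) (W : E) (t : ℝ) : Prop :=
  S.P y W = W ∧ ‖W‖ < r ∧ |t| < r ∧ S.ex y W = S.φ t z

variable {S} in
theorem Solves.mono {r r' : ℝ} (hr : r ≤ r') {y z : M} {W : E} {t : ℝ} (h : S.Solves r y z W t) :
    S.Solves r' y z W t :=
  ⟨h.1, h.2.1.trans_le hr, h.2.2.1.trans_le hr, h.2.2.2⟩

variable [FiniteDimensional ℝ E]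

/-- Along an ultrafilter with radii tending to zero the base points converge to some $p$ and $f(p)$,
and all vectors and times tend to zero. The estimate in one flow box then applies. -/
theorem exists_transition_le_add (η : ℝ) (hη : 0 < η) :
    ∃ r > 0, ∀ x y V₁ V₂ W₁ W₂ t₁ t₂, ‖S.ι y - S.ι (S.f x)‖ < r →
      S.P x V₁ = V₁ → S.P x V₂ = V₂ → ‖V₁‖ < r → ‖V₂‖ < r →
      S.Solves r y (S.f (S.ex x V₁)) W₁ t₁ → S.Solves r y (S.f (S.ex x V₂)) W₂ t₂ →
      ‖W₁ - W₂ - S.a (x, y) (V₁ - V₂)‖ ≤ η * (‖V₁ - V₂‖ + ‖W₁ - W₂‖) := by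
  obtain ⟨r, hr, H⟩ := exists_pos_of_ultrafilter (α := (M × M) × (E × E) × (E × E) × (ℝ × ℝ))
    (K := fun r a ↦ ‖S.ι a.1.2 - S.ι (S.f a.1.1)‖ < r ∧
      (S.P a.1.1 a.2.1.1 = a.2.1.1 ∧ S.P a.1.1 a.2.1.2 = a.2.1.2) ∧
      (‖a.2.1.1‖ < r ∧ ‖a.2.1.2‖ < r) ∧
      S.Solves r a.1.2 (S.f (S.ex a.1.1 a.2.1.1)) a.2.2.1.1 a.2.2.2.1 ∧
      S.Solves r a.1.2 (S.f (S.ex a.1.1 a.2.1.2)) a.2.2.1.2 a.2.2.2.2)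
    (C := fun a ↦ ‖a.2.2.1.1 - a.2.2.1.2 - S.a (a.1.1, a.1.2) (a.2.1.1 - a.2.1.2)‖
      ≤ η * (‖a.2.1.1 - a.2.1.2‖ + ‖a.2.2.1.1 - a.2.2.1.2‖))
    (fun r r' a hr h ↦ ⟨h.1.trans_le hr, h.2.1, ⟨h.2.2.1.1.trans_le hr, h.2.2.1.2.trans_le hr⟩,
      h.2.2.2.1.mono hr, h.2.2.2.2.mono hr⟩) (fun l hl ↦ by
      obtain ⟨p, hp⟩ := exists_le_nhds l (fun a ↦ a.1.1)
      have hy : Tendsto (fun a : (M × M) × (E × E) × (E × E) × (ℝ × ℝ) ↦ a.1.2) l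
          (𝓝 (S.f p)) := by
        refine S.tendsto_of_norm_sub ((S.f.continuous.tendsto p).comp hp) ?_
        exact tendsto_zero_of_forall_lt fun r hr ↦ (hl r hr).mono fun a h ↦ h.1
      obtain ⟨k, U, b, h, B, hB⟩ := S.exists_flowBox (S.f p)
      have := box_transition_isLittleO (S := S) hB hp hy
        (V₁ := fun a ↦ a.2.1.1) (V₂ := fun a ↦ a.2.1.2) (W₁ := fun a ↦ a.2.2.1.1)
        (W₂ := fun a ↦ a.2.2.1.2) (t₁ := fun a ↦ a.2.2.2.1) (t₂ := fun a ↦ a.2.2.2.2)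
        (tendsto_zero_of_forall_lt fun r hr ↦ (hl r hr).mono fun a h ↦ h.2.2.1.1)
        (tendsto_zero_of_forall_lt fun r hr ↦ (hl r hr).mono fun a h ↦ h.2.2.1.2)
        (tendsto_zero_of_forall_lt fun r hr ↦ (hl r hr).mono fun a h ↦ h.2.2.2.1.2.1)
        (tendsto_zero_of_forall_lt fun r hr ↦ (hl r hr).mono fun a h ↦ h.2.2.2.2.2.1)
        (tendsto_zero_of_forall_lt fun r hr ↦ (hl r hr).mono fun a h ↦ h.2.2.2.1.2.2.1)
        (tendsto_zero_of_forall_lt fun r hr ↦ (hl r hr).mono fun a h ↦ h.2.2.2.2.2.2.1)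
        ((hl 1 one_pos).mono fun a h ↦ h.2.1.1) ((hl 1 one_pos).mono fun a h ↦ h.2.1.2)
        ((hl 1 one_pos).mono fun a h ↦ h.2.2.2.1.1) ((hl 1 one_pos).mono fun a h ↦ h.2.2.2.2.1)
        ((hl 1 one_pos).mono fun a h ↦ h.2.2.2.1.2.2.2)
        ((hl 1 one_pos).mono fun a h ↦ h.2.2.2.2.2.2.2)
      filter_upwards [this.bound hη] with a ha
      rwa [Real.norm_of_nonneg (by positivity)] at ha)
  exact ⟨r, hr, fun x y V₁ V₂ W₁ W₂ t₁ t₂ h1 h2 h3 h4 h5 h6 h7 ↦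
    H ((x, y), (V₁, V₂), (W₁, W₂), (t₁, t₂)) ⟨h1, ⟨h2, h3⟩, ⟨h4, h5⟩, h6, h7⟩⟩

theorem exists_bound {X : Type*} [TopologicalSpace X] [CompactSpace X] (A : C(X, E →L[ℝ] E)) :
    ∃ C ≥ 1, ∀ x, ‖A x‖ ≤ C := by
  obtain ⟨C, hC⟩ := isCompact_univ.exists_bound_of_continuousOn A.continuous.continuousOn
  exact ⟨max C 1, le_max_right _ _, fun x ↦ (hC x trivial).trans (le_max_left _ _)⟩

theorem exists_transition_le (η : ℝ) (hη : 0 < η) :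
    ∃ r > 0, ∀ x y V₁ V₂ W₁ W₂ t₁ t₂, ‖S.ι y - S.ι (S.f x)‖ < r →
      S.P x V₁ = V₁ → S.P x V₂ = V₂ → ‖V₁‖ < r → ‖V₂‖ < r →
      S.Solves r y (S.f (S.ex x V₁)) W₁ t₁ → S.Solves r y (S.f (S.ex x V₂)) W₂ t₂ →
      ‖W₁ - W₂ - S.a (x, y) (V₁ - V₂)‖ ≤ η * ‖V₁ - V₂‖ := by
  obtain ⟨A, hA, hA'⟩ := exists_bound S.a
  -- The bound $1/2$ allows $\|W_1-W_2\|$ to be absorbed on the left, giving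
  -- $\|W_1-W_2\|\le(2A+1)\|V_1-V_2\|$. The second bound compensates the resulting factor $2A+2$.
  obtain ⟨r, hr, H⟩ := S.exists_transition_le_add (min (1 / 2) (η / (2 * A + 2))) (by positivity)
  refine ⟨r, hr, fun x y V₁ V₂ W₁ W₂ t₁ t₂ h1 h2 h3 h4 h5 h6 h7 ↦ ?_⟩
  have h := H x y V₁ V₂ W₁ W₂ t₁ t₂ h1 h2 h3 h4 h5 h6 h7
  have g1 : ‖S.a (x, y) (V₁ - V₂)‖ ≤ A * ‖V₁ - V₂‖ := (S.a (x, y)).le_of_opNorm_le (hA' _) _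
  have g2 : ‖W₁ - W₂‖ ≤ ‖W₁ - W₂ - S.a (x, y) (V₁ - V₂)‖ + ‖S.a (x, y) (V₁ - V₂)‖ :=
    norm_le_norm_sub_add _ _
  have g3 : ‖W₁ - W₂ - S.a (x, y) (V₁ - V₂)‖ ≤ 1 / 2 * (‖V₁ - V₂‖ + ‖W₁ - W₂‖) :=
    h.trans (mul_le_mul_of_nonneg_right (min_le_left _ _) (by positivity))
  have g4 : ‖V₁ - V₂‖ + ‖W₁ - W₂‖ ≤ (2 * A + 2) * ‖V₁ - V₂‖ := by linarith
  calc _ ≤ _ := h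
    _ ≤ η / (2 * A + 2) * ((2 * A + 2) * ‖V₁ - V₂‖) :=
        mul_le_mul (min_le_right _ _) g4 (by positivity) (by positivity)
    _ = _ := by field_simp

/-- The transition estimate with $V_1=V_2=0$ over the preimage of `z` forces $W_1=W_2$. Injectivity
of short orbit segments then identifies the times. -/
theorem exists_solves_unique :
    ∃ r > 0, ∀ y z W₁ W₂ t₁ t₂, ‖S.ι y - S.ι z‖ < r → S.Solves r y z W₁ t₁ →
      S.Solves r y z W₂ t₂ → W₁ = W₂ ∧ t₁ = t₂ := by
  obtain ⟨r, hr, H⟩ := S.exists_transition_le 1 one_pos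
  obtain ⟨r', hr', H'⟩ := S.exists_flow_injective
  refine ⟨min r r', by positivity, fun y z W₁ W₂ t₁ t₂ h h1 h2 ↦ ?_⟩
  have hW : W₁ = W₂ := by
    have := H (S.f.symm z) y 0 0 W₁ W₂ t₁ t₂
    simp only [S.f.apply_symm_apply, map_zero, norm_zero, S.ex_zero, sub_self, sub_zero,
      mul_zero, norm_le_zero_iff] at this
    exact sub_eq_zero.mp (this (h.trans_le (min_le_left _ _)) trivial trivial hr hr
      (h1.mono (min_le_left _ _)) (h2.mono (min_le_left _ _)))
  refine ⟨hW, H' z _ _ (h1.2.2.1.trans_le (min_le_right _ _))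
    (h2.2.2.1.trans_le (min_le_right _ _)) ?_⟩
  rw [← h1.2.2.2, ← h2.2.2.2, hW]

/-- Limits of solutions exist by compactness, solve the limiting equation, and are determined by
uniqueness. Halving the radius keeps the limits, which satisfy only weak inequalities, in the range
of uniqueness. -/
theorem exists_solves_continuous :
    ∃ r > 0, ∀ y z : M → M, Continuous y → Continuous z → (∀ a, ‖S.ι (y a) - S.ι (z a)‖ < r) →
      ∀ (W : M → E) (t : M → ℝ), (∀ a, S.Solves r (y a) (z a) (W a) (t a)) →
      Continuous W ∧ Continuous t := by
  obtain ⟨ρ, hρ, h⟩ := S.continuousOn_ex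
  obtain ⟨ρ', hρ', h'⟩ := S.exists_continuousOn_flow
  obtain ⟨R, hR, H⟩ := S.exists_solves_unique
  have := S.t2Space
  have := FiniteDimensional.proper_real E
  set m := min (min ρ ρ') R
  have hm : 0 < m := by positivity
  have hm1 : m ≤ ρ := (min_le_left _ _).trans (min_le_left _ _)
  have hm2 : m ≤ ρ' := (min_le_left _ _).trans (min_le_right _ _)
  have hm3 : m ≤ R := min_le_right _ _
  refine ⟨m / 2, by positivity, fun y z hy hz hyz W t hS ↦ ?_⟩
  have key (a : M) (g : Ultrafilter M) (hg : ↑g ≤ 𝓝 a) :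
      Tendsto W g (𝓝 (W a)) ∧ Tendsto t g (𝓝 (t a)) := by
    have hg' : Tendsto id (g : Filter M) (𝓝 a) := hg
    obtain ⟨W₀, hWr, hW⟩ := (isCompact_closedBall (0 : E) (m / 2)).ultrafilter_le_nhds (g.map W)
      (by
        rw [le_principal_iff]
        exact Filter.mem_map.mpr (univ_mem' fun y ↦ by simpa using (hS y).2.1.le))
    obtain ⟨t₀, htr, ht⟩ := (isCompact_closedBall (0 : ℝ) (m / 2)).ultrafilter_le_nhds (g.map t)
      (by
        rw [le_principal_iff]
        exact Filter.mem_map.mpr (univ_mem' fun y ↦ by simpa using (hS y).2.2.1.le))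
    have hW : Tendsto W g (𝓝 W₀) := hW
    have ht : Tendsto t g (𝓝 t₀) := ht
    have hWr : ‖W₀‖ ≤ m / 2 := by simpa using hWr
    have htr : |t₀| ≤ m / 2 := by simpa using htr
    have hy' := (hy.tendsto a).comp hg'
    have hz' := (hz.tendsto a).comp hg'
    have hPW : S.P (y a) W₀ = W₀ := by
      refine tendsto_nhds_unique ?_ hW
      refine (((S.P.continuous.tendsto _).comp hy').apply_clm hW).congr fun c ↦ ?_
      exact (hS c).1
    have he : S.ex (y a) W₀ = S.φ t₀ (z a) := by
      have h1 : ContinuousAt (Function.uncurry S.ex) (y a, W₀) := h.continuousAt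
        (prod_mem_nhds univ_mem (Metric.isOpen_ball.mem_nhds (by simp; linarith)))
      have h2 := h' (z a) t₀ (by linarith)
      refine tendsto_nhds_unique (h1.tendsto.comp (hy'.prodMk_nhds hW)) ?_
      refine (h2.tendsto.comp (hz'.prodMk_nhds ht)).congr fun c ↦ ?_
      exact (hS c).2.2.2.symm
    have := H (y a) (z a) W₀ (W a) t₀ (t a) (by linarith [hyz a])
      ⟨hPW, by linarith, by linarith, he⟩ ((hS a).mono (by linarith))
    rw [this.1] at hW
    rw [this.2] at ht
    exact ⟨hW, ht⟩
  exact ⟨continuous_iff_continuousAt.mpr fun a ↦ (tendsto_iff_ultrafilter _ _ _).mpr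
      fun g hg ↦ (key a g hg).1,
    continuous_iff_continuousAt.mpr fun a ↦ (tendsto_iff_ultrafilter _ _ _).mpr
      fun g hg ↦ (key a g hg).2⟩

end CenterSystem

/-! ### Nearby orbits meet the hyperbolic sections -/

namespace CenterSystem

open Asymptotics Filter

variable {M : Type*} [TopologicalSpace M] [CompactSpace M]
variable {E : Type*} [NormedAddCommGroup E] [NormedSpace ℝ E] [FiniteDimensional ℝ E]

/-- Composing with the projection makes the vectors free parameters in `E`. The domain no longer
varies with the base point, at the price of an error from the variation of `S.P`, which is
continuous. -/
theorem box_eventually_approx {S : CenterSystem M E} {q : M} {k : ℕ} {U : Set M}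
    {b : M → EuclideanSpace ℝ (Fin k)} {h : M → ℝ} {B : E →L[ℝ] EuclideanSpace ℝ (Fin k)}
    (hB : IsFlowBox S.ι S.φ (S.T q) (S.Pc q) q U b h B) {c : ℝ} (hc : 0 < c) :
    ∀ᶠ p : M × E × E in 𝓝 (q, 0, 0), ‖b (S.ex p.1 (S.P p.1 p.2.1)) - b (S.ex p.1 (S.P p.1 p.2.2))
      - B (S.P q (p.2.1 - p.2.2))‖ ≤ c * ‖p.2.1 - p.2.2‖ := by
  set l := 𝓝 (q, (0 : E), (0 : E))
  have t1 : Tendsto (fun p : M × E × E ↦ p.1) l (𝓝 q) := continuous_fst.tendsto _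
  have t2 : Tendsto (fun p : M × E × E ↦ p.2.1) l (𝓝 0) :=
    (continuous_fst.comp continuous_snd).tendsto _
  have t3 : Tendsto (fun p : M × E × E ↦ p.2.2) l (𝓝 0) :=
    (continuous_snd.comp continuous_snd).tendsto _
  have tP : Tendsto (fun p : M × E × E ↦ S.P p.1) l (𝓝 (S.P q)) :=
    (S.P.continuous.tendsto q).comp t1
  have t4 := tP.apply_clm t2
  have t5 := tP.apply_clm t3
  rw [map_zero] at t4 t5
  have e1 := box_ex_isLittleO hB t1 t4 t5 (Eventually.of_forall fun p ↦ S.T_of_P (S.P_P _ _))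
    (Eventually.of_forall fun p ↦ S.T_of_P (S.P_P _ _))
  have tP0 : Tendsto (fun p : M × E × E ↦ S.P p.1 - S.P q) l (𝓝 0) := by
    simpa using tP.sub_const (S.P q)
  have e0 : (fun p : M × E × E ↦ (S.P p.1 - S.P q) (p.2.1 - p.2.2)) =o[l]
      fun p ↦ p.2.1 - p.2.2 := by
    have h1 : (fun p : M × E × E ↦ (S.P p.1 - S.P q) (p.2.1 - p.2.2)) =O[l]
        fun p ↦ ‖S.P p.1 - S.P q‖ * ‖p.2.1 - p.2.2‖ :=
      IsBigO.of_bound 1 (Eventually.of_forall fun p ↦ by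
        rw [one_mul, norm_mul, norm_norm, norm_norm]; exact ContinuousLinearMap.le_opNorm _ _)
    have h2 : (fun p : M × E × E ↦ ‖S.P p.1 - S.P q‖) =o[l] fun _ ↦ (1 : ℝ) :=
      (isLittleO_one_iff ℝ).mpr (by simpa using tP0.norm)
    have h3 := h2.mul_isBigO (isBigO_refl (fun p : M × E × E ↦ ‖p.2.1 - p.2.2‖) l)
    simp only [one_mul] at h3
    exact (h1.trans_isLittleO h3).of_norm_right
  have e2 := (B.isBigO_comp _ l).trans_isLittleO e0
  have e3 : (fun p : M × E × E ↦ S.P p.1 p.2.1 - S.P p.1 p.2.2) =O[l]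
      fun p ↦ p.2.1 - p.2.2 := by
    refine (e0.isBigO.add ((S.P q).isBigO_comp (fun p ↦ p.2.1 - p.2.2) l)).congr_left fun p ↦ ?_
    rw [sub_apply, map_sub (S.P p.1)]
    abel
  refine (((e1.trans_isBigO e3).add e2).congr_left fun p ↦ ?_).bound hc
  simp only [sub_apply, map_sub]
  abel

theorem box_exists_rightInverse {S : CenterSystem M E} {q : M} {k : ℕ} {U : Set M}
    {b : M → EuclideanSpace ℝ (Fin k)} {h : M → ℝ} {B : E →L[ℝ] EuclideanSpace ℝ (Fin k)}
    (hB : IsFlowBox S.ι S.φ (S.T q) (S.Pc q) q U b h B) :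
    ∃ R : EuclideanSpace ℝ (Fin k) →L[ℝ] E, ∀ w, B (S.P q (R w)) = w := by
  have hsurj : LinearMap.range (B.toLinearMap ∘ₗ (S.P q).toLinearMap) = ⊤ := by
    refine LinearMap.range_eq_top.mpr fun w ↦ ?_
    obtain ⟨V, hV, rfl⟩ := hB.surjective w
    exact ⟨V, box_apply_P hB hV⟩
  obtain ⟨R, hR⟩ := LinearMap.exists_rightInverse_of_surjective _ hsurj
  exact ⟨LinearMap.toContinuousLinearMap R, fun w ↦ LinearMap.congr_fun hR w⟩

/-- A map that is close to the identity to first order covers a ball. -/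
theorem exists_eq_of_near_id {F : Type*} [NormedAddCommGroup F] [NormedSpace ℝ F]
    [CompleteSpace F] {G : F → F} {ε : ℝ} (hε : 0 ≤ ε)
    (hG : ∀ w₁ ∈ Metric.closedBall (0 : F) ε, ∀ w₂ ∈ Metric.closedBall (0 : F) ε,
      ‖G w₁ - G w₂ - (w₁ - w₂)‖ ≤ 1 / 2 * ‖w₁ - w₂‖) {y : F} (hy : ‖y - G 0‖ ≤ ε / 2) :
    ∃ w ∈ Metric.closedBall (0 : F) ε, G w = y := by
  set c : NNReal := 1 / 2
  have hc : (c : ℝ) = 1 / 2 := by simp [c]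
  have happ : ApproximatesLinearOn G (ContinuousLinearMap.id ℝ F) (Metric.closedBall 0 ε) c :=
    fun w₁ h₁ w₂ h₂ ↦ by rw [hc]; exact hG w₁ h₁ w₂ h₂
  refine happ.surjOn_closedBall_of_nonlinearRightInverse
    ⟨id, 1, fun w ↦ by simp, fun w ↦ rfl⟩ hε subset_rfl ?_
  rw [Metric.mem_closedBall, dist_eq_norm, hc]
  norm_num
  linarith

theorem exists_eventually_forall_closedBall {F : Type*} [NormedAddCommGroup F] {q : M}
    {p : M → F → F → Prop} (h : ∀ᶠ z : M × F × F in 𝓝 (q, 0, 0), p z.1 z.2.1 z.2.2) :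
    ∃ ε > 0, ∀ᶠ y in 𝓝 q, ∀ w₁ ∈ Metric.closedBall (0 : F) ε, ∀ w₂ ∈ Metric.closedBall (0 : F) ε,
      p y w₁ w₂ := by
  rw [nhds_prod_eq, nhds_prod_eq] at h
  obtain ⟨B₁, hB₁, B₂, hB₂, h2⟩ := Filter.eventually_prod_iff.mp h
  obtain ⟨C₁, hC₁, C₂, hC₂, h3⟩ := Filter.eventually_prod_iff.mp hB₂
  obtain ⟨ε, hε, h4⟩ := Metric.nhds_basis_closedBall.eventually_iff.mp (hC₁.and hC₂)
  refine ⟨ε, hε, hB₁.mono fun y hy w₁ h₁ w₂ h₂ ↦ ?_⟩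
  exact h2 hy (h3 (h4 h₁).1 (h4 h₂).2)

/-- Near the centre of a flow box, the hyperbolic sections are met by all nearby orbits. -/
theorem box_eventually_solves {S : CenterSystem M E} {q : M} {k : ℕ} {U : Set M}
    {b : M → EuclideanSpace ℝ (Fin k)} {h : M → ℝ} {B : E →L[ℝ] EuclideanSpace ℝ (Fin k)}
    (hB : IsFlowBox S.ι S.φ (S.T q) (S.Pc q) q U b h B) {ρ : ℝ} (hρ : 0 < ρ) {α : Type*}
    {l : Filter α} {y z : α → M} (hy : Tendsto y l (𝓝 q)) (hz : Tendsto z l (𝓝 q)) :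
    ∀ᶠ a in l, ∃ W t, S.Solves ρ (y a) (z a) W t := by
  obtain ⟨R, hR⟩ := box_exists_rightInverse hB
  have hlo : ∀ᶠ p : M × EuclideanSpace ℝ (Fin k) × EuclideanSpace ℝ (Fin k) in 𝓝 (q, 0, 0),
      ‖b (S.ex p.1 (S.P p.1 (R p.2.1))) - b (S.ex p.1 (S.P p.1 (R p.2.2))) - (p.2.1 - p.2.2)‖
        ≤ 1 / 2 * ‖p.2.1 - p.2.2‖ := by
    have ht : Tendsto (fun p : M × EuclideanSpace ℝ (Fin k) × EuclideanSpace ℝ (Fin k) ↦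
        (p.1, R p.2.1, R p.2.2)) (𝓝 (q, 0, 0)) (𝓝 (q, 0, 0)) := by
      have : Continuous (fun p : M × EuclideanSpace ℝ (Fin k) × EuclideanSpace ℝ (Fin k) ↦
        (p.1, R p.2.1, R p.2.2)) := by fun_prop
      simpa using this.tendsto (q, 0, 0)
    have hc : 0 < 1 / (2 * (‖R‖ + 1)) := by positivity
    refine (ht.eventually (box_eventually_approx hB hc)).mono fun p hp ↦ ?_
    simp only at hp
    rw [← map_sub R, hR] at hp
    refine hp.trans ?_
    have h1 : ‖R (p.2.1 - p.2.2)‖ ≤ (‖R‖ + 1) * ‖p.2.1 - p.2.2‖ :=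
      R.le_of_opNorm_le (by linarith) _
    calc _ ≤ 1 / (2 * (‖R‖ + 1)) * ((‖R‖ + 1) * ‖p.2.1 - p.2.2‖) := by gcongr
      _ = _ := by field_simp
  have hcont : Tendsto (fun p : M × EuclideanSpace ℝ (Fin k) ↦ S.P p.1 (R p.2)) (𝓝 (q, 0))
      (𝓝 0) := by
    have : Continuous (fun p : M × EuclideanSpace ℝ (Fin k) ↦ S.P p.1 (R p.2)) := by fun_prop
    simpa using this.tendsto (q, 0)
  have hex : Tendsto (fun p : M × EuclideanSpace ℝ (Fin k) ↦ S.ex p.1 (S.P p.1 (R p.2)))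
      (𝓝 (q, 0)) (𝓝 q) :=
    S.tendsto_ex (continuous_fst.tendsto _) hcont
  obtain ⟨F, hFU, -, r, hr, H⟩ := box_flow hB
  have hh := (hB.continuousAt_time q hB.mem).tendsto
  have hmin : 0 < min r ρ / 2 := by positivity
  have hsm : ∀ᶠ p : M × EuclideanSpace ℝ (Fin k) in 𝓝 (q, 0), ‖S.P p.1 (R p.2)‖ < ρ ∧
      S.ex p.1 (S.P p.1 (R p.2)) ∈ U ∧
      |h (S.ex p.1 (S.P p.1 (R p.2))) - h q| < min r ρ / 2 := by
    refine (hcont.norm.eventually_lt_const (by simpa using hρ)).and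
      ((hex.eventually (hB.isOpen.mem_nhds hB.mem)).and ?_)
    exact (hh.comp hex).eventually (Metric.ball_mem_nhds _ hmin)
  have hsm' : ∀ᶠ p : M × EuclideanSpace ℝ (Fin k) × EuclideanSpace ℝ (Fin k) in 𝓝 (q, 0, 0),
      ‖S.P p.1 (R p.2.1)‖ < ρ ∧ S.ex p.1 (S.P p.1 (R p.2.1)) ∈ U ∧
      |h (S.ex p.1 (S.P p.1 (R p.2.1))) - h q| < min r ρ / 2 :=
    ((continuous_fst.prodMk (continuous_fst.comp continuous_snd)).tendsto
      (q, (0 : EuclideanSpace ℝ (Fin k)), (0 : EuclideanSpace ℝ (Fin k)))).eventually hsm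
  obtain ⟨ε, hε, h4⟩ := exists_eventually_forall_closedBall
    (p := fun y (w₁ w₂ : EuclideanSpace ℝ (Fin k)) ↦ (‖b (S.ex y (S.P y (R w₁)))
      - b (S.ex y (S.P y (R w₂))) - (w₁ - w₂)‖ ≤ 1 / 2 * ‖w₁ - w₂‖) ∧
      ‖S.P y (R w₁)‖ < ρ ∧ S.ex y (S.P y (R w₁)) ∈ U ∧
      |h (S.ex y (S.P y (R w₁))) - h q| < min r ρ / 2) (hlo.and hsm')
  have hbq := (hB.continuousAt_transverse q hB.mem).tendsto
  have hbyz := ((hbq.comp hz).dist (hbq.comp hy)).eventually_lt_const (u := ε / 2)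
    (by simpa using hε)
  have hzr : ∀ᶠ a in l, ‖S.ι (z a) - S.ι q‖ < r := by
    have := ((S.continuous_ι.tendsto q).comp hz).eventually (Metric.ball_mem_nhds _ hr)
    simpa [dist_eq_norm] using this
  filter_upwards [hy.eventually h4, hbyz, hzr,
    (hh.comp hz).eventually (Metric.ball_mem_nhds _ hmin)] with a g2 g3 g4 g5
  -- The section at `y a` is parametrized by `w` so that its transverse coordinate is close to a
  -- translation. At $w=0$ the point is `y a` itself, hence the condition that $b(y)$ and $b(z)$
  -- differ by at most $\varepsilon/2$.
  obtain ⟨w, hw, hwb⟩ := exists_eq_of_near_id (G := fun w ↦ b (S.ex (y a) (S.P (y a) (R w))))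
    (y := b (z a)) hε.le (fun w₁ hw₁ w₂ hw₂ ↦ (g2 w₁ hw₁ w₂ hw₂).1)
    (by simpa [S.ex_zero, ← dist_eq_norm] using g3.le)
  obtain ⟨k1, k2, k3⟩ := (g2 w hw w hw).2
  have k4 : |h (S.ex (y a) (S.P (y a) (R w))) - h (z a)| < min r ρ := by
    have h5 : |h (z a) - h q| < min r ρ / 2 := g5
    have h6 := abs_sub_le (h (S.ex (y a) (S.P (y a) (R w)))) (h q) (h (z a))
    rw [abs_sub_comm (h q)] at h6
    linarith
  -- The time that aligns the time coordinates. The point of the section and the flowed point then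
  -- agree in both coordinates of the box, hence coincide.
  set t := h (S.ex (y a) (S.P (y a) (R w))) - h (z a) with ht
  obtain ⟨j1, j2, j3⟩ := H (z a) t g4 (k4.trans_le (min_le_left _ _))
  have j4 : S.ex (y a) (S.P (y a) (R w)) = S.φ t (z a) :=
    hB.injective _ k2 _ (hFU j1) (hwb.trans j2.symm) (by rw [j3, ht]; ring)
  exact ⟨S.P (y a) (R w), t, S.P_P (y a) (R w), k1, k4.trans_le (min_le_right _ _), j4⟩

variable (S : CenterSystem M E)

theorem exists_solves (ρ : ℝ) (hρ : 0 < ρ) :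
    ∃ r > 0, ∀ y z, ‖S.ι y - S.ι z‖ < r → ∃ W t, S.Solves ρ y z W t := by
  obtain ⟨r, hr, H⟩ := exists_pos_of_ultrafilter (α := M × M)
    (K := fun r a ↦ ‖S.ι a.1 - S.ι a.2‖ < r) (C := fun a ↦ ∃ W t, S.Solves ρ a.1 a.2 W t)
    (fun r r' a hr h ↦ lt_of_lt_of_le h hr) (fun l hl ↦ by
      obtain ⟨q, hq⟩ := exists_le_nhds l Prod.snd
      obtain ⟨k, U, b, h, B, hB⟩ := S.exists_flowBox q
      exact box_eventually_solves hB hρ (S.tendsto_of_norm_sub hq (tendsto_zero_of_forall_lt hl)) hq)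
  exact ⟨r, hr, fun y z ↦ H (y, z)⟩

end CenterSystem

/-! ### Existence and uniqueness of the semiconjugacy in a center system -/

namespace CenterSystem

open Asymptotics Filter

variable {M : Type*} [TopologicalSpace M] [CompactSpace M] [T2Space M]
variable {E : Type*} [NormedAddCommGroup E] [NormedSpace ℝ E] [FiniteDimensional ℝ E]
variable (S : CenterSystem M E)

/-- The filter of homeomorphisms that are close to `S.f`. -/
def nearby : Filter (M ≃ₜ M) :=
  comap (fun g : M ≃ₜ M ↦ (g : C(M, M))) (𝓝 (S.f : C(M, M)))

theorem eventually_nearby (r : ℝ) (hr : 0 < r) :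
    ∀ᶠ g in S.nearby, ∀ x, ‖S.ι (g x) - S.ι (S.f x)‖ < r := by
  have h1 : Continuous fun g : C(M, M) ↦ (⟨S.ι, S.continuous_ι⟩ : C(M, E)).comp g :=
    ContinuousMap.continuous_postcomp _
  have h2 := (h1.tendsto (S.f : C(M, M))).eventually (Metric.ball_mem_nhds _ hr)
  refine (tendsto_comap.eventually h2).mono fun g hg x ↦ ?_
  have := (ContinuousMap.dist_lt_iff hr).mp hg x
  rwa [dist_eq_norm] at this

theorem eventually_hasBoundedInverse
    (hs : ∃ n, ‖forwardCocycle (S.f : C(M, M))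
      (graphRestrict (pushTransport S.Ps S.D) S.f) n‖ < 1 / 2)
    (hu : ∃ n, ‖backwardCocycle (S.f : C(M, M))
      (graphRestrict (pullTransport S.Pu S.D') S.f) n‖ < 1 / 2) :
    ∃ K > 0, ∀ᶠ g in S.nearby, HasBoundedInverse (1 - hyperbolicOp S.Ps S.Pu S.D g) K := by
  have := FiniteDimensional.complete ℝ E
  refine PartialHyperbolicity.eventually_hasBoundedInverse S.f S.Ps S.Pu S.D S.D' S.su S.uu
    (fun x ↦ ?_) (fun x ↦ ?_) (fun x ↦ ?_) (fun x ↦ ?_) hs hu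
  · rw [S.Du, mul_assoc, S.uu]
  · rw [S.Du', mul_assoc, S.uu]
  · rw [S.DD, add_mul, add_mul, S.su, S.cu, S.uu, zero_add, zero_add]
  · rw [S.DD', add_mul, add_mul, S.su, S.cu, S.uu, zero_add, zero_add]

theorem hyperbolicOp_apply (g : M ≃ₜ M) (V : C(M, E)) (x : M) :
    hyperbolicOp S.Ps S.Pu S.D g V (g x) = S.a (x, g x) (V x) :=
  PartialHyperbolicity.hyperbolicOp_apply _ _ _ _ _ _

/-- `V` and `τ` describe a semiconjugacy from `g` to `S.f` along the orbits of the flow. -/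
structure IsSolution (r : ℝ) (g : M ≃ₜ M) (V : M → E) (τ : M → ℝ) : Prop where
  P_apply : ∀ x, S.P x (V x) = V x
  norm_lt : ∀ x, ‖V x‖ < r
  abs_lt : ∀ x, |τ x| < r
  continuous_ex : Continuous fun x ↦ S.ex x (V x)
  ex_eq : ∀ x, S.ex (g x) (V (g x)) = S.φ (τ (S.f x)) (S.f (S.ex x (V x)))

variable {S} in
theorem IsSolution.mono {r r' : ℝ} (hr : r ≤ r') {g : M ≃ₜ M} {V : M → E} {τ : M → ℝ}
    (h : S.IsSolution r g V τ) : S.IsSolution r' g V τ :=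
  ⟨h.1, fun x ↦ (h.2 x).trans_le hr, fun x ↦ (h.3 x).trans_le hr, h.4, h.5⟩

/-- The difference $\Delta$ of two solutions is an approximate fixed vector of the transport
operator, with error at most $\|\Delta\|/(2K)$. Invertibility of $1-L$ with bound $K$ forces
$\Delta=0$, and the times then agree by injectivity of short orbit segments. The radius is fixed
before `g`. -/
theorem eventually_unique
    (hs : ∃ n, ‖forwardCocycle (S.f : C(M, M))
      (graphRestrict (pushTransport S.Ps S.D) S.f) n‖ < 1 / 2)
    (hu : ∃ n, ‖backwardCocycle (S.f : C(M, M))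
      (graphRestrict (pullTransport S.Pu S.D') S.f) n‖ < 1 / 2) :
    ∃ R > 0, ∀ᶠ g in S.nearby, ∀ V₁ V₂ τ₁ τ₂, S.IsSolution R g V₁ τ₁ → S.IsSolution R g V₂ τ₂ →
      V₁ = V₂ ∧ τ₁ = τ₂ := by
  obtain ⟨K, hK, hinv⟩ := S.eventually_hasBoundedInverse hs hu
  obtain ⟨r₁, hr₁, h1⟩ := S.exists_transition_le (1 / (2 * K)) (by positivity)
  obtain ⟨r₂, hr₂, h2⟩ := S.exists_continuous_of_continuous_ex
  obtain ⟨r₃, hr₃, h3⟩ := S.exists_flow_injective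
  set R := min r₁ (min r₂ r₃)
  have hR1 : R ≤ r₁ := min_le_left _ _
  have hR2 : R ≤ r₂ := (min_le_right _ _).trans (min_le_left _ _)
  have hR3 : R ≤ r₃ := (min_le_right _ _).trans (min_le_right _ _)
  refine ⟨R, by positivity, ?_⟩
  filter_upwards [hinv, S.eventually_nearby r₁ hr₁] with g hg hgf V₁ V₂ τ₁ τ₂ H₁ H₂
  have c₁ := h2 V₁ H₁.P_apply (fun x ↦ (H₁.norm_lt x).trans_le hR2) H₁.continuous_ex
  have c₂ := h2 V₂ H₂.P_apply (fun x ↦ (H₂.norm_lt x).trans_le hR2) H₂.continuous_ex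
  set Δ : C(M, E) := ⟨V₁, c₁⟩ - ⟨V₂, c₂⟩ with hΔ
  have hΔx (x : M) : Δ x = V₁ x - V₂ x := rfl
  have hle : ‖Δ - hyperbolicOp S.Ps S.Pu S.D g Δ‖ ≤ 1 / (2 * K) * ‖Δ‖ := by
    refine (ContinuousMap.norm_le _ (by positivity)).mpr fun y ↦ ?_
    obtain ⟨x, rfl⟩ := g.surjective y
    rw [ContinuousMap.sub_apply, hyperbolicOp_apply, hΔx, hΔx]
    refine (h1 x (g x) (V₁ x) (V₂ x) (V₁ (g x)) (V₂ (g x)) (τ₁ (S.f x)) (τ₂ (S.f x)) (hgf x)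
      (H₁.P_apply x) (H₂.P_apply x) ((H₁.norm_lt x).trans_le hR1) ((H₂.norm_lt x).trans_le hR1)
      ⟨H₁.P_apply _, (H₁.norm_lt _).trans_le hR1, (H₁.abs_lt _).trans_le hR1, H₁.ex_eq x⟩
      ⟨H₂.P_apply _, (H₂.norm_lt _).trans_le hR1, (H₂.abs_lt _).trans_le hR1, H₂.ex_eq x⟩).trans ?_
    gcongr
    exact Δ.norm_coe_le_norm x
  have h0 : Δ = 0 := by
    have := norm_le_of_hasBoundedInverse hg Δ
    have h4 : K * ‖Δ - hyperbolicOp S.Ps S.Pu S.D g Δ‖ ≤ K * (1 / (2 * K) * ‖Δ‖) := by gcongr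
    have h5 : K * (1 / (2 * K) * ‖Δ‖) = ‖Δ‖ / 2 := by field_simp
    rw [← norm_eq_zero]
    linarith [norm_nonneg Δ]
  have hV : V₁ = V₂ := funext fun x ↦ sub_eq_zero.mp (by rw [← hΔx, h0]; rfl)
  refine ⟨hV, funext fun y ↦ ?_⟩
  obtain ⟨x, rfl⟩ := S.f.surjective y
  refine h3 (S.f (S.ex x (V₁ x))) _ _ ((H₁.abs_lt _).trans_le hR3)
    ((H₂.abs_lt _).trans_le hR3) ?_
  rw [← H₁.ex_eq, hV, H₂.ex_eq]

/-- The transform $V\mapsto W(V)\circ g^{-1}$ is written as $L+N$, and its fixed points are the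
solutions. Smallness of the Lipschitz constant of $N$ is the transition estimate; smallness of
$N(0)$ is the closeness of `g` to `f`. -/
theorem eventually_exists
    (hs : ∃ n, ‖forwardCocycle (S.f : C(M, M))
      (graphRestrict (pushTransport S.Ps S.D) S.f) n‖ < 1 / 2)
    (hu : ∃ n, ‖backwardCocycle (S.f : C(M, M))
      (graphRestrict (pullTransport S.Pu S.D') S.f) n‖ < 1 / 2) (ε : ℝ) (hε : 0 < ε) :
    ∀ᶠ g in S.nearby, ∃ (V : C(M, E)) (τ : C(M, ℝ)), S.IsSolution ε g V τ := by
  have := FiniteDimensional.complete ℝ E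
  obtain ⟨K, hK, hinv⟩ := S.eventually_hasBoundedInverse hs hu
  obtain ⟨C, hC, hPC⟩ := exists_bound S.P
  have hC0 : 0 < C := by linarith
  obtain ⟨r₁, hr₁, h1⟩ := S.exists_transition_le (1 / (2 * K * C)) (by positivity)
  obtain ⟨r₂, hr₂, h2⟩ := S.exists_solves_continuous
  obtain ⟨r₃, hr₃, h3⟩ := S.exists_solves_unique
  obtain ⟨r₄, hr₄, h4⟩ := S.continuousOn_ex
  set r := min (min r₁ r₂) (min r₃ ε)
  have hr : 0 < r := by positivity
  have hr1 : r ≤ r₁ := (min_le_left _ _).trans (min_le_left _ _)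
  have hr2 : r ≤ r₂ := (min_le_left _ _).trans (min_le_right _ _)
  have hr3 : r ≤ r₃ := (min_le_right _ _).trans (min_le_left _ _)
  have hrε : r ≤ ε := (min_le_right _ _).trans (min_le_right _ _)
  obtain ⟨r₅, hr₅, h5⟩ := S.exists_solves r hr
  set s := min r₅ r
  have hs0 : 0 < s := by positivity
  obtain ⟨r₆, hr₆, h6⟩ := S.exists_f_ex_near (s / 2) (by positivity)
  set σ := min (min r₄ r₆) r / 2 with hσ_def
  have hm : 0 < min (min r₄ r₆) r := by positivity
  have hσ : 0 < σ := by positivity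
  have hσ4 : σ < r₄ := by
    have := (min_le_left (min r₄ r₆) r).trans (min_le_left _ _); linarith
  have hσ6 : σ < r₆ := by
    have := (min_le_left (min r₄ r₆) r).trans (min_le_right _ _); linarith
  have hσr : σ < r := by
    have := min_le_right (min r₄ r₆) r; linarith
  -- The unknown ranges over all continuous functions into `E`, and only its projection enters.
  -- Dividing by the bound $C$ of the projection keeps the projected vectors within $\sigma$.
  set ρ := σ / C with hρ_def
  have hρ : 0 < ρ := by positivity
  have hρσ : ρ ≤ σ := div_le_self hσ.le hC
  -- A second, smaller scale: solutions for the zero section must have norm at most $\rho/(2K)$, so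
  -- that $K\|N(0)\|\le\rho/2$.
  set r₀ := min r (ρ / (2 * K)) with hr₀_def
  have hr₀ : 0 < r₀ := by positivity
  obtain ⟨r₇, hr₇, h7⟩ := S.exists_solves r₀ hr₀
  filter_upwards [hinv, S.eventually_nearby (s / 2) (by positivity), S.eventually_nearby r₇ hr₇]
    with g hg hgf hgf'
  have hgz (x : M) (v : E) (hv : ‖v‖ ≤ σ) : ‖S.ι (g x) - S.ι (S.f (S.ex x v))‖ < s := by
    have := h6 x v (hv.trans_lt hσ6)
    rw [norm_sub_rev] at this
    linarith [norm_sub_le_norm_sub_add_norm_sub (S.ι (g x)) (S.ι (S.f x)) (S.ι (S.f (S.ex x v))),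
      hgf x]
  have hPσ (V : C(M, E)) (hV : ‖V‖ ≤ ρ) (x : M) : ‖S.P x (V x)‖ ≤ σ := by
    calc _ ≤ C * ‖V x‖ := (S.P x).le_of_opNorm_le (hPC x) _
      _ ≤ C * ρ := by gcongr; exact (V.norm_coe_le_norm x).trans hV
      _ = σ := by rw [hρ_def]; field_simp
  have hex (V : C(M, E)) (hV : ‖V‖ ≤ ρ) : ∃ (W : C(M, E)) (t : C(M, ℝ)),
      ∀ x, S.Solves r (g x) (S.f (S.ex x (S.P x (V x)))) (W x) (t x) := by
    choose W t hWt using fun x ↦ h5 (g x) (S.f (S.ex x (S.P x (V x))))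
      ((hgz x _ (hPσ V hV x)).trans_le (min_le_left _ _))
    have hc : Continuous fun x ↦ S.ex x (S.P x (V x)) := by
      have hc' : Continuous fun x ↦ S.P x (V x) := S.P.continuous.clm_apply V.continuous
      have := h4.comp_continuous (f := fun x ↦ (x, S.P x (V x))) (continuous_id.prodMk hc')
        fun x ↦ ⟨trivial, by simpa using (hPσ V hV x).trans_lt hσ4⟩
      exact this
    obtain ⟨g1, g2⟩ := h2 g (fun x ↦ S.f (S.ex x (S.P x (V x)))) g.continuous
      (S.f.continuous.comp hc)
      (fun x ↦ ((hgz x _ (hPσ V hV x)).trans_le (min_le_right _ _)).trans_le hr2) W t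
      fun x ↦ (hWt x).mono hr2
    exact ⟨⟨W, g1⟩, ⟨t, g2⟩, hWt⟩
  -- Outside the ball of radius `ρ` the chosen values are arbitrary. The fixed point argument stays
  -- inside the ball.
  choose! W t hWt using hex
  set L := hyperbolicOp S.Ps S.Pu S.D g
  set N : C(M, E) → C(M, E) := fun V ↦ (W V).comp (g.symm : C(M, M)) - L V
  have hN (V : C(M, E)) (x : M) : N V (g x) = W V x - S.a (x, g x) (V x) := by
    simp only [N, ContinuousMap.sub_apply, ContinuousMap.comp_apply]
    rw [hyperbolicOp_apply]
    simp
  have hN0 : K * ‖N 0‖ ≤ ρ / 2 := by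
    have : ‖N 0‖ ≤ ρ / (2 * K) := by
      refine (ContinuousMap.norm_le _ (by positivity)).mpr fun y ↦ ?_
      obtain ⟨x, rfl⟩ := g.surjective y
      have h8 := hWt 0 (by simpa using hρ.le) x
      rw [ContinuousMap.zero_apply, map_zero, S.ex_zero] at h8
      -- The chosen solution is known to be small only at the coarse scale. Closeness of `g` to `f`
      -- yields one at scale `r₀`, and uniqueness identifies the two.
      obtain ⟨W', t', h9⟩ := h7 _ _ (hgf' x)
      have h10 := hgz x 0 (by simpa using hσ.le)
      rw [S.ex_zero] at h10
      have := (h3 _ _ _ _ _ _ ((h10.trans_le (min_le_right _ _)).trans_le hr3) (h8.mono hr3)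
        ((h9.mono (min_le_left _ _)).mono hr3)).1
      rw [hN, ContinuousMap.zero_apply, map_zero, sub_zero, this]
      exact h9.2.1.le.trans (min_le_right _ _)
    calc K * ‖N 0‖ ≤ K * (ρ / (2 * K)) := by gcongr
      _ = ρ / 2 := by field_simp
  obtain ⟨V, hVρ, hV⟩ := exists_eq_add_of_hasBoundedInverse (η := 1 / (2 * K)) hg hρ.le
    (N := N) (fun V₁ hV₁ V₂ hV₂ ↦ by
      have hV₁ : ‖V₁‖ ≤ ρ := by simpa using hV₁
      have hV₂ : ‖V₂‖ ≤ ρ := by simpa using hV₂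
      refine (ContinuousMap.norm_le _ (by positivity)).mpr fun y ↦ ?_
      obtain ⟨x, rfl⟩ := g.surjective y
      have h8 := h1 x (g x) (S.P x (V₁ x)) (S.P x (V₂ x)) (W V₁ x) (W V₂ x) (t V₁ x) (t V₂ x)
        ((hgf x).trans_le (by linarith [min_le_right r₅ r])) (S.P_P _ _) (S.P_P _ _)
        ((hPσ V₁ hV₁ x).trans_lt (hσr.trans_le hr1)) ((hPσ V₂ hV₂ x).trans_lt (hσr.trans_le hr1))
        ((hWt V₁ hV₁ x).mono hr1) ((hWt V₂ hV₂ x).mono hr1)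
      have h9 : N V₁ (g x) - N V₂ (g x)
          = W V₁ x - W V₂ x - S.a (x, g x) (S.P x (V₁ x) - S.P x (V₂ x)) := by
        rw [hN, hN, map_sub, S.a_P, S.a_P]; abel
      rw [ContinuousMap.sub_apply, h9]
      refine h8.trans ?_
      have h10 : ‖S.P x (V₁ x) - S.P x (V₂ x)‖ ≤ C * ‖V₁ - V₂‖ := by
        rw [← map_sub]
        refine ((S.P x).le_of_opNorm_le (hPC x) _).trans ?_
        gcongr
        exact (V₁ - V₂).norm_coe_le_norm x
      calc _ ≤ 1 / (2 * K * C) * (C * ‖V₁ - V₂‖) := by gcongr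
        _ = _ := by field_simp)
    (by rw [mul_one_div, div_le_div_iff₀ (by positivity) (by positivity)]; linarith) hN0
  have hVρ : ‖V‖ ≤ ρ := by simpa using hVρ
  have hVW (x : M) : V (g x) = W V x := by
    conv_lhs => rw [hV]
    rw [ContinuousMap.add_apply, hN, hyperbolicOp_apply]
    abel
  -- Only the projection of `V` was constrained so far. A fixed point takes its values among the
  -- solutions `W`, which lie in the hyperbolic space, so it equals its projection.
  have hPV (y : M) : S.P y (V y) = V y := by
    obtain ⟨x, rfl⟩ := g.surjective y
    rw [hVW]
    exact (hWt V hVρ x).1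
  refine ⟨V, (t V).comp (S.f.symm : C(M, M)), hPV, fun x ↦ ?_, fun x ↦ ?_, ?_, fun x ↦ ?_⟩
  · exact ((V.norm_coe_le_norm x).trans hVρ).trans_lt ((hρσ.trans_lt hσr).trans_le hrε)
  · exact (hWt V hVρ _).2.2.1.trans_le hrε
  · refine h4.comp_continuous (f := fun x ↦ (x, V x)) (continuous_id.prodMk V.continuous)
      fun x ↦ ⟨trivial, ?_⟩
    simpa using ((V.norm_coe_le_norm x).trans hVρ).trans_lt (hρσ.trans_lt hσ4)
  · have := (hWt V hVρ x).2.2.2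
    rw [hVW, this, hPV]
    simp

end CenterSystem

/-! ### Continuity of splittings from separated growth rates -/

section Splitting

set_option maxSynthPendingDepth 3

open Set Filter

variable {M : Type*} [TopologicalSpace M]
variable {E : Type*} [NormedAddCommGroup E] [NormedSpace ℝ E]

/-- A uniform lower bound for the angles. Otherwise normalized tuples with sum tending to zero would
converge, by closedness, to a nonzero tuple in the summands over one point with sum zero. -/
theorem exists_pos_mul_norm_le_norm_sum [CompactSpace M] [FiniteDimensional ℝ E] {κ : Type*}
    [Fintype κ] [DecidableEq κ] {p : κ → M → E →L[ℝ] E}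
    (hne : ∀ i j x, i ≠ j → p i x * p j x = 0)
    (hcl : ∀ i, IsClosed {z : M × E | p i z.1 z.2 = z.2}) :
    ∃ r > 0, ∀ x (v : κ → E), (∀ i, p i x (v i) = v i) → r * ‖v‖ ≤ ‖∑ i, v i‖ := by
  obtain ⟨r, hr, H⟩ := exists_pos_of_ultrafilter (α := M × (κ → E))
    (K := fun r z ↦ (∀ i, p i z.1 (z.2 i) = z.2 i) ∧ ‖z.2‖ = 1 ∧ ‖∑ i, z.2 i‖ < r)
    (C := fun _ ↦ False) (fun r r' z hr h ↦ ⟨h.1, h.2.1, h.2.2.trans_le hr⟩) fun l hl ↦ by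
    exfalso
    obtain ⟨q, -, hq⟩ := isCompact_univ.ultrafilter_le_nhds (l.map Prod.fst) (by simp)
    obtain ⟨w, hw1, hw⟩ := (isCompact_sphere (0 : κ → E) 1).ultrafilter_le_nhds (l.map Prod.snd) (by
      rw [Ultrafilter.coe_map, le_principal_iff]
      refine Filter.mem_map.mpr ((hl 1 one_pos).mono fun z hz ↦ ?_)
      exact mem_sphere_zero_iff_norm.mpr hz.2.1)
    have hq' : Tendsto (fun z : M × (κ → E) ↦ z.1) l (𝓝 q) := hq
    have hw' : Tendsto (fun z : M × (κ → E) ↦ z.2) l (𝓝 w) := hw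
    have h1 (i : κ) : p i q (w i) = w i := by
      have h := (hq'.prodMk_nhds ((tendsto_pi_nhds.mp hw') i))
      exact (hcl i).mem_of_tendsto h ((hl 1 one_pos).mono fun z hz ↦ hz.1 i)
    have h2 : ∑ i, w i = 0 := by
      have h : Tendsto (fun z : M × (κ → E) ↦ ∑ i, z.2 i) l (𝓝 (∑ i, w i)) :=
        tendsto_finsetSum _ fun i _ ↦ (tendsto_pi_nhds.mp hw') i
      refine tendsto_nhds_unique h ?_
      rw [tendsto_zero_iff_norm_tendsto_zero]
      refine tendsto_order.mpr ⟨fun a ha ↦ Eventually.of_forall fun z ↦ ha.trans_le (norm_nonneg _),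
        fun a ha ↦ (hl a ha).mono fun z hz ↦ hz.2.2⟩
    have h3 : w = 0 := by
      funext j
      have h := congrArg (p j q) h2
      rw [map_sum, map_zero, Finset.sum_eq_single j, h1] at h
      · exact h
      · intro i _ hij
        rw [← h1 i]
        exact congrArg (fun A : E →L[ℝ] E ↦ A (w i)) (hne j i q hij.symm)
      · simp
    rw [h3] at hw1
    simp at hw1
  refine ⟨r, hr, fun x v hv ↦ ?_⟩
  by_contra! hlt
  have hv0 : ‖v‖ ≠ 0 := fun h0 ↦ by
    rw [h0, mul_zero] at hlt
    exact absurd hlt (norm_nonneg _).not_gt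
  refine H (x, ‖v‖⁻¹ • v) ⟨fun i ↦ ?_, ?_, ?_⟩
  · change p i x (‖v‖⁻¹ • v i) = ‖v‖⁻¹ • v i
    rw [map_smul, hv]
  · change ‖‖v‖⁻¹ • v‖ = 1
    rw [norm_smul, norm_inv, norm_norm, inv_mul_cancel₀ hv0]
  · change ‖∑ i, ‖v‖⁻¹ • v i‖ < r
    rw [← Finset.smul_sum, norm_smul, norm_inv, norm_norm, inv_mul_lt_iff₀ (by positivity), mul_comm]
    exact hlt

/-- The projections of a direct sum decomposition into closed families of subspaces are
continuous. -/
theorem continuous_of_isClosed_range [CompactSpace M] [FiniteDimensional ℝ E] {κ : Type*}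
    [Fintype κ] [DecidableEq κ] {p : κ → M → E →L[ℝ] E} (hidem : ∀ i x, p i x * p i x = p i x)
    (hne : ∀ i j x, i ≠ j → p i x * p j x = 0) (hsum : ∀ x, ∑ i, p i x = 1)
    (hcl : ∀ i, IsClosed {z : M × E | p i z.1 z.2 = z.2}) (i : κ) : Continuous (p i) := by
  obtain ⟨r, hr, H⟩ := exists_pos_mul_norm_le_norm_sum hne hcl
  have hid (j : κ) (x : M) (V : E) : p j x (p j x V) = p j x V :=
    congrArg (fun A : E →L[ℝ] E ↦ A V) (hidem j x)
  have hsumV (x : M) (V : E) : ∑ j, p j x V = V := by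
    have := congrArg (fun A : E →L[ℝ] E ↦ A V) (hsum x)
    simpa using this
  refine continuous_clm_apply.mpr fun V ↦ continuous_iff_ultrafilter.mpr fun q l hl ↦ ?_
  obtain ⟨w, -, hw⟩ := (isCompact_closedBall (0 : κ → E) (r⁻¹ * ‖V‖)).ultrafilter_le_nhds
    (l.map fun x j ↦ p j x V) (by
      rw [Ultrafilter.coe_map, le_principal_iff]
      refine Filter.mem_map.mpr (Filter.univ_mem' fun x ↦ ?_)
      have h := H x (fun j ↦ p j x V) fun j ↦ hid j x V
      rw [hsumV] at h
      change (fun j ↦ p j x V) ∈ Metric.closedBall (0 : κ → E) (r⁻¹ * ‖V‖)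
      rw [mem_closedBall_zero_iff, ← div_eq_inv_mul, le_div_iff₀' hr]
      exact h)
  have hw' (j : κ) : Tendsto (fun x ↦ p j x V) l (𝓝 (w j)) :=
    (tendsto_pi_nhds.mp (show Tendsto (fun x j ↦ p j x V) l (𝓝 w) from hw)) j
  have h1 (j : κ) : p j q (w j) = w j :=
    (hcl j).mem_of_tendsto ((show Tendsto (fun x ↦ x) l (𝓝 q) from hl).prodMk_nhds (hw' j))
      (Filter.Eventually.of_forall fun x ↦ hid j x V)
  have h2 : ∑ j, w j = V := by
    refine tendsto_nhds_unique (tendsto_finsetSum _ fun j _ ↦ hw' j) ?_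
    simp only [hsumV]
    exact tendsto_const_nhds
  have h3 : p i q V = w i := by
    have h := congrArg (p i q) h2
    rw [map_sum, Finset.sum_eq_single i, h1] at h
    · exact h.symm
    · intro j _ hij
      rw [← h1 j]
      exact congrArg (fun A : E →L[ℝ] E ↦ A (w j)) (hne i j q hij.symm)
    · simp
  change Tendsto (fun x ↦ p i x V) l (𝓝 (p i q V))
  rw [h3]
  exact hw' i

theorem norm_nonpos_of_forall_pow_le {κ K α β x : ℝ} (hκ : 0 < κ) (hα : 0 < α) (hαβ : α < β)
    (h : ∀ n : ℕ, κ * β ^ n * x ≤ K * α ^ n) : x ≤ 0 := by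
  have hβ : 0 < β := hα.trans hαβ
  have h1 : Tendsto (fun n : ℕ ↦ κ⁻¹ * K * (α / β) ^ n) atTop (𝓝 (κ⁻¹ * K * 0)) :=
    (tendsto_pow_atTop_nhds_zero_of_lt_one (by positivity)
      ((div_lt_one hβ).mpr hαβ)).const_mul _
  rw [mul_zero] at h1
  refine ge_of_tendsto' h1 fun n ↦ ?_
  have h2 := h n
  rw [div_pow, mul_assoc, ← mul_div_assoc, ← div_eq_inv_mul, div_div, le_div_iff₀ (by positivity)]
  linarith

/-- Both $V$ and $V-W$ grow at most at rate $\alpha$, hence so does $W$. A nonzero $W$ would grow at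
least at the larger rate $\beta$. -/
theorem eq_zero_of_growth {L : ℕ → E →L[ℝ] E} {V W : E} {κ K K' α β : ℝ} (hκ : 0 < κ) (hα : 0 < α)
    (hαβ : α < β) (hV : ∀ n, ‖L n V‖ ≤ K * α ^ n) (hd : ∀ n, ‖L n (V - W)‖ ≤ K' * α ^ n)
    (hW : ∀ n, κ * β ^ n * ‖W‖ ≤ ‖L n W‖) : W = 0 := by
  refine norm_le_zero_iff.mp (norm_nonpos_of_forall_pow_le (K := K + K') hκ hα hαβ fun n ↦ ?_)
  refine (hW n).trans ?_
  have h1 : L n W = L n V - L n (V - W) := by rw [← map_sub, sub_sub_cancel]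
  rw [h1, add_mul]
  exact (norm_sub_le _ _).trans (add_le_add (hV n) (hd n))

/-- If the pieces of a decomposition grow at three different rates, the slowest one is closed. -/
theorem isClosed_slowest {T : C(M, E →L[ℝ] E)} {p₀ p₁ p₂ : M → E →L[ℝ] E}
    {L : ℕ → C(M, E →L[ℝ] E)} {a b b' c κ K : ℝ}
    (hsum : ∀ x, p₀ x + p₁ x + p₂ x = T x) (h00 : ∀ x, p₀ x * p₀ x = p₀ x)
    (h10 : ∀ x, p₁ x * p₀ x = 0) (h20 : ∀ x, p₂ x * p₀ x = 0) (hκ : 0 < κ)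
    (ha : 0 < a) (hab : a < b) (hbb' : b ≤ b') (hbc : b' < c)
    (h₀ : ∀ x V, p₀ x V = V → ∀ n, ‖L n x V‖ ≤ K * a ^ n * ‖V‖)
    (h₁ : ∀ x V n, κ * b ^ n * ‖p₁ x V‖ ≤ ‖L n x (p₁ x V)‖)
    (h₁' : ∀ x V n, ‖L n x (p₁ x V)‖ ≤ K * b' ^ n * ‖p₁ x V‖)
    (h₂ : ∀ x V n, κ * c ^ n * ‖p₂ x V‖ ≤ ‖L n x (p₂ x V)‖) :
    IsClosed {z : M × E | p₀ z.1 z.2 = z.2} := by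
  have hK (x : M) (V : E) : 0 ≤ K * ‖p₀ x V‖ ∧ 0 ≤ K * ‖p₁ x V‖ := by
    constructor
    · have := (norm_nonneg _).trans
        (h₀ x (p₀ x V) (congrArg (fun A : E →L[ℝ] E ↦ A V) (h00 x)) 0)
      simpa using this
    · simpa using (norm_nonneg _).trans (h₁' x V 0)
  -- A tangent vector lies in the slowest piece exactly if all its iterates obey the slow bound. The
  -- right-hand side is closed without continuity of the projections. For the converse the fastest
  -- component is eliminated first, then the middle one.
  have hset : {z : M × E | p₀ z.1 z.2 = z.2} = {z : M × E | T z.1 z.2 = z.2} ∩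
      ⋂ n, {z : M × E | ‖L n z.1 z.2‖ ≤ K * a ^ n * ‖z.2‖} := by
    ext ⟨x, V⟩
    simp only [mem_ofPred_eq, mem_inter_iff, mem_iInter]
    have hsumV : p₀ x V + p₁ x V + p₂ x V = T x V := congrArg (fun A : E →L[ℝ] E ↦ A V) (hsum x)
    constructor
    · intro h
      refine ⟨?_, h₀ x V h⟩
      have h1 : p₁ x (p₀ x V) = 0 := congrArg (fun A : E →L[ℝ] E ↦ A V) (h10 x)
      have h2 : p₂ x (p₀ x V) = 0 := congrArg (fun A : E →L[ℝ] E ↦ A V) (h20 x)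
      rw [h] at h1 h2
      rw [← hsumV, h1, h2, h, add_zero, add_zero]
    · rintro ⟨hT, hn⟩
      rw [hT] at hsumV
      have hp0 : p₀ x (p₀ x V) = p₀ x V := congrArg (fun A : E →L[ℝ] E ↦ A V) (h00 x)
      have hb : 0 < b := ha.trans hab
      have hb' : 0 < b' := hb.trans_le hbb'
      have g0 (n : ℕ) : ‖L n x (p₀ x V)‖ ≤ K * ‖p₀ x V‖ * a ^ n := by
        rw [mul_right_comm]
        exact h₀ x _ hp0 n
      have gV (n : ℕ) : ‖L n x V‖ ≤ |K| * ‖V‖ * a ^ n := by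
        rw [mul_right_comm]
        refine (hn n).trans ?_
        gcongr
        exact le_abs_self K
      have e2 : p₂ x V = 0 := by
        refine eq_zero_of_growth (L := fun n ↦ L n x) (V := V) (K := |K| * ‖V‖)
          (K' := K * ‖p₀ x V‖ + K * ‖p₁ x V‖) hκ hb' hbc (fun n ↦ ?_) (fun n ↦ ?_) (h₂ x V)
        · refine (gV n).trans ?_
          gcongr
          exact hab.le.trans hbb'
        · have h1 : V - p₂ x V = p₀ x V + p₁ x V := by
            rw [sub_eq_iff_eq_add, hsumV]
          rw [h1, map_add, add_mul]
          refine (norm_add_le _ _).trans (add_le_add ((g0 n).trans ?_) ?_)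
          · refine mul_le_mul_of_nonneg_left ?_ (hK x V).1
            gcongr
            exact hab.le.trans hbb'
          · rw [mul_right_comm]
            exact h₁' x V n
      rw [e2, add_zero] at hsumV
      have e1 : p₁ x V = 0 := by
        refine eq_zero_of_growth (L := fun n ↦ L n x) (V := V) (K := |K| * ‖V‖)
          (K' := K * ‖p₀ x V‖) hκ ha hab gV (fun n ↦ ?_) (h₁ x V)
        have h1 : V - p₁ x V = p₀ x V := by
          rw [sub_eq_iff_eq_add, hsumV]
        rw [h1]
        exact g0 n
      rw [e1, add_zero] at hsumV
      exact hsumV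
  rw [hset]
  have hc (A : C(M, E →L[ℝ] E)) : Continuous fun z : M × E ↦ A z.1 z.2 :=
    (A.continuous.comp continuous_fst).clm_apply continuous_snd
  refine (isClosed_eq (hc T) continuous_snd).inter (isClosed_iInter fun n ↦ ?_)
  exact isClosed_le (hc (L n)).norm (continuous_const.mul continuous_snd.norm)

/-- If the pieces of a decomposition grow at three different rates, the intermediate one is
closed. -/
theorem isClosed_intermediate {T : C(M, E →L[ℝ] E)} {p₀ p₁ p₂ : M → E →L[ℝ] E}
    {L L' : ℕ → C(M, E →L[ℝ] E)} {a b c a' b' κ K : ℝ}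
    (hsum : ∀ x, p₀ x + p₁ x + p₂ x = T x) (h11 : ∀ x, p₁ x * p₁ x = p₁ x)
    (h01 : ∀ x, p₀ x * p₁ x = 0) (h21 : ∀ x, p₂ x * p₁ x = 0) (hκ : 0 < κ)
    (ha : 0 < a) (hab : a < b) (hbc : b < c) (hb' : 0 < b') (hba' : b' < a')
    (h₀ : ∀ x V n, ‖L n x (p₀ x V)‖ ≤ K * a ^ n * ‖p₀ x V‖)
    (h₁ : ∀ x V, p₁ x V = V → ∀ n, ‖L n x V‖ ≤ K * b ^ n * ‖V‖)
    (h₂ : ∀ x V n, κ * c ^ n * ‖p₂ x V‖ ≤ ‖L n x (p₂ x V)‖)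
    (h₀' : ∀ x V n, κ * a' ^ n * ‖p₀ x V‖ ≤ ‖L' n x (p₀ x V)‖)
    (h₁' : ∀ x V, p₁ x V = V → ∀ n, ‖L' n x V‖ ≤ K * b' ^ n * ‖V‖) :
    IsClosed {z : M × E | p₁ z.1 z.2 = z.2} := by
  -- The forward bounds exclude a component in the fast piece and the backward bounds one in the
  -- slow piece. Neither family alone isolates the middle piece.
  have hset : {z : M × E | p₁ z.1 z.2 = z.2} = ({z : M × E | T z.1 z.2 = z.2} ∩
      ⋂ n, {z : M × E | ‖L n z.1 z.2‖ ≤ K * b ^ n * ‖z.2‖}) ∩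
      ⋂ n, {z : M × E | ‖L' n z.1 z.2‖ ≤ K * b' ^ n * ‖z.2‖} := by
    ext ⟨x, V⟩
    simp only [mem_ofPred_eq, mem_inter_iff, mem_iInter]
    have hsumV : p₀ x V + p₁ x V + p₂ x V = T x V := congrArg (fun A : E →L[ℝ] E ↦ A V) (hsum x)
    constructor
    · intro h
      refine ⟨⟨?_, h₁ x V h⟩, h₁' x V h⟩
      have h1 : p₀ x (p₁ x V) = 0 := congrArg (fun A : E →L[ℝ] E ↦ A V) (h01 x)
      have h2 : p₂ x (p₁ x V) = 0 := congrArg (fun A : E →L[ℝ] E ↦ A V) (h21 x)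
      rw [h] at h1 h2
      rw [← hsumV, h1, h2, h, add_zero, zero_add]
    · rintro ⟨⟨hT, hn⟩, hn'⟩
      rw [hT] at hsumV
      have hp1 : p₁ x (p₁ x V) = p₁ x V := congrArg (fun A : E →L[ℝ] E ↦ A V) (h11 x)
      have hb : 0 < b := ha.trans hab
      have e2 : p₂ x V = 0 := by
        refine eq_zero_of_growth (L := fun n ↦ L n x) (V := V) (K := K * ‖V‖)
          (K' := |K| * ‖p₀ x V‖ + K * ‖p₁ x V‖) hκ hb hbc (fun n ↦ ?_) (fun n ↦ ?_) (h₂ x V)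
        · rw [mul_right_comm]
          exact hn n
        · have h1 : V - p₂ x V = p₀ x V + p₁ x V := by
            rw [sub_eq_iff_eq_add, hsumV]
          rw [h1, map_add, add_mul]
          refine (norm_add_le _ _).trans (add_le_add ((h₀ x V n).trans ?_) ?_)
          · rw [mul_right_comm]
            gcongr
            exact le_abs_self K
          · rw [mul_right_comm]
            exact h₁ x _ hp1 n
      rw [e2, add_zero] at hsumV
      have e1 : p₀ x V = 0 := by
        refine eq_zero_of_growth (L := fun n ↦ L' n x) (V := V) (K := K * ‖V‖)
          (K' := K * ‖p₁ x V‖) hκ hb' hba' (fun n ↦ ?_) (fun n ↦ ?_) (h₀' x V)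
        · rw [mul_right_comm]
          exact hn' n
        · have h1 : V - p₀ x V = p₁ x V := by
            rw [sub_eq_iff_eq_add', hsumV]
          rw [h1, mul_right_comm]
          exact h₁' x _ hp1 n
      rw [e1, zero_add] at hsumV
      exact hsumV
  rw [hset]
  have hc (A : C(M, E →L[ℝ] E)) : Continuous fun z : M × E ↦ A z.1 z.2 :=
    (A.continuous.comp continuous_fst).clm_apply continuous_snd
  refine ((isClosed_eq (hc T) continuous_snd).inter (isClosed_iInter fun n ↦ ?_)).inter
    (isClosed_iInter fun n ↦ ?_)
  · exact isClosed_le (hc (L n)).norm (continuous_const.mul continuous_snd.norm)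
  · exact isClosed_le (hc (L' n)).norm (continuous_const.mul continuous_snd.norm)

end Splitting

/-! ### Linear cocycles with three rates -/

section HyperbolicCocycle

set_option maxSynthPendingDepth 3

open Set Filter

variable {M : Type*} [TopologicalSpace M]
variable {E : Type*} [NormedAddCommGroup E] [NormedSpace ℝ E]

/-- A linear cocycle over `f`, with inverse `D'` on the fixed spaces of `T`, that respects a
splitting into three subbundles and grows on them at three different rates. -/
structure IsHyperbolicCocycle [CompactSpace M] (f : M ≃ₜ M) (T D D' : C(M, E →L[ℝ] E))
    (p : Fin 3 → M → E →L[ℝ] E) : Prop where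
  mul_self : ∀ i x, p i x * p i x = p i x
  mul_ne : ∀ i j x, i ≠ j → p i x * p j x = 0
  sum_eq : ∀ x, p 0 x + p 1 x + p 2 x = T x
  comm : ∀ i x, p i (f x) * D x = D x * p i x
  comm' : ∀ i x, p i x * D' x = D' x * p i (f x)
  mul_right : ∀ x, T (f x) * D x = D x
  left_inv : ∀ x, D' x * D x = T x
  right_inv : ∀ x, D x * D' x = T (f x)
  rates : ∃ l l' μ' μ K : ℝ, 0 < l ∧ l < 1 ∧ 1 < μ ∧ l < l' ∧ l' ≤ μ' ∧ μ' < μ ∧ 0 < K ∧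
    ∀ n x V,
      (p 0 x V = V → ‖forwardCocycle (f : C(M, M)) D n x V‖ ≤ K * l ^ n * ‖V‖) ∧
      (p 1 x V = V → K⁻¹ * l' ^ n * ‖V‖ ≤ ‖forwardCocycle (f : C(M, M)) D n x V‖ ∧
        ‖forwardCocycle (f : C(M, M)) D n x V‖ ≤ K * μ' ^ n * ‖V‖) ∧
      (p 2 x V = V → K⁻¹ * μ ^ n * ‖V‖ ≤ ‖forwardCocycle (f : C(M, M)) D n x V‖)

namespace IsHyperbolicCocycle

variable [CompactSpace M] {f : M ≃ₜ M} {T D D' : C(M, E →L[ℝ] E)} {p : Fin 3 → M → E →L[ℝ] E}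

theorem apply_apply (h : IsHyperbolicCocycle f T D D' p) (i : Fin 3) (x : M) (V : E) :
    p i x (p i x V) = p i x V :=
  congrArg (fun A : E →L[ℝ] E ↦ A V) (h.mul_self i x)

theorem mul_eq (h : IsHyperbolicCocycle f T D D' p) (i : Fin 3) (x : M) : T x * p i x = p i x := by
  rw [← h.sum_eq, add_mul, add_mul]
  fin_cases i
  · change p 0 x * p 0 x + p 1 x * p 0 x + p 2 x * p 0 x = p 0 x
    rw [h.mul_self, h.mul_ne 1 0 x (by decide), h.mul_ne 2 0 x (by decide), add_zero, add_zero]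
  · change p 0 x * p 1 x + p 1 x * p 1 x + p 2 x * p 1 x = p 1 x
    rw [h.mul_self, h.mul_ne 0 1 x (by decide), h.mul_ne 2 1 x (by decide), zero_add, add_zero]
  · change p 0 x * p 2 x + p 1 x * p 2 x + p 2 x * p 2 x = p 2 x
    rw [h.mul_self, h.mul_ne 0 2 x (by decide), h.mul_ne 1 2 x (by decide), zero_add, zero_add]

theorem eq_mul (h : IsHyperbolicCocycle f T D D' p) (i : Fin 3) (x : M) : p i x * T x = p i x := by
  rw [← h.sum_eq, mul_add, mul_add]
  fin_cases i
  · change p 0 x * p 0 x + p 0 x * p 1 x + p 0 x * p 2 x = p 0 x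
    rw [h.mul_self, h.mul_ne 0 1 x (by decide), h.mul_ne 0 2 x (by decide), add_zero, add_zero]
  · change p 1 x * p 0 x + p 1 x * p 1 x + p 1 x * p 2 x = p 1 x
    rw [h.mul_self, h.mul_ne 1 0 x (by decide), h.mul_ne 1 2 x (by decide), zero_add, add_zero]
  · change p 2 x * p 0 x + p 2 x * p 1 x + p 2 x * p 2 x = p 2 x
    rw [h.mul_self, h.mul_ne 2 0 x (by decide), h.mul_ne 2 1 x (by decide), zero_add, zero_add]

theorem mul_T (h : IsHyperbolicCocycle f T D D' p) (x : M) : T x * T x = T x := by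
  nth_rewrite 2 [← h.sum_eq]
  rw [mul_add, mul_add, h.mul_eq, h.mul_eq, h.mul_eq, h.sum_eq]

/-- Since `D'` inverts `D` only on the tangent spaces, inversion of the iterated cocycles is
asserted on the ranges of the projections, which `D'` preserves. -/
theorem backwardCocycle_spec (h : IsHyperbolicCocycle f T D D' p) (i : Fin 3) (n : ℕ) (y : M)
    {V : E} (hV : p i (f^[n] y) V = V) :
    p i y (backwardCocycle (f : C(M, M)) D' n y V) = backwardCocycle (f : C(M, M)) D' n y V ∧
    forwardCocycle (f : C(M, M)) D n y (backwardCocycle (f : C(M, M)) D' n y V) = V := by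
  induction n generalizing y with
  | zero => exact ⟨hV, rfl⟩
  | succ n ih =>
    obtain ⟨h1, h2⟩ := ih (f y) hV
    set W := backwardCocycle (f : C(M, M)) D' n (f y) V
    change p i y (D' y W) = D' y W ∧ forwardCocycle (f : C(M, M)) D n (f y) (D y (D' y W)) = V
    have h3 : p i y (D' y W) = D' y (p i (f y) W) :=
      congrArg (fun A : E →L[ℝ] E ↦ A W) (h.comm' i y)
    have h4 : D y (D' y W) = T (f y) W := congrArg (fun A : E →L[ℝ] E ↦ A W) (h.right_inv y)
    have h5 : T (f y) (p i (f y) W) = p i (f y) W :=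
      congrArg (fun A : E →L[ℝ] E ↦ A W) (h.mul_eq i (f y))
    rw [h1] at h3 h5
    rw [h3, h4, h5]
    exact ⟨rfl, h2⟩

/-- The iterates of the inverse cocycle. -/
def inverseCocycle (f : M ≃ₜ M) (D' : C(M, E →L[ℝ] E)) (n : ℕ) : C(M, E →L[ℝ] E) :=
  (backwardCocycle (f : C(M, M)) D' n).comp ⟨f.symm^[n], f.symm.continuous.iterate n⟩

theorem inverseCocycle_spec (h : IsHyperbolicCocycle f T D D' p) (i : Fin 3) (n : ℕ) (x : M)
    {V : E} (hV : p i x V = V) :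
    p i (f.symm^[n] x) (inverseCocycle f D' n x V) = inverseCocycle f D' n x V ∧
    forwardCocycle (f : C(M, M)) D n (f.symm^[n] x) (inverseCocycle f D' n x V) = V := by
  refine h.backwardCocycle_spec i n (f.symm^[n] x) ?_
  have : f^[n] (f.symm^[n] x) = x :=
    Function.RightInverse.iterate (f := f) (g := f.symm) f.apply_symm_apply n x
  rwa [this]

/-- The stable piece is the slowest in forward time, the unstable one the slowest in backward time,
and the center is cut out by both directions together. -/
theorem isClosed_range [FiniteDimensional ℝ E] (h : IsHyperbolicCocycle f T D D' p) (i : Fin 3) :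
    IsClosed {z : M × E | p i z.1 z.2 = z.2} := by
  obtain ⟨l, l', μ', μ, K, hl, hl1, hμ1, hll, hlμ, hμμ, hK, H⟩ := h.rates
  have hl' := hl.trans hll
  have hμ' := hl'.trans_le hlμ
  have hμ := hμ'.trans hμμ
  have hKi : 0 < K⁻¹ := by positivity
  -- The forward estimates, applied at a preimage, become backward estimates with inverted rates and
  -- the same constant.
  have k₀ (x : M) (V : E) (hV : p 0 x V = V) (n : ℕ) :
      K⁻¹ * l⁻¹ ^ n * ‖V‖ ≤ ‖inverseCocycle f D' n x V‖ := by
    obtain ⟨h1, h2⟩ := h.inverseCocycle_spec 0 n x hV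
    have h3 := (H n _ _).1 h1
    rw [h2] at h3
    rwa [inv_pow, ← mul_inv, inv_mul_le_iff₀ (by positivity)]
  have k₁ (x : M) (V : E) (hV : p 1 x V = V) (n : ℕ) :
      K⁻¹ * μ'⁻¹ ^ n * ‖V‖ ≤ ‖inverseCocycle f D' n x V‖ ∧
      ‖inverseCocycle f D' n x V‖ ≤ K * l'⁻¹ ^ n * ‖V‖ := by
    obtain ⟨h1, h2⟩ := h.inverseCocycle_spec 1 n x hV
    have h3 := (H n _ _).2.1 h1
    rw [h2] at h3
    refine ⟨by rw [inv_pow, ← mul_inv, inv_mul_le_iff₀ (by positivity)]; exact h3.2, ?_⟩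
    have h4 := h3.1
    rwa [← inv_inv (K⁻¹ * l' ^ n), inv_mul_le_iff₀ (by positivity), mul_inv, inv_inv, ← inv_pow]
      at h4
  have k₂ (x : M) (V : E) (hV : p 2 x V = V) (n : ℕ) :
      ‖inverseCocycle f D' n x V‖ ≤ K * μ⁻¹ ^ n * ‖V‖ := by
    obtain ⟨h1, h2⟩ := h.inverseCocycle_spec 2 n x hV
    have h3 := (H n _ _).2.2 h1
    rw [h2] at h3
    rwa [← inv_inv (K⁻¹ * μ ^ n), inv_mul_le_iff₀ (by positivity), mul_inv, inv_inv, ← inv_pow]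
      at h3
  have i1 : l'⁻¹ < l⁻¹ := inv_strictAnti₀ hl hll
  have i2 : μ'⁻¹ ≤ l'⁻¹ := inv_anti₀ hl' hlμ
  have i3 : μ⁻¹ < μ'⁻¹ := inv_strictAnti₀ hμ' hμμ
  fin_cases i
  · exact isClosed_slowest h.sum_eq (h.mul_self 0) (fun x ↦ h.mul_ne 1 0 x (by decide))
      (fun x ↦ h.mul_ne 2 0 x (by decide)) hKi hl hll hlμ hμμ (fun x V hV n ↦ (H n x V).1 hV)
      (fun x V n ↦ ((H n x _).2.1 (h.apply_apply 1 x V)).1)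
      (fun x V n ↦ ((H n x _).2.1 (h.apply_apply 1 x V)).2)
      (fun x V n ↦ (H n x _).2.2 (h.apply_apply 2 x V))
  · exact isClosed_intermediate (L := forwardCocycle (f : C(M, M)) D) (L' := inverseCocycle f D')
      h.sum_eq (h.mul_self 1) (fun x ↦ h.mul_ne 0 1 x (by decide))
      (fun x ↦ h.mul_ne 2 1 x (by decide)) hKi hl (hll.trans_le hlμ) hμμ (by positivity) i1
      (fun x V n ↦ (H n x _).1 (h.apply_apply 0 x V))
      (fun x V hV n ↦ ((H n x _).2.1 hV).2)
      (fun x V n ↦ (H n x _).2.2 (h.apply_apply 2 x V))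
      (fun x V n ↦ k₀ x _ (h.apply_apply 0 x V) n)
      (fun x V hV n ↦ (k₁ x _ hV n).2)
  · refine isClosed_slowest (T := T) (p₁ := p 1) (p₂ := p 0) (L := inverseCocycle f D')
      (fun x ↦ ?_) (h.mul_self 2) (fun x ↦ h.mul_ne 1 2 x (by decide))
      (fun x ↦ h.mul_ne 0 2 x (by decide)) hKi (a := μ⁻¹) (by positivity) i3 i2 i1
      (fun x V hV n ↦ k₂ x V hV n)
      (fun x V n ↦ (k₁ x _ (h.apply_apply 1 x V) n).1)
      (fun x V n ↦ (k₁ x _ (h.apply_apply 1 x V) n).2)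
      (fun x V n ↦ k₀ x _ (h.apply_apply 0 x V) n)
    rw [← h.sum_eq]
    change p 2 x + p 1 x + p 0 x = _
    abel

theorem continuous_proj [FiniteDimensional ℝ E] (h : IsHyperbolicCocycle f T D D' p) (i : Fin 3) :
    Continuous (p i) := by
  -- The three projections add up to `T` and not to the identity. The complement $1-T$ serves as a
  -- fourth piece; it is continuous, so its range is closed.
  refine continuous_of_isClosed_range (κ := Option (Fin 3))
    (p := fun j x ↦ j.elim (1 - T x) fun i ↦ p i x) ?_ ?_ (fun x ↦ ?_) ?_ (some i)
  · rintro (_ | j) x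
    · change (1 - T x) * (1 - T x) = 1 - T x
      rw [mul_sub, sub_mul (1 : E →L[ℝ] E), sub_mul, h.mul_T]
      simp
    · exact h.mul_self j x
  · rintro (_ | j) (_ | k) x hjk
    · exact absurd rfl hjk
    · change (1 - T x) * p k x = 0
      rw [sub_mul, h.mul_eq, one_mul, sub_self]
    · change p j x * (1 - T x) = 0
      rw [mul_sub, h.eq_mul, mul_one, sub_self]
    · exact h.mul_ne j k x fun h ↦ hjk (congrArg some h)
  · rw [Fintype.sum_option, Fin.sum_univ_three]
    change 1 - T x + (p 0 x + p 1 x + p 2 x) = 1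
    rw [h.sum_eq, sub_add_cancel]
  · rintro (_ | j)
    · refine isClosed_eq ?_ continuous_snd
      change Continuous fun z : M × E ↦ (1 - T z.1) z.2
      exact (continuous_const.sub (T.continuous.comp continuous_fst)).clm_apply continuous_snd
    · exact h.isClosed_range j

/-- The projections of a hyperbolic cocycle, as continuous maps. -/
def proj [FiniteDimensional ℝ E] (h : IsHyperbolicCocycle f T D D' p) (i : Fin 3) :
    C(M, E →L[ℝ] E) := ⟨p i, h.continuous_proj i⟩

theorem forwardCocycle_restrict [FiniteDimensional ℝ E] (h : IsHyperbolicCocycle f T D D' p) (i : Fin 3) (n : ℕ) (x : M)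
    {V : E} (hV : p i x V = V) :
    forwardCocycle (f : C(M, M)) (graphRestrict (pushTransport (h.proj i) D) (f : C(M, M))) n x V
      = forwardCocycle (f : C(M, M)) D n x V := by
  induction n generalizing x V with
  | zero => rfl
  | succ n ih =>
    have h1 : p i (f x) (D x V) = D x V := by
      have h2 : p i (f x) (D x V) = D x (p i x V) :=
        congrArg (fun A : E →L[ℝ] E ↦ A V) (h.comm i x)
      rwa [hV] at h2
    change forwardCocycle (f : C(M, M)) _ n (f x) (p i (f x) (D x (p i x V))) = _
    rw [hV, h1, ih (f x) h1]
    rfl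

theorem backwardCocycle_restrict [FiniteDimensional ℝ E] (h : IsHyperbolicCocycle f T D D' p) (i : Fin 3) (n : ℕ) (x : M)
    {V : E} (hV : p i (f^[n] x) V = V) :
    backwardCocycle (f : C(M, M)) (graphRestrict (pullTransport (h.proj i) D') (f : C(M, M))) n x V
      = backwardCocycle (f : C(M, M)) D' n x V := by
  induction n generalizing x with
  | zero => rfl
  | succ n ih =>
    change p i x (D' x (p i (f x) (backwardCocycle (f : C(M, M)) _ n (f x) V))) = _
    rw [ih (f x) hV, (h.backwardCocycle_spec i n (f x) hV).1]
    exact (h.backwardCocycle_spec i (n + 1) x hV).1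

theorem exists_norm_forwardCocycle_lt [FiniteDimensional ℝ E] (h : IsHyperbolicCocycle f T D D' p) :
    ∃ n, ‖forwardCocycle (f : C(M, M))
      (graphRestrict (pushTransport (h.proj 0) D) (f : C(M, M))) n‖ < 1 / 2 := by
  obtain ⟨l, l', μ', μ, K, hl, hl1, hμ1, hll, hlμ, hμμ, hK, H⟩ := h.rates
  -- The exponent $n+1$ is needed because the cocycle of length zero is the identity on all of `E`.
  -- With at least one factor the vector may be replaced by its projection.
  have h1 : Tendsto (fun n : ℕ ↦ K * ‖h.proj 0‖ * l ^ (n + 1)) atTop (𝓝 (K * ‖h.proj 0‖ * 0)) :=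
    ((tendsto_pow_atTop_nhds_zero_of_lt_one hl.le hl1).comp (tendsto_add_atTop_nat 1)).const_mul _
  rw [mul_zero] at h1
  obtain ⟨n, hn⟩ := (h1.eventually_lt_const (show (0 : ℝ) < 1 / 2 by norm_num)).exists
  refine ⟨n + 1, lt_of_le_of_lt ?_ hn⟩
  have h0 : 0 ≤ ‖h.proj 0‖ := ContinuousMap.zero_le_norm _
  refine (ContinuousMap.norm_le _ (by positivity)).mpr fun x ↦ ?_
  refine ContinuousLinearMap.opNorm_le_bound _ (by positivity) fun V ↦ ?_
  have e1 : forwardCocycle (f : C(M, M))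
      (graphRestrict (pushTransport (h.proj 0) D) (f : C(M, M))) (n + 1) x V
      = forwardCocycle (f : C(M, M)) D (n + 1) x (p 0 x V) := by
    rw [← h.forwardCocycle_restrict 0 (n + 1) x (h.apply_apply 0 x V)]
    change forwardCocycle (f : C(M, M)) _ n (f x) (p 0 (f x) (D x (p 0 x V)))
      = forwardCocycle (f : C(M, M)) _ n (f x) (p 0 (f x) (D x (p 0 x (p 0 x V))))
    rw [h.apply_apply]
  rw [e1]
  refine ((H _ _ _).1 (h.apply_apply 0 x V)).trans ?_
  have e2 : ‖p 0 x V‖ ≤ ‖h.proj 0‖ * ‖V‖ :=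
    ContinuousLinearMap.le_of_opNorm_le _ ((h.proj 0).norm_coe_le_norm x) V
  calc _ ≤ K * l ^ (n + 1) * (‖h.proj 0‖ * ‖V‖) := by gcongr
    _ = _ := by ring

theorem exists_norm_backwardCocycle_lt [FiniteDimensional ℝ E]
    (h : IsHyperbolicCocycle f T D D' p) :
    ∃ n, ‖backwardCocycle (f : C(M, M))
      (graphRestrict (pullTransport (h.proj 2) D') (f : C(M, M))) n‖ < 1 / 2 := by
  obtain ⟨l, l', μ', μ, K, hl, hl1, hμ1, hll, hlμ, hμμ, hK, H⟩ := h.rates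
  have hμ : 0 < μ := one_pos.trans hμ1
  have h1 : Tendsto (fun n : ℕ ↦ K * ‖h.proj 2‖ * μ⁻¹ ^ (n + 1)) atTop (𝓝 (K * ‖h.proj 2‖ * 0)) :=
    ((tendsto_pow_atTop_nhds_zero_of_lt_one (by positivity) (inv_lt_one_of_one_lt₀ hμ1)).comp
      (tendsto_add_atTop_nat 1)).const_mul _
  rw [mul_zero] at h1
  obtain ⟨n, hn⟩ := (h1.eventually_lt_const (show (0 : ℝ) < 1 / 2 by norm_num)).exists
  refine ⟨n + 1, lt_of_le_of_lt ?_ hn⟩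
  have h0 : 0 ≤ ‖h.proj 2‖ := ContinuousMap.zero_le_norm _
  refine (ContinuousMap.norm_le _ (by positivity)).mpr fun x ↦ ?_
  refine ContinuousLinearMap.opNorm_le_bound _ (by positivity) fun V ↦ ?_
  have e0 (n : ℕ) (x : M) : backwardCocycle (f : C(M, M))
      (graphRestrict (pullTransport (h.proj 2) D') (f : C(M, M))) (n + 1) x V
      = backwardCocycle (f : C(M, M)) (graphRestrict (pullTransport (h.proj 2) D') (f : C(M, M)))
        (n + 1) x (p 2 (f^[n + 1] x) V) := by
    induction n generalizing x with
    | zero =>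
      change p 2 x (D' x (p 2 (f x) V)) = p 2 x (D' x (p 2 (f x) (p 2 (f x) V)))
      rw [h.apply_apply]
    | succ n ih =>
      change p 2 x (D' x (p 2 (f x) (backwardCocycle (f : C(M, M)) _ (n + 1) (f x) V))) = _
      rw [ih (f x)]
      rfl
  have hV := h.apply_apply 2 (f^[n + 1] x) V
  rw [e0, h.backwardCocycle_restrict 2 (n + 1) x hV]
  obtain ⟨k1, k2⟩ := h.backwardCocycle_spec 2 (n + 1) x hV
  have k3 := (H (n + 1) x _).2.2 k1
  rw [k2, ← inv_inv (K⁻¹ * μ ^ (n + 1)), inv_mul_le_iff₀ (by positivity), mul_inv, inv_inv,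
    ← inv_pow] at k3
  refine k3.trans ?_
  have e2 : ‖p 2 (f^[n + 1] x) V‖ ≤ ‖h.proj 2‖ * ‖V‖ :=
    ContinuousLinearMap.le_of_opNorm_le _ ((h.proj 2).norm_coe_le_norm _) V
  calc _ ≤ K * μ⁻¹ ^ (n + 1) * (‖h.proj 2‖ * ‖V‖) := by gcongr
    _ = _ := by ring

end IsHyperbolicCocycle

end HyperbolicCocycle

/-! ### The geodesic spray of a metric in coordinates -/

section Spray

set_option maxSynthPendingDepth 3

open ContinuousLinearMap

variable {V : Type*} [NormedAddCommGroup V] [NormedSpace ℝ V]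

/-- The quadratic form `(a, a) ↦ ∂_a g(a, w) - ∂_w g(a, a) / 2`, as a bilinear form with values in
the dual space. -/
def geodesicForm (D : V →L[ℝ] V →L[ℝ] V →L[ℝ] ℝ) : V →L[ℝ] V →L[ℝ] V →L[ℝ] ℝ :=
  D - (1 / 2 : ℝ) •
    (flipₗᵢ ℝ V V ℝ).toContinuousLinearEquiv.toContinuousLinearMap.comp D.flip

theorem geodesicForm_apply (D : V →L[ℝ] V →L[ℝ] V →L[ℝ] ℝ) (a b w : V) :
    geodesicForm D a b w = D a b w - 1 / 2 * D w a b := by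
  simp [geodesicForm]

theorem contDiff_geodesicForm {n : WithTop ℕ∞} :
    ContDiff ℝ n (geodesicForm : (V →L[ℝ] V →L[ℝ] V →L[ℝ] ℝ) → _) := by
  have h1 : ContDiff ℝ n fun D : V →L[ℝ] V →L[ℝ] V →L[ℝ] ℝ ↦
      (flipₗᵢ ℝ V V ℝ).toContinuousLinearEquiv.toContinuousLinearMap.comp D.flip :=
    contDiff_const.clm_comp (flipₗᵢ ℝ V V (V →L[ℝ] ℝ)).toContinuousLinearEquiv.contDiff
  have h2 : ContDiff ℝ n fun D : V →L[ℝ] V →L[ℝ] V →L[ℝ] ℝ ↦ (1 / 2 : ℝ) • D :=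
    ((1 / 2 : ℝ) • ContinuousLinearMap.id ℝ (V →L[ℝ] V →L[ℝ] V →L[ℝ] ℝ)).contDiff
  exact contDiff_id.sub (h2.comp h1)

/-- The coefficients of the geodesic spray of the metric `G`. -/
def sprayCoeff (G : V → V →L[ℝ] V →L[ℝ] ℝ) (y : V) : V →L[ℝ] V →L[ℝ] V :=
  -(compL ℝ V (V →L[ℝ] ℝ) V (inverse (G y))).comp (geodesicForm (fderiv ℝ G y))

theorem sprayCoeff_apply (G : V → V →L[ℝ] V →L[ℝ] ℝ) (y a b : V) :
    sprayCoeff G y a b = -inverse (G y) (geodesicForm (fderiv ℝ G y) a b) := by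
  simp [sprayCoeff]

theorem apply_sprayCoeff {G : V → V →L[ℝ] V →L[ℝ] ℝ} {y : V} (hG : (G y).IsInvertible) (a b : V) :
    G y (sprayCoeff G y a b) = -geodesicForm (fderiv ℝ G y) a b := by
  obtain ⟨e, he⟩ := hG
  rw [sprayCoeff_apply, ← he, inverse_equiv, map_neg]
  simp

theorem contDiffOn_sprayCoeff [CompleteSpace V] {G : V → V →L[ℝ] V →L[ℝ] ℝ} {O : Set V}
    (hO : IsOpen O) (hG : ContDiffOn ℝ 2 G O) (hinv : ∀ y ∈ O, (G y).IsInvertible) :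
    ContDiffOn ℝ 1 (sprayCoeff G) O := by
  refine ContDiffOn.neg ?_
  refine ContDiffOn.clm_comp ?_ ?_
  · refine (compL ℝ V (V →L[ℝ] ℝ) V).contDiff.comp_contDiffOn fun y hy ↦ ?_
    obtain ⟨e, he⟩ := hinv y hy
    have h1 : ContDiffAt ℝ 1 inverse (G y) := he ▸ contDiffAt_map_inverse e
    exact h1.comp_contDiffWithinAt y ((hG.of_le (by norm_num)) y hy)
  · exact contDiff_geodesicForm.comp_contDiffOn (hG.fderiv_of_isOpen hO (by norm_num))

theorem eq_sprayCoeff_iff {G : V → V →L[ℝ] V →L[ℝ] ℝ} {y : V} (hG : (G y).IsInvertible) (z a : V) :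
    z = sprayCoeff G y a a ↔ ∀ w, G y z w + geodesicForm (fderiv ℝ G y) a a w = 0 := by
  constructor
  · rintro rfl w
    rw [apply_sprayCoeff hG]
    simp
  · intro h
    obtain ⟨e, he⟩ := id hG
    have h1 : G y z = G y (sprayCoeff G y a a) := by
      ext w
      rw [apply_sprayCoeff hG]
      have := h w
      simp only [neg_apply]
      linarith
    rw [← he] at h1
    exact e.injective h1

/-- The geodesic equation does not depend on the coordinates. -/
theorem sprayCoeff_change {G H : V → V →L[ℝ] V →L[ℝ] ℝ} {θ : V → V} {y : V}
    (hθ : ContDiffAt ℝ 2 θ y) (hGH : ∀ᶠ x in 𝓝 y, ∀ a b,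
      G x a b = H (θ x) (fderiv ℝ θ x a) (fderiv ℝ θ x b))
    (hG : DifferentiableAt ℝ G y) (hH : DifferentiableAt ℝ H (θ y))
    (hGi : (G y).IsInvertible) (hHi : (H (θ y)).IsInvertible)
    (hHs : ∀ a b, H (θ y) a b = H (θ y) b a)
    (hsurj : Function.Surjective (fderiv ℝ θ y)) (a : V) :
    fderiv ℝ θ y (sprayCoeff G y a a) + fderiv ℝ (fderiv ℝ θ) y a a
      = sprayCoeff H (θ y) (fderiv ℝ θ y a) (fderiv ℝ θ y a) := by
  rw [eq_sprayCoeff_iff hHi]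
  intro w'
  obtain ⟨w, rfl⟩ := hsurj w'
  have hsymm : IsSymmSndFDerivAt ℝ θ y := hθ.isSymmSndFDerivAt (by simp)
  have hθ1 : DifferentiableAt ℝ θ y := hθ.differentiableAt (by norm_num)
  have hθ2 : DifferentiableAt ℝ (fderiv ℝ θ) y :=
    (hθ.fderiv_right (m := 1) (by norm_num)).differentiableAt (by norm_num)
  -- The derivative of the pulled back metric. In the geodesic equation the terms with second
  -- derivatives of `θ` collapse to $H(D^2\theta(a,a),D\theta\,w)$, by the symmetry of $D^2\theta$
  -- and of `H`. This is the transformation rule.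
  have key (c a b : V) : fderiv ℝ G y c a b
      = fderiv ℝ H (θ y) (fderiv ℝ θ y c) (fderiv ℝ θ y a) (fderiv ℝ θ y b)
        + H (θ y) (fderiv ℝ (fderiv ℝ θ) y c a) (fderiv ℝ θ y b)
        + H (θ y) (fderiv ℝ θ y a) (fderiv ℝ (fderiv ℝ θ) y c b) := by
    have h1 : HasFDerivAt (fun x ↦ G x a b) (((fderiv ℝ G y).flip a).flip b) y := by
      have := (hG.hasFDerivAt.clm_apply (hasFDerivAt_const a y)).clm_apply (hasFDerivAt_const b y)
      refine this.congr_fderiv ?_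
      ext c
      simp
    have h2 := hH.hasFDerivAt.comp y hθ1.hasFDerivAt
    have h3 := (h2.clm_apply (hθ2.hasFDerivAt.clm_apply (hasFDerivAt_const a y))).clm_apply
      (hθ2.hasFDerivAt.clm_apply (hasFDerivAt_const b y))
    have h4 := h3.congr_of_eventuallyEq (hGH.mono fun x hx ↦ hx a b)
    have h5 := congrArg (fun A : V →L[ℝ] ℝ ↦ A c) (h1.unique h4)
    simp at h5
    rw [h5]
    ring
  have h1 := (eq_sprayCoeff_iff hGi (sprayCoeff G y a a) a).mp rfl w
  rw [geodesicForm_apply, key, key, hGH.self_of_nhds] at h1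
  rw [geodesicForm_apply, map_add, add_apply]
  have h2 := hsymm a w
  have h3 := hHs (fderiv ℝ (fderiv ℝ θ) y w a) (fderiv ℝ θ y a)
  rw [h2] at h1
  linarith

/-- On the diagonal `geodesicForm` is half of the derivative of the metric, so the geodesic equation
tested against the velocity says that the energy is constant. -/
theorem hasDerivAt_energy {G : V → V →L[ℝ] V →L[ℝ] ℝ} {z : ℝ → V × V} {t : ℝ}
    (hG : DifferentiableAt ℝ G (z t).1) (hGi : (G (z t).1).IsInvertible)
    (hGs : ∀ a b, G (z t).1 a b = G (z t).1 b a)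
    (hz : HasDerivAt z (sprayField (sprayCoeff G) (z t)) t) :
    HasDerivAt (fun s ↦ G (z s).1 (z s).2 (z s).2) 0 t := by
  have h1 := HasDerivAt.prod_fst hz
  have h2 := HasDerivAt.prod_snd hz
  set Q := sprayCoeff G (z t).1 (z t).2 (z t).2 with hQ
  have h3 : HasDerivAt (fun s ↦ G (z s).1) (fderiv ℝ G (z t).1 (z t).2) t :=
    hG.hasFDerivAt.comp_hasDerivAt t h1
  have h4 : HasDerivAt (fun s ↦ G (z s).1 (z s).2)
      (fderiv ℝ G (z t).1 (z t).2 (z t).2 + G (z t).1 Q) t := h3.clm_apply h2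
  have h5 : HasDerivAt (fun s ↦ G (z s).1 (z s).2 (z s).2)
      ((fderiv ℝ G (z t).1 (z t).2 (z t).2 + G (z t).1 Q) (z t).2 + G (z t).1 (z t).2 Q) t :=
    h4.clm_apply h2
  refine h5.congr_deriv ?_
  have h6 := (eq_sprayCoeff_iff hGi Q (z t).2).mp rfl (z t).2
  rw [geodesicForm_apply] at h6
  have h7 := hGs Q (z t).2
  rw [add_apply]
  linarith

end Spray

/-! ### The Riemannian metric in preferred charts -/

section ChartMetric

set_option maxSynthPendingDepth 3

open Set Filter

variable {m : ℕ} {M : Type*} [TopologicalSpace M] [ChartedSpace (EuclideanSpace ℝ (Fin m)) M]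

/-- The derivative of the inverse of the preferred chart at `p`. -/
def chartSymmDeriv (p : M) (y : EuclideanSpace ℝ (Fin m)) :
    EuclideanSpace ℝ (Fin m) →L[ℝ] EuclideanSpace ℝ (Fin m) :=
  mfderiv 𝓘(ℝ, EuclideanSpace ℝ (Fin m)) (𝓡 m) (extChartAt (𝓡 m) p).symm y

/-- The tangent vector with given coordinates in the preferred chart at `p`. -/
def tangentPoint (p : M) (z : EuclideanSpace ℝ (Fin m) × EuclideanSpace ℝ (Fin m)) :
    TangentBundle (𝓡 m) M :=
  ⟨(extChartAt (𝓡 m) p).symm z.1, chartSymmDeriv p z.1 z.2⟩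

/-- Tangent spaces at different points are definitionally the same model space, so vectors over
equal base points can be compared there without transport. -/
theorem tangentBundle_ext {x y : M} {v : TangentSpace (𝓡 m) x} {w : TangentSpace (𝓡 m) y}
    (h : x = y) (hvw : (show EuclideanSpace ℝ (Fin m) from v) = w) :
    (⟨x, v⟩ : TangentBundle (𝓡 m) M) = ⟨y, w⟩ := by
  subst h
  exact congrArg _ hvw

theorem snd_eq_of_tangentBundle_eq {x y : M} {v : TangentSpace (𝓡 m) x} {w : TangentSpace (𝓡 m) y}
    (h : (⟨x, v⟩ : TangentBundle (𝓡 m) M) = ⟨y, w⟩) :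
    (show EuclideanSpace ℝ (Fin m) from v) = w := by
  cases h
  rfl

/-- The change of coordinates between two preferred charts. -/
def chartChange (p p' : M) : EuclideanSpace ℝ (Fin m) → EuclideanSpace ℝ (Fin m) :=
  extChartAt (𝓡 m) p' ∘ (extChartAt (𝓡 m) p).symm

variable [IsManifold (𝓡 m) ∞ M]

theorem mdifferentiableAt_extChartAt_symm {p : M} {y : EuclideanSpace ℝ (Fin m)}
    (hy : y ∈ (extChartAt (𝓡 m) p).target) :
    MDifferentiableAt 𝓘(ℝ, EuclideanSpace ℝ (Fin m)) (𝓡 m) (extChartAt (𝓡 m) p).symm y := by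
  have := (contMDiffOn_extChartAt_symm (I := 𝓡 m) (n := ∞) p).contMDiffAt
    ((isOpen_extChartAt_target p).mem_nhds hy)
  exact this.mdifferentiableAt (by simp)

theorem mdifferentiableAt_extChartAt' {p x : M} (hx : x ∈ (extChartAt (𝓡 m) p).source) :
    MDifferentiableAt (𝓡 m) 𝓘(ℝ, EuclideanSpace ℝ (Fin m)) (extChartAt (𝓡 m) p) x := by
  have : IsManifold (𝓡 m) 1 M := IsManifold.of_le (n := ∞) (by simp)
  exact mdifferentiableAt_extChartAt (by simpa using hx)

theorem mfderiv_extChartAt_chartSymmDeriv {p : M} {y : EuclideanSpace ℝ (Fin m)}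
    (hy : y ∈ (extChartAt (𝓡 m) p).target) (a : EuclideanSpace ℝ (Fin m)) :
    mfderiv (𝓡 m) 𝓘(ℝ, EuclideanSpace ℝ (Fin m)) (extChartAt (𝓡 m) p)
      ((extChartAt (𝓡 m) p).symm y) (chartSymmDeriv p y a) = a := by
  have : IsManifold (𝓡 m) 1 M := IsManifold.of_le (n := ∞) (by simp)
  have h := mfderiv_extChartAt_comp_mfderivWithin_extChartAt_symm (I := 𝓡 m) hy
  simp only [ModelWithCorners.range_eq_univ, mfderivWithin_univ] at h
  exact congrArg (fun A ↦ A a) h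

theorem chartSymmDeriv_mfderiv_extChartAt {p x : M} (hx : x ∈ (extChartAt (𝓡 m) p).source)
    (v : TangentSpace (𝓡 m) x) :
    chartSymmDeriv p (extChartAt (𝓡 m) p x)
      (mfderiv (𝓡 m) 𝓘(ℝ, EuclideanSpace ℝ (Fin m)) (extChartAt (𝓡 m) p) x v) = v := by
  have : IsManifold (𝓡 m) 1 M := IsManifold.of_le (n := ∞) (by simp)
  have h := mfderivWithin_extChartAt_symm_comp_mfderiv_extChartAt' (I := 𝓡 m) hx
  simp only [ModelWithCorners.range_eq_univ, mfderivWithin_univ] at h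
  exact congrArg (fun A ↦ A v) h

theorem chartSymmDeriv_bijective {p : M} {y : EuclideanSpace ℝ (Fin m)}
    (hy : y ∈ (extChartAt (𝓡 m) p).target) : Function.Bijective (chartSymmDeriv p y) := by
  have hinj : Function.Injective (chartSymmDeriv p y) := fun a b hab ↦ by
    rw [← mfderiv_extChartAt_chartSymmDeriv hy a, ← mfderiv_extChartAt_chartSymmDeriv hy b, hab]
  exact ⟨hinj, LinearMap.injective_iff_surjective.mp hinj⟩

theorem tangentPoint_mfderiv {p x : M} (hx : x ∈ (extChartAt (𝓡 m) p).source)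
    (v : TangentSpace (𝓡 m) x) :
    tangentPoint p (extChartAt (𝓡 m) p x,
      mfderiv (𝓡 m) 𝓘(ℝ, EuclideanSpace ℝ (Fin m)) (extChartAt (𝓡 m) p) x v) = ⟨x, v⟩ :=
  tangentBundle_ext ((extChartAt (𝓡 m) p).left_inv hx) (chartSymmDeriv_mfderiv_extChartAt hx v)

theorem tangentPoint_injOn (p : M) :
    InjOn (tangentPoint (m := m) p) {z | z.1 ∈ (extChartAt (𝓡 m) p).target} := by
  rintro ⟨y, a⟩ hy ⟨y', a'⟩ hy' h
  have hy : y ∈ (extChartAt (𝓡 m) p).target := hy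
  have hy' : y' ∈ (extChartAt (𝓡 m) p).target := hy'
  have h1 : (extChartAt (𝓡 m) p).symm y = (extChartAt (𝓡 m) p).symm y' :=
    congrArg Bundle.TotalSpace.proj h
  obtain rfl : y = y' := (extChartAt (𝓡 m) p).symm.injOn hy hy' h1
  exact congrArg _ ((chartSymmDeriv_bijective hy).1 (snd_eq_of_tangentBundle_eq h))

section Change

variable {p p' : M} {y : EuclideanSpace ℝ (Fin m)} (hy : y ∈ (extChartAt (𝓡 m) p).target)
  (hy' : (extChartAt (𝓡 m) p).symm y ∈ (extChartAt (𝓡 m) p').source)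

include hy hy'

theorem contDiffAt_chartChange : ContDiffAt ℝ ∞ (chartChange p p') y := by
  have h := contDiffWithinAt_ext_coord_change (I := 𝓡 m) (n := ∞) p' p (y := y) (by
      rw [PartialEquiv.trans_source]
      exact ⟨hy, hy'⟩)
  rw [ModelWithCorners.range_eq_univ, contDiffWithinAt_univ] at h
  exact h

theorem chartChange_mem_target : chartChange p p' y ∈ (extChartAt (𝓡 m) p').target :=
  (extChartAt (𝓡 m) p').map_source hy'

theorem symm_chartChange :
    (extChartAt (𝓡 m) p').symm (chartChange p p' y) = (extChartAt (𝓡 m) p).symm y :=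
  (extChartAt (𝓡 m) p').left_inv hy'

theorem eventually_chart_mem : ∀ᶠ x in 𝓝 y, x ∈ (extChartAt (𝓡 m) p).target ∧
    (extChartAt (𝓡 m) p).symm x ∈ (extChartAt (𝓡 m) p').source := by
  refine ((isOpen_extChartAt_target p).eventually_mem hy).and ?_
  exact (mdifferentiableAt_extChartAt_symm hy).continuousAt.eventually
    ((isOpen_extChartAt_source p').eventually_mem hy')

theorem chartSymmDeriv_change (a : EuclideanSpace ℝ (Fin m)) :
    chartSymmDeriv p' (chartChange p p' y) (fderiv ℝ (chartChange p p') y a)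
      = chartSymmDeriv p y a := by
  have h1 : (extChartAt (𝓡 m) p).symm =ᶠ[𝓝 y] (extChartAt (𝓡 m) p').symm ∘ chartChange p p' :=
    (eventually_chart_mem hy hy').mono fun x hx ↦ (symm_chartChange hx.1 hx.2).symm
  have h2 : MDifferentiableAt 𝓘(ℝ, EuclideanSpace ℝ (Fin m)) 𝓘(ℝ, EuclideanSpace ℝ (Fin m))
      (chartChange p p') y :=
    ((contDiffAt_chartChange hy hy').differentiableAt (by simp)).mdifferentiableAt
  have h3 := mfderiv_comp y (mdifferentiableAt_extChartAt_symm (chartChange_mem_target hy hy')) h2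
  rw [← h1.mfderiv_eq, mfderiv_eq_fderiv] at h3
  exact (congrArg (fun A ↦ A a) h3).symm

theorem fderiv_chartChange_surjective : Function.Surjective (fderiv ℝ (chartChange p p') y) := by
  refine LinearMap.injective_iff_surjective.mp fun a b hab ↦ ?_
  refine (chartSymmDeriv_bijective hy).1 ?_
  rw [← chartSymmDeriv_change hy hy', ← chartSymmDeriv_change hy hy']
  exact congrArg _ hab

end Change

variable [RiemannianBundle (fun x : M ↦ TangentSpace (𝓡 m) x)]


/-- The Riemannian inner product of two tangent vectors at `x`. -/
def tangentInner (x : M) (v w : EuclideanSpace ℝ (Fin m)) : ℝ :=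
  inner ℝ (show TangentSpace (𝓡 m) x from v) (show TangentSpace (𝓡 m) x from w)

/-- The Riemannian inner product at `x`, as a bilinear form. -/
def tangentInnerForm (x : M) :
    EuclideanSpace ℝ (Fin m) →ₗ[ℝ] EuclideanSpace ℝ (Fin m) →ₗ[ℝ] ℝ :=
  LinearMap.mk₂ ℝ (tangentInner x)
    (fun u v w ↦ inner_add_left (𝕜 := ℝ) (E := TangentSpace (𝓡 m) x) u v w)
    (fun r v w ↦ real_inner_smul_left (F := TangentSpace (𝓡 m) x) v w r)
    (fun u v w ↦ inner_add_right (𝕜 := ℝ) (E := TangentSpace (𝓡 m) x) u v w)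
    (fun r v w ↦ real_inner_smul_right (F := TangentSpace (𝓡 m) x) v w r)

/-- The metric in the preferred chart at `p`, as a bilinear form. -/
def metricForm (p : M) (y : EuclideanSpace ℝ (Fin m)) :
    EuclideanSpace ℝ (Fin m) →L[ℝ] EuclideanSpace ℝ (Fin m) →L[ℝ] ℝ :=
  ((tangentInnerForm ((extChartAt (𝓡 m) p).symm y)).compl₁₂ (chartSymmDeriv p y).toLinearMap
    (chartSymmDeriv p y).toLinearMap).toContinuousBilinearMap

theorem metricForm_apply (p : M) (y a b : EuclideanSpace ℝ (Fin m)) :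
    metricForm p y a b = chartMetric p y a b := rfl

theorem metricForm_comm (p : M) (y a b : EuclideanSpace ℝ (Fin m)) :
    metricForm p y a b = metricForm p y b a :=
  real_inner_comm (F := TangentSpace (𝓡 m) ((extChartAt (𝓡 m) p).symm y)) _ _

theorem metricForm_self (p : M) (y a : EuclideanSpace ℝ (Fin m)) :
    metricForm p y a a = ‖(tangentPoint p (y, a)).2‖ ^ 2 :=
  real_inner_self_eq_norm_sq (F := TangentSpace (𝓡 m) ((extChartAt (𝓡 m) p).symm y)) _

theorem metricForm_pos {p : M} {y : EuclideanSpace ℝ (Fin m)}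
    (hy : y ∈ (extChartAt (𝓡 m) p).target) {a : EuclideanSpace ℝ (Fin m)} (ha : a ≠ 0) :
    0 < metricForm p y a a := by
  refine (real_inner_self_pos (F := TangentSpace (𝓡 m) ((extChartAt (𝓡 m) p).symm y))).mpr fun h ↦ ha ?_
  refine (chartSymmDeriv_bijective hy).1 ?_
  rw [map_zero]
  exact h

theorem isInvertible_metricForm {p : M} {y : EuclideanSpace ℝ (Fin m)}
    (hy : y ∈ (extChartAt (𝓡 m) p).target) : (metricForm p y).IsInvertible := by
  have hinj : Function.Injective (metricForm p y) := by
    refine (injective_iff_map_eq_zero _).mpr fun a ha ↦ ?_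
    by_contra h
    have := metricForm_pos hy h
    rw [ha] at this
    simp at this
  have hfin : Module.finrank ℝ (EuclideanSpace ℝ (Fin m))
      = Module.finrank ℝ (EuclideanSpace ℝ (Fin m) →L[ℝ] ℝ) := by
    rw [← LinearEquiv.finrank_eq (LinearMap.toContinuousLinearMap (𝕜 := ℝ)
      (E := EuclideanSpace ℝ (Fin m)) (F' := ℝ))]
    exact (Subspace.dual_finrank_eq).symm
  exact ⟨(LinearEquiv.ofInjectiveOfFinrankEq _ hinj hfin).toContinuousLinearEquiv, rfl⟩

/-- The coordinate fields are smooth sections of the tangent bundle, and the inner product of smooth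
sections is smooth. In finite dimension it suffices to test on fixed vectors. -/
theorem contDiffOn_metricForm [IsContMDiffRiemannianBundle (𝓡 m) ∞ (EuclideanSpace ℝ (Fin m))
      (fun x : M ↦ TangentSpace (𝓡 m) x)] (p : M) :
    ContDiffOn ℝ ∞ (metricForm p) (extChartAt (𝓡 m) p).target := by
  refine contDiffOn_clm_apply.mpr fun a ↦ contDiffOn_clm_apply.mpr fun b ↦ ?_
  have hsec (a : EuclideanSpace ℝ (Fin m)) : ContMDiffOn 𝓘(ℝ, EuclideanSpace ℝ (Fin m))
      ((𝓡 m).prod 𝓘(ℝ, EuclideanSpace ℝ (Fin m))) ∞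
      (fun y ↦ tangentPoint p (y, a)) (extChartAt (𝓡 m) p).target := by
    have h1 := (contMDiffOn_extChartAt_symm (I := 𝓡 m) (n := ∞) p).contMDiffOn_tangentMapWithin
      (m := ∞) (by simp) (isOpen_extChartAt_target p).uniqueMDiffOn
    have h2 : ContMDiff 𝓘(ℝ, EuclideanSpace ℝ (Fin m)) 𝓘(ℝ, EuclideanSpace ℝ (Fin m)).tangent ∞
        (fun y ↦ (⟨y, a⟩ : TangentBundle 𝓘(ℝ, EuclideanSpace ℝ (Fin m))
          (EuclideanSpace ℝ (Fin m)))) :=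
      contMDiff_vectorSpace_iff_contDiff.mpr contDiff_const
    have h3 := h1.comp h2.contMDiffOn (s := (extChartAt (𝓡 m) p).target) fun y hy ↦ hy
    refine h3.congr fun y hy ↦ ?_
    refine tangentBundle_ext rfl ?_
    rw [mfderivWithin_of_isOpen (isOpen_extChartAt_target p) hy]
    rfl
  exact (ContMDiffOn.inner_bundle (hsec a) (hsec b)).contDiffOn

end ChartMetric

/-! ### Geodesics: change of charts, uniqueness and constant speed -/

section Geodesic

set_option maxSynthPendingDepth 3

open Set Filter

variable {m : ℕ} {M : Type*} [TopologicalSpace M] [ChartedSpace (EuclideanSpace ℝ (Fin m)) M]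
  [IsManifold (𝓡 m) ∞ M] [RiemannianBundle (fun x : M ↦ TangentSpace (𝓡 m) x)]
  [IsContMDiffRiemannianBundle (𝓡 m) ∞ (EuclideanSpace ℝ (Fin m))
    (fun x : M ↦ TangentSpace (𝓡 m) x)]

theorem differentiableAt_metricForm {p : M} {y : EuclideanSpace ℝ (Fin m)}
    (hy : y ∈ (extChartAt (𝓡 m) p).target) : DifferentiableAt ℝ (metricForm p) y :=
  ((contDiffOn_metricForm p).contDiffAt
    ((isOpen_extChartAt_target p).mem_nhds hy)).differentiableAt (by simp)

/-- The geodesic equation in the chart at `p`, as a differential equation of the second order. -/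
def geodesicCoeff (p : M) (y : EuclideanSpace ℝ (Fin m)) :
    EuclideanSpace ℝ (Fin m) →L[ℝ] EuclideanSpace ℝ (Fin m) →L[ℝ] EuclideanSpace ℝ (Fin m) :=
  sprayCoeff (metricForm p) y

theorem contDiffOn_geodesicCoeff (p : M) :
    ContDiffOn ℝ 1 (geodesicCoeff p) (extChartAt (𝓡 m) p).target :=
  contDiffOn_sprayCoeff (isOpen_extChartAt_target p)
    ((contDiffOn_metricForm p).of_le ENat.LEInfty.out) fun _ ↦ isInvertible_metricForm

theorem christoffel_eq {p : M} {y : EuclideanSpace ℝ (Fin m)}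
    (hy : y ∈ (extChartAt (𝓡 m) p).target) (a w : EuclideanSpace ℝ (Fin m)) :
    christoffel p y a a w = geodesicForm (fderiv ℝ (metricForm p) y) a a w := by
  have h (a b c : EuclideanSpace ℝ (Fin m)) :
      fderiv ℝ (fun z ↦ chartMetric p z a b) y c = fderiv ℝ (metricForm p) y c a b := by
    have h1 : HasFDerivAt (fun z ↦ metricForm p z a b)
        (((fderiv ℝ (metricForm p) y).flip a).flip b) y := by
      have := ((differentiableAt_metricForm hy).hasFDerivAt.clm_apply
        (hasFDerivAt_const a y)).clm_apply (hasFDerivAt_const b y)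
      refine this.congr_fderiv ?_
      ext c
      simp
    exact congrArg (fun A : _ →L[ℝ] ℝ ↦ A c) h1.fderiv
  rw [christoffel, h, h, geodesicForm_apply]
  ring

theorem geodesic_equation_iff {p : M} {y : EuclideanSpace ℝ (Fin m)}
    (hy : y ∈ (extChartAt (𝓡 m) p).target) (z a : EuclideanSpace ℝ (Fin m)) :
    (∀ w, chartMetric p y z w + christoffel p y a a w = 0) ↔ z = geodesicCoeff p y a a := by
  rw [geodesicCoeff, eq_sprayCoeff_iff (isInvertible_metricForm hy)]
  simp only [christoffel_eq hy, metricForm_apply]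

/-- Near the time `t`, the curve `z` in the chart at `p` solves the geodesic equation and represents
`γ` and its velocity. -/
def SolvesGeodesic (p : M) (z : ℝ → EuclideanSpace ℝ (Fin m) × EuclideanSpace ℝ (Fin m))
    (γ : ℝ → M) (t : ℝ) : Prop :=
  ∀ᶠ s in 𝓝 t, (z s).1 ∈ (extChartAt (𝓡 m) p).target ∧
    γ s = (extChartAt (𝓡 m) p).symm (z s).1 ∧ HasDerivAt z (sprayField (geodesicCoeff p) (z s)) s

/-- The velocity of a curve. -/
def velocity (m : ℕ) {M : Type*} [TopologicalSpace M] [ChartedSpace (EuclideanSpace ℝ (Fin m)) M]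
    (γ : ℝ → M) (t : ℝ) : TangentBundle (𝓡 m) M :=
  ⟨γ t, mfderiv 𝓘(ℝ, ℝ) (𝓡 m) γ t (1 : ℝ)⟩

variable (m) in
/-- The curve `γ` is a geodesic near the time `t`. -/
def IsGeodesicAt (γ : ℝ → M) (t : ℝ) : Prop :=
  ∃ (p : M) (z : ℝ → EuclideanSpace ℝ (Fin m) × EuclideanSpace ℝ (Fin m)), SolvesGeodesic p z γ t

section

variable {p p' : M} {z z' : ℝ → EuclideanSpace ℝ (Fin m) × EuclideanSpace ℝ (Fin m)}
  {γ γ' : ℝ → M} {t : ℝ}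

theorem SolvesGeodesic.congr (h : SolvesGeodesic p z γ t) (hγ : γ =ᶠ[𝓝 t] γ') :
    SolvesGeodesic p z γ' t := by
  filter_upwards [h, hγ] with s hs hs'
  exact ⟨hs.1, hs'.symm.trans hs.2.1, hs.2.2⟩

theorem SolvesGeodesic.eventually (h : SolvesGeodesic p z γ t) :
    ∀ᶠ s in 𝓝 t, SolvesGeodesic p z γ s :=
  eventually_eventually_nhds.mpr h

theorem SolvesGeodesic.continuousAt (h : SolvesGeodesic p z γ t) : ContinuousAt z t :=
  h.self_of_nhds.2.2.continuousAt

theorem SolvesGeodesic.mem_source (h : SolvesGeodesic p z γ t) :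
    γ t ∈ (extChartAt (𝓡 m) p).source := by
  rw [h.self_of_nhds.2.1]
  exact (extChartAt (𝓡 m) p).map_target h.self_of_nhds.1

theorem SolvesGeodesic.velocity_eq (h : SolvesGeodesic p z γ t) :
    velocity m γ t = tangentPoint p (z t) := by
  obtain ⟨h1, h2, h3⟩ := h.self_of_nhds
  refine tangentBundle_ext h2 ?_
  have h4 : γ =ᶠ[𝓝 t] (extChartAt (𝓡 m) p).symm ∘ fun s ↦ (z s).1 := h.mono fun s hs ↦ hs.2.1
  have h5 : HasMFDerivAt 𝓘(ℝ, ℝ) 𝓘(ℝ, EuclideanSpace ℝ (Fin m)) (fun s ↦ (z s).1) t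
      (ContinuousLinearMap.toSpanSingleton ℝ (z t).2) :=
    (HasDerivAt.prod_fst h3).hasFDerivAt.hasMFDerivAt
  have h6 : HasMFDerivAt 𝓘(ℝ, EuclideanSpace ℝ (Fin m)) (𝓡 m) (extChartAt (𝓡 m) p).symm (z t).1
      (chartSymmDeriv p (z t).1) := (mdifferentiableAt_extChartAt_symm h1).hasMFDerivAt
  have h7 := (HasMFDerivAt.comp t h6 h5).congr_of_eventuallyEq h4
  have h8 := congrArg (fun A : ℝ →L[ℝ] EuclideanSpace ℝ (Fin m) ↦ A 1) h7.mfderiv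
  refine h8.trans ?_
  change chartSymmDeriv p (z t).1 ((1 : ℝ) • (z t).2) = chartSymmDeriv p (z t).1 (z t).2
  rw [one_smul]

theorem SolvesGeodesic.curve_continuousAt (h : SolvesGeodesic p z γ t) : ContinuousAt γ t := by
  have h4 : γ =ᶠ[𝓝 t] (extChartAt (𝓡 m) p).symm ∘ fun s ↦ (z s).1 := h.mono fun s hs ↦ hs.2.1
  refine ContinuousAt.congr ?_ h4.symm
  exact ContinuousAt.comp (f := fun s ↦ (z s).1)
    (mdifferentiableAt_extChartAt_symm h.self_of_nhds.1).continuousAt h.continuousAt.fst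

/-- The chain rule for the second derivative, combined with the transformation rule
`sprayCoeff_change` for the coefficients. -/
theorem SolvesGeodesic.change (h : SolvesGeodesic p z γ t)
    (ht : γ t ∈ (extChartAt (𝓡 m) p').source) :
    SolvesGeodesic p' (fun s ↦ (chartChange p p' (z s).1, fderiv ℝ (chartChange p p') (z s).1
      (z s).2)) γ t := by
  have hev : ∀ᶠ s in 𝓝 t, γ s ∈ (extChartAt (𝓡 m) p').source :=
    h.curve_continuousAt.eventually ((isOpen_extChartAt_source p').eventually_mem ht)
  filter_upwards [h, hev] with s ⟨h1, h2, h3⟩ h4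
  rw [h2] at h4
  refine ⟨chartChange_mem_target h1 h4, h2.trans (symm_chartChange h1 h4).symm, ?_⟩
  have hθ := contDiffAt_chartChange h1 h4
  have hθ1 : DifferentiableAt ℝ (chartChange p p') (z s).1 := hθ.differentiableAt (by simp)
  have hθ2 : DifferentiableAt ℝ (fderiv ℝ (chartChange p p')) (z s).1 :=
    (hθ.fderiv_right (m := 1) (by norm_num; exact ENat.LEInfty.out)).differentiableAt (by norm_num)
  have d1 : HasDerivAt (fun s ↦ (z s).1) (z s).2 s := HasDerivAt.prod_fst h3
  have d2 : HasDerivAt (fun s ↦ (z s).2) (geodesicCoeff p (z s).1 (z s).2 (z s).2) s :=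
    HasDerivAt.prod_snd h3
  have e1 : HasDerivAt (fun s ↦ chartChange p p' (z s).1)
      (fderiv ℝ (chartChange p p') (z s).1 (z s).2) s :=
    HasFDerivAt.comp_hasDerivAt (f := fun s ↦ (z s).1) s hθ1.hasFDerivAt d1
  have e2 : HasDerivAt (fun s ↦ fderiv ℝ (chartChange p p') (z s).1)
      (fderiv ℝ (fderiv ℝ (chartChange p p')) (z s).1 (z s).2) s :=
    HasFDerivAt.comp_hasDerivAt (f := fun s ↦ (z s).1) s hθ2.hasFDerivAt d1
  have e3 := e2.clm_apply d2
  refine (e1.prodMk e3).congr_deriv (Prod.ext rfl ?_)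
  have h5 := sprayCoeff_change (G := metricForm p) (H := metricForm p')
    (hθ.of_le ENat.LEInfty.out)
    ((eventually_chart_mem h1 h4).mono fun x hx a b ↦ by
      change tangentInner _ (chartSymmDeriv p x a) (chartSymmDeriv p x b) =
        tangentInner _ (chartSymmDeriv p' _ _) (chartSymmDeriv p' _ _)
      rw [chartSymmDeriv_change hx.1 hx.2, chartSymmDeriv_change hx.1 hx.2,
        symm_chartChange hx.1 hx.2])
    (differentiableAt_metricForm h1) (differentiableAt_metricForm (chartChange_mem_target h1 h4))
    (isInvertible_metricForm h1) (isInvertible_metricForm (chartChange_mem_target h1 h4))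
    (metricForm_comm _ _) (fderiv_chartChange_surjective h1 h4) (z s).2
  exact (add_comm _ _).trans h5

/-- Both curves are moved to one chart, where equal velocities mean equal initial data for a locally
Lipschitz field. -/
theorem SolvesGeodesic.eventuallyEq (h : SolvesGeodesic p z γ t) (h' : SolvesGeodesic p' z' γ' t)
    (hv : velocity m γ t = velocity m γ' t) : γ =ᶠ[𝓝 t] γ' := by
  have ht : γ' t ∈ (extChartAt (𝓡 m) p).source := by
    have : γ t = γ' t := congrArg Bundle.TotalSpace.proj hv
    rw [← this]
    exact h.mem_source
  have h'' := h'.change ht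
  set w := fun s ↦ (chartChange p' p (z' s).1, fderiv ℝ (chartChange p' p) (z' s).1 (z' s).2)
  have hzw : z t = w t := by
    rw [h.velocity_eq, h''.velocity_eq] at hv
    exact tangentPoint_injOn p h.self_of_nhds.1 h''.self_of_nhds.1 hv
  have hQ : ContDiffAt ℝ 1 (sprayField (geodesicCoeff p)) (z t) :=
    contDiffAt_sprayField ((contDiffOn_geodesicCoeff p).contDiffAt
      ((isOpen_extChartAt_target p).mem_nhds h.self_of_nhds.1))
  obtain ⟨K, S, hS, hl⟩ := hQ.exists_lipschitzOnWith
  have hzS : ∀ᶠ s in 𝓝 t, z s ∈ S := h.continuousAt.eventually_mem hS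
  have hwS : ∀ᶠ s in 𝓝 t, w s ∈ S := h''.continuousAt.eventually_mem (hzw ▸ hS)
  have := ODE_solution_unique_of_eventually (v := fun _ ↦ sprayField (geodesicCoeff p))
    (s := fun _ ↦ S) (K := K) (f := z) (g := w) (t₀ := t) (Eventually.of_forall fun _ ↦ hl)
    ((h.and hzS).mono fun s hs ↦ ⟨hs.1.2.2, hs.2⟩)
    ((h''.and hwS).mono fun s hs ↦ ⟨hs.1.2.2, hs.2⟩) hzw
  filter_upwards [this, h, h''] with s h1 h2 h3
  rw [h2.2.1, h3.2.1, h1]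

end

theorem IsGeodesicAt.congr {γ γ' : ℝ → M} {t : ℝ} (h : IsGeodesicAt m γ t) (hγ : γ =ᶠ[𝓝 t] γ') :
    IsGeodesicAt m γ' t :=
  let ⟨p, z, hz⟩ := h
  ⟨p, z, hz.congr hγ⟩

theorem velocity_congr {γ γ' : ℝ → M} {t : ℝ} (hγ : γ =ᶠ[𝓝 t] γ') :
    velocity m γ t = velocity m γ' t :=
  tangentBundle_ext hγ.self_of_nhds
    (congrArg (fun A : ℝ →L[ℝ] EuclideanSpace ℝ (Fin m) ↦ A 1) hγ.mfderiv_eq)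

theorem IsGeodesicAt.comp_sub {γ : ℝ → M} {t : ℝ} (h : IsGeodesicAt m γ t) (c : ℝ) :
    IsGeodesicAt m (fun s ↦ γ (s - c)) (t + c) ∧
      velocity m (fun s ↦ γ (s - c)) (t + c) = velocity m γ t := by
  obtain ⟨p, z, hz⟩ := h
  have h1 : SolvesGeodesic p (fun s ↦ z (s - c)) (fun s ↦ γ (s - c)) (t + c) := by
    have h2 : Tendsto (fun s ↦ s - c) (𝓝 (t + c)) (𝓝 t) := by
      have := (continuous_sub_right c).tendsto (t + c)
      simpa using this
    filter_upwards [h2.eventually hz] with s hs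
    exact ⟨hs.1, hs.2.1, hs.2.2.comp_sub_const s c⟩
  refine ⟨⟨p, _, h1⟩, ?_⟩
  rw [h1.velocity_eq, hz.velocity_eq, add_sub_cancel_right]

/-- The set of times near which the curves agree is open. It is relatively closed because position
and velocity, read in one chart, pass to the limit and local uniqueness applies there. -/
theorem IsGeodesicAt.eqOn [T2Space M] {γ γ' : ℝ → M} {I : Set ℝ} (hI : IsPreconnected I)
    (h : ∀ t ∈ I, IsGeodesicAt m γ t) (h' : ∀ t ∈ I, IsGeodesicAt m γ' t) {t₀ : ℝ} (ht₀ : t₀ ∈ I)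
    (hv : velocity m γ t₀ = velocity m γ' t₀) : EqOn γ γ' I := by
  set u : Set ℝ := {t | γ =ᶠ[𝓝 t] γ'}
  have hu : IsOpen u := isOpen_iff_mem_nhds.mpr fun t ht ↦ eventually_eventually_nhds.mpr ht
  have hsub : I ⊆ u := by
    refine hI.subset_of_closure_inter_subset hu ⟨t₀, ht₀, ?_⟩ ?_
    · obtain ⟨p, z, hz⟩ := h t₀ ht₀
      obtain ⟨p', z', hz'⟩ := h' t₀ ht₀
      exact hz.eventuallyEq hz' hv
    · rintro t ⟨ht, htI⟩
      obtain ⟨p, z, hz⟩ := h t htI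
      obtain ⟨p', z', hz'⟩ := h' t htI
      have hfr : ∃ᶠ s in 𝓝 t, s ∈ u := mem_closure_iff_frequently.mp ht
      have heq : γ t = γ' t := tendsto_nhds_unique_of_frequently_eq hz.curve_continuousAt
        hz'.curve_continuousAt (hfr.mono fun s hs ↦ hs.self_of_nhds)
      have hz'' := hz'.change (p' := p) (heq ▸ hz.mem_source)
      have hzz := tendsto_nhds_unique_of_frequently_eq hz.continuousAt hz''.continuousAt
        ((hfr.and_eventually (hz.eventually.and hz''.eventually)).mono fun s ⟨hs, h1, h2⟩ ↦ by
          have h3 := velocity_congr (m := m) hs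
          rw [h1.velocity_eq, h2.velocity_eq] at h3
          exact tangentPoint_injOn p h1.self_of_nhds.1 h2.self_of_nhds.1 h3)
      refine hz.eventuallyEq hz'' ?_
      rw [hz.velocity_eq, hz''.velocity_eq]
      exact congrArg _ hzz
  exact fun t ht ↦ (hsub ht).self_of_nhds

/-- Conservation of energy. It allows an existence result for small velocities to be reapplied along
a geodesic. -/
theorem IsGeodesicAt.norm_velocity_eq {γ : ℝ → M} {a b : ℝ} (h : ∀ t ∈ Ioo a b, IsGeodesicAt m γ t)
    {s t : ℝ} (hs : s ∈ Ioo a b) (ht : t ∈ Ioo a b) :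
    ‖(velocity m γ s).2‖ = ‖(velocity m γ t).2‖ := by
  have hd (t : ℝ) (ht : t ∈ Ioo a b) :
      HasDerivAt (fun s ↦ ‖(velocity m γ s).2‖ ^ 2) 0 t := by
    obtain ⟨p, z, hz⟩ := h t ht
    have h1 := hasDerivAt_energy (differentiableAt_metricForm hz.self_of_nhds.1)
      (isInvertible_metricForm hz.self_of_nhds.1) (metricForm_comm _ _) hz.self_of_nhds.2.2
    refine h1.congr_of_eventuallyEq (hz.eventually.mono fun s hs ↦ ?_)
    exact (congrArg (fun X : TangentBundle (𝓡 m) M ↦ ‖X.2‖ ^ 2) hs.velocity_eq).trans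
      (metricForm_self p (z s).1 (z s).2).symm
  have h2 := (convex_Ioo a b).norm_image_sub_le_of_norm_hasDerivWithin_le (C := 0)
    (fun t ht ↦ (hd t ht).hasDerivWithinAt) (fun t _ ↦ by simp) hs ht
  rw [zero_mul, norm_le_zero_iff, sub_eq_zero] at h2
  exact ((sq_eq_sq₀ (norm_nonneg _) (norm_nonneg _)).mp h2).symm

end Geodesic

/-! ### Extension of geodesics to all times -/

section Completeness

set_option maxSynthPendingDepth 3

open Set Filter

/-- A property that holds locally with some positive radius holds globally on a compact space. -/
theorem exists_pos_forall_of_compact {M : Type*} [TopologicalSpace M] [CompactSpace M]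
    {K : ℝ → M → Prop} (hK : ∀ r r' x, r ≤ r' → K r' x → K r x)
    (h : ∀ p, ∃ r > 0, ∀ᶠ x in 𝓝 p, K r x) : ∃ r > 0, ∀ x, K r x := by
  have : ∃ r > 0, ∀ x ∈ (univ : Set M), K r x := by
    refine isCompact_univ.induction_on (p := fun s ↦ ∃ r > 0, ∀ x ∈ s, K r x) ⟨1, one_pos, by simp⟩
      ?_ ?_ ?_
    · rintro s t hst ⟨r, hr, H⟩
      exact ⟨r, hr, fun x hx ↦ H x (hst hx)⟩
    · rintro s t ⟨r, hr, H⟩ ⟨r', hr', H'⟩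
      refine ⟨min r r', lt_min hr hr', ?_⟩
      rintro x (hx | hx)
      · exact hK _ _ _ (min_le_left _ _) (H x hx)
      · exact hK _ _ _ (min_le_right _ _) (H' x hx)
    · intro p _
      obtain ⟨r, hr, H⟩ := h p
      exact ⟨_, mem_nhdsWithin_of_mem_nhds H, r, hr, fun x hx ↦ hx⟩
  obtain ⟨r, hr, H⟩ := this
  exact ⟨r, hr, fun x ↦ H x trivial⟩

/-- Bootstrapping: a solution is continuous, so its derivative is continuous, so the solution is
$C^1$, so its derivative is $C^1$. -/
theorem contDiffAt_two_of_ode {V : Type*} [NormedAddCommGroup V] [NormedSpace ℝ V] {F : V → V}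
    {z : ℝ → V} {t : ℝ} (hF : ContDiffAt ℝ 1 F (z t))
    (hz : ∀ᶠ s in 𝓝 t, HasDerivAt z (F (z s)) s) : ContDiffAt ℝ 2 z t := by
  have hsucc (n : ℕ) (h : ContDiffAt ℝ n (fun s ↦ F (z s)) t) :
      ContDiffAt ℝ (n + 1) z t := by
    refine contDiffAt_succ_iff_hasFDerivAt.mpr
      ⟨fun s ↦ ContinuousLinearMap.toSpanSingleton ℝ (F (z s)), ⟨_, hz, fun s hs ↦ hs.hasFDerivAt⟩, ?_⟩
    exact (ContinuousLinearMap.toSpanSingletonCLE (𝕜 := ℝ) (E := V)).contDiff.contDiffAt.comp t h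
  have hc : ContinuousAt z t := hz.self_of_nhds.continuousAt
  have h0 : ContDiffAt ℝ (0 : ℕ) (fun s ↦ F (z s)) t := by
    refine contDiffAt_zero.mpr ?_
    have h1 : ∀ᶠ x in 𝓝 (z t), ContDiffAt ℝ 1 F x := hF.eventually (by simp)
    refine ⟨_, (hc.eventually h1).and hz, fun s hs ↦ ?_⟩
    exact (hs.1.continuousAt.comp hs.2.continuousAt).continuousWithinAt
  have h1 : ContDiffAt ℝ 1 z t := by simpa using hsucc 0 h0
  have h2 := hsucc 1 (by exact_mod_cast hF.comp t h1)
  exact_mod_cast h2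

variable {m : ℕ} {M : Type*} [TopologicalSpace M] [ChartedSpace (EuclideanSpace ℝ (Fin m)) M]
  [IsManifold (𝓡 m) ∞ M] [RiemannianBundle (fun x : M ↦ TangentSpace (𝓡 m) x)]
  [IsContMDiffRiemannianBundle (𝓡 m) ∞ (EuclideanSpace ℝ (Fin m))
    (fun x : M ↦ TangentSpace (𝓡 m) x)]

theorem IsGeodesic.isGeodesicAt {γ : ℝ → M} (h : IsGeodesic (m := m) γ) (t : ℝ) :
    IsGeodesicAt m γ t := by
  obtain ⟨hγ, heq⟩ := h
  set p := γ t
  set c : ℝ → EuclideanSpace ℝ (Fin m) := fun s ↦ extChartAt (𝓡 m) p (γ s) with hc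
  refine ⟨p, fun s ↦ (c s, deriv c s), ?_⟩
  have hev : ∀ᶠ s in 𝓝 t, γ s ∈ (extChartAt (𝓡 m) p).source :=
    hγ.continuous.continuousAt.eventually ((isOpen_extChartAt_source p).eventually_mem
      (mem_extChartAt_source p))
  filter_upwards [hev] with s hs
  have hcs : ContDiffAt ℝ 2 c s := by
    have h1 : ContMDiffAt (𝓡 m) 𝓘(ℝ, EuclideanSpace ℝ (Fin m)) 2 (extChartAt (𝓡 m) p) (γ s) :=
      (contMDiffAt_extChartAt' (n := ∞) (by simpa using hs)).of_le ENat.LEInfty.out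
    exact (h1.comp s (hγ s)).contDiffAt
  have h1 : HasDerivAt c (deriv c s) s := (hcs.differentiableAt (by norm_num)).hasDerivAt
  have h2 : HasDerivAt (deriv c) (deriv (deriv c) s) s := by
    have : DifferentiableAt ℝ (fun s ↦ fderiv ℝ c s 1) s :=
      ((hcs.fderiv_right (m := 1) (by norm_num)).differentiableAt (by norm_num)).clm_apply
        (differentiableAt_const _)
    exact this.hasDerivAt
  refine ⟨(extChartAt (𝓡 m) p).map_source hs, ((extChartAt (𝓡 m) p).left_inv hs).symm, ?_⟩
  have h3 := (geodesic_equation_iff ((extChartAt (𝓡 m) p).map_source hs) _ _).mp (heq p s hs)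
  refine (h1.prodMk h2).congr_deriv (Prod.ext rfl h3)

/-- The local notion asks for the equation in one chart, while `IsGeodesic` demands it in every
preferred chart and asks for $C^2$. Coordinate invariance and bootstrapping close the gap. -/
theorem isGeodesic_of_forall {γ : ℝ → M} (h : ∀ t, IsGeodesicAt m γ t) : IsGeodesic (m := m) γ := by
  have hsm {p : M} {z} {t : ℝ} (hz : SolvesGeodesic (m := m) p z γ t) : ContDiffAt ℝ 2 z t :=
    contDiffAt_two_of_ode (contDiffAt_sprayField ((contDiffOn_geodesicCoeff p).contDiffAt
      ((isOpen_extChartAt_target p).mem_nhds hz.self_of_nhds.1))) (hz.mono fun s hs ↦ hs.2.2)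
  refine ⟨fun t ↦ ?_, fun p t ht ↦ ?_⟩
  · obtain ⟨p, z, hz⟩ := h t
    have h4 : γ =ᶠ[𝓝 t] (extChartAt (𝓡 m) p).symm ∘ fun s ↦ (z s).1 := hz.mono fun s hs ↦ hs.2.1
    refine ContMDiffAt.congr_of_eventuallyEq ?_ h4
    have h1 : ContMDiffAt 𝓘(ℝ, EuclideanSpace ℝ (Fin m)) (𝓡 m) 2 (extChartAt (𝓡 m) p).symm
        (z t).1 :=
      ((contMDiffOn_extChartAt_symm (n := ∞) p).contMDiffAt
        ((isOpen_extChartAt_target p).mem_nhds hz.self_of_nhds.1)).of_le ENat.LEInfty.out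
    exact ContMDiffAt.comp (f := fun s ↦ (z s).1) t h1 (hsm hz).fst.contMDiffAt
  · obtain ⟨p', z', hz'⟩ := h t
    have hz := hz'.change ht
    set z := fun s ↦ (chartChange p' p (z' s).1, fderiv ℝ (chartChange p' p) (z' s).1 (z' s).2)
    have hc : (fun s ↦ extChartAt (𝓡 m) p (γ s)) =ᶠ[𝓝 t] fun s ↦ (z s).1 := by
      filter_upwards [hz] with s hs
      rw [hs.2.1, (extChartAt (𝓡 m) p).right_inv hs.1]
    have hc' : deriv (fun s ↦ extChartAt (𝓡 m) p (γ s)) =ᶠ[𝓝 t] fun s ↦ (z s).2 := by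
      filter_upwards [hc.eventuallyEq_nhds, hz] with s hs hs'
      rw [hs.deriv_eq]
      exact (HasDerivAt.prod_fst hs'.2.2).deriv
    rw [geodesic_equation_iff ((extChartAt (𝓡 m) p).map_source ht), hc'.deriv_eq,
      hc'.self_of_nhds, show extChartAt (𝓡 m) p (γ t) = (z t).1 from hc.self_of_nhds]
    exact (HasDerivAt.prod_snd hz.self_of_nhds.2.2).deriv

theorem isGeodesicAt_const (x : M) (t : ℝ) : IsGeodesicAt m (fun _ ↦ x) t := by
  refine ⟨x, fun _ ↦ (extChartAt (𝓡 m) x x, 0), Eventually.of_forall fun s ↦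
    ⟨mem_extChartAt_target x, ((extChartAt (𝓡 m) x).left_inv (mem_extChartAt_source x)).symm, ?_⟩⟩
  exact (hasDerivAt_const s _).congr_deriv (Prod.ext rfl (by simp [sprayField]))

/-- By uniqueness the two geodesics agree in a neighbourhood of `τ`, so the glued curve equals each
of them near `τ` as well. -/
theorem IsGeodesicAt.glue {γ₁ γ₂ : ℝ → M} {τ : ℝ} (h₁ : IsGeodesicAt m γ₁ τ)
    (h₂ : IsGeodesicAt m γ₂ τ) (hv : velocity m γ₁ τ = velocity m γ₂ τ) :
    ∃ γ : ℝ → M, (∀ t ≤ τ, γ =ᶠ[𝓝 t] γ₁) ∧ ∀ t ≥ τ, γ =ᶠ[𝓝 t] γ₂ := by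
  obtain ⟨p, z, hz⟩ := h₁
  obtain ⟨p', z', hz'⟩ := h₂
  have heq := hz.eventuallyEq hz' hv
  refine ⟨fun t ↦ if t ≤ τ then γ₁ t else γ₂ t, fun t ht ↦ ?_, fun t ht ↦ ?_⟩
  · rcases ht.lt_or_eq with ht | rfl
    · filter_upwards [Iio_mem_nhds ht] with s hs
      exact if_pos (le_of_lt hs)
    · filter_upwards [heq] with s hs
      split_ifs
      · rfl
      · exact hs.symm
  · rcases (show τ ≤ t from ht).lt_or_eq with ht | rfl
    · filter_upwards [Ioi_mem_nhds ht] with s hs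
      exact if_neg (not_le.mpr hs)
    · filter_upwards [heq] with s hs
      split_ifs
      · exact hs
      · rfl

/-- If geodesics of small velocity exist for two units of time, then they exist for all times. -/
theorem exists_isGeodesic [T2Space M] {r : ℝ}
    (h : ∀ X : TangentBundle (𝓡 m) M, ‖X.2‖ < r →
      ∃ γ : ℝ → M, (∀ t ∈ Ioo (-2 : ℝ) 2, IsGeodesicAt m γ t) ∧ velocity m γ 0 = X)
    (X : TangentBundle (𝓡 m) M) (hX : ‖X.2‖ < r) :
    ∃ γ : ℝ → M, (∀ t, IsGeodesicAt m γ t) ∧ velocity m γ 0 = X := by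
  -- The interval grows by one unit at each end: at the times $\pm(n+1)$ the geodesic is restarted,
  -- still with speed below `r`, for two units of time.
  have hn (n : ℕ) : ∃ γ : ℝ → M, (∀ t ∈ Ioo (-(n + 2 : ℝ)) (n + 2), IsGeodesicAt m γ t) ∧
      velocity m γ 0 = X := by
    induction n with
    | zero => simpa using h X hX
    | succ n ih =>
      obtain ⟨γ, hγ, hv⟩ := ih
      have hn0 : (0 : ℝ) ≤ n := n.cast_nonneg
      have hsp (t : ℝ) (ht : t ∈ Ioo (-(n + 2 : ℝ)) (n + 2)) : ‖(velocity m γ t).2‖ < r := by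
        rw [IsGeodesicAt.norm_velocity_eq hγ ht (show (0 : ℝ) ∈ _ by constructor <;> linarith), hv]
        exact hX
      have hr1 : (n + 1 : ℝ) ∈ Ioo (-(n + 2 : ℝ)) (n + 2) := by constructor <;> linarith
      have hl1 : -(n + 1 : ℝ) ∈ Ioo (-(n + 2 : ℝ)) (n + 2) := by constructor <;> linarith
      obtain ⟨σ, hσ, hσv⟩ := h _ (hsp _ hr1)
      obtain ⟨σ', hσ', hσv'⟩ := h _ (hsp _ hl1)
      have h0 : (0 : ℝ) ∈ Ioo (-2 : ℝ) 2 := by constructor <;> norm_num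
      have e1 := (hσ 0 h0).comp_sub (n + 1 : ℝ)
      have e2 := (hσ' 0 h0).comp_sub (-(n + 1) : ℝ)
      rw [zero_add] at e1 e2
      obtain ⟨γ₁, g1, g2⟩ := IsGeodesicAt.glue (hγ _ hr1) e1.1 (by rw [e1.2, hσv])
      have e3 : velocity m γ₁ (-(n + 1)) = velocity m γ (-(n + 1)) :=
        velocity_congr (g1 _ (by linarith))
      obtain ⟨γ₂, g3, g4⟩ := IsGeodesicAt.glue e2.1
        ((hγ _ hl1).congr (g1 _ (by linarith)).symm) (by rw [e2.2, hσv', e3])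
      refine ⟨γ₂, fun t ht ↦ ?_, ?_⟩
      · push_cast at ht
        rcases le_total t (-(n + 1 : ℝ)) with ht1 | ht1
        · have := ((hσ' (t + (n + 1)) ⟨by linarith [ht.1], by linarith⟩).comp_sub
            (-(n + 1) : ℝ)).1
          rw [add_neg_cancel_right] at this
          exact this.congr (g3 t ht1).symm
        · refine IsGeodesicAt.congr ?_ (g4 t ht1).symm
          rcases le_total t (n + 1 : ℝ) with ht2 | ht2
          · exact (hγ t ⟨by linarith, by linarith⟩).congr (g1 t ht2).symm
          · have := ((hσ (t - (n + 1)) ⟨by linarith, by linarith [ht.2]⟩).comp_sub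
              (n + 1 : ℝ)).1
            rw [sub_add_cancel] at this
            exact this.congr (g2 t ht2).symm
      · rw [velocity_congr (g4 0 (by linarith)), velocity_congr (g1 0 (by linarith)), hv]
  choose γ hγ hv using hn
  have hagree (k N : ℕ) (hkN : k ≤ N) (t : ℝ) (ht : t ∈ Ioo (-(k + 2 : ℝ)) (k + 2)) :
      γ k t = γ N t := by
    have hkN' : (k : ℝ) ≤ N := by exact_mod_cast hkN
    have hk : (0 : ℝ) ≤ k := k.cast_nonneg
    refine IsGeodesicAt.eqOn isPreconnected_Ioo (hγ k) (fun s hs ↦ hγ N s ?_) (t₀ := 0) ?_ ?_ ht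
    · exact ⟨by linarith [hs.1], by linarith [hs.2]⟩
    · constructor <;> linarith
    · rw [hv, hv]
  -- The curve with index $k$ lives on $(-(k+2),k+2)$. Near `t` the varying index is at most
  -- $\lceil|t|+1\rceil$, so one fixed curve represents the union there.
  have heq (t : ℝ) : (fun s ↦ γ ⌈|s|⌉₊ s) =ᶠ[𝓝 t] γ ⌈|t| + 1⌉₊ := by
    have : ∀ᶠ s in 𝓝 t, |s| < |t| + 1 := continuous_abs.continuousAt.eventually_lt_const (by linarith)
    filter_upwards [this] with s hs
    refine hagree _ _ (Nat.ceil_mono hs.le) s ?_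
    have h1 := Nat.le_ceil |s|
    exact ⟨by linarith [neg_abs_le s], by linarith [le_abs_self s]⟩
  refine ⟨fun s ↦ γ ⌈|s|⌉₊ s, fun t ↦ ?_, ?_⟩
  · refine (hγ _ t ?_).congr (heq t).symm
    have h1 := Nat.le_ceil (|t| + 1)
    exact ⟨by linarith [neg_abs_le t], by linarith [le_abs_self t]⟩
  · rw [velocity_congr (heq 0), hv]

/-- A complete geodesic is needed for `riemExp` to leave its default value. By uniqueness any
geodesic on $(-2,2)$ with the same initial velocity then computes it. -/
theorem riemExp_eq [T2Space M] {x : M} {v : TangentSpace (𝓡 m) x} {γ γ' : ℝ → M}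
    (hγ : ∀ t, IsGeodesicAt m γ t) (hv : velocity m γ 0 = ⟨x, v⟩)
    (hγ' : ∀ t ∈ Ioo (-2 : ℝ) 2, IsGeodesicAt m γ' t) (hv' : velocity m γ' 0 = ⟨x, v⟩) :
    riemExp x v = γ' 1 := by
  have h : ∃ γ : ℝ → M, IsGeodesicFrom x v γ := ⟨γ, isGeodesic_of_forall hγ, hv⟩
  rw [riemExp, dif_pos h]
  obtain ⟨h1, h2⟩ := h.choose_spec
  exact IsGeodesicAt.eqOn isPreconnected_Ioo (fun t _ ↦ h1.isGeodesicAt t) hγ'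
    (t₀ := 0) (by constructor <;> norm_num) (h2.trans hv'.symm) (by constructor <;> norm_num)

end Completeness

/-! ### The exponential map in local coordinates -/

section ExpLocal

set_option maxSynthPendingDepth 3

open Set Filter

variable {m : ℕ} {M : Type*} [TopologicalSpace M] [ChartedSpace (EuclideanSpace ℝ (Fin m)) M]
  [IsManifold (𝓡 m) ∞ M] [RiemannianBundle (fun x : M ↦ TangentSpace (𝓡 m) x)]
  [IsContMDiffRiemannianBundle (𝓡 m) ∞ (EuclideanSpace ℝ (Fin m))
    (fun x : M ↦ TangentSpace (𝓡 m) x)]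

theorem isContinuousRiemannianBundle :
    IsContinuousRiemannianBundle (EuclideanSpace ℝ (Fin m)) (fun x : M ↦ TangentSpace (𝓡 m) x) := by
  obtain ⟨g, h1, h2⟩ := IsContMDiffRiemannianBundle.exists_contMDiff (IB := 𝓡 m) (n := ∞)
    (F := EuclideanSpace ℝ (Fin m)) (E := fun x : M ↦ TangentSpace (𝓡 m) x)
  exact ⟨g, h1.continuous, h2⟩

/-- The derivative of the preferred chart at `p`. -/
def chartDeriv (p x : M) : EuclideanSpace ℝ (Fin m) →L[ℝ] EuclideanSpace ℝ (Fin m) :=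
  mfderiv (𝓡 m) 𝓘(ℝ, EuclideanSpace ℝ (Fin m)) (extChartAt (𝓡 m) p) x

theorem eventually_norm_chartDeriv_le (p : M) :
    ∃ C > 0, ∀ᶠ x in 𝓝 p, ∀ v : TangentSpace (𝓡 m) x, ‖chartDeriv p x v‖ ≤ C * ‖v‖ := by
  have : IsManifold (𝓡 m) 1 M := IsManifold.of_le (n := ∞) (by simp)
  have := isContinuousRiemannianBundle (m := m) (M := M)
  obtain ⟨C, hC, h⟩ := eventually_norm_mfderiv_extChartAt_lt (𝓡 m) p
  exact ⟨C, hC, h.mono fun x hx v ↦ ContinuousLinearMap.le_of_opNorm_le (E := TangentSpace (𝓡 m) x)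
    (F := EuclideanSpace ℝ (Fin m)) _ hx.le v⟩

theorem eventually_norm_le_chartDeriv (p : M) :
    ∃ C > 0, ∀ᶠ x in 𝓝 p, ∀ v : TangentSpace (𝓡 m) x, ‖v‖ ≤ C * ‖chartDeriv p x v‖ := by
  have : IsManifold (𝓡 m) 1 M := IsManifold.of_le (n := ∞) (by simp)
  have := isContinuousRiemannianBundle (m := m) (M := M)
  obtain ⟨C, hC, h⟩ := eventually_norm_mfderivWithin_symm_extChartAt_lt (𝓡 m) p
  rw [ModelWithCorners.range_eq_univ, nhdsWithin_univ] at h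
  refine ⟨C, hC, ?_⟩
  filter_upwards [(continuousAt_extChartAt (I := 𝓡 m) p).eventually h,
    (isOpen_extChartAt_source (I := 𝓡 m) p).eventually_mem (mem_extChartAt_source p)] with x hx hxs v
  rw [mfderivWithin_univ] at hx
  have h1 := ContinuousLinearMap.le_of_opNorm_le (E := EuclideanSpace ℝ (Fin m))
    (F := TangentSpace (𝓡 m) ((extChartAt (𝓡 m) p).symm (extChartAt (𝓡 m) p x))) _ hx.le
    (chartDeriv p x v)
  have h2 := tangentPoint_mfderiv hxs v
  have h3 := congrArg (fun X : TangentBundle (𝓡 m) M ↦ ‖X.2‖) h2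
  exact h3.symm.trans_le h1

/-- The local description of the geodesics of small velocity. -/
theorem exists_local_geodesicFlow (p : M) :
    ∃ ρ > 0, ∃ Φ : EuclideanSpace ℝ (Fin m) → EuclideanSpace ℝ (Fin m) → EuclideanSpace ℝ (Fin m),
      (∀ y ∈ Metric.ball (extChartAt (𝓡 m) p p) ρ, ∀ a ∈ Metric.ball 0 ρ,
        Φ y a ∈ (extChartAt (𝓡 m) p).target ∧
        ∃ γ : ℝ → M, (∀ t ∈ Ioo (-2 : ℝ) 2, IsGeodesicAt m γ t) ∧
          velocity m γ 0 = tangentPoint p (y, a) ∧ γ 1 = (extChartAt (𝓡 m) p).symm (Φ y a)) ∧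
      ContinuousOn (fun z : EuclideanSpace ℝ (Fin m) × EuclideanSpace ℝ (Fin m) ↦ Φ z.1 z.2)
        (Metric.ball (extChartAt (𝓡 m) p p) ρ ×ˢ Metric.ball 0 ρ) ∧
      ∀ η > 0, ∃ ρ' > 0, ∀ y ∈ Metric.ball (extChartAt (𝓡 m) p p) ρ', ∀ a₁ ∈ Metric.ball 0 ρ',
        ∀ a₂ ∈ Metric.ball 0 ρ', ‖Φ y a₁ - Φ y a₂ - (a₁ - a₂)‖ ≤ η * ‖a₁ - a₂‖ := by
  obtain ⟨ρ, hρ, Ψ, h1, h2, h3⟩ := exists_sprayFlow (isOpen_extChartAt_target (I := 𝓡 m) p)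
    (contDiffOn_geodesicCoeff p) (mem_extChartAt_target p)
  refine ⟨ρ, hρ, fun y a ↦ (Ψ y a 1).1, fun y hy a ha ↦ ?_, h2, h3⟩
  obtain ⟨h4, h5⟩ := h1 y hy a ha
  have h6 (t : ℝ) (ht : t ∈ Ioo (-2 : ℝ) 2) :
      SolvesGeodesic p (Ψ y a) (fun t ↦ (extChartAt (𝓡 m) p).symm (Ψ y a t).1) t := by
    filter_upwards [isOpen_Ioo.mem_nhds ht] with s hs
    exact ⟨(h5 s hs).1, rfl, (h5 s hs).2⟩
  have h0 : (0 : ℝ) ∈ Ioo (-2 : ℝ) 2 := by constructor <;> norm_num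
  refine ⟨(h5 1 (by constructor <;> norm_num)).1, _, fun t ht ↦ ⟨p, _, h6 t ht⟩, ?_, rfl⟩
  rw [(h6 0 h0).velocity_eq, h4]

/-- In a chart, small coordinate velocities suffice. The Riemannian and coordinate norms are
comparable near each point, and compactness provides one radius. -/
theorem exists_forall_geodesic [CompactSpace M] :
    ∃ r > 0, ∀ X : TangentBundle (𝓡 m) M, ‖X.2‖ < r →
      ∃ γ : ℝ → M, (∀ t ∈ Ioo (-2 : ℝ) 2, IsGeodesicAt m γ t) ∧ velocity m γ 0 = X := by
  obtain ⟨r, hr, H⟩ := exists_pos_forall_of_compact (M := M)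
    (K := fun r x ↦ ∀ v : TangentSpace (𝓡 m) x, ‖v‖ < r →
      ∃ γ : ℝ → M, (∀ t ∈ Ioo (-2 : ℝ) 2, IsGeodesicAt m γ t) ∧ velocity m γ 0 = ⟨x, v⟩)
    (fun r r' x hr h v hv ↦ h v (hv.trans_le hr)) (fun p ↦ by
      obtain ⟨ρ, hρ, Φ, h1, -, -⟩ := exists_local_geodesicFlow (m := m) p
      obtain ⟨C, hC, h⟩ := eventually_norm_chartDeriv_le (m := m) p
      refine ⟨ρ / C, by positivity, ?_⟩
      filter_upwards [h, (continuousAt_extChartAt (I := 𝓡 m) p).eventually_mem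
        (Metric.ball_mem_nhds _ hρ), (isOpen_extChartAt_source (I := 𝓡 m) p).eventually_mem
        (mem_extChartAt_source p)] with x hx hxρ hxs v hv
      obtain ⟨-, γ, h2, h3, -⟩ := h1 _ hxρ (chartDeriv p x v) (by
        rw [mem_ball_zero_iff]
        refine (hx v).trans_lt ?_
        rwa [lt_div_iff₀' hC] at hv)
      exact ⟨γ, h2, h3.trans (tangentPoint_mfderiv hxs v)⟩)
  exact ⟨r, hr, fun X hX ↦ H X.1 X.2 hX⟩

/-- The exponential map in local coordinates. -/
theorem exists_riemExp_eq [CompactSpace M] [T2Space M] :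
    ∃ r > 0, ∀ (x : M) (v : TangentSpace (𝓡 m) x), ‖v‖ < r → ∀ γ : ℝ → M,
      (∀ t ∈ Ioo (-2 : ℝ) 2, IsGeodesicAt m γ t) → velocity m γ 0 = ⟨x, v⟩ → riemExp x v = γ 1 := by
  obtain ⟨r, hr, H⟩ := exists_forall_geodesic (m := m) (M := M)
  refine ⟨r, hr, fun x v hv γ' hγ' hv' ↦ ?_⟩
  obtain ⟨γ, h1, h2⟩ := exists_isGeodesic H ⟨x, v⟩ hv
  exact riemExp_eq h1 h2 hγ' hv'

theorem riemExp_zero [CompactSpace M] [T2Space M] (x : M) :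
    riemExp x (0 : TangentSpace (𝓡 m) x) = x := by
  obtain ⟨r, hr, H⟩ := exists_riemExp_eq (m := m) (M := M)
  have h0 : velocity m (fun _ : ℝ ↦ x) 0 = ⟨x, 0⟩ :=
    tangentBundle_ext rfl (congrArg (fun A : ℝ →L[ℝ] EuclideanSpace ℝ (Fin m) ↦ A 1)
      (mfderiv_const (c := x)))
  exact H x 0 (by rwa [norm_zero]) (fun _ ↦ x) (fun t _ ↦ isGeodesicAt_const x t) h0

/-- The coordinate expression `Φ` inherits continuity and the first order estimate from the time-one
map of the spray. -/
theorem exists_local_riemExp [CompactSpace M] [T2Space M] (p : M) :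
    ∃ ρ > 0, ∃ Φ : EuclideanSpace ℝ (Fin m) → EuclideanSpace ℝ (Fin m) → EuclideanSpace ℝ (Fin m),
      (∀ x ∈ (extChartAt (𝓡 m) p).source, extChartAt (𝓡 m) p x ∈ Metric.ball (extChartAt (𝓡 m) p p) ρ →
        ∀ v : TangentSpace (𝓡 m) x, ‖v‖ < ρ → ‖chartDeriv p x v‖ < ρ →
          Φ (extChartAt (𝓡 m) p x) (chartDeriv p x v) ∈ (extChartAt (𝓡 m) p).target ∧
          riemExp x v = (extChartAt (𝓡 m) p).symm (Φ (extChartAt (𝓡 m) p x) (chartDeriv p x v))) ∧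
      ContinuousOn (fun z : EuclideanSpace ℝ (Fin m) × EuclideanSpace ℝ (Fin m) ↦ Φ z.1 z.2)
        (Metric.ball (extChartAt (𝓡 m) p p) ρ ×ˢ Metric.ball 0 ρ) ∧
      ∀ η > 0, ∃ ρ' > 0, ∀ y ∈ Metric.ball (extChartAt (𝓡 m) p p) ρ', ∀ a₁ ∈ Metric.ball 0 ρ',
        ∀ a₂ ∈ Metric.ball 0 ρ', ‖Φ y a₁ - Φ y a₂ - (a₁ - a₂)‖ ≤ η * ‖a₁ - a₂‖ := by
  obtain ⟨r, hr, H⟩ := exists_riemExp_eq (m := m) (M := M)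
  obtain ⟨ρ, hρ, Φ, h1, h2, h3⟩ := exists_local_geodesicFlow (m := m) p
  refine ⟨min r ρ, by positivity, Φ, fun x hx hxρ v hv hv' ↦ ?_,
    h2.mono (prod_mono (Metric.ball_subset_ball (min_le_right _ _))
      (Metric.ball_subset_ball (min_le_right _ _))), h3⟩
  obtain ⟨h4, γ, h5, h6, h7⟩ := h1 _ (Metric.ball_subset_ball (min_le_right _ _) hxρ)
    (chartDeriv p x v) (by simpa using hv'.trans_le (min_le_right _ _))
  refine ⟨h4, ?_⟩
  rw [← h7]
  exact H x v (hv.trans_le (min_le_left _ _)) γ h5 (h6.trans (tangentPoint_mfderiv hx v))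

end ExpLocal

/-! ### The orthogonal left inverse of an injective linear map -/

section LeftInverse

open ContinuousLinearMap

variable {V E : Type*} [NormedAddCommGroup V] [InnerProductSpace ℝ V] [FiniteDimensional ℝ V]
  [NormedAddCommGroup E] [InnerProductSpace ℝ E] [FiniteDimensional ℝ E]

/-- The orthogonal left inverse `(K†K)⁻¹K†` of an injective linear map. -/
def leftInv [CompleteSpace V] [CompleteSpace E] (K : V →L[ℝ] E) : E →L[ℝ] V :=
  (inverse (adjoint K ∘L K)).comp (adjoint K)

variable [CompleteSpace V] [CompleteSpace E]

theorem adjoint_comp_self_injective {K : V →L[ℝ] E} (hK : Function.Injective K) :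
    Function.Injective (adjoint K ∘L K) := by
  refine (injective_iff_map_eq_zero _).mpr fun v hv ↦ ?_
  have h1 : inner ℝ (K v) (K v) = 0 := by
    rw [← adjoint_inner_left K v (K v)]
    change inner ℝ ((adjoint K ∘L K) v) v = 0
    rw [hv, inner_zero_left]
  exact hK (by rw [inner_self_eq_zero.mp h1, map_zero])

theorem isInvertible_adjoint_comp_self {K : V →L[ℝ] E} (hK : Function.Injective K) :
    (adjoint K ∘L K).IsInvertible :=
  ⟨(LinearEquiv.ofInjectiveEndo (adjoint K ∘L K).toLinearMap
    (adjoint_comp_self_injective hK)).toContinuousLinearEquiv, rfl⟩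

theorem adjoint_apply_leftInv {K : V →L[ℝ] E} (hK : Function.Injective K) (w : E) :
    adjoint K (K (leftInv K w)) = adjoint K w := by
  obtain ⟨e, he⟩ := isInvertible_adjoint_comp_self hK
  change (adjoint K ∘L K) (inverse (adjoint K ∘L K) (adjoint K w)) = _
  rw [← he, inverse_equiv]
  exact e.apply_symm_apply _

theorem leftInv_eq {K : V →L[ℝ] E} (hK : Function.Injective K) {w : E} {v : V}
    (h : adjoint K (K v) = adjoint K w) : leftInv K w = v :=
  adjoint_comp_self_injective hK ((adjoint_apply_leftInv hK w).trans h.symm)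

theorem leftInv_apply_self {K : V →L[ℝ] E} (hK : Function.Injective K) (v : V) :
    leftInv K (K v) = v :=
  leftInv_eq hK rfl

/-- The normal equations for `K` and for `K ∘L A` are equivalent when `A` is onto. Hence least
squares solutions do not depend on the coordinates of the domain. -/
theorem apply_leftInv_comp {K : V →L[ℝ] E} (hK : Function.Injective K) {A : V →L[ℝ] V}
    (hA : Function.Bijective A) (w : E) : A (leftInv (K ∘L A) w) = leftInv K w := by
  refine (leftInv_eq hK ?_).symm
  have h1 := adjoint_apply_leftInv (K := K ∘L A) (hK.comp hA.1) w
  refine ext_inner_left ℝ fun v ↦ ?_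
  obtain ⟨v, rfl⟩ := hA.2 v
  have h2 := congrArg (inner ℝ v) h1
  rw [adjoint_inner_right, adjoint_inner_right] at h2
  rw [adjoint_inner_right, adjoint_inner_right]
  exact h2

theorem continuousAt_leftInv {K : V →L[ℝ] E} (hK : Function.Injective K) :
    ContinuousAt leftInv K := by
  have h1 : Continuous fun K : V →L[ℝ] E ↦ adjoint K := (adjoint (𝕜 := ℝ)).continuous
  have h2 : Continuous fun K : V →L[ℝ] E ↦ adjoint K ∘L K := h1.clm_comp continuous_id
  obtain ⟨e, he⟩ := isInvertible_adjoint_comp_self hK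
  have h3 : ContinuousAt inverse (adjoint K ∘L K) :=
    he ▸ (contDiffAt_map_inverse (n := 0) e).continuousAt
  exact (h3.comp (f := fun K : V →L[ℝ] E ↦ adjoint K ∘L K) h2.continuousAt).clm_comp
    h1.continuousAt

end LeftInverse

/-! ### Derivatives on the manifold read in an ambient Euclidean space -/

section Transfer

set_option maxSynthPendingDepth 3

open Set Filter Asymptotics

variable {m : ℕ} {M : Type*} [TopologicalSpace M] [ChartedSpace (EuclideanSpace ℝ (Fin m)) M]
variable {E F : Type*} [NormedAddCommGroup E] [InnerProductSpace ℝ E] [FiniteDimensional ℝ E]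
  [CompleteSpace E] [NormedAddCommGroup F] [NormedSpace ℝ F]

/-- The derivative of a map from a manifold to a vector space, as a linear map on the model space. -/
def flatDeriv (m : ℕ) {M F : Type*} [TopologicalSpace M] [ChartedSpace (EuclideanSpace ℝ (Fin m)) M]
    [NormedAddCommGroup F] [NormedSpace ℝ F] (h : M → F) (x : M) :
    EuclideanSpace ℝ (Fin m) →L[ℝ] F :=
  mfderiv (𝓡 m) 𝓘(ℝ, F) h x

/-- The derivative of `h`, as a map on the ambient space of the immersion `ι`. -/
def transferDeriv (m : ℕ) {M : Type*} [TopologicalSpace M]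
    [ChartedSpace (EuclideanSpace ℝ (Fin m)) M] (ι : M → E) (h : M → F) (x : M) : E →L[ℝ] F :=
  (flatDeriv m h x).comp (leftInv (flatDeriv m ι x))

/-- The derivative of `h` in the chart at `p`. -/
def localDeriv (m : ℕ) {M : Type*} [TopologicalSpace M]
    [ChartedSpace (EuclideanSpace ℝ (Fin m)) M] (p : M) (h : M → F) (x : M) :
    EuclideanSpace ℝ (Fin m) →L[ℝ] F :=
  fderiv ℝ (h ∘ (extChartAt (𝓡 m) p).symm) (extChartAt (𝓡 m) p x)

variable [IsManifold (𝓡 m) ∞ M]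

theorem chartDeriv_bijective {p x : M} (hx : x ∈ (extChartAt (𝓡 m) p).source) :
    Function.Bijective (chartDeriv (m := m) p x) := by
  have hinj : Function.Injective (chartDeriv (m := m) p x) := fun a b hab ↦ by
    have h1 := chartSymmDeriv_mfderiv_extChartAt hx a
    have h2 := chartSymmDeriv_mfderiv_extChartAt hx b
    exact h1.symm.trans ((congrArg _ hab).trans h2)
  exact ⟨hinj, LinearMap.injective_iff_surjective.mp hinj⟩

theorem flatDeriv_eq {p x : M} (hx : x ∈ (extChartAt (𝓡 m) p).source) {h : M → F}
    (hh : MDifferentiableAt (𝓡 m) 𝓘(ℝ, F) h x) :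
    flatDeriv m h x = localDeriv m p h x ∘L chartDeriv p x := by
  have h1 : h =ᶠ[𝓝 x] (h ∘ (extChartAt (𝓡 m) p).symm) ∘ extChartAt (𝓡 m) p := by
    filter_upwards [(isOpen_extChartAt_source (I := 𝓡 m) p).eventually_mem hx] with y hy
    simp only [Function.comp, (extChartAt (𝓡 m) p).left_inv hy]
  have hy := (extChartAt (𝓡 m) p).map_source hx
  have h2 : MDifferentiableAt 𝓘(ℝ, EuclideanSpace ℝ (Fin m)) 𝓘(ℝ, F)
      (h ∘ (extChartAt (𝓡 m) p).symm) (extChartAt (𝓡 m) p x) := by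
    refine MDifferentiableAt.comp (I' := 𝓡 m) _ ?_ (mdifferentiableAt_extChartAt_symm hy)
    rwa [(extChartAt (𝓡 m) p).left_inv hx]
  have h3 := mfderiv_comp x h2 (mdifferentiableAt_extChartAt' hx)
  rw [← h1.mfderiv_eq, mfderiv_eq_fderiv] at h3
  exact h3

theorem contDiffAt_comp_symm {p x : M} (hx : x ∈ (extChartAt (𝓡 m) p).source) {h : M → F}
    (hh : ContMDiffAt (𝓡 m) 𝓘(ℝ, F) 1 h x) :
    ContDiffAt ℝ 1 (h ∘ (extChartAt (𝓡 m) p).symm) (extChartAt (𝓡 m) p x) := by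
  have hy := (extChartAt (𝓡 m) p).map_source hx
  refine ContMDiffAt.contDiffAt (ContMDiffAt.comp (I' := 𝓡 m) _ ?_
    (((contMDiffOn_extChartAt_symm (n := ∞) p).contMDiffAt
      ((isOpen_extChartAt_target p).mem_nhds hy)).of_le (by simp)))
  rwa [(extChartAt (𝓡 m) p).left_inv hx]

theorem continuousAt_localDeriv {p x : M} (hx : x ∈ (extChartAt (𝓡 m) p).source) {h : M → F}
    (hh : ContMDiffAt (𝓡 m) 𝓘(ℝ, F) 1 h x) : ContinuousAt (localDeriv m p h) x :=
  ContinuousAt.comp (g := fderiv ℝ (h ∘ (extChartAt (𝓡 m) p).symm))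
    ((contDiffAt_comp_symm hx hh).continuousAt_fderiv (by norm_num)) (continuousAt_extChartAt' hx)

theorem localDeriv_injective {p x : M} (hx : x ∈ (extChartAt (𝓡 m) p).source) {ι : M → E}
    (hι : ContMDiff (𝓡 m) 𝓘(ℝ, E) 1 ι) (hinj : Function.Injective (flatDeriv m ι x)) :
    Function.Injective (localDeriv m p ι x) := by
  rw [flatDeriv_eq hx (hι.mdifferentiableAt (by norm_num))] at hinj
  intro a b hab
  obtain ⟨a, rfl⟩ := (chartDeriv_bijective hx).2 a
  obtain ⟨b, rfl⟩ := (chartDeriv_bijective hx).2 b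
  rw [hinj hab]

variable {ι : M → E} (hι : ContMDiff (𝓡 m) 𝓘(ℝ, E) 1 ι)
  (hinj : ∀ x, Function.Injective (flatDeriv m ι x))

include hι hinj

/-- `flatDeriv` alone depends on the preferred chart at each point and may jump with it. In
`transferDeriv` this choice cancels, so it can be computed in one fixed chart, where all ingredients
are continuous. -/
theorem transferDeriv_eq {p x : M} (hx : x ∈ (extChartAt (𝓡 m) p).source) {h : M → F}
    (hh : MDifferentiableAt (𝓡 m) 𝓘(ℝ, F) h x) :
    transferDeriv m ι h x = localDeriv m p h x ∘L leftInv (localDeriv m p ι x) := by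
  ext w
  have h1 := apply_leftInv_comp (localDeriv_injective hx hι (hinj x)) (chartDeriv_bijective hx) w
  rw [transferDeriv, flatDeriv_eq hx hh, flatDeriv_eq hx (hι.mdifferentiableAt (by norm_num))]
  exact congrArg _ h1

theorem continuousAt_transferDeriv {h : M → F} {p : M}
    (hh : ∀ᶠ x in 𝓝 p, ContMDiffAt (𝓡 m) 𝓘(ℝ, F) 1 h x) :
    ContinuousAt (transferDeriv m ι h) p := by
  have hp := mem_extChartAt_source (I := 𝓡 m) p
  have h1 : transferDeriv m ι h =ᶠ[𝓝 p]
      fun x ↦ localDeriv m p h x ∘L leftInv (localDeriv m p ι x) := by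
    filter_upwards [hh, (isOpen_extChartAt_source (I := 𝓡 m) p).eventually_mem hp] with x hx hxs
    exact transferDeriv_eq hι hinj hxs (hx.mdifferentiableAt (by norm_num))
  refine ContinuousAt.congr ?_ h1.symm
  refine (continuousAt_localDeriv hp hh.self_of_nhds).clm_comp ?_
  exact ContinuousAt.comp (g := leftInv) (continuousAt_leftInv (localDeriv_injective hp hι (hinj p)))
    (continuousAt_localDeriv hp (hι p))

/-- Strict differentiability in a chart, with coordinate differences exchanged for differences of
`ι`. -/
theorem transferDeriv_isLittleO {h : M → F} {p : M} (hh : ContMDiffAt (𝓡 m) 𝓘(ℝ, F) 1 h p) :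
    (fun z : M × M ↦ h z.1 - h z.2 - transferDeriv m ι h p (ι z.1 - ι z.2)) =o[𝓝 (p, p)]
      fun z ↦ ι z.1 - ι z.2 := by
  have hp := mem_extChartAt_source (I := 𝓡 m) p
  set e := extChartAt (𝓡 m) p
  have hK := localDeriv_injective hp hι (hinj p)
  have s1 : HasStrictFDerivAt (h ∘ e.symm) (localDeriv m p h p) (e p) :=
    (contDiffAt_comp_symm hp hh).hasStrictFDerivAt (by norm_num)
  have s2 : HasStrictFDerivAt (ι ∘ e.symm) (localDeriv m p ι p) (e p) :=
    (contDiffAt_comp_symm hp (hι p)).hasStrictFDerivAt (by norm_num)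
  obtain ⟨C, hC, hA⟩ := LinearMap.exists_antilipschitzWith (localDeriv m p ι p).toLinearMap
    (LinearMap.ker_eq_bot.mpr hK)
  have he : Tendsto (fun z : M × M ↦ (e z.1, e z.2)) (𝓝 (p, p)) (𝓝 (e p, e p)) := by
    have := continuousAt_extChartAt (I := 𝓡 m) p
    exact (this.tendsto.comp (continuous_fst.tendsto (p, p))).prodMk_nhds
      (this.tendsto.comp (continuous_snd.tendsto (p, p)))
  have o1 := s1.isLittleO.comp_tendsto he
  have o2 := s2.isLittleO.comp_tendsto he
  have hsrc : ∀ᶠ z : M × M in 𝓝 (p, p), z.1 ∈ e.source ∧ z.2 ∈ e.source :=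
    ((isOpen_extChartAt_source p).prod (isOpen_extChartAt_source p)).mem_nhds ⟨hp, hp⟩
  have o3 : (fun z : M × M ↦ h z.1 - h z.2 - localDeriv m p h p (e z.1 - e z.2)) =o[𝓝 (p, p)]
      fun z ↦ e z.1 - e z.2 := by
    refine o1.congr' (hsrc.mono fun z hz ↦ ?_) EventuallyEq.rfl
    simp only [Function.comp, e.left_inv hz.1, e.left_inv hz.2]
  have o4 : (fun z : M × M ↦ ι z.1 - ι z.2 - localDeriv m p ι p (e z.1 - e z.2)) =o[𝓝 (p, p)]
      fun z ↦ e z.1 - e z.2 := by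
    refine o2.congr' (hsrc.mono fun z hz ↦ ?_) EventuallyEq.rfl
    simp only [Function.comp, e.left_inv hz.1, e.left_inv hz.2]
  have b1 : (fun z : M × M ↦ e z.1 - e z.2) =O[𝓝 (p, p)]
      fun z ↦ localDeriv m p ι p (e z.1 - e z.2) :=
    IsBigO.of_bound C (Eventually.of_forall fun z ↦ hA.le_mul_norm (map_zero _) _)
  -- The derivative of the immersion is bounded below and its linearization error is of smaller
  -- order, so coordinate differences are controlled by differences of `ι`.
  have b2 : (fun z : M × M ↦ e z.1 - e z.2) =O[𝓝 (p, p)] fun z ↦ ι z.1 - ι z.2 := by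
    refine b1.trans ?_
    have h1 := (o4.trans_isBigO b1).right_isBigO_add
    simpa using h1
  rw [transferDeriv_eq hι hinj hp (hh.mdifferentiableAt (by norm_num))]
  have o5 := ((localDeriv m p h p ∘L leftInv (localDeriv m p ι p)).isBigO_comp _ _).trans_isLittleO
    o4
  refine ((o3.sub o5).trans_isBigO b2).congr_left fun z ↦ ?_
  simp only [map_sub, ContinuousLinearMap.comp_apply, leftInv_apply_self hK]
  abel

end Transfer

/-! ### The exponential map in the ambient space -/

section AmbientExp

set_option maxSynthPendingDepth 3

open Set Filter

variable {m : ℕ} {M : Type*} [TopologicalSpace M] [ChartedSpace (EuclideanSpace ℝ (Fin m)) M]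
  [IsManifold (𝓡 m) ∞ M] [RiemannianBundle (fun x : M ↦ TangentSpace (𝓡 m) x)]
  [IsContMDiffRiemannianBundle (𝓡 m) ∞ (EuclideanSpace ℝ (Fin m))
    (fun x : M ↦ TangentSpace (𝓡 m) x)]
variable {E : Type*} [NormedAddCommGroup E] [InnerProductSpace ℝ E] [FiniteDimensional ℝ E]
  [CompleteSpace E]

theorem continuousAt_leftInv_localDeriv {ι : M → E} (hι : ContMDiff (𝓡 m) 𝓘(ℝ, E) 1 ι)
    (hinj : ∀ x, Function.Injective (flatDeriv m ι x)) {p x : M}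
    (hx : x ∈ (extChartAt (𝓡 m) p).source) :
    ContinuousAt (fun x ↦ leftInv (localDeriv m p ι x)) x :=
  ContinuousAt.comp (g := leftInv) (continuousAt_leftInv (localDeriv_injective hx hι (hinj x)))
    (continuousAt_localDeriv hx (hι x))

theorem eventually_norm_leftInv_localDeriv_le {ι : M → E} (hι : ContMDiff (𝓡 m) 𝓘(ℝ, E) 1 ι)
    (hinj : ∀ x, Function.Injective (flatDeriv m ι x)) (p : M) :
    ∃ C > 0, ∀ᶠ x in 𝓝 p, ∀ V, ‖leftInv (localDeriv m p ι x) V‖ ≤ C * ‖V‖ := by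
  have h := (continuousAt_leftInv_localDeriv hι hinj (mem_extChartAt_source (I := 𝓡 m) p)).norm
  refine ⟨‖leftInv (localDeriv m p ι p)‖ + 1, by positivity, ?_⟩
  filter_upwards [h.tendsto.eventually_lt_const (lt_add_one _)] with x hx V
  exact ContinuousLinearMap.le_of_opNorm_le _ hx.le V

theorem eventually_norm_localDeriv_le {ι : M → E} (hι : ContMDiff (𝓡 m) 𝓘(ℝ, E) 1 ι) (p : M) :
    ∃ C > 0, ∀ᶠ x in 𝓝 p, ∀ a, ‖localDeriv m p ι x a‖ ≤ C * ‖a‖ := by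
  have h := (continuousAt_localDeriv (mem_extChartAt_source (I := 𝓡 m) p) (hι p)).norm
  refine ⟨‖localDeriv m p ι p‖ + 1, by positivity, ?_⟩
  filter_upwards [h.tendsto.eventually_lt_const (lt_add_one _)] with x hx V
  exact ContinuousLinearMap.le_of_opNorm_le _ hx.le V

/-- The Riemannian norm is equivalent to the one induced by an immersion. -/
theorem exists_norm_flatDeriv_equiv [CompactSpace M] {ι : M → E}
    (hι : ContMDiff (𝓡 m) 𝓘(ℝ, E) 1 ι) (hinj : ∀ x, Function.Injective (flatDeriv m ι x)) :
    ∃ c > 0, ∀ x, ∀ v : TangentSpace (𝓡 m) x,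
      c * ‖flatDeriv m ι x v‖ ≤ ‖v‖ ∧ c * ‖v‖ ≤ ‖flatDeriv m ι x v‖ := by
  refine exists_pos_forall_of_compact (M := M) (K := fun c x ↦ ∀ v : TangentSpace (𝓡 m) x,
      c * ‖flatDeriv m ι x v‖ ≤ ‖v‖ ∧ c * ‖v‖ ≤ ‖flatDeriv m ι x v‖) ?_ fun p ↦ ?_
  · intro r r' x hr h v
    exact ⟨(mul_le_mul_of_nonneg_right hr (norm_nonneg _)).trans (h v).1,
      (mul_le_mul_of_nonneg_right hr (norm_nonneg _)).trans (h v).2⟩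
  obtain ⟨C₁, h₁, e₁⟩ := eventually_norm_leftInv_localDeriv_le hι hinj p
  obtain ⟨C₂, h₂, e₂⟩ := eventually_norm_localDeriv_le hι p
  obtain ⟨C₃, h₃, e₃⟩ := eventually_norm_chartDeriv_le (m := m) p
  obtain ⟨C₄, h₄, e₄⟩ := eventually_norm_le_chartDeriv (m := m) p
  refine ⟨min (C₂ * C₃)⁻¹ (C₄ * C₁)⁻¹, by positivity, ?_⟩
  filter_upwards [e₁, e₂, e₃, e₄, (isOpen_extChartAt_source (I := 𝓡 m) p).eventually_mem
    (mem_extChartAt_source p)] with x k₁ k₂ k₃ k₄ hx v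
  have h5 : flatDeriv m ι x v = localDeriv m p ι x (chartDeriv p x v) :=
    congrArg (fun A ↦ A v) (flatDeriv_eq hx (hι.mdifferentiableAt (by norm_num)))
  have h6 := k₁ (localDeriv m p ι x (chartDeriv p x v))
  rw [leftInv_apply_self (localDeriv_injective hx hι (hinj x))] at h6
  rw [h5]
  constructor
  · refine (mul_le_mul_of_nonneg_right (min_le_left _ _) (norm_nonneg _)).trans ?_
    rw [inv_mul_le_iff₀ (by positivity), mul_assoc]
    exact (k₂ _).trans (mul_le_mul_of_nonneg_left (k₃ v) h₂.le)
  · refine (mul_le_mul_of_nonneg_right (min_le_right _ _) (norm_nonneg _)).trans ?_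
    rw [inv_mul_le_iff₀ (by positivity), mul_assoc]
    exact (k₄ v).trans (mul_le_mul_of_nonneg_left h6 h₄.le)

/-- The exponential map, with tangent vectors read in the ambient space of an immersion. -/
def ambientExp (m : ℕ) {M E : Type*} [TopologicalSpace M]
    [ChartedSpace (EuclideanSpace ℝ (Fin m)) M]
    [RiemannianBundle (fun x : M ↦ TangentSpace (𝓡 m) x)]
    [NormedAddCommGroup E] [InnerProductSpace ℝ E] [FiniteDimensional ℝ E] [CompleteSpace E]
    (ι : M → E) (x : M) (V : E) : M :=
  riemExp x (leftInv (flatDeriv m ι x) V : TangentSpace (𝓡 m) x)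

theorem ambientExp_zero [CompactSpace M] [T2Space M] (ι : M → E) (x : M) :
    ambientExp m ι x 0 = x := by
  refine Eq.trans ?_ (riemExp_zero (m := m) x)
  exact congrArg (fun v : TangentSpace (𝓡 m) x ↦ riemExp x v) (map_zero (leftInv (flatDeriv m ι x)))

theorem chartDeriv_leftInv {ι : M → E} (hι : ContMDiff (𝓡 m) 𝓘(ℝ, E) 1 ι)
    (hinj : ∀ x, Function.Injective (flatDeriv m ι x)) {p x : M}
    (hx : x ∈ (extChartAt (𝓡 m) p).source) (V : E) :
    chartDeriv p x (leftInv (flatDeriv m ι x) V) = leftInv (localDeriv m p ι x) V := by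
  rw [flatDeriv_eq hx (hι.mdifferentiableAt (by norm_num))]
  exact apply_leftInv_comp (localDeriv_injective hx hι (hinj x)) (chartDeriv_bijective hx) V

theorem exists_local_ambientExp [CompactSpace M] [T2Space M] {ι : M → E}
    (hι : ContMDiff (𝓡 m) 𝓘(ℝ, E) 1 ι) (hinj : ∀ x, Function.Injective (flatDeriv m ι x)) (p : M) :
    ∃ ρ > 0, ∃ Φ : EuclideanSpace ℝ (Fin m) → EuclideanSpace ℝ (Fin m) → EuclideanSpace ℝ (Fin m),
      (∃ r > 0, ∀ᶠ x in 𝓝 p, x ∈ (extChartAt (𝓡 m) p).source ∧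
        extChartAt (𝓡 m) p x ∈ Metric.ball (extChartAt (𝓡 m) p p) ρ ∧ ∀ V ∈ Metric.ball (0 : E) r,
          leftInv (localDeriv m p ι x) V ∈ Metric.ball 0 ρ ∧
          Φ (extChartAt (𝓡 m) p x) (leftInv (localDeriv m p ι x) V) ∈ (extChartAt (𝓡 m) p).target ∧
          ambientExp m ι x V = (extChartAt (𝓡 m) p).symm
            (Φ (extChartAt (𝓡 m) p x) (leftInv (localDeriv m p ι x) V))) ∧
      ContinuousOn (fun z : EuclideanSpace ℝ (Fin m) × EuclideanSpace ℝ (Fin m) ↦ Φ z.1 z.2)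
        (Metric.ball (extChartAt (𝓡 m) p p) ρ ×ˢ Metric.ball 0 ρ) ∧
      ∀ η > 0, ∃ ρ' > 0, ∀ y ∈ Metric.ball (extChartAt (𝓡 m) p p) ρ', ∀ a₁ ∈ Metric.ball 0 ρ',
        ∀ a₂ ∈ Metric.ball 0 ρ', ‖Φ y a₁ - Φ y a₂ - (a₁ - a₂)‖ ≤ η * ‖a₁ - a₂‖ := by
  obtain ⟨ρ, hρ, Φ, H, hc, ha⟩ := exists_local_riemExp (m := m) p
  obtain ⟨C₁, h₁, e₁⟩ := eventually_norm_leftInv_localDeriv_le hι hinj p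
  obtain ⟨C₄, h₄, e₄⟩ := eventually_norm_le_chartDeriv (m := m) p
  refine ⟨ρ, hρ, Φ, ⟨min (ρ / C₁) (ρ / (C₄ * C₁)), by positivity, ?_⟩, hc, ha⟩
  filter_upwards [e₁, e₄, (isOpen_extChartAt_source (I := 𝓡 m) p).eventually_mem
    (mem_extChartAt_source p), (continuousAt_extChartAt (I := 𝓡 m) p).eventually_mem
      (Metric.ball_mem_nhds _ hρ)] with x k₁ k₄ hx hxρ
  refine ⟨hx, hxρ, fun V hV ↦ ?_⟩
  rw [mem_ball_zero_iff, lt_min_iff, lt_div_iff₀' h₁, lt_div_iff₀' (by positivity), mul_assoc] at hV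
  have h5 := chartDeriv_leftInv hι hinj hx V
  have h6 := k₁ V
  have h7 := k₄ (leftInv (flatDeriv m ι x) V)
  rw [h5] at h7
  obtain ⟨h8, h9⟩ := H x hx hxρ (leftInv (flatDeriv m ι x) V)
    (h7.trans_lt ((mul_le_mul_of_nonneg_left h6 h₄.le).trans_lt hV.2))
    (by rw [h5]; exact h6.trans_lt hV.1)
  rw [h5] at h8 h9
  exact ⟨by rw [mem_ball_zero_iff]; exact h6.trans_lt hV.1, h8, h9⟩

theorem exists_continuousOn_ambientExp [CompactSpace M] [T2Space M] {ι : M → E}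
    (hι : ContMDiff (𝓡 m) 𝓘(ℝ, E) 1 ι) (hinj : ∀ x, Function.Injective (flatDeriv m ι x)) :
    ∃ ρ > 0, ContinuousOn (Function.uncurry (ambientExp m ι)) (univ ×ˢ Metric.ball 0 ρ) := by
  obtain ⟨ρ, hρ, H⟩ := exists_pos_forall_of_compact (M := M)
    (K := fun r x ↦ ∀ V ∈ Metric.ball (0 : E) r, ContinuousAt (Function.uncurry (ambientExp m ι))
      (x, V)) (fun r r' x hr h V hV ↦ h V (Metric.ball_subset_ball hr hV)) fun p ↦ by
    obtain ⟨ρ, hρ, Φ, ⟨r, hr, H⟩, hc, -⟩ := exists_local_ambientExp hι hinj p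
    refine ⟨r, hr, H.eventually_nhds.mono fun x hx V hV ↦ ?_⟩
    obtain ⟨hxs, hxρ, h1⟩ := hx.self_of_nhds
    obtain ⟨h2, h3, h4⟩ := h1 V hV
    have h5 : Function.uncurry (ambientExp m ι) =ᶠ[𝓝 (x, V)] fun z : M × E ↦
        (extChartAt (𝓡 m) p).symm
          (Φ (extChartAt (𝓡 m) p z.1) (leftInv (localDeriv m p ι z.1) z.2)) := by
      rw [nhds_prod_eq]
      filter_upwards [hx.prod_mk (Metric.isOpen_ball.eventually_mem hV)] with z hz
      exact (hz.1.2.2 z.2 hz.2).2.2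
    refine ContinuousAt.congr ?_ h5.symm
    refine ContinuousAt.comp (g := (extChartAt (𝓡 m) p).symm)
      (f := fun z : M × E ↦ Φ (extChartAt (𝓡 m) p z.1) (leftInv (localDeriv m p ι z.1) z.2))
      ((continuousOn_extChartAt_symm p).continuousAt ((isOpen_extChartAt_target p).mem_nhds h3)) ?_
    refine ContinuousAt.comp (x := (x, V))
      (g := fun z : EuclideanSpace ℝ (Fin m) × EuclideanSpace ℝ (Fin m) ↦ Φ z.1 z.2)
      (f := fun z : M × E ↦ (extChartAt (𝓡 m) p z.1, leftInv (localDeriv m p ι z.1) z.2))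
      (hc.continuousAt ((Metric.isOpen_ball.prod Metric.isOpen_ball).mem_nhds ⟨hxρ, h2⟩)) ?_
    refine ContinuousAt.prodMk ?_ ?_
    · exact ContinuousAt.comp (x := (x, V)) (g := extChartAt (𝓡 m) p) (continuousAt_extChartAt' hxs)
        continuousAt_fst
    · exact ContinuousAt.clm_apply (ContinuousAt.comp (x := (x, V))
        (g := fun x ↦ leftInv (localDeriv m p ι x))
        (continuousAt_leftInv_localDeriv hι hinj hxs) continuousAt_fst) continuousAt_snd
  exact ⟨ρ, hρ, fun z hz ↦ (H z.1 z.2 hz.2).continuousWithinAt⟩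

/-- In a chart the exponential map is a translation to first order and the immersion is linear to
first order with nearly constant derivative. Composing the estimates and using compactness gives a
radius uniform in the base point. -/
theorem exists_ambientExp_approx [CompactSpace M] [T2Space M] {ι : M → E}
    (hι : ContMDiff (𝓡 m) 𝓘(ℝ, E) 1 ι) (hinj : ∀ x, Function.Injective (flatDeriv m ι x)) (η : ℝ)
    (hη : 0 < η) :
    ∃ ρ > 0, ∀ x V W, transferDeriv m ι ι x V = V → transferDeriv m ι ι x W = W → ‖V‖ < ρ →
      ‖W‖ < ρ → ‖ι (ambientExp m ι x V) - ι (ambientExp m ι x W) - (V - W)‖ ≤ η * ‖V - W‖ := by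
  refine exists_pos_forall_of_compact (M := M) (K := fun ρ x ↦ ∀ V W,
      transferDeriv m ι ι x V = V → transferDeriv m ι ι x W = W → ‖V‖ < ρ →
      ‖W‖ < ρ → ‖ι (ambientExp m ι x V) - ι (ambientExp m ι x W) - (V - W)‖ ≤ η * ‖V - W‖)
    (fun r r' x hr h V W h1 h2 h3 h4 ↦ h V W h1 h2 (h3.trans_le hr) (h4.trans_le hr)) fun p ↦ ?_
  set e := extChartAt (𝓡 m) p with he
  set K := localDeriv m p ι
  have hp : p ∈ e.source := mem_extChartAt_source (I := 𝓡 m) p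
  obtain ⟨ρ, hρ, Φ, ⟨r, hr, H⟩, hc, ha⟩ := exists_local_ambientExp hι hinj p
  obtain ⟨C, hC, e₁⟩ := eventually_norm_leftInv_localDeriv_le hι hinj p
  have hΦ0 : Φ (e p) 0 = e p := by
    obtain ⟨-, -, h1⟩ := H.self_of_nhds
    obtain ⟨-, h2, h3⟩ := h1 0 (Metric.mem_ball_self hr)
    rw [map_zero] at h2 h3
    rw [ambientExp_zero] at h3
    have h4 := e.right_inv h2
    rw [← h3] at h4
    exact h4.symm
  -- The errors below add up to $\theta(3+\|K_p\|)\|a-b\|$, and $\|a-b\|\le C\|V-W\|$. The bound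
  -- $\theta\le1$ gives `hd`.
  set θ := min 1 (η / ((3 + ‖K p‖) * C)) with hθ
  have hθ0 : 0 < θ := by positivity
  have hθ1 : θ * ((3 + ‖K p‖) * C) ≤ η := by
    rw [← le_div_iff₀ (by positivity)]
    exact min_le_right _ _
  have s : HasStrictFDerivAt (ι ∘ e.symm) (K p) (e p) :=
    (contDiffAt_comp_symm hp (hι p)).hasStrictFDerivAt (by norm_num)
  have hF := s.isLittleO.bound hθ0
  obtain ⟨ρ', hρ', ha'⟩ := ha θ hθ0
  rw [nhds_prod_eq] at hF
  obtain ⟨r₁, hr₁, hF'⟩ : ∃ r₁ > 0, ∀ y ∈ Metric.ball (e p) r₁, ∀ y' ∈ Metric.ball (e p) r₁,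
      ‖(ι ∘ e.symm) y - (ι ∘ e.symm) y' - K p (y - y')‖ ≤ θ * ‖y - y'‖ := by
    obtain ⟨S, hS, hS'⟩ := (Filter.HasBasis.prod_self Metric.nhds_basis_ball).eventually_iff.mp hF
    exact ⟨S, hS, fun y hy y' hy' ↦ hS' (mk_mem_prod hy hy')⟩
  have hΦc : ContinuousAt (fun z : EuclideanSpace ℝ (Fin m) × EuclideanSpace ℝ (Fin m) ↦ Φ z.1 z.2)
      (e p, 0) := hc.continuousAt ((Metric.isOpen_ball.prod Metric.isOpen_ball).mem_nhds
        ⟨Metric.mem_ball_self hρ, Metric.mem_ball_self hρ⟩)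
  obtain ⟨r₂, hr₂, hΦ2⟩ : ∃ r₂ > 0, ∀ y ∈ Metric.ball (e p) r₂, ∀ a ∈ Metric.ball 0 r₂,
      Φ y a ∈ Metric.ball (e p) r₁ := by
    have h1 := hΦc.eventually_mem (Metric.ball_mem_nhds (Φ (e p) 0) hr₁)
    rw [hΦ0] at h1
    obtain ⟨S, hS, hS'⟩ := Metric.eventually_nhds_iff_ball.mp h1
    refine ⟨S, hS, fun y hy a ha ↦ hS' (y, a) ?_⟩
    rw [← ball_prod_same]
    exact ⟨hy, ha⟩
  refine ⟨min r (min ρ' r₂ / C), by positivity, ?_⟩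
  have hKc : ContinuousAt K p := continuousAt_localDeriv hp (hι p)
  filter_upwards [H, e₁, hKc.eventually_mem (Metric.ball_mem_nhds _ hθ0),
    (continuousAt_extChartAt (I := 𝓡 m) p).eventually_mem (Metric.ball_mem_nhds _ hρ'),
    (continuousAt_extChartAt (I := 𝓡 m) p).eventually_mem (Metric.ball_mem_nhds _ hr₂)]
    with x hx k₁ kK kρ kr V W hV hW hVr hWr
  obtain ⟨hxs, -, h1⟩ := hx
  rw [lt_min_iff, lt_div_iff₀' hC, lt_min_iff] at hVr hWr
  obtain ⟨-, -, hV1⟩ := h1 V (mem_ball_zero_iff.mpr hVr.1)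
  obtain ⟨-, -, hW1⟩ := h1 W (mem_ball_zero_iff.mpr hWr.1)
  rw [transferDeriv_eq hι hinj hxs (hι.mdifferentiableAt (by norm_num))] at hV hW
  have hVW := k₁ (V - W)
  rw [map_sub] at hVW
  have hVn := k₁ V
  have hWn := k₁ W
  set a := leftInv (localDeriv m p ι x) V
  set b := leftInv (localDeriv m p ι x) W
  change K x a = V at hV
  change K x b = W at hW
  have hb1 := ha' _ kρ a (mem_ball_zero_iff.mpr (hVn.trans_lt hVr.2.1)) b
    (mem_ball_zero_iff.mpr (hWn.trans_lt hWr.2.1))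
  have hb2 := hF' _ (hΦ2 _ kr a (mem_ball_zero_iff.mpr (hVn.trans_lt hVr.2.2))) _
    (hΦ2 _ kr b (mem_ball_zero_iff.mpr (hWn.trans_lt hWr.2.2)))
  rw [hV1, hW1]
  change ‖(ι ∘ e.symm) (Φ (e x) a) - (ι ∘ e.symm) (Φ (e x) b) - (V - W)‖ ≤ _
  have hKx : ‖(K p - K x) (a - b)‖ ≤ θ * ‖a - b‖ := by
    refine ContinuousLinearMap.le_of_opNorm_le _ ?_ _
    rw [← dist_eq_norm, dist_comm]
    exact (Metric.mem_ball.mp kK).le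
  have hKp : ‖K p (Φ (e x) a - Φ (e x) b - (a - b))‖ ≤ ‖K p‖ * (θ * ‖a - b‖) :=
    ((K p).le_opNorm _).trans (mul_le_mul_of_nonneg_left hb1 (norm_nonneg _))
  have hd : ‖Φ (e x) a - Φ (e x) b‖ ≤ 2 * ‖a - b‖ := by
    have h2 := norm_add_le (Φ (e x) a - Φ (e x) b - (a - b)) (a - b)
    rw [sub_add_cancel] at h2
    have h3 : θ * ‖a - b‖ ≤ 1 * ‖a - b‖ :=
      mul_le_mul_of_nonneg_right (min_le_left _ _) (norm_nonneg _)
    linarith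
  -- Three errors: the nonlinearity of the immersion, that of the exponential map, and the variation
  -- of the derivative of the immersion between `p` and `x`.
  have hid : (ι ∘ e.symm) (Φ (e x) a) - (ι ∘ e.symm) (Φ (e x) b) - (V - W)
      = ((ι ∘ e.symm) (Φ (e x) a) - (ι ∘ e.symm) (Φ (e x) b) - K p (Φ (e x) a - Φ (e x) b))
        + K p (Φ (e x) a - Φ (e x) b - (a - b)) + (K p - K x) (a - b) := by
    rw [← hV, ← hW]
    simp only [map_sub, sub_apply]
    abel
  rw [hid]
  calc _ ≤ θ * (2 * ‖a - b‖) + ‖K p‖ * (θ * ‖a - b‖) + θ * ‖a - b‖ :=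
        (norm_add₃_le).trans (add_le_add (add_le_add (hb2.trans
          (mul_le_mul_of_nonneg_left hd hθ0.le)) hKp) hKx)
    _ = θ * (3 + ‖K p‖) * ‖a - b‖ := by ring
    _ ≤ θ * (3 + ‖K p‖) * (C * ‖V - W‖) := mul_le_mul_of_nonneg_left hVW (by positivity)
    _ = θ * ((3 + ‖K p‖) * C) * ‖V - W‖ := by ring
    _ ≤ η * ‖V - W‖ := mul_le_mul_of_nonneg_right hθ1 (norm_nonneg _)

end AmbientExp

/-! ### The derivative of the diffeomorphism as a hyperbolic cocycle -/

section DerivativeCocycle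

set_option maxSynthPendingDepth 3

open Set Filter

theorem exists_projections {κ V : Type*} [Fintype κ] [DecidableEq κ] [AddCommGroup V] [Module ℝ V]
    {A : κ → Submodule ℝ V} (hA : DirectSum.IsInternal A) :
    ∃ P : κ → V →ₗ[ℝ] V, (∀ i v, P i v ∈ A i) ∧ (∀ i, ∀ v ∈ A i, P i v = v) ∧
      (∀ i j, i ≠ j → ∀ v ∈ A j, P i v = 0) ∧ ∀ v, ∑ i, P i v = v := by
  let e := LinearEquiv.ofBijective (DirectSum.coeLinearMap A) hA
  have he (i : κ) (v : V) (hv : v ∈ A i) : e.symm v = DirectSum.lof ℝ κ (fun i ↦ A i) i ⟨v, hv⟩ := by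
    rw [LinearEquiv.symm_apply_eq]
    exact (DirectSum.coeLinearMap_lof A i ⟨v, hv⟩).symm
  let P (i : κ) : V →ₗ[ℝ] V :=
    (A i).subtype ∘ₗ DirectSum.component ℝ κ (fun i ↦ A i) i ∘ₗ e.symm.toLinearMap
  have h1 (i : κ) (v : V) (hv : v ∈ A i) : P i v = v := by
    change ((DirectSum.component ℝ κ (fun i ↦ A i) i (e.symm v) : A i) : V) = v
    rw [he i v hv, DirectSum.component.lof_self]
  have h2 (i j : κ) (hij : i ≠ j) (v : V) (hv : v ∈ A j) : P i v = 0 := by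
    change ((DirectSum.component ℝ κ (fun i ↦ A i) i (e.symm v) : A i) : V) = 0
    rw [he j v hv, DirectSum.component.of, dif_neg hij.symm]
    rfl
  refine ⟨P, fun i v ↦ Subtype.property _, h1, h2, fun v ↦ ?_⟩
  have hv : v ∈ ⨆ i, A i := hA.submodule_iSup_eq_top ▸ Submodule.mem_top
  induction hv using Submodule.iSup_induction' with
  | mem i x hx =>
    rw [Finset.sum_eq_single i (fun j _ hj ↦ h2 j i hj x hx) (by simp), h1 i x hx]
  | zero => simp
  | add x y _ _ hx hy => simp only [map_add, Finset.sum_add_distrib, hx, hy]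

variable {m : ℕ} {M : Type*} [TopologicalSpace M] [ChartedSpace (EuclideanSpace ℝ (Fin m)) M]
variable {E : Type*} [NormedAddCommGroup E] [InnerProductSpace ℝ E] [FiniteDimensional ℝ E]
  [CompleteSpace E]

/-- The derivative of a map of `M`, as a linear map on the model space. -/
def modelDeriv (m : ℕ) {M : Type*} [TopologicalSpace M] [ChartedSpace (EuclideanSpace ℝ (Fin m)) M]
    (f : M → M) (x : M) : EuclideanSpace ℝ (Fin m) →L[ℝ] EuclideanSpace ℝ (Fin m) :=
  mfderiv (𝓡 m) (𝓡 m) f x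

theorem modelDeriv_comp {f g : M → M} (x : M) (hg : MDifferentiableAt (𝓡 m) (𝓡 m) g (f x))
    (hf : MDifferentiableAt (𝓡 m) (𝓡 m) f x) :
    modelDeriv m (g ∘ f) x = modelDeriv m g (f x) ∘L modelDeriv m f x :=
  mfderiv_comp x hg hf

theorem modelDeriv_id (x : M) : modelDeriv m (id : M → M) x = 1 :=
  mfderiv_id

/-- A linear map from the tangent space at `x` to the one at `y`, read in the ambient space of the
immersion `ι`. -/
def ambientMap (m : ℕ) {M : Type*} [TopologicalSpace M] [ChartedSpace (EuclideanSpace ℝ (Fin m)) M]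
    (ι : M → E) (x y : M) (A : EuclideanSpace ℝ (Fin m) →L[ℝ] EuclideanSpace ℝ (Fin m)) :
    E →L[ℝ] E :=
  (flatDeriv m ι y ∘L A) ∘L leftInv (flatDeriv m ι x)

theorem ambientMap_mul {ι : M → E} (hinj : ∀ x, Function.Injective (flatDeriv m ι x)) (x y z : M)
    (A B : EuclideanSpace ℝ (Fin m) →L[ℝ] EuclideanSpace ℝ (Fin m)) :
    ambientMap m ι y z B * ambientMap m ι x y A = ambientMap m ι x z (B ∘L A) := by
  ext V
  change flatDeriv m ι z (B (leftInv (flatDeriv m ι y) (flatDeriv m ι y (A _)))) = _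
  rw [leftInv_apply_self (hinj y)]
  rfl

theorem ambientMap_apply {ι : M → E} (hinj : ∀ x, Function.Injective (flatDeriv m ι x)) (x y : M)
    (A : EuclideanSpace ℝ (Fin m) →L[ℝ] EuclideanSpace ℝ (Fin m)) (v : EuclideanSpace ℝ (Fin m)) :
    ambientMap m ι x y A (flatDeriv m ι x v) = flatDeriv m ι y (A v) := by
  change flatDeriv m ι y (A (leftInv (flatDeriv m ι x) (flatDeriv m ι x v))) = _
  rw [leftInv_apply_self (hinj x)]

theorem exists_eq_flatDeriv {ι : M → E} (hinj : ∀ x, Function.Injective (flatDeriv m ι x)) {x : M}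
    {A : EuclideanSpace ℝ (Fin m) →L[ℝ] EuclideanSpace ℝ (Fin m)} {V : E}
    (h : ambientMap m ι x x A V = V) : ∃ v, A v = v ∧ V = flatDeriv m ι x v := by
  refine ⟨A (leftInv (flatDeriv m ι x) V), ?_, h.symm⟩
  have h1 := congrArg (leftInv (flatDeriv m ι x)) h
  have h2 : leftInv (flatDeriv m ι x) (ambientMap m ι x x A V) = A (leftInv (flatDeriv m ι x) V) :=
    leftInv_apply_self (hinj x) _
  rw [h2] at h1
  rw [h1]
  exact h1

theorem transferDeriv_self (ι : M → E) (x : M) :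
    transferDeriv m ι ι x = ambientMap m ι x x 1 := rfl

theorem transferDeriv_comp {ι : M → E} {f : M → M} {x : M}
    (hι : MDifferentiableAt (𝓡 m) 𝓘(ℝ, E) ι (f x)) (hf : MDifferentiableAt (𝓡 m) (𝓡 m) f x) :
    transferDeriv m ι (ι ∘ f) x = ambientMap m ι x (f x) (modelDeriv m f x) := by
  have h : flatDeriv m (ι ∘ f) x = flatDeriv m ι (f x) ∘L modelDeriv m f x :=
    mfderiv_comp x hι hf
  rw [transferDeriv, h]
  rfl

variable [IsManifold (𝓡 m) ∞ M]

theorem ambientMap_add {ι : M → E} (x y : M)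
    (A B : EuclideanSpace ℝ (Fin m) →L[ℝ] EuclideanSpace ℝ (Fin m)) :
    ambientMap m ι x y (A + B) = ambientMap m ι x y A + ambientMap m ι x y B := by
  ext V
  change flatDeriv m ι y (A _ + B _) = flatDeriv m ι y (A _) + flatDeriv m ι y (B _)
  rw [map_add]

/-- The derivative of `h` along an immersion, as a continuous family of linear maps. -/
def ambientDeriv {F : Type*} [NormedAddCommGroup F] [NormedSpace ℝ F] {ι : M → E}
    (hι : ContMDiff (𝓡 m) 𝓘(ℝ, E) 1 ι) (hinj : ∀ x, Function.Injective (flatDeriv m ι x)) {h : M → F}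
    (hh : ContMDiff (𝓡 m) 𝓘(ℝ, F) 1 h) : C(M, E →L[ℝ] F) :=
  ⟨transferDeriv m ι h, continuous_iff_continuousAt.mpr fun x ↦
    continuousAt_transferDeriv hι hinj (Eventually.of_forall fun y ↦ hh y)⟩

variable [RiemannianBundle (fun x : M ↦ TangentSpace (𝓡 m) x)]
  [IsContMDiffRiemannianBundle (𝓡 m) ∞ (EuclideanSpace ℝ (Fin m))
    (fun x : M ↦ TangentSpace (𝓡 m) x)] [CompactSpace M]

/-- The derivative of a `C^1` diffeomorphism, as a cocycle on the ambient space. -/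
def derivCocycle {ι : M → E} (hι : ContMDiff (𝓡 m) 𝓘(ℝ, E) 1 ι)
    (hinj : ∀ x, Function.Injective (flatDeriv m ι x)) (f : M ≃ₘ^1⟮𝓡 m, 𝓡 m⟯ M) : C(M, E →L[ℝ] E) :=
  ambientDeriv hι hinj (hι.comp f.contMDiff)

/-- The derivative of the inverse of a `C^1` diffeomorphism, as a cocycle on the ambient space. -/
def derivCocycleInv {ι : M → E} (hι : ContMDiff (𝓡 m) 𝓘(ℝ, E) 1 ι)
    (hinj : ∀ x, Function.Injective (flatDeriv m ι x)) (f : M ≃ₘ^1⟮𝓡 m, 𝓡 m⟯ M) : C(M, E →L[ℝ] E) :=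
  (ambientDeriv hι hinj (hι.comp f.symm.contMDiff)).comp f.toHomeomorph

variable {ι : M → E} {hι : ContMDiff (𝓡 m) 𝓘(ℝ, E) 1 ι}
  {hinj : ∀ x, Function.Injective (flatDeriv m ι x)} {f : M ≃ₘ^1⟮𝓡 m, 𝓡 m⟯ M}

theorem derivCocycle_eq (x : M) :
    derivCocycle hι hinj f x = ambientMap m ι x (f x) (modelDeriv m f x) :=
  transferDeriv_comp (hι.mdifferentiableAt (by norm_num)) (f.mdifferentiable (by norm_num) x)

theorem derivCocycleInv_eq (x : M) :
    derivCocycleInv hι hinj f x = ambientMap m ι (f x) x (modelDeriv m f.symm (f x)) := by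
  have h := transferDeriv_comp (m := m) (ι := ι) (f := f.symm) (x := f x)
    (hι.mdifferentiableAt (by norm_num)) (f.symm.mdifferentiable (by norm_num) (f x))
  rw [f.symm_apply_apply] at h
  exact h

theorem modelDeriv_symm_comp (x : M) :
    modelDeriv m f.symm (f x) ∘L modelDeriv m f x = 1 := by
  rw [← modelDeriv_comp x (f.symm.mdifferentiable (by norm_num) _)
    (f.mdifferentiable (by norm_num) _), ← modelDeriv_id x]
  congr 1
  exact funext f.symm_apply_apply

theorem modelDeriv_comp_symm (x : M) :
    modelDeriv m f x ∘L modelDeriv m f.symm (f x) = 1 := by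
  have h := modelDeriv_comp (m := m) (f := f.symm) (g := f) (f x)
    (f.mdifferentiable (by norm_num) _) (f.symm.mdifferentiable (by norm_num) _)
  rw [f.symm_apply_apply] at h
  rw [← h, ← modelDeriv_id (f x)]
  congr 1
  exact funext f.apply_symm_apply

theorem mdifferentiable_iterate (n : ℕ) : MDifferentiable (𝓡 m) (𝓡 m) f^[n] := by
  induction n with
  | zero => exact mdifferentiable_id
  | succ n ih => exact ih.comp (f.mdifferentiable (by norm_num))

theorem forwardCocycle_flatDeriv (n : ℕ) (x : M) (v : EuclideanSpace ℝ (Fin m)) :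
    forwardCocycle (f.toHomeomorph : C(M, M)) (derivCocycle hι hinj f) n x (flatDeriv m ι x v)
      = flatDeriv m ι (f^[n] x) (modelDeriv m f^[n] x v) := by
  induction n generalizing x v with
  | zero =>
    have h := congrArg (fun A : EuclideanSpace ℝ (Fin m) →L[ℝ] EuclideanSpace ℝ (Fin m) ↦ A v)
      (modelDeriv_id (m := m) x)
    exact (congrArg (flatDeriv m ι x) h).symm
  | succ n ih =>
    change forwardCocycle (f.toHomeomorph : C(M, M)) _ n (f x)
      (derivCocycle hι hinj f x (flatDeriv m ι x v)) = _
    rw [derivCocycle_eq, ambientMap_apply hinj, ih, Function.iterate_succ,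
      modelDeriv_comp x (mdifferentiable_iterate n (f x)) (f.mdifferentiable (by norm_num) x)]
    rfl

/-- The derivative maps each summand into the corresponding summand, so it preserves the
decomposition of a vector. -/
theorem modelDeriv_projection_comm {F : Fin 3 → (x : M) → Submodule ℝ (TangentSpace (𝓡 m) x)}
    {P : Fin 3 → M → EuclideanSpace ℝ (Fin m) →L[ℝ] EuclideanSpace ℝ (Fin m)}
    (hmap : ∀ i x, ∀ v ∈ F i x, modelDeriv m f x v ∈ F i (f x))
    (h1 : ∀ i x v, P i x v ∈ F i x) (h2 : ∀ i x, ∀ v ∈ F i x, P i x v = v)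
    (h3 : ∀ i j x, i ≠ j → ∀ v ∈ F j x, P i x v = 0) (h4 : ∀ x v, ∑ i, P i x v = v) (i : Fin 3)
    (x : M) : P i (f x) ∘L modelDeriv m f x = modelDeriv m f x ∘L P i x := by
  ext1 v
  change P i (f x) (modelDeriv m f x v) = modelDeriv m f x (P i x v)
  conv_lhs => rw [← h4 x v]
  rw [map_sum, map_sum, Finset.sum_eq_single i]
  · exact h2 i (f x) _ (hmap i x _ (h1 i x v))
  · intro j _ hj
    exact h3 i j (f x) hj.symm _ (hmap j x _ (h1 j x v))
  · simp

/-- The projections onto the subbundles of a splitting. -/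
theorem exists_tangent_projections {F : Fin 3 → (x : M) → Submodule ℝ (TangentSpace (𝓡 m) x)}
    (hF : ∀ x, DirectSum.IsInternal fun i ↦ F i x) :
    ∃ P : Fin 3 → M → EuclideanSpace ℝ (Fin m) →L[ℝ] EuclideanSpace ℝ (Fin m),
      (∀ i x v, P i x v ∈ F i x) ∧ (∀ i x, ∀ v ∈ F i x, P i x v = v) ∧
      (∀ i j x, i ≠ j → ∀ v ∈ F j x, P i x v = 0) ∧ ∀ x v, ∑ i, P i x v = v := by
  choose P h1 h2 h3 h4 using fun x ↦ exists_projections (hF x)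
  exact ⟨fun i x ↦ LinearMap.toContinuousLinearMap
    (E := EuclideanSpace ℝ (Fin m)) (F' := EuclideanSpace ℝ (Fin m)) (P x i),
    fun i x ↦ h1 x i, fun i x ↦ h2 x i, fun i j x ↦ h3 x i j, h4⟩

/-- `ambientMap` respects composition, so the algebraic identities carry over from the tangent
spaces. The rates survive because they are insensitive to a change to an equivalent norm. -/
theorem isHyperbolicCocycle_derivCocycle {Es Ec Eu : (x : M) → Submodule ℝ (TangentSpace (𝓡 m) x)}
    (hf : IsPartiallyHyperbolic f Es Ec Eu)
    {P : Fin 3 → M → EuclideanSpace ℝ (Fin m) →L[ℝ] EuclideanSpace ℝ (Fin m)}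
    (h1 : ∀ i x v, P i x v ∈ ![Es x, Ec x, Eu x] i)
    (h2 : ∀ i x, ∀ v ∈ ![Es x, Ec x, Eu x] i, P i x v = v)
    (h3 : ∀ i j x, i ≠ j → ∀ v ∈ ![Es x, Ec x, Eu x] j, P i x v = 0)
    (h4 : ∀ x v, ∑ i, P i x v = v) :
    IsHyperbolicCocycle f.toHomeomorph (ambientDeriv hι hinj hι) (derivCocycle hι hinj f)
      (derivCocycleInv hι hinj f) fun i x ↦ ambientMap m ι x x (P i x) := by
  have hcomm := modelDeriv_projection_comm (f := f) (F := fun i x ↦ ![Es x, Ec x, Eu x] i)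
    (P := P) (fun i x v hv ↦ by
      fin_cases i
      · change mfderiv (𝓡 m) (𝓡 m) f x v ∈ Es (f x)
        rw [← hf.map_stable x]
        exact Submodule.mem_map_of_mem hv
      · change mfderiv (𝓡 m) (𝓡 m) f x v ∈ Ec (f x)
        rw [← hf.map_center x]
        exact Submodule.mem_map_of_mem hv
      · change mfderiv (𝓡 m) (𝓡 m) f x v ∈ Eu (f x)
        rw [← hf.map_unstable x]
        exact Submodule.mem_map_of_mem hv) h1 h2 h3 h4
  have hT (x : M) : ambientDeriv hι hinj hι x = ambientMap m ι x x 1 := rfl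
  have hfx (x : M) : f.toHomeomorph x = f x := rfl
  constructor
  · intro i x
    rw [ambientMap_mul hinj]
    congr 1
    ext1 v
    exact h2 i x _ (h1 i x v)
  · intro i j x hij
    rw [ambientMap_mul hinj]
    have : P i x ∘L P j x = 0 := by
      ext1 v
      exact h3 i j x hij _ (h1 j x v)
    rw [this]
    ext V
    change flatDeriv m ι x 0 = 0
    rw [map_zero]
  · intro x
    rw [hT, ← ambientMap_add, ← ambientMap_add]
    congr 1
    ext1 v
    have := h4 x v
    rw [Fin.sum_univ_three] at this
    exact this
  · intro i x
    rw [derivCocycle_eq, hfx, ambientMap_mul hinj, ambientMap_mul hinj, hcomm]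
  · intro i x
    rw [derivCocycleInv_eq, hfx, ambientMap_mul hinj, ambientMap_mul hinj]
    congr 1
    have e1 : P i x = (modelDeriv m f.symm (f x) ∘L P i (f x)) ∘L modelDeriv m f x := by
      rw [ContinuousLinearMap.comp_assoc, hcomm, ← ContinuousLinearMap.comp_assoc,
        modelDeriv_symm_comp]
      rfl
    rw [e1, ContinuousLinearMap.comp_assoc, modelDeriv_comp_symm]
    rfl
  · intro x
    rw [derivCocycle_eq, hfx, hT, ambientMap_mul hinj]
    rfl
  · intro x
    rw [derivCocycle_eq, derivCocycleInv_eq, ambientMap_mul hinj, modelDeriv_symm_comp, hT]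
  · intro x
    rw [derivCocycle_eq, derivCocycleInv_eq, ambientMap_mul hinj, modelDeriv_comp_symm, hfx, hT]
  · obtain ⟨l, l', μ', μ, C, hl, hl1, hμ1, hll, hlμ, hμμ, hC, H⟩ := hf.rates
    obtain ⟨c, hc, hcn⟩ := exists_norm_flatDeriv_equiv hι hinj
    have hl' := hl.trans hll
    have hμ' := hl'.trans_le hlμ
    have hμ := hμ'.trans hμμ
    have up (x : M) (n : ℕ) (v : TangentSpace (𝓡 m) x) (t : ℝ) (ht : 0 ≤ t)
        (h : ‖mfderiv (𝓡 m) (𝓡 m) f^[n] x v‖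
          ≤ C * t * ‖v‖) :
        ‖forwardCocycle (f.toHomeomorph : C(M, M)) (derivCocycle hι hinj f) n x (flatDeriv m ι x v)‖
          ≤ C / (c * c) * t * ‖flatDeriv m ι x v‖ := by
      refine (congrArg norm (forwardCocycle_flatDeriv n x v)).trans_le ?_
      have k1 := (hcn (f^[n] x) (modelDeriv m f^[n] x v)).1
      have k2 := (hcn x v).2
      have k3 : c * (c * ‖flatDeriv m ι (f^[n] x) (modelDeriv m f^[n] x v)‖)
          ≤ C * t * ‖flatDeriv m ι x v‖ := by
        calc _ ≤ c * (C * t * ‖v‖) :=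
              mul_le_mul_of_nonneg_left (k1.trans h) hc.le
          _ = C * t * (c * ‖v‖) := by ring
          _ ≤ _ := mul_le_mul_of_nonneg_left k2 (by positivity)
      rw [div_mul_eq_mul_div, div_mul_eq_mul_div, le_div_iff₀ (by positivity)]
      linarith
    have low (x : M) (n : ℕ) (v : TangentSpace (𝓡 m) x) (t : ℝ) (ht : 0 ≤ t)
        (h : C⁻¹ * t * ‖v‖
          ≤ ‖mfderiv (𝓡 m) (𝓡 m) f^[n] x v‖) :
        (C / (c * c))⁻¹ * t * ‖flatDeriv m ι x v‖ ≤
        ‖forwardCocycle (f.toHomeomorph : C(M, M)) (derivCocycle hι hinj f) n x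
          (flatDeriv m ι x v)‖ := by
      refine le_of_le_of_eq ?_ (congrArg norm (forwardCocycle_flatDeriv n x v)).symm
      have k1 := (hcn (f^[n] x) (modelDeriv m f^[n] x v)).2
      have k2 := (hcn x v).1
      have k3 := mul_le_mul_of_nonneg_left h hc.le
      calc (C / (c * c))⁻¹ * t * ‖flatDeriv m ι x v‖
          = c * (C⁻¹ * t) * (c * ‖flatDeriv m ι x v‖) := by rw [inv_div]; ring
        _ ≤ c * (C⁻¹ * t) * ‖v‖ :=
            mul_le_mul_of_nonneg_left k2 (by positivity)
        _ = c * (C⁻¹ * t * ‖v‖) := by ring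
        _ ≤ _ := k3.trans k1
    -- The norms are compared once at the initial point and once at the final point, hence the
    -- factor $c^{-2}$.
    refine ⟨l, l', μ', μ, C / (c * c), hl, hl1, hμ1, hll, hlμ, hμμ, by positivity, fun n x V ↦
      ⟨fun hV ↦ ?_, fun hV ↦ ?_, fun hV ↦ ?_⟩⟩
    · obtain ⟨v, hv, rfl⟩ := exists_eq_flatDeriv hinj hV
      have hv' : v ∈ Es x := hv ▸ h1 0 x v
      exact up x n v _ (by positivity) ((H x n).1 v hv')
    · obtain ⟨v, hv, rfl⟩ := exists_eq_flatDeriv hinj hV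
      have hv' : v ∈ Ec x := hv ▸ h1 1 x v
      exact ⟨low x n v _ (by positivity) ((H x n).2.1 v hv').1,
        up x n v _ (by positivity) ((H x n).2.1 v hv').2⟩
    · obtain ⟨v, hv, rfl⟩ := exists_eq_flatDeriv hinj hV
      have hv' : v ∈ Eu x := hv ▸ h1 2 x v
      exact low x n v _ (by positivity) ((H x n).2.2 v hv')

end DerivativeCocycle

/-! ### Flow boxes from foliated charts -/

section Flow

set_option maxSynthPendingDepth 3

open Set Filter

/-- A primitive of `1 / g` in the first variable. -/
theorem exists_time_coordinate {F : Type*} [NormedAddCommGroup F] {g : ℝ × F → ℝ} {c : ℝ × F}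
    {r : ℝ} (hg : ContinuousOn g (Metric.closedBall c r)) (hne : ∀ z ∈ Metric.closedBall c r, g z ≠ 0) :
    ∃ H : ℝ × F → ℝ, Continuous H ∧
      (∀ z ∈ Metric.closedBall c r, HasDerivAt (fun s ↦ H (s, z.2)) (g z)⁻¹ z.1) ∧
      ∀ s s' b, (s, b) ∈ Metric.closedBall c r → (s', b) ∈ Metric.closedBall c r →
        H (s, b) = H (s', b) → s = s' := by
  -- Tietze extension of $1/g$ to the whole space allows integration from $0$ although the segment
  -- may leave the ball.
  obtain ⟨β, hβ⟩ := ContinuousMap.exists_restrict_eq (Metric.isClosed_closedBall (x := c) (ε := r))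
    ⟨fun z ↦ (g z)⁻¹, (continuousOn_iff_continuous_restrict.mp hg).inv₀ fun z ↦ hne z z.2⟩
  have hβ' (z : ℝ × F) (hz : z ∈ Metric.closedBall c r) : β z = (g z)⁻¹ :=
    congrArg (fun F ↦ F ⟨z, hz⟩) hβ
  have hd (s : ℝ) (b : F) : HasDerivAt (fun s ↦ ∫ t in (0 : ℝ)..s, β (t, b)) (β (s, b)) s := by
    have h : Continuous fun t : ℝ ↦ β (t, b) := by fun_prop
    exact (h.integral_hasStrictDerivAt 0 s).hasDerivAt
  -- By Rolle, equal integrals force a zero of $1/g$ in between, and the ball of the product metric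
  -- contains the segment. The same argument excludes $s'<s$.
  have key (s s' : ℝ) (b : F) (hs : (s, b) ∈ Metric.closedBall c r)
      (hs' : (s', b) ∈ Metric.closedBall c r)
      (h : ∫ t in (0 : ℝ)..s, β (t, b) = ∫ t in (0 : ℝ)..s', β (t, b)) : ¬ s < s' := by
    intro hlt
    obtain ⟨x, hx, hx0⟩ := exists_hasDerivAt_eq_zero hlt
      (fun t _ ↦ (hd t b).continuousAt.continuousWithinAt) h fun t _ ↦ hd t b
    have hxc : (x, b) ∈ Metric.closedBall c r := by
      rw [Metric.mem_closedBall, Prod.dist_eq, max_le_iff, Real.dist_eq, abs_le] at hs hs' ⊢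
      exact ⟨⟨by linarith [hs.1.1, hx.1], by linarith [hs'.1.2, hx.2]⟩, hs.2⟩
    rw [hβ' _ hxc] at hx0
    exact hne _ hxc (inv_eq_zero.mp hx0)
  refine ⟨fun z ↦ ∫ t in (0 : ℝ)..z.1, β (t, z.2), ?_, fun z hz ↦ ?_, fun s s' b hs hs' h ↦ ?_⟩
  · exact intervalIntegral.continuous_parametric_intervalIntegral_of_continuous
      (f := fun (z : ℝ × F) t ↦ β (t, z.2)) (by fun_prop) continuous_fst
  · rw [← hβ' z hz]
    exact hd z.1 z.2
  · exact le_antisymm (not_lt.mp (key s' s b hs' hs h.symm)) (not_lt.mp (key s s' b hs hs' h))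

variable {m : ℕ} {M : Type*} [TopologicalSpace M] [ChartedSpace (EuclideanSpace ℝ (Fin m)) M]
variable {F G : Type*} [NormedAddCommGroup F] [NormedSpace ℝ F] [NormedAddCommGroup G]
  [NormedSpace ℝ G]

theorem flatDeriv_clm_comp {h : M → F} {x : M} (A : F →L[ℝ] G)
    (hh : MDifferentiableAt (𝓡 m) 𝓘(ℝ, F) h x) :
    flatDeriv m (fun y ↦ A (h y)) x = A ∘L flatDeriv m h x :=
  (A.hasFDerivAt.hasMFDerivAt.comp x hh.hasMFDerivAt).mfderiv

theorem bijective_flatDeriv {e : OpenPartialHomeomorph M F}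
    (he : ContMDiffOn (𝓡 m) 𝓘(ℝ, F) 1 e e.source)
    (he' : ContMDiffOn 𝓘(ℝ, F) (𝓡 m) 1 e.symm e.target) {x : M} (hx : x ∈ e.source) :
    Function.Bijective (flatDeriv m e x) := by
  have h1 := (he.contMDiffAt (e.open_source.mem_nhds hx)).mdifferentiableAt (by norm_num)
  have h2 := (he'.contMDiffAt (e.open_target.mem_nhds (e.map_source hx))).mdifferentiableAt
    (by norm_num)
  have h3 : MDifferentiableAt (𝓡 m) 𝓘(ℝ, F) e (e.symm (e x)) := by rwa [e.left_inv hx]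
  have h4 : e.symm ∘ e =ᶠ[𝓝 x] id := by
    filter_upwards [e.open_source.mem_nhds hx] with y hy using e.left_inv hy
  have h5 : e ∘ e.symm =ᶠ[𝓝 (e x)] id := by
    filter_upwards [e.open_target.mem_nhds (e.map_source hx)] with y hy using e.right_inv hy
  have h6 := (mfderiv_comp x h2 h1).symm.trans (h4.mfderiv_eq.trans mfderiv_id)
  have h7 := (mfderiv_comp (e x) h3 h2).symm.trans (h5.mfderiv_eq.trans mfderiv_id)
  have h8 : e.symm (e x) = x := e.left_inv hx
  constructor
  · intro a b hab
    have ha := congrArg (fun A : EuclideanSpace ℝ (Fin m) →L[ℝ] EuclideanSpace ℝ (Fin m) ↦ A a) h6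
    have hb := congrArg (fun A : EuclideanSpace ℝ (Fin m) →L[ℝ] EuclideanSpace ℝ (Fin m) ↦ A b) h6
    exact ha.symm.trans ((congrArg (mfderiv 𝓘(ℝ, F) (𝓡 m) e.symm (e x)) hab).trans hb)
  · intro w
    refine ⟨mfderiv 𝓘(ℝ, F) (𝓡 m) e.symm (e x) w, ?_⟩
    have hw := congrArg (fun A : F →L[ℝ] F ↦ A w) h7
    refine Eq.trans ?_ hw
    change flatDeriv m e x (mfderiv 𝓘(ℝ, F) (𝓡 m) e.symm (e x) w)
      = flatDeriv m e (e.symm (e x)) (mfderiv 𝓘(ℝ, F) (𝓡 m) e.symm (e x) w)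
    rw [h8]

theorem hasDerivAt_comp_flow {φ : ℝ → M → M} {u : (x : M) → TangentSpace (𝓡 m) x}
    (hφ : IsFlowOf φ u) {h : M → F} {x : M} {t : ℝ}
    (hh : MDifferentiableAt (𝓡 m) 𝓘(ℝ, F) h (φ t x)) :
    HasDerivAt (fun s ↦ h (φ s x)) (flatDeriv m h (φ t x) (u (φ t x))) t := by
  have h1 := hh.hasMFDerivAt.comp t ((hφ x).2 t)
  have h2 : HasFDerivAt (fun s ↦ h (φ s x)) (flatDeriv m h (φ t x) ∘L
      ((1 : ℝ →L[ℝ] ℝ).smulRight (u (φ t x) : EuclideanSpace ℝ (Fin m)))) t := h1.hasFDerivAt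
  exact (hasDerivAt_iff_hasFDerivAt.mpr (h2.congr_fderiv (ContinuousLinearMap.ext_ring
    ((congrArg (flatDeriv m h (φ t x)) (one_smul ℝ (u (φ t x) : EuclideanSpace ℝ (Fin m)))).trans
      (one_smul ℝ (flatDeriv m h (φ t x) (u (φ t x)))).symm))))

variable [RiemannianBundle (fun x : M ↦ TangentSpace (𝓡 m) x)]
  {E : Type*} [NormedAddCommGroup E] [InnerProductSpace ℝ E] [FiniteDimensional ℝ E]
  [CompleteSpace E]

theorem norm_flow_sub_le {ι : M → E} (hι : ContMDiff (𝓡 m) 𝓘(ℝ, E) 1 ι) {K : ℝ}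
    (hK : ∀ x, ∀ v : TangentSpace (𝓡 m) x, ‖flatDeriv m ι x v‖ ≤ K * ‖v‖)
    {φ : ℝ → M → M} {u : (x : M) → TangentSpace (𝓡 m) x} (hφ : IsFlowOf φ u) (hu : ∀ x, ‖u x‖ = 1)
    (t : ℝ) (x : M) : ‖ι (φ t x) - ι x‖ ≤ K * |t| := by
  have h := convex_univ.norm_image_sub_le_of_norm_hasDerivWithin_le (𝕜 := ℝ) (C := K) (x := 0)
    (y := t) (f := fun s ↦ ι (φ s x)) (f' := fun s ↦ flatDeriv m ι (φ s x) (u (φ s x))) (fun s _ ↦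
      (hasDerivAt_comp_flow hφ (hι.mdifferentiableAt (by norm_num))).hasDerivWithinAt)
    (fun s _ ↦ by
      have h1 := hK (φ s x) (u (φ s x))
      rwa [hu, mul_one] at h1) (mem_univ _) (mem_univ _)
  rw [sub_zero, Real.norm_eq_abs, (hφ x).1] at h
  exact h

variable [IsManifold (𝓡 m) ∞ M]

omit [RiemannianBundle (fun x : M ↦ TangentSpace (𝓡 m) x)] in
theorem continuous_flatDeriv_section {ι : M → E} (hι : ContMDiff (𝓡 m) 𝓘(ℝ, E) 1 ι)
    {u : (x : M) → TangentSpace (𝓡 m) x}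
    (hu : Continuous fun x ↦ (⟨x, u x⟩ : TangentBundle (𝓡 m) M)) :
    Continuous fun x ↦ flatDeriv m ι x (u x) := by
  have : IsManifold (𝓡 m) 1 M := IsManifold.of_le (n := ∞) (by simp)
  have h1 := (hι.continuous_tangentMap le_rfl).comp hu
  have h2 := (tangentBundleModelSpaceHomeomorph 𝓘(ℝ, E)).continuous.comp h1
  exact (continuous_snd (X := E) (Y := E)).comp h2

/-- The vector field becomes a continuous function in the ambient space, to which the continuous
transferred derivative is applied. -/
theorem continuousAt_flatDeriv_section {ι : M → E} (hι : ContMDiff (𝓡 m) 𝓘(ℝ, E) 1 ι)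
    (hinj : ∀ x, Function.Injective (flatDeriv m ι x)) {u : (x : M) → TangentSpace (𝓡 m) x}
    (hu : Continuous fun x ↦ (⟨x, u x⟩ : TangentBundle (𝓡 m) M)) {h : M → F} {p : M}
    (hh : ∀ᶠ x in 𝓝 p, ContMDiffAt (𝓡 m) 𝓘(ℝ, F) 1 h x) :
    ContinuousAt (fun x ↦ flatDeriv m h x (u x)) p := by
  have h1 := (continuousAt_transferDeriv hι hinj hh).clm_apply
    (continuous_flatDeriv_section hι hu).continuousAt
  refine h1.congr (Eventually.of_forall fun x ↦ ?_)
  exact congrArg (flatDeriv m h x) (leftInv_apply_self (hinj x) (u x))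

/-- Flow boxes from foliated charts. -/
theorem exists_isFlowBox {ι : M → E} (hι : ContMDiff (𝓡 m) 𝓘(ℝ, E) 1 ι)
    (hinj : ∀ x, Function.Injective (flatDeriv m ι x))
    {Ec : (x : M) → Submodule ℝ (TangentSpace (𝓡 m) x)}
    {k : ℕ} (W : Foliation m M 1 1 k) (hW : W.IsTangentTo Ec)
    {u : (x : M) → TangentSpace (𝓡 m) x}
    (hu_cont : Continuous fun x ↦ (⟨x, u x⟩ : TangentBundle (𝓡 m) M))
    (hu_mem : ∀ x, u x ∈ Ec x) (hu_norm : ∀ x, ‖u x‖ = 1)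
    {φ : ℝ → M → M} (hφ : IsFlowOf φ u) (q : M) {Pc : E →L[ℝ] E}
    (hPc : ∀ v : TangentSpace (𝓡 m) q, v ∈ Ec q ↔ Pc (flatDeriv m ι q v) = flatDeriv m ι q v) :
    ∃ (U : Set M) (b : M → EuclideanSpace ℝ (Fin k)) (h : M → ℝ)
      (B : E →L[ℝ] EuclideanSpace ℝ (Fin k)), IsFlowBox ι φ (transferDeriv m ι ι q) Pc q U b h B := by
  obtain ⟨e, heW, hq⟩ := W.covers q
  have he : ContMDiffOn (𝓡 m) 𝓘(ℝ, EuclideanSpace ℝ (Fin 1) × EuclideanSpace ℝ (Fin k)) 1 e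
    e.source := W.contMDiffOn e heW
  have he' : ContMDiffOn 𝓘(ℝ, EuclideanSpace ℝ (Fin 1) × EuclideanSpace ℝ (Fin k)) (𝓡 m) 1 e.symm
    e.target := W.contMDiffOn_symm e heW
  let A : EuclideanSpace ℝ (Fin 1) × EuclideanSpace ℝ (Fin k) →L[ℝ] ℝ :=
    (EuclideanSpace.proj (0 : Fin 1)) ∘L ContinuousLinearMap.fst ℝ _ _
  let B : EuclideanSpace ℝ (Fin 1) × EuclideanSpace ℝ (Fin k) →L[ℝ] EuclideanSpace ℝ (Fin k) :=
    ContinuousLinearMap.snd ℝ _ _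
  have hea (x : M) (hx : x ∈ e.source) := he.contMDiffAt (e.open_source.mem_nhds hx)
  have hAa (x : M) (hx : x ∈ e.source) : ContMDiffAt (𝓡 m) 𝓘(ℝ, ℝ) 1 (fun y ↦ A (e y)) x :=
    A.contMDiff.contMDiffAt.comp x (hea x hx)
  have hBa (x : M) (hx : x ∈ e.source) :
      ContMDiffAt (𝓡 m) 𝓘(ℝ, EuclideanSpace ℝ (Fin k)) 1 (fun y ↦ B (e y)) x :=
    B.contMDiff.contMDiffAt.comp x (hea x hx)
  have hsrc (x : M) (hx : x ∈ e.source) : ∀ᶠ y in 𝓝 x, y ∈ e.source := e.open_source.mem_nhds hx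
  -- The velocity of the leaf coordinate along the flow.
  set α : M → ℝ := fun z ↦ flatDeriv m (fun y ↦ A (e y)) z (u z) with hα
  have hαc (x : M) (hx : x ∈ e.source) : ContinuousAt α x :=
    continuousAt_flatDeriv_section hι hinj hu_cont ((hsrc x hx).mono fun y hy ↦ hAa y hy)
  have hBu (z : M) (hz : z ∈ e.source) : flatDeriv m (fun y ↦ B (e y)) z (u z) = 0 :=
    (hW e heW z hz (u z)).mp (hu_mem z)
  -- The transverse component of the velocity vanishes because `u` is tangent to the leaves. If the
  -- leaf component vanished too, `u z` would be zero, contrary to its unit length.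
  have hα0 (z : M) (hz : z ∈ e.source) : α z ≠ 0 := by
    intro h0
    have h1 := hBu z hz
    rw [flatDeriv_clm_comp B ((hea z hz).mdifferentiableAt (by norm_num))] at h1
    rw [hα] at h0
    simp only at h0
    rw [flatDeriv_clm_comp A ((hea z hz).mdifferentiableAt (by norm_num))] at h0
    have h2 : flatDeriv m e z (u z) = 0 := by
      refine Prod.ext ?_ h1
      ext i
      rw [Fin.fin_one_eq_zero i]
      exact h0
    have h3 : u z = 0 := (bijective_flatDeriv he he' hz).1 (h2.trans (map_zero _).symm)
    have h4 := hu_norm z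
    rw [h3, norm_zero] at h4
    exact zero_ne_one h4
  let Θ : ℝ × EuclideanSpace ℝ (Fin k) → EuclideanSpace ℝ (Fin 1) × EuclideanSpace ℝ (Fin k) :=
    fun z ↦ (WithLp.toLp 2 fun _ ↦ z.1, z.2)
  let ψ : M → ℝ × EuclideanSpace ℝ (Fin k) := fun z ↦ (A (e z), B (e z))
  have hΘc : Continuous Θ := by
    exact ((PiLp.continuous_toLp 2 _).comp
      (continuous_pi fun _ ↦ continuous_fst)).prodMk continuous_snd
  have hΘψ (z : M) : Θ (ψ z) = e z := by
    refine Prod.ext ?_ rfl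
    ext i
    rw [Fin.fin_one_eq_zero i]
    simp [Θ, ψ, A]
  have hψc (z : M) (hz : z ∈ e.source) : ContinuousAt ψ z :=
    (hAa z hz).continuousAt.prodMk (hBa z hz).continuousAt
  obtain ⟨r, hr, hrs⟩ : ∃ r > 0, Metric.closedBall (ψ q) r ⊆ Θ ⁻¹' e.target := by
    refine Metric.nhds_basis_closedBall.mem_iff.mp ((e.open_target.preimage hΘc).mem_nhds ?_)
    rw [mem_preimage, hΘψ]
    exact e.map_source hq
  -- The time coordinate is the integral of $1/\alpha$ along a plaque, that is, the time spent by
  -- the flow.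
  obtain ⟨H, hHc, hHd, hHi⟩ := exists_time_coordinate (g := fun z ↦ α (e.symm (Θ z))) (c := ψ q)
    (r := r) (fun z hz ↦ ((hαc _ (e.map_target (hrs hz))).comp
      (f := fun z ↦ e.symm (Θ z)) ((e.symm.continuousAt (hrs hz)).comp
        hΘc.continuousAt)).continuousWithinAt)
    fun z hz ↦ hα0 _ (e.map_target (hrs hz))
  have hUs : IsOpen (e.source ∩ ψ ⁻¹' Metric.ball (ψ q) r) :=
    ContinuousOn.isOpen_inter_preimage (fun z hz ↦ (hψc z hz).continuousWithinAt) e.open_source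
      Metric.isOpen_ball
  have hb0 (z : M) (hz : z ∈ e.source ∩ ψ ⁻¹' Metric.ball (ψ q) r) :
      ψ z ∈ Metric.closedBall (ψ q) r := Metric.ball_subset_closedBall hz.2
  refine ⟨e.source ∩ ψ ⁻¹' Metric.ball (ψ q) r, fun y ↦ B (e y), fun z ↦ H (ψ z),
    transferDeriv m ι (fun y ↦ B (e y)) q, hUs, ⟨hq, Metric.mem_ball_self hr⟩,
    transferDeriv_isLittleO hι hinj (hBa q hq), fun V hV ↦ ?_, fun w ↦ ?_,
    fun z hz ↦ (hBa z hz.1).continuousAt,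
    fun z hz ↦ hHc.continuousAt.comp (hψc z hz.1), fun z hz z' hz' hbz hhz ↦ ?_,
    fun z t hzt ↦ ?_⟩
  · rw [transferDeriv_self] at hV
    obtain ⟨v, -, rfl⟩ := exists_eq_flatDeriv hinj hV
    rw [← hPc v]
    have h1 : transferDeriv m ι (fun y ↦ B (e y)) q (flatDeriv m ι q v)
        = flatDeriv m (fun y ↦ B (e y)) q v :=
      congrArg (flatDeriv m (fun y ↦ B (e y)) q) (leftInv_apply_self (hinj q) v)
    rw [h1]
    exact (hW e heW q hq v).symm
  · obtain ⟨v, hv⟩ := (bijective_flatDeriv he he' hq).2 (0, w)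
    refine ⟨flatDeriv m ι q v, ?_, ?_⟩
    · rw [transferDeriv_self, ambientMap_apply hinj]
      rfl
    · have h1 : transferDeriv m ι (fun y ↦ B (e y)) q (flatDeriv m ι q v)
          = flatDeriv m (fun y ↦ B (e y)) q v :=
        congrArg (flatDeriv m (fun y ↦ B (e y)) q) (leftInv_apply_self (hinj q) v)
      rw [h1, flatDeriv_clm_comp B ((hea q hq).mdifferentiableAt (by norm_num))]
      exact congrArg B hv
  · have h1 : ψ z = ((ψ z).1, B (e z)) := rfl
    have h2 : ψ z' = ((ψ z').1, B (e z)) := Prod.ext rfl hbz.symm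
    have h3 : (ψ z).1 = (ψ z').1 :=
      hHi _ _ (B (e z)) (h1 ▸ hb0 z hz) (h2 ▸ hb0 z' hz') (by rw [← h2]; exact hhz)
    have h4 : ψ z = ψ z' := by rw [h1, h2, h3]
    refine e.injOn hz.1 hz'.1 ?_
    rw [← hΘψ, ← hΘψ, h4]
  · have hB (s : ℝ) (hs : s ∈ uIcc 0 t) : HasDerivAt (fun s ↦ B (e (φ s z))) 0 s := by
      have h1 := hasDerivAt_comp_flow hφ (x := z) (t := s)
        ((hBa _ (hzt s hs).1).mdifferentiableAt (by norm_num))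
      rwa [hBu _ (hzt s hs).1] at h1
    have hconst (s : ℝ) (hs : s ∈ uIcc 0 t) : B (e (φ s z)) = B (e z) := by
      have h1 := (convex_uIcc 0 t).norm_image_sub_le_of_norm_hasDerivWithin_le (𝕜 := ℝ) (C := 0)
        (f := fun s ↦ B (e (φ s z))) (fun s hs ↦ (hB s hs).hasDerivWithinAt) (fun s _ ↦ by simp)
        left_mem_uIcc hs
      rw [zero_mul] at h1
      have h2 := sub_eq_zero.mp (norm_le_zero_iff.mp h1)
      rwa [(hφ z).1] at h2
    refine ⟨hconst t right_mem_uIcc, ?_⟩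
    -- Along an orbit the transverse coordinate is frozen, and the time coordinate has derivative
    -- $\alpha^{-1}\alpha=1$.
    have hH (s : ℝ) (hs : s ∈ uIcc 0 t) :
        HasDerivAt (fun s ↦ H ((ψ (φ s z)).1, B (e z)) - s) 0 s := by
      have h1 : HasDerivAt (fun s ↦ (ψ (φ s z)).1) (α (φ s z)) s :=
        hasDerivAt_comp_flow hφ (x := z) (t := s)
          ((hAa _ (hzt s hs).1).mdifferentiableAt (by norm_num))
      have h2 := hHd _ (hb0 _ (hzt s hs))
      rw [hΘψ, e.left_inv (hzt s hs).1] at h2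
      have h3 : (ψ (φ s z)).2 = B (e z) := hconst s hs
      rw [h3] at h2
      have h4 := (HasDerivAt.comp s (h := fun s ↦ (ψ (φ s z)).1) h2 h1).sub (hasDerivAt_id s)
      rw [inv_mul_cancel₀ (hα0 _ (hzt s hs).1), sub_self] at h4
      exact h4
    have h1 := (convex_uIcc 0 t).norm_image_sub_le_of_norm_hasDerivWithin_le (𝕜 := ℝ) (C := 0)
      (f := fun s ↦ H ((ψ (φ s z)).1, B (e z)) - s) (fun s hs ↦ (hH s hs).hasDerivWithinAt)
      (fun s _ ↦ by simp) left_mem_uIcc right_mem_uIcc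
    rw [zero_mul] at h1
    have h2 := sub_eq_zero.mp (norm_le_zero_iff.mp h1)
    have h3 : ψ (φ t z) = ((ψ (φ t z)).1, B (e z)) := Prod.ext rfl (hconst t right_mem_uIcc)
    have h4 : ψ (φ 0 z) = ((ψ (φ 0 z)).1, B (e z)) := Prod.ext rfl (hconst 0 left_mem_uIcc)
    rw [← h3, ← h4, (hφ z).1] at h2
    linarith

end Flow

/-! ### Surjectivity of maps close to the identity -/

section Surjectivity

open Set Filter

/-- Pairs whose images under the injective map `ι` merge can only accumulate on the diagonal, so by
compactness one radius serves all of `K`. -/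
theorem exists_pos_forall_close {M E : Type*} [TopologicalSpace M] [CompactSpace M]
    [NormedAddCommGroup E] {ι : M → E} (hι : Continuous ι) (hinj : Function.Injective ι)
    {K : Set M} (hK : IsClosed K) {R : M × M → Prop} (hR : ∀ z ∈ K, ∀ᶠ a in 𝓝 (z, z), R a) :
    ∃ r > 0, ∀ z ∈ K, ∀ w, ‖ι w - ι z‖ < r → R (z, w) := by
  obtain ⟨r, hr, H⟩ := exists_pos_of_ultrafilter (α := M × M)
    (K := fun r a ↦ a.1 ∈ K ∧ ‖ι a.2 - ι a.1‖ < r) (C := R)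
    (fun r r' a hr h ↦ ⟨h.1, h.2.trans_le hr⟩) fun l hl ↦ by
    obtain ⟨z, -, hz⟩ := isCompact_univ.ultrafilter_le_nhds (l.map Prod.fst) (by simp)
    obtain ⟨w, -, hw⟩ := isCompact_univ.ultrafilter_le_nhds (l.map Prod.snd) (by simp)
    have hz' : Tendsto (fun a : M × M ↦ a.1) l (𝓝 z) := hz
    have hw' : Tendsto (fun a : M × M ↦ a.2) l (𝓝 w) := hw
    have hzK : z ∈ K := hK.mem_of_tendsto hz' ((hl 1 one_pos).mono fun a ha ↦ ha.1)
    have h1 : Tendsto (fun a : M × M ↦ ι a.2 - ι a.1) l (𝓝 (ι w - ι z)) :=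
      ((hι.tendsto w).comp hw').sub ((hι.tendsto z).comp hz')
    have h2 : Tendsto (fun a : M × M ↦ ι a.2 - ι a.1) l (𝓝 0) :=
      tendsto_zero_iff_norm_tendsto_zero.mpr (tendsto_order.mpr
        ⟨fun a ha ↦ Eventually.of_forall fun z ↦ ha.trans_le (norm_nonneg _),
          fun a ha ↦ (hl a ha).mono fun z hz ↦ hz.2⟩)
    have h3 : w = z := hinj (sub_eq_zero.mp (tendsto_nhds_unique h1 h2))
    rw [h3] at hw'
    exact (hz'.prodMk_nhds hw') (hR z hzK)
  exact ⟨r, hr, fun z hz w hw ↦ H (z, w) ⟨hz, hw⟩⟩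

/-- A continuous map of a closed manifold that is close to the identity is surjective. -/
theorem exists_pos_forall_surjective {m : ℕ} {M E : Type*} [TopologicalSpace M] [CompactSpace M]
    [T2Space M] [ChartedSpace (EuclideanSpace ℝ (Fin m)) M] [NormedAddCommGroup E] {ι : M → E}
    (hι : Continuous ι) (hinj : Function.Injective ι) :
    ∃ r > 0, ∀ P : C(M, M), (∀ x, ‖ι (P x) - ι x‖ < r) → Function.Surjective P := by
  obtain ⟨r, hr, H⟩ := exists_pos_forall_of_compact (M := M)
    (K := fun r x ↦ ∀ P : C(M, M), (∀ x, ‖ι (P x) - ι x‖ < r) → x ∈ range P)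
    (fun r r' x hr h P hP ↦ h P fun x ↦ (hP x).trans_le hr) fun p ↦ by
    set e := extChartAt (𝓡 m) p
    have hp : p ∈ e.source := mem_extChartAt_source (I := 𝓡 m) p
    obtain ⟨R, hR, hRt⟩ := Metric.nhds_basis_closedBall.mem_iff.mp
      ((isOpen_extChartAt_target (I := 𝓡 m) p).mem_nhds (mem_extChartAt_target p))
    have hK : IsClosed (e.symm '' Metric.closedBall (e p) R) :=
      ((isCompact_closedBall _ _).image_of_continuousOn
        ((continuousOn_extChartAt_symm p).mono hRt)).isClosed
    obtain ⟨r, hr, H⟩ := exists_pos_forall_close hι hinj hK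
      (R := fun a ↦ a.2 ∈ e.source ∧ ‖e a.2 - e a.1‖ < R / 4) (by
        rintro _ ⟨y, hy, rfl⟩
        have hs : e.symm y ∈ e.source := e.map_target (hRt hy)
        have h1 : ContinuousAt (fun a : M × M ↦ ‖e a.2 - e a.1‖) (e.symm y, e.symm y) :=
          ((ContinuousAt.comp (g := e) (f := Prod.snd) (x := (e.symm y, e.symm y))
            (continuousAt_extChartAt' hs) continuousAt_snd).sub
            (ContinuousAt.comp (g := e) (f := Prod.fst) (x := (e.symm y, e.symm y))
              (continuousAt_extChartAt' hs) continuousAt_fst)).norm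
        have h2 := h1.tendsto.eventually_lt_const (u := R / 4) (by
          simp only [sub_self, norm_zero]; positivity)
        exact ((continuousAt_snd (X := M) (Y := M) (p := (e.symm y, e.symm y))).eventually
          ((isOpen_extChartAt_source p).eventually_mem hs)).and h2)
    refine ⟨r, hr, ?_⟩
    filter_upwards [(continuousAt_extChartAt (I := 𝓡 m) p).eventually_mem
      (Metric.ball_mem_nhds _ (half_pos hR)), (isOpen_extChartAt_source (I := 𝓡 m) p).eventually_mem
      hp] with x hx hxs P hP
    -- The ball around `e x` of radius $R/2$ lies in the chart. There the map moves points by less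
    -- than $R/4$ in coordinates, so it covers the center `e x`.
    have hsub : Metric.closedBall (e x) (R / 2) ⊆ Metric.closedBall (e p) R :=
      Metric.closedBall_subset_closedBall' (by linarith [Metric.mem_ball.mp hx])
    have h1 (y : EuclideanSpace ℝ (Fin m)) (hy : y ∈ Metric.closedBall (e x) (R / 2)) :
        P (e.symm y) ∈ e.source ∧ ‖e (P (e.symm y)) - y‖ < R / 4 := by
      have h2 := H (e.symm y) ⟨y, hsub hy, rfl⟩ (P (e.symm y)) (hP _)
      rwa [e.right_inv (hRt (hsub hy))] at h2
    obtain ⟨y, hy, hyx⟩ := mem_image_closedBall_of_near_id (h := fun y ↦ e (P (e.symm y)))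
      (c := e x) (R := R / 2) (ε := R / 4) (by positivity) (by linarith)
      (fun y hy ↦ (ContinuousAt.comp (g := e) (f := fun y ↦ P (e.symm y))
        (continuousAt_extChartAt' (h1 y hy).1) (P.continuous.continuousAt.comp
        ((continuousOn_extChartAt_symm p).continuousAt
          ((isOpen_extChartAt_target p).mem_nhds (hRt (hsub hy)))))).continuousWithinAt)
      fun y hy ↦ (h1 y hy).2.le
    exact ⟨e.symm y, e.injOn (h1 y hy).1 hxs hyx⟩
  exact ⟨r, hr, fun P hP x ↦ H x P hP⟩

end Surjectivity

/-! ### The center system of a partially hyperbolic diffeomorphism -/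

section Assembly

set_option maxSynthPendingDepth 3

open Set Filter

variable {m : ℕ} {M : Type*} [TopologicalSpace M] [CompactSpace M] [T2Space M]
  [ChartedSpace (EuclideanSpace ℝ (Fin m)) M] [IsManifold (𝓡 m) ∞ M]
  [RiemannianBundle (fun x : M ↦ TangentSpace (𝓡 m) x)]
  [IsContMDiffRiemannianBundle (𝓡 m) ∞ (EuclideanSpace ℝ (Fin m))
    (fun x : M ↦ TangentSpace (𝓡 m) x)]
variable {E : Type*} [NormedAddCommGroup E] [InnerProductSpace ℝ E] [FiniteDimensional ℝ E]
  [CompleteSpace E]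

/-- The center system of a partially hyperbolic diffeomorphism with one-dimensional oriented center
foliation. -/
def centerSystem {ι : M → E} (hι : ContMDiff (𝓡 m) 𝓘(ℝ, E) 1 ι)
    (hinj : ∀ x, Function.Injective (flatDeriv m ι x)) (hemb : Topology.IsEmbedding ι)
    {f : M ≃ₘ^1⟮𝓡 m, 𝓡 m⟯ M}
    {P : Fin 3 → M → EuclideanSpace ℝ (Fin m) →L[ℝ] EuclideanSpace ℝ (Fin m)}
    (H : IsHyperbolicCocycle f.toHomeomorph (ambientDeriv hι hinj hι) (derivCocycle hι hinj f)
      (derivCocycleInv hι hinj f) fun i x ↦ ambientMap m ι x x (P i x))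
    {Ec : (x : M) → Submodule ℝ (TangentSpace (𝓡 m) x)}
    (hP : ∀ x v, v ∈ Ec x ↔ P 1 x v = v)
    {q : ℕ} (W : Foliation m M 1 1 q) (hW : W.IsTangentTo Ec)
    {u : (x : M) → TangentSpace (𝓡 m) x}
    (hu_cont : Continuous fun x ↦ (⟨x, u x⟩ : TangentBundle (𝓡 m) M))
    (hu_mem : ∀ x, u x ∈ Ec x) (hu_norm : ∀ x, ‖u x‖ = 1)
    {φ : ℝ → M → M} (hφ : IsFlowOf φ u) : CenterSystem M E where
  ι := ι
  f := f.toHomeomorph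
  φ := φ
  ex := ambientExp m ι
  Ps := H.proj 0
  Pc := H.proj 1
  Pu := H.proj 2
  D := derivCocycle hι hinj f
  D' := derivCocycleInv hι hinj f
  isEmbedding := hemb
  ss := H.mul_self 0
  cc := H.mul_self 1
  uu := H.mul_self 2
  sc x := H.mul_ne 0 1 x (by decide)
  su x := H.mul_ne 0 2 x (by decide)
  cs x := H.mul_ne 1 0 x (by decide)
  cu x := H.mul_ne 1 2 x (by decide)
  us x := H.mul_ne 2 0 x (by decide)
  uc x := H.mul_ne 2 1 x (by decide)
  Ds := H.comm 0
  Du := H.comm 2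
  Du' := H.comm' 2
  DT x := (congrArg (· * derivCocycle hι hinj f x) (H.sum_eq (f x))).trans (H.mul_right x)
  DD x := (H.left_inv x).trans (H.sum_eq x).symm
  DD' x := (H.right_inv x).trans (H.sum_eq (f x)).symm
  ex_zero := ambientExp_zero ι
  ex_approx η hη := by
    obtain ⟨ρ, hρ, h⟩ := exists_ambientExp_approx hι hinj η hη
    have hT (x : M) : H.proj 0 x + H.proj 1 x + H.proj 2 x = transferDeriv m ι ι x := H.sum_eq x
    refine ⟨ρ, hρ, fun x V W hV hW ↦ h x V W ?_ ?_⟩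
    · rwa [hT] at hV
    · rwa [hT] at hW
  continuousOn_ex := exists_continuousOn_ambientExp hι hinj
  strict_f p := by
    refine transferDeriv_isLittleO hι hinj (h := ι ∘ f) ?_
    exact (hι.comp f.contMDiff).contMDiffAt
  flow_speed := by
    obtain ⟨c, hc, h⟩ := exists_norm_flatDeriv_equiv hι hinj
    exact ⟨c⁻¹, fun t x ↦ norm_flow_sub_le hι
      (fun x v ↦ (le_inv_mul_iff₀ hc).mpr (h x v).1) hφ hu_norm t x⟩
  exists_flowBox p := by
    obtain ⟨U, b, h, B, hB⟩ := exists_isFlowBox hι hinj W hW hu_cont hu_mem hu_norm hφ p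
      (Pc := ambientMap m ι p p (P 1 p)) (fun v ↦ by
        have h1 := ambientMap_apply hinj p p (P 1 p) v
        exact (hP p v).trans ⟨fun h ↦ h1.trans (congrArg (flatDeriv m ι p) h),
          fun h ↦ hinj p (h1.symm.trans h)⟩)
    have hT : H.proj 0 p + H.proj 1 p + H.proj 2 p = transferDeriv m ι ι p := H.sum_eq p
    refine ⟨q, U, b, h, B, ?_⟩
    rw [hT]
    exact hB

/-- A partially hyperbolic diffeomorphism with one-dimensional oriented center foliation gives rise
to a center system in a Euclidean space. -/
theorem exists_centerSystem {f : M ≃ₘ^1⟮𝓡 m, 𝓡 m⟯ M}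
    {Es Ec Eu : (x : M) → Submodule ℝ (TangentSpace (𝓡 m) x)}
    (hf : IsPartiallyHyperbolic f Es Ec Eu)
    {q : ℕ} (W : Foliation m M 1 1 q) (hW : W.IsTangentTo Ec)
    {u : (x : M) → TangentSpace (𝓡 m) x}
    (hu_cont : Continuous fun x ↦ (⟨x, u x⟩ : TangentBundle (𝓡 m) M))
    (hu_mem : ∀ x, u x ∈ Ec x) (hu_norm : ∀ x, ‖u x‖ = 1)
    {φ : ℝ → M → M} (hφ : IsFlowOf φ u) :
    ∃ (n : ℕ) (S : CenterSystem M (EuclideanSpace ℝ (Fin n))),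
      ContMDiff (𝓡 m) 𝓘(ℝ, EuclideanSpace ℝ (Fin n)) 1 S.ι ∧
      (∀ x, Function.Injective (flatDeriv m S.ι x)) ∧ S.f = f.toHomeomorph ∧ S.φ = φ ∧
      S.ex = ambientExp m S.ι ∧
      (∀ x (v : TangentSpace (𝓡 m) x), S.T x (flatDeriv m S.ι x v) = flatDeriv m S.ι x v) ∧
      (∀ x, ∀ v ∈ Es x ⊔ Eu x, S.P x (flatDeriv m S.ι x v) = flatDeriv m S.ι x v) ∧
      (∀ x V, S.P x V = V → ∃ v ∈ Es x ⊔ Eu x, flatDeriv m S.ι x v = V) ∧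
      (∃ n, ‖forwardCocycle (S.f : C(M, M))
        (graphRestrict (pushTransport S.Ps S.D) S.f) n‖ < 1 / 2) ∧
      (∃ n, ‖backwardCocycle (S.f : C(M, M))
        (graphRestrict (pullTransport S.Pu S.D') S.f) n‖ < 1 / 2) := by
  obtain ⟨n, ι, hι, hemb, hinj⟩ := exists_embedding_euclidean_of_compact (I := 𝓡 m) (M := M)
  have hι1 : ContMDiff (𝓡 m) 𝓘(ℝ, EuclideanSpace ℝ (Fin n)) 1 ι := hι.of_le (by simp)
  have hinj' (x : M) : Function.Injective (flatDeriv m ι x) := hinj x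
  obtain ⟨P, h1, h2, h3, h4⟩ := exists_tangent_projections
    (F := fun i x ↦ ![Es x, Ec x, Eu x] i) hf.isInternal
  have H := isHyperbolicCocycle_derivCocycle (hι := hι1) (hinj := hinj') hf h1 h2 h3 h4
  have hP (x : M) (v : TangentSpace (𝓡 m) x) : v ∈ Ec x ↔ P 1 x v = v :=
    ⟨h2 1 x v, fun h ↦ h ▸ h1 1 x v⟩
  refine ⟨n, centerSystem hι1 hinj' hemb.isEmbedding H hP W hW hu_cont hu_mem hu_norm hφ, hι1,
    hinj', rfl, rfl, rfl, fun x v ↦ ?_, fun x v hv ↦ ?_, fun x V hV ↦ ?_, H.exists_norm_forwardCocycle_lt,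
    H.exists_norm_backwardCocycle_lt⟩
  · exact (congrArg (fun A : EuclideanSpace ℝ (Fin n) →L[ℝ] EuclideanSpace ℝ (Fin n) ↦
      A (flatDeriv m ι x v)) (H.sum_eq x)).trans (ambientMap_apply hinj' x x 1 v)
  · refine (congrArg₂ (· + ·) (ambientMap_apply hinj' x x (P 0 x) v)
      (ambientMap_apply hinj' x x (P 2 x) v)).trans ?_
    refine (map_add (flatDeriv m ι x) _ _).symm.trans (congrArg (flatDeriv m ι x) ?_)
    obtain ⟨a, ha, b, hb, rfl⟩ := Submodule.mem_sup.mp hv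
    have key (a b : EuclideanSpace ℝ (Fin m)) (e1 : P 0 x a = a) (e2 : P 2 x a = 0)
        (e3 : P 0 x b = 0) (e4 : P 2 x b = b) : P 0 x (a + b) + P 2 x (a + b) = a + b := by
      rw [map_add, map_add, e1, e2, e3, e4, add_zero, zero_add]
    exact key a b (h2 0 x a ha) (h3 2 0 x (by decide) a ha) (h3 0 2 x (by decide) b hb)
      (h2 2 x b hb)
  · refine ⟨P 0 x (leftInv (flatDeriv m ι x) V) + P 2 x (leftInv (flatDeriv m ι x) V), ?_, ?_⟩
    · exact Submodule.add_mem_sup (h1 0 x _) (h1 2 x _)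
    · rw [map_add]
      exact hV

theorem ambientExp_flatDeriv {ι : M → E} (hinj : ∀ x, Function.Injective (flatDeriv m ι x)) (x : M)
    (v : TangentSpace (𝓡 m) x) : ambientExp m ι x (flatDeriv m ι x v) = riemExp x v :=
  congrArg (fun v : TangentSpace (𝓡 m) x ↦ riemExp x v) (leftInv_apply_self (hinj x) v)

theorem _root_.CompactSpace.exists_pos_of_eventually_nearby {M : Type*} [EMetricSpace M]
    [CompactSpace M] {f : M ≃ₜ M} {Q : (M ≃ₜ M) → Prop}
    (h : ∀ᶠ g in comap (fun g : M ≃ₜ M ↦ (g : C(M, M))) (𝓝 (f : C(M, M))), Q g) :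
    ∃ δ : ℝ, 0 < δ ∧ ∀ g : M ≃ₜ M, (∀ x, edist (f x) (g x) < ENNReal.ofReal δ) → Q g := by
  have hb := (nhds_basis_uniformity' (x := (f : C(M, M)))
    (uniformity_basis_edist (α := M)).compactConvergenceUniformity_of_compact).comap
    fun g : M ≃ₜ M ↦ (g : C(M, M))
  obtain ⟨δ, hδ, H⟩ := hb.mem_iff.mp h
  -- Radii of the extended metric may be infinite; truncation yields a real `δ`.
  have h1 : min δ 1 ≠ ⊤ := ne_top_of_le_ne_top ENNReal.one_ne_top (min_le_right _ _)
  refine ⟨(min δ 1).toReal, ENNReal.toReal_pos (lt_min hδ one_pos).ne' h1, fun g hg ↦ H fun x ↦ ?_⟩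
  have h2 := hg x
  rw [ENNReal.ofReal_toReal h1] at h2
  exact h2.trans_le (min_le_left _ _)

end Assembly

end PartialHyperbolicity

end

/-! ### Deduction of the theorem from the center system -/

theorem mainTheorem3 {m : ℕ} {M : Type*} [EMetricSpace M] [CompactSpace M]
    [ChartedSpace (EuclideanSpace ℝ (Fin m)) M] [IsManifold (𝓡 m) ∞ M]
    [RiemannianBundle (fun x : M ↦ TangentSpace (𝓡 m) x)]
    [IsContMDiffRiemannianBundle (𝓡 m) ∞ (EuclideanSpace ℝ (Fin m))
      (fun x : M ↦ TangentSpace (𝓡 m) x)]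
    [IsRiemannianManifold (𝓡 m) M]
    {r : ℕ∞} (hr : 1 ≤ r) (f : M ≃ₘ^r⟮𝓡 m, 𝓡 m⟯ M)
    (Es Ec Eu : (x : M) → Submodule ℝ (TangentSpace (𝓡 m) x))
    (hf : PartialHyperbolicity.IsPartiallyHyperbolic f Es Ec Eu)
    {q : ℕ} (W : PartialHyperbolicity.Foliation m M 1 1 q) (hW : W.IsTangentTo Ec)
    (u : (x : M) → TangentSpace (𝓡 m) x)
    (hu_cont : Continuous fun x ↦ (⟨x, u x⟩ : TangentBundle (𝓡 m) M))
    (hu_mem : ∀ x, u x ∈ Ec x) (hu_norm : ∀ x, ‖u x‖ = 1)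
    (φ : ℝ → M → M) (hφ : PartialHyperbolicity.IsFlowOf φ u) :
    ∃ ρ₀ : ℝ, 0 < ρ₀ ∧
      (∀ x : M, Set.InjOn (PartialHyperbolicity.riemExp (m := m) x) {v | ‖v‖ < ρ₀}) ∧
      ∃ ε₀ : ℝ, 0 < ε₀ ∧ ε₀ < ρ₀ ∧
        ∀ ε : ℝ, 0 < ε → ε < ε₀ → ∃ δ : ℝ, 0 < δ ∧
          ∀ g : M ≃ₜ M, (∀ x, edist (f x) (g x) < ENNReal.ofReal δ) →
            ∃ (τ : C(M, ℝ)) (P : C(M, M)),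
              Function.Surjective P ∧
              (∀ x, P (g x) = φ (τ (f x)) (f (P x))) ∧
              PartialHyperbolicity.IsAdmissible Es Eu ρ₀ ε τ P ∧
              ∀ (τ' : C(M, ℝ)) (P' : C(M, M)),
                (∀ x, P' (g x) = φ (τ' (f x)) (f (P' x))) →
                PartialHyperbolicity.IsAdmissible Es Eu ρ₀ ε τ' P' →
                τ' = τ ∧ P' = P := by
  have hr' : (1 : WithTop ℕ∞) ≤ r := by exact_mod_cast hr
  -- The argument takes place in class $C^1$.
  let f₁ : M ≃ₘ^1⟮𝓡 m, 𝓡 m⟯ M :=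
    ⟨f.toEquiv, f.contMDiff.of_le hr', f.symm.contMDiff.of_le hr'⟩
  have hf₁ : PartialHyperbolicity.IsPartiallyHyperbolic f₁ Es Ec Eu := hf
  obtain ⟨n, S, hι, hinj, hSf, hSφ, hSex, hT, hP, hP', hs, hu⟩ :=
    PartialHyperbolicity.exists_centerSystem hf₁ W hW hu_cont hu_mem hu_norm hφ
  have hf₂ (x : M) : S.f x = f x := by rw [hSf]; rfl
  have hex (x : M) (v : TangentSpace (𝓡 m) x) :
      S.ex x (PartialHyperbolicity.flatDeriv m S.ι x v) = PartialHyperbolicity.riemExp x v := by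
    rw [hSex]
    exact PartialHyperbolicity.ambientExp_flatDeriv hinj x v
  obtain ⟨c, hc, hcn⟩ := PartialHyperbolicity.exists_norm_flatDeriv_equiv hι hinj
  obtain ⟨R, hR, huniq⟩ := S.eventually_unique hs hu
  obtain ⟨ρ, hρ, happ⟩ := S.ex_approx (1 / 2) (by norm_num)
  have hlt (x : M) (v : TangentSpace (𝓡 m) x) (s : ℝ) (hv : ‖v‖ < c * s) :
      ‖PartialHyperbolicity.flatDeriv m S.ι x v‖ < s :=
    lt_of_mul_lt_mul_left ((hcn x v).1.trans_lt hv) hc.le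
  -- A Riemannian norm below $\rho_0=c\min(R,\rho)$ gives an ambient norm below both the radius $R$
  -- of uniqueness and the radius $\rho$ of injectivity of the exponential map. The bound
  -- $\varepsilon_0\le R$ brings the times into the range of uniqueness, and
  -- $\varepsilon_0\le\rho_0/2$ gives $\varepsilon_0<\rho_0$.
  refine ⟨c * min R ρ, by positivity, fun x v hv w hw hvw ↦ ?_, min R (c * min R ρ / 2),
    by positivity, (min_le_right _ _).trans_lt (half_lt_self (by positivity)), fun ε hε hε₀ ↦ ?_⟩
  · have h1 := happ x _ _ (hT x v) (hT x w) ((hlt x v _ hv).trans_le (min_le_right _ _))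
      ((hlt x w _ hw).trans_le (min_le_right _ _))
    rw [hex, hex, hvw, sub_self, zero_sub, norm_neg] at h1
    have h2 : ‖PartialHyperbolicity.flatDeriv m S.ι x v
        - PartialHyperbolicity.flatDeriv m S.ι x w‖ ≤ 0 := by linarith
    exact hinj x (sub_eq_zero.mp (norm_le_zero_iff.mp h2))
  obtain ⟨r₁, hr₁, hsurj⟩ := PartialHyperbolicity.exists_pos_forall_surjective (m := m)
    S.isEmbedding.continuous S.isEmbedding.injective
  obtain ⟨r₂, hr₂, hclose⟩ := PartialHyperbolicity.exists_pos_forall_close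
    S.isEmbedding.continuous S.isEmbedding.injective isClosed_univ
    (R := fun a : M × M ↦ edist a.2 a.1 < ENNReal.ofReal ε) fun z _ ↦
      (continuous_snd.edist continuous_fst).tendsto (z, z) |>.eventually_lt_const (by simpa using hε)
  -- The ambient scale of the constructed solution. The bound $c\rho_0$ makes the Riemannian norm of
  -- its vectors less than $\rho_0$. As points move by less than $2\varepsilon'$, the halves of
  -- $r_1$ and $r_2$ give surjectivity and the bound $\varepsilon$ on the distance.
  set ε' := min (min (min ε R) (min ρ (c * (c * min R ρ)))) (min (r₁ / 2) (r₂ / 2)) with hε'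
  have hε'0 : 0 < ε' := by positivity
  have k1 : ε' ≤ ε := by simp [hε']
  have k2 : ε' ≤ R := by simp [hε']
  have k3 : ε' ≤ ρ := by simp [hε']
  have k4 : ε' ≤ c * (c * min R ρ) := by simp only [hε', min_le_iff, le_refl, true_or, or_true]
  have k5 : ε' ≤ r₁ / 2 := by simp [hε']
  have k6 : ε' ≤ r₂ / 2 := by simp [hε']
  obtain ⟨δ, hδ, H⟩ := CompactSpace.exists_pos_of_eventually_nearby
    (huniq.and (S.eventually_exists hs hu ε' hε'0))
  refine ⟨δ, hδ, fun g hg ↦ ?_⟩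
  obtain ⟨huniq, V, τ, hV⟩ := H g fun x ↦ by rw [hf₂]; exact hg x
  let P : C(M, M) := ⟨fun x ↦ S.ex x (V x), hV.continuous_ex⟩
  have hPι (x : M) : ‖S.ι (P x) - S.ι x‖ < 2 * ε' := by
    have h1 := happ x (V x) 0 (S.T_of_P (hV.P_apply x)) (map_zero _) ((hV.norm_lt x).trans_le k3)
      (by rwa [norm_zero])
    rw [S.ex_zero, sub_zero] at h1
    have h2 := norm_add_le (S.ι (P x) - S.ι x - V x) (V x)
    rw [sub_add_cancel] at h2
    have h3 : ‖S.ι (P x) - S.ι x - V x‖ ≤ 1 / 2 * ‖V x‖ := h1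
    linarith [hV.norm_lt x, norm_nonneg (V x)]
  refine ⟨τ, P, hsurj P fun x ↦ (hPι x).trans_le (by linarith), fun x ↦ ?_,
    ⟨fun x ↦ (hV.abs_lt x).trans_le k1, fun x ↦ ?_, fun x ↦ ?_⟩, fun τ' P' heq hadm ↦ ?_⟩
  · have h1 := hV.ex_eq x
    rw [hSφ, hf₂, hf₂] at h1
    exact h1
  · exact hclose x (Set.mem_univ x) (P x) ((hPι x).trans_le (by linarith))
  · obtain ⟨v, hv, hvV⟩ := hP' x _ (hV.P_apply x)
    refine ⟨v, hv, ?_, ?_⟩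
    · have h1 := (hcn x v).2
      rw [hvV] at h1
      exact lt_of_mul_lt_mul_left (h1.trans_lt ((hV.norm_lt x).trans_le k4)) hc.le
    · rw [← hex, hvV]
      rfl
  · choose v hv hvn hvP using hadm.exp_inv_mem
    -- A competing pair need not be small at the scale $\varepsilon'$. The bound $\|v\|<\rho_0$
    -- places it within the radius $R$, where uniqueness was established.
    have hV' : S.IsSolution R g (fun x ↦ PartialHyperbolicity.flatDeriv m S.ι x (v x)) τ' := by
      have h1 (x : M) : S.ex x (PartialHyperbolicity.flatDeriv m S.ι x (v x)) = P' x :=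
        (hex x (v x)).trans (hvP x)
      refine ⟨fun x ↦ hP x _ (hv x), fun x ↦ (hlt x _ _ (hvn x)).trans_le (min_le_left _ _),
        fun x ↦ (hadm.abs_lt x).trans (hε₀.trans_le (min_le_left _ _)), ?_, fun x ↦ ?_⟩
      · simp only [h1]
        exact P'.continuous
      · rw [h1, h1, hSφ, hf₂, hf₂]
        exact heq x
    obtain ⟨h1, h2⟩ := huniq _ _ _ _ hV' (hV.mono k2)
    refine ⟨DFunLike.coe_injective h2, ContinuousMap.ext fun x ↦ ?_⟩
    exact (hvP x).symm.trans ((hex x (v x)).symm.trans (congrArg (S.ex x) (congrFun h1 x)))
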